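/- Let $N\ge 1$. A frame is a matrix of functions $A=(A_i^j)$ on $\mathbb R^N$, with vector fields $X_i=\sum_j A_i^j\,\partial/\partial x^j$. Let $\mathcal D$ be a distribution of tangent subspaces of codimension $1$ on $\mathbb R^N$. The frame $A$ is adapted to $\mathcal D$ if the $A_i^j$ are $C^\infty$ with all derivatives bounded on $\mathbb R^N$, $|\det A|\ge c>0$ on $\mathbb R^N$, and $X_1,\dots,X_{N-1}$ span $\mathcal D$ at every point. All distributions $\mathcal D$ below are assumed to admit an adapted frame. Put $(B_j^k)=A^{-1}$, $\rho_x(\xi)=\bigl(\sum_{i<N}|\sum_j A_i^j(x)\xi_j|^2\bigr)^{1/2}$, $D_\xi=\sum_j B_j^N(x)\,\partial_{\xi_j}$, and $$D_i=\partial_{x^i}+\sum_{k,p,l}\frac{\partial B_k^p}{\partial x^i}(x)A_p^l(x)\,\xi_l\,\partial_{\xi_k},\qquad D^I=D_{i_1}\cdots D_{i_k}\quad\text{for } I=(i_1,\dots,i_k).$$ For $m,n\in\mathbb R$, $S^{m,n}(\mathcal D)$ is the set of $a\in C^\infty(\mathbb R^N\times\mathbb R^N;\mathbb C)$ such that for all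 $\alpha,\beta,I$ $$|\partial_\xi^\alpha D_\xi^\beta D^I a(x,\xi)|\le C_{\alpha,\beta,I}\,(1+|\xi|)^{m-|\beta|}(1+\rho_x(\xi)+|\xi|^{1/2})^{n-|\alpha|}$$ for some adapted frame. Let $T_af(x)=\int a(x,\xi)\widehat f(\xi)e^{2\pi i x\cdot\xi}\,d\xi$. Let $S^{-\infty}$ be the set of $e\in C^\infty(\mathbb R^N\times\mathbb R^N;\mathbb C)$ with $|\partial_\xi^\alpha\partial_x^I e|\le C_{M,\alpha,I}(1+|\xi|)^{-M-|\alpha|}$ for all $M\in\mathbb N$ and all $\alpha,I$; an infinitely smoothing operator is an operator $T_e$ with $e\in S^{-\infty}$. Let $\mathcal D^0_x=\ker dx^N$ for every $x$. **(1) Independence of the frame.** Any two frames adapted to $\mathcal D$ define the same class $S^{m,n}(\mathcal D)$. **(2) Changes of coordinates.** Let $\Phi$ be an admissible change of coordinates: a diffeomorphism of $\mathbb R^N$ such that $\partial\Phi/\partial x$ and all its derivatives are bounded and $|\det(\partial\Phi/\partial x)|\ge c>0$. For every $a\in S^{m,n}(\mathcal D)$ there is $\tilde a\in S^{m,n}(d\Phi(\mathcal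 D))$ with $$T_af(x)=T_{\tilde a}(f\circ\Phi^{-1})(\Phi(x))\quad\text{for all } f\in\mathcal S(\mathbb R^N),\ x\in\mathbb R^N.$$ **(3) Representation with a compatible phase.** Let $\delta>0$, $c_0>0$ and constants $C_k$ ($k\ge 0$) be given. There is $\delta_0\in(0,\delta]$, depending only on $N,\delta,c_0,(C_k)$, such that the following holds. Put $\Delta=\{(x,y):|x-y|<\delta\}$, and let $\Theta:\Delta\to\mathbb R^N$ be $C^\infty$, with its derivatives of order $k$ bounded by $C_k$ on $\Delta$ for every $k\ge 0$, and with $\Theta(x,x)=0$ for all $x$. Put $\mathcal B_j^k(x)=-\partial_{y^j}\Theta(x,y)_k|_{y=x}$ and suppose that $|\det\mathcal B(x)|\ge c_0$ for all $x$. Let $\mathcal D$ be a distribution with which $\Theta$ is compatible, that is, $\mathcal D_x=\ker\sum_j\mathcal B_j^N(x)\,dx^j$ for all $x$. Let $\phi\in C_c^\infty(B(0,\delta_0))$ with $\phi=1$ on $B(0,\delta_0/2)$, and let $m,n\in\mathbb R$. Then for $a_0\in S^{m,n}(\mathcal D^0)$ and $f\in\mathcal S(\mathbb R^N)$ the iterated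 integral in $$(*)\qquad T_af(x)=\int_{\mathbb R^N}\int_{\mathbb R^N}\phi(x-y)\,a_0(x,\xi)f(y)\,e^{2\pi i\Theta(x,y)\cdot\xi}\,dy\,d\xi+Ef(x)$$ converges for every $x$ (the inner integral is integrable in $\xi$), and: (a) for every $a\in S^{m,n}(\mathcal D)$ there are $a_0\in S^{m,n}(\mathcal D^0)$ and an infinitely smoothing operator $E$ such that $(*)$ holds for all $f\in\mathcal S(\mathbb R^N)$ and all $x$; (b) for every $a_0\in S^{m,n}(\mathcal D^0)$ and every infinitely smoothing operator $E$ there is $a\in S^{m,n}(\mathcal D)$ such that $(*)$ holds for all $f\in\mathcal S(\mathbb R^N)$ and all $x$. -/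

import Mathlib

open scoped FourierTransform SchwartzMap ContDiff
open MeasureTheory

noncomputable section

namespace MixedPDO

/-- Euclidean space `ℝ^N` with `N = d + 1 ≥ 1`; the distinguished last index is `Fin.last d`. -/
abbrev E (d : ℕ) : Type := EuclideanSpace ℝ (Fin (d + 1))

/-- The `i`-th standard basis vector. -/
def stdVec {d : ℕ} (i : Fin (d + 1)) : E d := EuclideanSpace.single i 1

/-- A distribution of tangent subspaces of `ℝ^N`. -/
abbrev Distr (d : ℕ) : Type := E d → Submodule ℝ (E d)

/-- The coefficients `A_i^j(x)` of a frame `X_i = ∑ j, A_i^j(x) ∂/∂x^j`; row `i` is `X_i`. -/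
abbrev Frame (d : ℕ) : Type := E d → Matrix (Fin (d + 1)) (Fin (d + 1)) ℝ

/-- The vector `X_i(x)`. -/
def frameVec {d : ℕ} (A : Frame d) (i : Fin (d + 1)) (x : E d) : E d :=
  WithLp.toLp 2 (A x i)

/-- `A` is a global frame adapted to `D`: its coefficients are smooth with all derivatives bounded,
its determinant is bounded away from `0`, and its first `N - 1` vectors span `D` at every point. -/
structure IsAdaptedFrame {d : ℕ} (D : Distr d) (A : Frame d) : Prop where
  smooth : ∀ i j, ContDiff ℝ ∞ (fun x => A x i j)
  bounded : ∀ i j, ∀ k : ℕ, ∃ C : ℝ, ∀ x, ‖iteratedFDeriv ℝ k (fun x => A x i j) x‖ ≤ C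
  det_bound : ∃ c : ℝ, 0 < c ∧ ∀ x, c ≤ |(A x).det|
  span_eq : ∀ x, D x =
    Submodule.span ℝ (Set.range fun i : Fin d => frameVec A i.castSucc x)

/-- The constant distribution `D⁰_x = ker dx^N`. -/
def constDistr (d : ℕ) : Distr d := fun _ =>
  LinearMap.ker (EuclideanSpace.proj (Fin.last d) : E d →L[ℝ] ℝ).toLinearMap

/-- Functions `a(x, ξ)` on the cotangent bundle of `ℝ^N`. -/
abbrev Symb (d : ℕ) : Type := E d → E d → ℂ

/-- `∂/∂ξ_j`. -/
def dXi {d : ℕ} (j : Fin (d + 1)) (a : Symb d) : Symb d := fun x ξ =>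
  fderiv ℝ (fun η => a x η) ξ (stdVec j)

/-- `∂/∂x^i`. -/
def dX {d : ℕ} (i : Fin (d + 1)) (a : Symb d) : Symb d := fun x ξ =>
  fderiv ℝ (fun y => a y ξ) x (stdVec i)

/-- The coefficients `B_j^k(x)` of the inverse of the matrix `(A_i^j(x))`. -/
def invFrame {d : ℕ} (A : Frame d) : Frame d := fun x => (A x)⁻¹

/-- The good derivative `D_ξ = ∑ j, B_j^N(x) ∂/∂ξ_j`. -/
def goodXi {d : ℕ} (A : Frame d) (a : Symb d) : Symb d := fun x ξ =>
  ∑ j, (invFrame A x j (Fin.last d) : ℂ) * dXi j a x ξ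

/-- The good derivative `D_i = ∂/∂x^i + ∑ k p l, (∂B_k^p/∂x^i)(x) A_p^l(x) ξ_l ∂/∂ξ_k`. -/
def goodX {d : ℕ} (A : Frame d) (i : Fin (d + 1)) (a : Symb d) : Symb d := fun x ξ =>
  dX i a x ξ + ∑ k, ∑ p, ∑ l,
    ((fderiv ℝ (fun y => invFrame A y k p) x (stdVec i) * A x p l * ξ l : ℝ) : ℂ) * dXi k a x ξ

/-- The seminorm `ρ_x(ξ) = (∑ i < N, |(M_x ξ)_i|²)^{1/2}` with `(M_x ξ)_i = ∑ j, A_i^j(x) ξ_j`. -/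
def rho {d : ℕ} (A : Frame d) (x ξ : E d) : ℝ :=
  Real.sqrt (∑ i : Fin d, (∑ j, A x i.castSucc j * ξ j) ^ 2)

/-- The mixed symbols of order `(m, n)` with respect to the frame `A`: smooth functions with
`|∂_ξ^α D_ξ^β D^I a| ≤ C_{α,β,I} (1 + |ξ|)^{m - |β|} (1 + ρ_x(ξ) + |ξ|^{1/2})^{n - |α|}`. -/
structure IsFrameSymbol {d : ℕ} (A : Frame d) (m n : ℝ) (a : Symb d) : Prop where
  smooth : ContDiff ℝ ∞ (fun p : E d × E d => a p.1 p.2)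
  bound : ∀ (α : List (Fin (d + 1))) (β : ℕ) (I : List (Fin (d + 1))), ∃ C : ℝ, ∀ x ξ : E d,
    ‖(α.foldr dXi ((goodXi A)^[β] (I.foldr (goodX A) a))) x ξ‖ ≤
      C * (1 + ‖ξ‖) ^ (m - β) * (1 + rho A x ξ + Real.sqrt ‖ξ‖) ^ (n - α.length)

/-- The class `S^{m,n}(D)`. -/
def mixedSymbols {d : ℕ} (D : Distr d) (m n : ℝ) : Set (Symb d) :=
  {a | ∃ A : Frame d, IsAdaptedFrame D A ∧ IsFrameSymbol A m n a}

/-- The class `S^m` of isotropic symbols. -/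
def isotropicSymbols (d : ℕ) (m : ℝ) : Set (Symb d) :=
  {a | ContDiff ℝ ∞ (fun p : E d × E d => a p.1 p.2) ∧
    ∀ α I : List (Fin (d + 1)), ∃ C : ℝ, ∀ x ξ : E d,
      ‖(α.foldr dXi (I.foldr dX a)) x ξ‖ ≤ C * (1 + ‖ξ‖) ^ (m - α.length)}

/-- The class `S^{-∞}`; the operators `T_e`, `e ∈ S^{-∞}`, are the infinitely smoothing ones. -/
def smoothingSymbols (d : ℕ) : Set (Symb d) :=
  {e | ∀ m : ℕ, e ∈ isotropicSymbols d (-(m : ℝ))}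

/-- `T_a f(x) = ∫ a(x, ξ) (𝓕 f)(ξ) e^{2πi x·ξ} dξ`. -/
def opT {d : ℕ} (a : Symb d) (f : E d → ℂ) (x : E d) : ℂ :=
  ∫ ξ : E d, a x ξ * (𝓕 f) ξ * Complex.exp (2 * Real.pi * Complex.I * (inner ℝ x ξ : ℝ))

/-- An admissible change of coordinates of `ℝ^N`: a diffeomorphism `Φ` of `ℝ^N` such that
`∂Φ/∂x` and all its derivatives are bounded and `det (∂Φ/∂x)` is bounded away from `0`. -/
structure IsAdmissible {d : ℕ} (Φ : E d ≃ E d) : Prop where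
  smooth : ContDiff ℝ ∞ Φ
  smooth_symm : ContDiff ℝ ∞ Φ.symm
  bounded : ∀ k : ℕ, 1 ≤ k → ∃ C : ℝ, ∀ x, ‖iteratedFDeriv ℝ k Φ x‖ ≤ C
  det_bound : ∃ c : ℝ, 0 < c ∧ ∀ x, c ≤ |(fderiv ℝ Φ x).det|

/-- The distribution `dΦ(D)`, with fibre `dΦ_x(D_x)` at the point `Φ(x)`. -/
def pushDistr {d : ℕ} (Φ : E d ≃ E d) (D : Distr d) : Distr d := fun y =>
  (D (Φ.symm y)).map (fderiv ℝ Φ (Φ.symm y)).toLinearMap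

/-- The tubular neighbourhood `Δ = {(x, y) : |x - y| < δ}` of the diagonal. -/
def tube (d : ℕ) (δ : ℝ) : Set (E d × E d) := {p | ‖p.1 - p.2‖ < δ}

/-- The matrix `𝓑_j^k(x) = -∂/∂y^j Θ(x, y)_k` at `y = x`. -/
def phaseMatrix {d : ℕ} (Θ : E d → E d → E d) (x : E d) :
    Matrix (Fin (d + 1)) (Fin (d + 1)) ℝ :=
  Matrix.of fun j k => -(fderiv ℝ (fun y => Θ x y) x (stdVec j)) k

/-- `Θ` is a phase function on `Δ` with structural constants `C` and `c₀`. Only its values on `Δ`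
matter. -/
structure IsPhase {d : ℕ} (δ : ℝ) (C : ℕ → ℝ) (c₀ : ℝ) (Θ : E d → E d → E d) : Prop where
  smooth : ContDiffOn ℝ ∞ (fun p : E d × E d => Θ p.1 p.2) (tube d δ)
  bounded : ∀ k : ℕ, ∀ p ∈ tube d δ,
    ‖iteratedFDeriv ℝ k (fun p : E d × E d => Θ p.1 p.2) p‖ ≤ C k
  diag : ∀ x, Θ x x = 0
  det_bound : ∀ x, c₀ ≤ |(phaseMatrix Θ x).det|

/-- `Θ` is compatible with `D`: `D_x` is the kernel of `∑ j, 𝓑_j^N(x) dx^j` for all `x`. -/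
def IsCompatible {d : ℕ} (Θ : E d → E d → E d) (D : Distr d) : Prop :=
  ∀ x v : E d, v ∈ D x ↔ ∑ j, phaseMatrix Θ x j (Fin.last d) * v j = 0

/-- The inner integral `∫ φ(x - y) a₀(x, ξ) f(y) e^{2πi Θ(x,y)·ξ} dy`. -/
def phaseInner {d : ℕ} (Θ : E d → E d → E d) (φ : E d → ℂ) (a₀ : Symb d) (f : E d → ℂ)
    (x ξ : E d) : ℂ :=
  ∫ y : E d, φ (x - y) * a₀ x ξ * f y *
    Complex.exp (2 * Real.pi * Complex.I * (inner ℝ (Θ x y) ξ : ℝ))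

/-- `∫ ∫ φ(x - y) a₀(x, ξ) f(y) e^{2πi Θ(x,y)·ξ} dy dξ`. -/
def phaseOp {d : ℕ} (Θ : E d → E d → E d) (φ : E d → ℂ) (a₀ : Symb d) (f : E d → ℂ)
    (x : E d) : ℂ :=
  ∫ ξ : E d, phaseInner Θ φ a₀ f x ξ

end MixedPDO

end

open MixedPDO

open scoped FourierTransform SchwartzMap ContDiff
open MeasureTheory

noncomputable section

set_option linter.unusedSectionVars false

namespace MixedPDO

/-! In the fibre coordinates θ = A(x)ξ the good derivatives become coordinate derivatives: D_i is
∂/∂x^i at fixed θ, and ∑_j B_j^l ∂/∂ξ_j is ∂/∂θ_l. So a lies in S^{m,n}(D) if and only if its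
transplant a♯ = `sharp A a` lies in one fixed class `SMem m n`, in which ∂_x costs nothing, ∂/∂θ_N
gains a factor 1 + |θ|, and ∂/∂θ_j with j < N gains `lam θ` = 1 + |θ'| + |θ|^{1/2}
(`isFrameSymbol_iff`). Two frames adapted to the same distribution differ by a block triangular
matrix A A'⁻¹, and `SMem` is invariant under block triangular changes of the fibre variable
(`SMem.fib`). This gives (1).

For (2) and (3), T_a f(x) is the integral of a♯(x,θ) against the inverse Fourier transform of u ↦
f(x - Aᵀu) (`opT_sharp`). With the right frame, a change of coordinates and a compatible phase both
amount to replacing u by u - p(x,u), where p vanishes to second order at u = 0. Both therefore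
reduce to one family of operators on symbols, `opU`, U b(x,θ) = ∫∫ ψ(x,w) b(x,η) e^{2πi(w·(η-θ) +
g(x,w)·θ)} dw dη. Integrating U b against the inverse Fourier transform of F gives the same as
integrating b against that of ψ(x,w) F(w - g(x,w)) (`integral_opU_mul`): U carries out the
substitution w ↦ w - g(x,w).

The core is `opU_smem`: if ψ vanishes to order s at w = 0, then U maps `SMem m n` to `SMem (m - s/2)
n`. For the size of U b put w = v/R and η = θ + Rζ with R = (1 + |θ|)^{1/2}. Since g = O(|w|²), the
phase g(x,v/R)·θ is controlled uniformly in θ, the weights vary slowly at this scale, and ψ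
contributes R^{-s}. Integration by parts in v and ζ gives uniform bounds as long as |η| is not small
compared to |θ|. In the remaining region the w-gradient of the phase is at least |θ|/4, because |∂_w
g| ≤ 1/2, and non-stationary phase applies. As for derivatives, ∂_x produces the factors θ_j ∂_x
g_j, whose growth is paid for by the second order vanishing of ∂_x g_j, and ∂/∂θ_j produces U(∂_j b)
and the amplitude g_j ψ, which gains a full order. No asymptotic expansion is needed.

If g = 0 and ψ is constant in w near w = 0, then U is multiplication by ψ(x,0) modulo rapidly
decreasing functions (`Flat.opU_sub_smem`), since the Fourier transform of ψ has vanishing moments.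

For (3) take the frame A = 𝓑⁻¹, which is adapted to D by compatibility, so that Θ(x, x - Aᵀu) = u -
p(x,u) on the support of the cutoff. Let w ↦ w - g(x,w) be the inverse of u ↦ u - p(x,u). A symbol
a₀ then corresponds exactly to a♯ = U a₀ with phase g and an amplitude that contains the Jacobians,
which is (b). Conversely, a₀ = U a♯ with phase p returns a♯ up to a flat amplitude, hence up to a
smoothing operator, which is (a). For (2) one defines p by Φ(x) - Φ(x - Aᵀu) = Ãᵀ(u - p(x,u)) with
the image frame Ã. The smoothing remainder is transported through its kernel (`smoothing_change`).
-/

/-- The directional derivative of a function in the direction `v`. -/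
def dd {P : Type} [NormedAddCommGroup P] [NormedSpace ℝ P] (v : P) (f : P → ℂ) : P → ℂ :=
  fun p => fderiv ℝ f p v

/-- A family of weights `a ^ m * b ^ n` of orders `(m, n)`, depending on a parameter `q : Q`, on
subsets `dom q` of `P`, and directions of differentiation, each of which shifts the order. -/
structure WSys (Q P : Type) where
  ι : Type
  dir : ι → P
  shift : ι → ℝ × ℝ
  dom : Q → Set P
  a : Q → P → ℝ
  b : Q → P → ℝ
  a_pos : ∀ q p, p ∈ dom q → 0 < a q p
  b_pos : ∀ q p, p ∈ dom q → 0 < b q p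

/-! ### Directional derivatives -/

section dd
variable {P : Type} [NormedAddCommGroup P] [NormedSpace ℝ P]

theorem dd_add {f g : P → ℂ} (hf : Differentiable ℝ f) (hg : Differentiable ℝ g) (v : P) :
    dd v (fun p => f p + g p) = fun p => dd v f p + dd v g p := by
  ext p; simp [dd, fderiv_fun_add (hf p) (hg p)]

theorem dd_mul {f g : P → ℂ} (hf : Differentiable ℝ f) (hg : Differentiable ℝ g) (v : P) :
    dd v (fun p => f p * g p) = fun p => dd v f p * g p + f p * dd v g p := by
  ext p; simp [dd, fderiv_fun_mul (hf p) (hg p)]; ring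

theorem dd_const (c : ℂ) (v : P) : dd v (fun _ : P => c) = fun _ => 0 := by
  ext p; simp [dd]

theorem dd_const_mul {f : P → ℂ} (hf : Differentiable ℝ f) (c : ℂ) (v : P) :
    dd v (fun p => c * f p) = fun p => c * dd v f p := by
  rw [dd_mul (differentiable_const c) hf, dd_const]; simp

theorem dd_sum {ι : Type*} (s : Finset ι) {f : ι → P → ℂ} (hf : ∀ i, Differentiable ℝ (f i))
    (v : P) : dd v (fun p => ∑ i ∈ s, f i p) = fun p => ∑ i ∈ s, dd v (f i) p := by
  ext p; simp [dd, fderiv_fun_sum (fun i _ => (hf i) p)]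

theorem dd_inv {f : P → ℂ} (hf : Differentiable ℝ f) (h0 : ∀ p, f p ≠ 0) (v : P) :
    dd v (fun p => (f p)⁻¹) = fun p => -1 * (dd v f p * ((f p)⁻¹ * (f p)⁻¹)) := by
  ext p
  have h := (hasDerivAt_inv (h0 p)).comp_hasFDerivAt p (hf p).hasFDerivAt
  have h2 : HasFDerivAt (fun p => (f p)⁻¹) (-(f p ^ 2)⁻¹ • fderiv ℝ f p) p := h
  simp only [dd, h2.fderiv]
  simp [pow_two, mul_comm]

theorem contDiff_dd {f : P → ℂ} (hf : ContDiff ℝ ∞ f) (v : P) : ContDiff ℝ ∞ (dd v f) :=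
  (hf.fderiv_right (m := ∞) (by simp)).clm_apply contDiff_const

theorem dd_comm {f : P → ℂ} (hf : ContDiff ℝ ∞ f) (v w : P) : dd v (dd w f) = dd w (dd v f) := by
  ext p
  have hd : DifferentiableAt ℝ (fderiv ℝ f) p :=
    ((hf.fderiv_right (m := ∞) (by simp)).differentiable (by simp)) p
  have h1 : ∀ u : P, fderiv ℝ (fun p => fderiv ℝ f p u) p = (fderiv ℝ (fderiv ℝ f) p).flip u := by
    intro u
    rw [fderiv_clm_apply hd (differentiableAt_const u)]
    simp
  unfold dd
  rw [h1, h1]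
  have := (hf.contDiffAt (x := p)).isSymmSndFDerivAt (by
    simpa using (show ((2 : ℕ∞) : WithTop ℕ∞) ≤ ((⊤ : ℕ∞) : WithTop ℕ∞) from WithTop.coe_le_coe.2 le_top))
  exact this v w

theorem dd_smul_dir {f : P → ℂ} (c : ℝ) (v : P) : dd (c • v) f = fun p => (c : ℂ) * dd v f p := by
  ext p; simp [dd]

theorem dd_add_dir {f : P → ℂ} (v w : P) : dd (v + w) f = fun p => dd v f p + dd w f p := by
  ext p; simp [dd]

theorem dd_sum_dir {ι : Type*} (s : Finset ι) {f : P → ℂ} (v : ι → P) :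
    dd (∑ i ∈ s, v i) f = fun p => ∑ i ∈ s, dd (v i) f p := by
  ext p; simp [dd]

theorem dd_comp_linear {P' : Type} [NormedAddCommGroup P'] [NormedSpace ℝ P'] {f : P → ℂ}
    (hf : Differentiable ℝ f) (L : P' →L[ℝ] P) (c : P) (v : P') :
    dd v (fun p => f (c + L p)) = fun p => dd (L v) f (c + L p) := by
  ext p
  have h : HasFDerivAt (fun p => c + L p) L p := L.hasFDerivAt.const_add c
  have := (hf (c + L p)).hasFDerivAt.comp p h
  have h2 : HasFDerivAt (fun p => f (c + L p)) ((fderiv ℝ f (c + L p)).comp L) p := this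
  simp [dd, h2.fderiv]

end dd

/-! ### Calculus of functions dominated by weights -/

namespace WSys

variable {Q P : Type} [NormedAddCommGroup P] [NormedSpace ℝ P] (S : WSys Q P)

/-- The weight of order `μ`. -/
def w (μ : ℝ × ℝ) (q : Q) (p : P) : ℝ := S.a q p ^ μ.1 * S.b q p ^ μ.2

/-- `f` is dominated by the weight of order `μ`. -/
def Dom (μ : ℝ × ℝ) (f : Q → P → ℂ) : Prop :=
  ∃ C : ℝ, ∀ q, ∀ p ∈ S.dom q, ‖f q p‖ ≤ C * S.w μ q p

/-- The smooth functions whose derivatives of order at most `k` are dominated by the shifted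
weights. -/
def Mem : ℕ → ℝ × ℝ → (Q → P → ℂ) → Prop
  | 0, μ, f => (∀ q, ContDiff ℝ ∞ (f q)) ∧ S.Dom μ f
  | k + 1, μ, f => (∀ q, ContDiff ℝ ∞ (f q)) ∧ S.Dom μ f ∧
      ∀ i, Mem k (μ + S.shift i) (fun q => dd (S.dir i) (f q))

variable {S}

theorem w_pos (μ : ℝ × ℝ) {q : Q} {p : P} (hp : p ∈ S.dom q) : 0 < S.w μ q p :=
  mul_pos (Real.rpow_pos_of_pos (S.a_pos q p hp) _) (Real.rpow_pos_of_pos (S.b_pos q p hp) _)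

theorem w_add (μ ν : ℝ × ℝ) {q : Q} {p : P} (hp : p ∈ S.dom q) :
    S.w (μ + ν) q p = S.w μ q p * S.w ν q p := by
  simp only [w, Prod.fst_add, Prod.snd_add, Real.rpow_add (S.a_pos q p hp),
    Real.rpow_add (S.b_pos q p hp)]
  ring

theorem w_zero (q : Q) (p : P) : S.w 0 q p = 1 := by simp [w]

theorem Dom.bound {μ : ℝ × ℝ} {f : Q → P → ℂ} (h : S.Dom μ f) :
    ∃ C : ℝ, 0 < C ∧ ∀ q, ∀ p ∈ S.dom q, ‖f q p‖ ≤ C * S.w μ q p := by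
  obtain ⟨C, hC⟩ := h
  refine ⟨max C 1, by positivity, fun q p hp => (hC q p hp).trans ?_⟩
  exact mul_le_mul_of_nonneg_right (le_max_left _ _) (w_pos μ hp).le

theorem Dom.add {μ : ℝ × ℝ} {f g : Q → P → ℂ} (hf : S.Dom μ f) (hg : S.Dom μ g) :
    S.Dom μ (fun q p => f q p + g q p) := by
  obtain ⟨C, hC⟩ := hf
  obtain ⟨C', hC'⟩ := hg
  refine ⟨C + C', fun q p hp => (norm_add_le _ _).trans ?_⟩
  have := hC q p hp
  have := hC' q p hp
  linarith [add_mul C C' (S.w μ q p)]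

theorem Dom.mul {μ ν : ℝ × ℝ} {f g : Q → P → ℂ} (hf : S.Dom μ f) (hg : S.Dom ν g) :
    S.Dom (μ + ν) (fun q p => f q p * g q p) := by
  obtain ⟨C, hC0, hC⟩ := hf.bound
  obtain ⟨C', hC0', hC'⟩ := hg.bound
  refine ⟨C * C', fun q p hp => ?_⟩
  rw [norm_mul, w_add μ ν hp]
  calc ‖f q p‖ * ‖g q p‖ ≤ (C * S.w μ q p) * (C' * S.w ν q p) := by
        gcongr
        · exact mul_nonneg hC0.le (w_pos μ hp).le
        · exact hC q p hp
        · exact hC' q p hp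
    _ = _ := by ring

theorem Mem.smooth {k : ℕ} {μ : ℝ × ℝ} {f : Q → P → ℂ} (h : S.Mem k μ f) (q : Q) :
    ContDiff ℝ ∞ (f q) := by
  cases k <;> exact h.1 q

theorem Mem.diff {k : ℕ} {μ : ℝ × ℝ} {f : Q → P → ℂ} (h : S.Mem k μ f) (q : Q) :
    Differentiable ℝ (f q) := (h.smooth q).differentiable (by simp)

theorem Mem.dom {k : ℕ} {μ : ℝ × ℝ} {f : Q → P → ℂ} (h : S.Mem k μ f) : S.Dom μ f := by
  cases k
  · exact h.2
  · exact h.2.1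

theorem Mem.deriv {k : ℕ} {μ : ℝ × ℝ} {f : Q → P → ℂ} (h : S.Mem (k + 1) μ f) (i : S.ι) :
    S.Mem k (μ + S.shift i) (fun q => dd (S.dir i) (f q)) := h.2.2 i

/-- Membership by coinduction. -/
theorem mem_of_coind (R : ℝ × ℝ → (Q → P → ℂ) → Prop)
    (h0 : ∀ μ f, R μ f → (∀ q, ContDiff ℝ ∞ (f q)) ∧ S.Dom μ f)
    (h1 : ∀ μ f, R μ f → ∀ i, R (μ + S.shift i) (fun q => dd (S.dir i) (f q)))
    (k : ℕ) {μ : ℝ × ℝ} {f : Q → P → ℂ} (h : R μ f) : S.Mem k μ f := by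
  induction k generalizing μ f with
  | zero => exact h0 μ f h
  | succ k ih => exact ⟨(h0 μ f h).1, (h0 μ f h).2, fun i => ih (h1 μ f h i)⟩

theorem Mem.pred {k : ℕ} {μ : ℝ × ℝ} {f : Q → P → ℂ} (h : S.Mem (k + 1) μ f) : S.Mem k μ f := by
  induction k generalizing μ f with
  | zero => exact ⟨h.1, h.2.1⟩
  | succ k ih => exact ⟨h.1, h.2.1, fun i => ih (h.2.2 i)⟩

theorem mem_zero (k : ℕ) (μ : ℝ × ℝ) : S.Mem k μ (fun _ _ => (0 : ℂ)) := by
  refine mem_of_coind (fun _ f => f = fun _ _ => (0 : ℂ)) ?_ ?_ k rfl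
  · rintro μ f rfl
    exact ⟨fun _ => contDiff_const, 0, by simp⟩
  · rintro μ f rfl i
    ext q p; simp [dd]

/-- Functions of the parameter alone. -/
theorem mem_param (k : ℕ) {μ : ℝ × ℝ} {c : Q → ℂ} (h : S.Dom μ (fun q _ => c q)) :
    S.Mem k μ (fun q _ => c q) := by
  cases k with
  | zero => exact ⟨fun _ => contDiff_const, h⟩
  | succ k =>
    refine ⟨fun _ => contDiff_const, h, fun i => ?_⟩
    simp only [dd_const]
    exact mem_zero k _

theorem mem_const (k : ℕ) (c : ℂ) : S.Mem k 0 (fun _ _ => c) :=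
  mem_param k ⟨‖c‖, fun q p _ => by simp [w_zero]⟩

theorem Mem.add {k : ℕ} {μ : ℝ × ℝ} {f g : Q → P → ℂ} (hf : S.Mem k μ f) (hg : S.Mem k μ g) :
    S.Mem k μ (fun q p => f q p + g q p) := by
  induction k generalizing μ f g with
  | zero => exact ⟨fun q => (hf.smooth q).add (hg.smooth q), hf.dom.add hg.dom⟩
  | succ k ih =>
    refine ⟨fun q => (hf.smooth q).add (hg.smooth q), hf.dom.add hg.dom, fun i => ?_⟩
    have := ih (hf.deriv i) (hg.deriv i)
    convert this using 2 with q
    exact dd_add (hf.diff q) (hg.diff q) _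

theorem Mem.mul {k : ℕ} {μ ν : ℝ × ℝ} {f g : Q → P → ℂ} (hf : S.Mem k μ f) (hg : S.Mem k ν g) :
    S.Mem k (μ + ν) (fun q p => f q p * g q p) := by
  induction k generalizing μ ν f g with
  | zero => exact ⟨fun q => (hf.smooth q).mul (hg.smooth q), hf.dom.mul hg.dom⟩
  | succ k ih =>
    refine ⟨fun q => (hf.smooth q).mul (hg.smooth q), hf.dom.mul hg.dom, fun i => ?_⟩
    have h1 := ih (hf.deriv i) hg.pred
    have h2 := ih hf.pred (hg.deriv i)
    rw [show μ + S.shift i + ν = μ + ν + S.shift i by abel] at h1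
    rw [show μ + (ν + S.shift i) = μ + ν + S.shift i by abel] at h2
    convert h1.add h2 using 2 with q
    exact dd_mul (hf.diff q) (hg.diff q) _

theorem Mem.cast {k : ℕ} {μ ν : ℝ × ℝ} {f g : Q → P → ℂ} (hf : S.Mem k μ f) (h : μ = ν)
    (hfg : ∀ q p, g q p = f q p) : S.Mem k ν g := by
  subst h
  rwa [show g = f from funext fun q => funext fun p => hfg q p]

theorem Mem.const_mul {k : ℕ} {μ : ℝ × ℝ} {f : Q → P → ℂ} (hf : S.Mem k μ f) (c : ℂ) :
    S.Mem k μ (fun q p => c * f q p) :=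
  ((mem_const k c).mul hf).cast (by simp) fun _ _ => rfl

theorem Mem.sum {k : ℕ} {μ : ℝ × ℝ} {ι : Type*} (s : Finset ι) {f : ι → Q → P → ℂ}
    (hf : ∀ i ∈ s, S.Mem k μ (f i)) : S.Mem k μ (fun q p => ∑ i ∈ s, f i q p) := by
  classical
  induction s using Finset.induction_on with
  | empty => simpa using mem_zero k μ
  | insert i s hi ih =>
    refine Mem.cast ((hf i (by simp)).add (ih fun j hj => hf j (by simp [hj]))) rfl fun q p => ?_
    rw [Finset.sum_insert hi]

theorem Mem.neg {k : ℕ} {μ : ℝ × ℝ} {f : Q → P → ℂ} (hf : S.Mem k μ f) :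
    S.Mem k μ (fun q p => -f q p) := (hf.const_mul (-1)).cast rfl fun _ _ => by ring

theorem Mem.sub {k : ℕ} {μ : ℝ × ℝ} {f g : Q → P → ℂ} (hf : S.Mem k μ f) (hg : S.Mem k μ g) :
    S.Mem k μ (fun q p => f q p - g q p) := (hf.add hg.neg).cast rfl fun _ _ => by ring

/-- An order can be raised by `δ` if the weight of order `-δ` is bounded. -/
theorem Mem.weaken {k : ℕ} {μ ν : ℝ × ℝ} {f : Q → P → ℂ} (hf : S.Mem k μ f)
    (C : ℝ) (h : ∀ q, ∀ p ∈ S.dom q, S.w (μ - ν) q p ≤ C) : S.Mem k ν f := by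
  -- The weights are multiplicative in the order, so an upper bound for the weight of order μ - ν
  -- says that the constant 1 has order ν - μ.
  have h1 : S.Mem k (ν - μ) (fun _ _ => (1 : ℂ)) := by
    refine mem_param k ⟨C, fun q p hp => ?_⟩
    have h2 := w_add (S := S) (μ - ν) (ν - μ) hp
    rw [show μ - ν + (ν - μ) = 0 by abel, w_zero] at h2
    rw [norm_one, h2]
    exact mul_le_mul_of_nonneg_right (h q p hp) (w_pos _ hp).le
  exact (h1.mul hf).cast (by abel) fun _ _ => by ring

theorem Mem.pow {k : ℕ} {μ : ℝ × ℝ} {f : Q → P → ℂ} (hf : S.Mem k μ f) (n : ℕ) :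
    S.Mem k ((n : ℝ) • μ) (fun q p => f q p ^ n) := by
  induction n with
  | zero => exact (mem_const k 1).cast (by simp) (by simp)
  | succ n ih =>
    exact (ih.mul hf).cast (by simp [add_smul]) fun q p => pow_succ _ _

/-- The derivative -f'/f² has again order -μ plus the shift, so only the size of f⁻¹ needs the lower
bound. Non-vanishing off the domains serves smoothness alone. -/
theorem Mem.inv {k : ℕ} {μ : ℝ × ℝ} {f : Q → P → ℂ} (hf : S.Mem k μ f) (h0 : ∀ q p, f q p ≠ 0)
    (c : ℝ) (hc : 0 < c) (h : ∀ q, ∀ p ∈ S.dom q, c * S.w μ q p ≤ ‖f q p‖) :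
    S.Mem k (-μ) (fun q p => (f q p)⁻¹) := by
  have hd : S.Dom (-μ) (fun q p => (f q p)⁻¹) := by
    refine ⟨c⁻¹, fun q p hp => ?_⟩
    have h2 := w_add (S := S) μ (-μ) hp
    rw [show μ + -μ = 0 by abel, w_zero] at h2
    have h3 := w_pos (S := S) μ hp
    rw [norm_inv, inv_le_comm₀ (norm_pos_iff.2 (h0 q p)) (mul_pos (inv_pos.2 hc) (w_pos _ hp)),
      mul_inv, inv_inv, show (S.w (-μ) q p)⁻¹ = S.w μ q p by
        rw [inv_eq_iff_eq_inv]; exact eq_inv_of_mul_eq_one_left ((mul_comm _ _).trans h2.symm)]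
    exact h q p hp
  have hs : ∀ q, ContDiff ℝ ∞ (fun p => (f q p)⁻¹) := fun q => (hf.smooth q).inv (h0 q)
  induction k with
  | zero => exact ⟨hs, hd⟩
  | succ k ih =>
    refine ⟨hs, hd, fun i => ?_⟩
    have h1 := ih hf.pred
    refine Mem.cast (((hf.deriv i).mul (h1.mul h1)).const_mul (-1)) (by abel) fun q p => ?_
    rw [dd_inv (hf.diff q) (h0 q)]

theorem Mem.mono {k l : ℕ} (h : l ≤ k) {μ : ℝ × ℝ} {f : Q → P → ℂ} (hf : S.Mem k μ f) :
    S.Mem l μ f := by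
  induction h with
  | refl => exact hf
  | step _ ih => exact ih hf.pred

end WSys

/-! ### Smooth functions with bounded derivatives: products, compositions, inverses -/

section Cb
variable {P P' F F' G R : Type} [NormedAddCommGroup P] [NormedSpace ℝ P]
  [NormedAddCommGroup P'] [NormedSpace ℝ P']
  [NormedAddCommGroup F] [NormedSpace ℝ F] [NormedAddCommGroup F'] [NormedSpace ℝ F']
  [NormedAddCommGroup G] [NormedSpace ℝ G]
  [NormedRing R] [NormedAlgebra ℝ R] [CompleteSpace R]

/-- The derivatives of `f` of order at most `n` are bounded. -/
def BddTo (n : ℕ) (f : P → F) : Prop := ∀ k ≤ n, ∃ C : ℝ, ∀ x, ‖iteratedFDeriv ℝ k f x‖ ≤ C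

/-- Smooth functions with all derivatives bounded. -/
structure Cb (f : P → F) : Prop where
  smooth : ContDiff ℝ ∞ f
  bdd : ∀ k : ℕ, ∃ C : ℝ, ∀ x, ‖iteratedFDeriv ℝ k f x‖ ≤ C

/-- Smooth functions with all derivatives of positive order bounded. -/
structure Cb1 (f : P → F) : Prop where
  smooth : ContDiff ℝ ∞ f
  bdd : ∀ k : ℕ, 1 ≤ k → ∃ C : ℝ, ∀ x, ‖iteratedFDeriv ℝ k f x‖ ≤ C

theorem Cb.bddTo {f : P → F} (hf : Cb f) (n : ℕ) : BddTo n f := fun k _ => hf.bdd k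

theorem Cb.cb1 {f : P → F} (hf : Cb f) : Cb1 f := ⟨hf.smooth, fun k _ => hf.bdd k⟩

theorem contDiff_fderiv {f : P → F} (hf : ContDiff ℝ ∞ f) : ContDiff ℝ ∞ (fderiv ℝ f) :=
  hf.fderiv_right (m := ∞) (by simp)

theorem Cb1.fderiv {f : P → F} (hf : Cb1 f) : Cb (fderiv ℝ f) :=
  ⟨contDiff_fderiv hf.smooth, fun k => by
    obtain ⟨C, hC⟩ := hf.bdd (k + 1) (by omega)
    exact ⟨C, fun x => by rw [norm_iteratedFDeriv_fderiv]; exact hC x⟩⟩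

theorem Cb1.of_fderiv {f : P → F} (hf : ContDiff ℝ ∞ f) (h : Cb (_root_.fderiv ℝ f)) : Cb1 f :=
  ⟨hf, fun k hk => by
    obtain ⟨C, hC⟩ := h.bdd (k - 1)
    refine ⟨C, fun x => ?_⟩
    have := hC x
    rwa [norm_iteratedFDeriv_fderiv, Nat.sub_add_cancel hk] at this⟩

theorem Cb.fderiv {f : P → F} (hf : Cb f) : Cb (_root_.fderiv ℝ f) := hf.cb1.fderiv

theorem Cb.bound {f : P → F} (hf : Cb f) : ∃ C : ℝ, 0 < C ∧ ∀ x, ‖f x‖ ≤ C := by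
  obtain ⟨C, hC⟩ := hf.bdd 0
  refine ⟨max C 1, by positivity, fun x => ?_⟩
  have := hC x
  rw [norm_iteratedFDeriv_zero] at this
  exact this.trans (le_max_left _ _)

theorem Cb1.cb {f : P → F} (hf : Cb1 f) (h : ∃ C : ℝ, ∀ x, ‖f x‖ ≤ C) : Cb f :=
  ⟨hf.smooth, fun k => by
    rcases Nat.eq_zero_or_pos k with rfl | hk
    · simpa only [norm_iteratedFDeriv_zero] using h
    · exact hf.bdd k hk⟩

theorem Cb1.lipschitz {f : P → F} (hf : Cb1 f) :
    ∃ C : ℝ, 0 < C ∧ ∀ x y, ‖f x - f y‖ ≤ C * ‖x - y‖ := by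
  obtain ⟨C, hC0, hC⟩ := hf.fderiv.bound
  refine ⟨C, hC0, fun x y => ?_⟩
  exact convex_univ.norm_image_sub_le_of_norm_fderiv_le
    (fun z _ => (hf.smooth.differentiable (by simp)) z) (fun z _ => hC z) (Set.mem_univ y)
    (Set.mem_univ x)

theorem BddTo.bilin {n : ℕ} (B : F →L[ℝ] F' →L[ℝ] G) {f : P → F} {g : P → F'}
    (hfs : ContDiff ℝ ∞ f) (hgs : ContDiff ℝ ∞ g) (hf : BddTo n f) (hg : BddTo n g) :
    BddTo n (fun x => B (f x) (g x)) := by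
  intro k hk
  choose! C hC using hf
  choose! C' hC' using hg
  refine ⟨‖B‖ * ∑ i ∈ Finset.range (k + 1), (k.choose i : ℝ) * C i * C' (k - i), fun x => ?_⟩
  refine (B.norm_iteratedFDeriv_le_of_bilinear hfs hgs x (by exact_mod_cast le_top)).trans ?_
  gcongr with i hi
  · exact mul_nonneg (by positivity)
      ((norm_nonneg _).trans (hC i (by simp at hi; omega) x))
  · exact hC i (by simp at hi; omega) x
  · exact hC' (k - i) (by omega) x

theorem Cb.bilin (B : F →L[ℝ] F' →L[ℝ] G) {f : P → F} {g : P → F'} (hf : Cb f) (hg : Cb g) :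
    Cb (fun x => B (f x) (g x)) :=
  ⟨(B.contDiff.comp hf.smooth).clm_apply hg.smooth, fun k =>
    BddTo.bilin B hf.smooth hg.smooth (hf.bddTo k) (hg.bddTo k) k le_rfl⟩

theorem BddTo.comp {n : ℕ} {g : P' → F} {f : P → P'} (hgs : ContDiff ℝ ∞ g)
    (hfs : ContDiff ℝ ∞ f) (hg : BddTo n g)
    (hf : ∀ k, 1 ≤ k → k ≤ n → ∃ C : ℝ, ∀ x, ‖iteratedFDeriv ℝ k f x‖ ≤ C) :
    BddTo n (fun x => g (f x)) := by
  intro k hk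
  choose! C hC using hg
  choose! C' hC' using hf
  -- The estimate for compositions wants one number D whose i-th power bounds the i-th derivative of
  -- f, for 1 ≤ i ≤ k. One plus the sum of all the bounds serves; f itself may be unbounded.
  refine ⟨k.factorial * (∑ i ∈ Finset.range (k + 1), |C i|) *
    (1 + ∑ i ∈ Finset.range (k + 1), |C' i|) ^ k, fun x => ?_⟩
  refine norm_iteratedFDeriv_comp_le hgs hfs (n := k) (by exact_mod_cast le_top) x ?_ ?_
  · intro i hi
    refine (hC i (by omega) _).trans ((le_abs_self _).trans ?_)
    exact Finset.single_le_sum (f := fun i => |C i|) (fun _ _ => abs_nonneg _) (by simp; omega)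
  · intro i h1 hi
    have h2 : |C' i| ≤ ∑ i ∈ Finset.range (k + 1), |C' i| :=
      Finset.single_le_sum (f := fun i => |C' i|) (fun _ _ => abs_nonneg _) (by simp; omega)
    have h3 := hC' i h1 (by omega) x
    have h4 := le_abs_self (C' i)
    refine le_trans (by linarith) (le_self_pow₀ ?_ (by omega : i ≠ 0))
    have := abs_nonneg (C' i)
    linarith

theorem Cb.comp {g : P' → F} {f : P → P'} (hg : Cb g) (hf : Cb1 f) : Cb (fun x => g (f x)) :=
  ⟨hg.smooth.comp hf.smooth, fun k => BddTo.comp hg.smooth hf.smooth (hg.bddTo k)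
    (fun i h _ => hf.bdd i h) k le_rfl⟩

theorem Cb.const (c : F) : Cb (fun _ : P => c) :=
  ⟨contDiff_const, fun k => by
    rcases Nat.eq_zero_or_pos k with rfl | hk
    · exact ⟨‖c‖, fun x => by rw [norm_iteratedFDeriv_zero]⟩
    · exact ⟨0, fun x => by rw [iteratedFDeriv_const_of_ne (by omega)]; simp⟩⟩

theorem Cb1.clm (L : P →L[ℝ] F) : Cb1 (fun x => L x) := by
  refine Cb1.of_fderiv L.contDiff ?_
  have : _root_.fderiv ℝ (fun x => L x) = fun _ => L := by ext1 x; exact L.fderiv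
  rw [this]
  exact Cb.const L

theorem Cb.clm (L : F →L[ℝ] F') {f : P → F} (hf : Cb f) : Cb (fun x => L (f x)) :=
  ⟨L.contDiff.comp hf.smooth, fun k => by
    obtain ⟨C, hC⟩ := hf.bdd k
    refine ⟨‖L‖ * C, fun x => ?_⟩
    exact (L.norm_iteratedFDeriv_comp_left hf.smooth.contDiffAt (by exact_mod_cast le_top)).trans
      (by gcongr; exact hC x)⟩

theorem Cb.add {f g : P → F} (hf : Cb f) (hg : Cb g) : Cb (fun x => f x + g x) :=
  ⟨hf.smooth.add hg.smooth, fun k => by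
    obtain ⟨C, hC⟩ := hf.bdd k
    obtain ⟨C', hC'⟩ := hg.bdd k
    refine ⟨C + C', fun x => ?_⟩
    have h : iteratedFDeriv ℝ k (fun x => f x + g x) x =
        iteratedFDeriv ℝ k f x + iteratedFDeriv ℝ k g x :=
      iteratedFDeriv_add_apply (hf.smooth.contDiffAt.of_le (by exact_mod_cast le_top))
        (hg.smooth.contDiffAt.of_le (by exact_mod_cast le_top))
    rw [h]
    exact (norm_add_le _ _).trans (add_le_add (hC x) (hC' x))⟩

theorem Cb.neg {f : P → F} (hf : Cb f) : Cb (fun x => -f x) := by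
  simpa using hf.clm (-ContinuousLinearMap.id ℝ F)

theorem Cb.sub {f g : P → F} (hf : Cb f) (hg : Cb g) : Cb (fun x => f x - g x) := by
  simpa [sub_eq_add_neg] using hf.add hg.neg

theorem Cb.sum {ι : Type*} (s : Finset ι) {f : ι → P → F} (hf : ∀ i ∈ s, Cb (f i)) :
    Cb (fun x => ∑ i ∈ s, f i x) := by
  classical
  induction s using Finset.induction_on with
  | empty => simpa using Cb.const (0 : F)
  | insert i s hi ih =>
    simp only [Finset.sum_insert hi]
    exact (hf i (by simp)).add (ih fun j hj => hf j (by simp [hj]))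

theorem Cb.mul {f g : P → R} (hf : Cb f) (hg : Cb g) : Cb (fun x => f x * g x) :=
  hf.bilin (ContinuousLinearMap.mul ℝ R) hg

theorem Cb.smul {f : P → ℝ} {g : P → F} (hf : Cb f) (hg : Cb g) : Cb (fun x => f x • g x) :=
  hf.bilin (ContinuousLinearMap.lsmul ℝ ℝ) hg

theorem Cb.prod {ι : Type*} (s : Finset ι) {f : ι → P → ℝ} (hf : ∀ i ∈ s, Cb (f i)) :
    Cb (fun x => ∏ i ∈ s, f i x) := by
  classical
  induction s using Finset.induction_on with
  | empty => simpa using Cb.const (1 : ℝ)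
  | insert i s hi ih =>
    simp only [Finset.prod_insert hi]
    exact (hf i (by simp)).mul (ih fun j hj => hf j (by simp [hj]))

theorem Cb.clm_apply {L : P → F →L[ℝ] F'} {f : P → F} (hL : Cb L) (hf : Cb f) :
    Cb (fun x => L x (f x)) :=
  hL.bilin (ContinuousLinearMap.id ℝ (F →L[ℝ] F')) hf

theorem Cb.clm_comp {L : P → F →L[ℝ] F'} {M : P → G →L[ℝ] F} (hL : Cb L) (hM : Cb M) :
    Cb (fun x => (L x).comp (M x)) :=
  hL.bilin (ContinuousLinearMap.compL ℝ G F F') hM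

theorem Cb1.add {f g : P → F} (hf : Cb1 f) (hg : Cb1 g) : Cb1 (fun x => f x + g x) := by
  refine Cb1.of_fderiv (hf.smooth.add hg.smooth) ?_
  have : _root_.fderiv ℝ (fun x => f x + g x) = fun x => _root_.fderiv ℝ f x + _root_.fderiv ℝ g x := by
    ext1 x
    exact fderiv_fun_add (hf.smooth.differentiable (by simp) x) (hg.smooth.differentiable (by simp) x)
  rw [this]
  exact hf.fderiv.add hg.fderiv

theorem Cb1.sub {f g : P → F} (hf : Cb1 f) (hg : Cb1 g) : Cb1 (fun x => f x - g x) := by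
  refine Cb1.of_fderiv (hf.smooth.sub hg.smooth) ?_
  have : _root_.fderiv ℝ (fun x => f x - g x) = fun x => _root_.fderiv ℝ f x - _root_.fderiv ℝ g x := by
    ext1 x
    exact fderiv_fun_sub (hf.smooth.differentiable (by simp) x) (hg.smooth.differentiable (by simp) x)
  rw [this]
  exact hf.fderiv.sub hg.fderiv

theorem Cb1.comp {g : P' → F} {f : P → P'} (hg : Cb1 g) (hf : Cb1 f) :
    Cb1 (fun x => g (f x)) := by
  refine Cb1.of_fderiv (hg.smooth.comp hf.smooth) ?_
  have : _root_.fderiv ℝ (fun x => g (f x)) =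
      fun x => (_root_.fderiv ℝ g (f x)).comp (_root_.fderiv ℝ f x) := by
    ext1 x
    exact fderiv_comp x (hg.smooth.differentiable (by simp) _) (hf.smooth.differentiable (by simp) x)
  rw [this]
  exact (hg.fderiv.comp hf).clm_comp hf.fderiv

theorem Cb1.prodMk {f : P → F} {g : P → F'} (hf : Cb1 f) (hg : Cb1 g) :
    Cb1 (fun x => (f x, g x)) := by
  have h := ((Cb1.clm (ContinuousLinearMap.inl ℝ F F')).comp hf).add
    ((Cb1.clm (ContinuousLinearMap.inr ℝ F F')).comp hg)
  simpa using h

theorem Cb1.fst : Cb1 (fun p : P × P' => p.1) := Cb1.clm (ContinuousLinearMap.fst ℝ P P')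

theorem Cb1.snd : Cb1 (fun p : P × P' => p.2) := Cb1.clm (ContinuousLinearMap.snd ℝ P P')

theorem Cb1.id : Cb1 (fun p : P => p) := Cb1.clm (ContinuousLinearMap.id ℝ P)

theorem Cb.of_compact {f : P → F} (hf : ContDiff ℝ ∞ f) (h : HasCompactSupport f) : Cb f :=
  ⟨hf, fun k => by
    have h1 : Continuous (iteratedFDeriv ℝ k f) := hf.continuous_iteratedFDeriv
      (by exact_mod_cast le_top)
    exact h1.bounded_above_of_compact_support (h.iteratedFDeriv k)⟩

theorem BddTo.succ {n : ℕ} {f : P → F} (h0 : ∃ C : ℝ, ∀ x, ‖f x‖ ≤ C)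
    (h : BddTo n (_root_.fderiv ℝ f)) : BddTo (n + 1) f := by
  intro k hk
  cases k with
  | zero => simpa only [norm_iteratedFDeriv_zero] using h0
  | succ k =>
    obtain ⟨C, hC⟩ := h k (by omega)
    exact ⟨C, fun x => by rw [← norm_iteratedFDeriv_fderiv]; exact hC x⟩

/-- A bounded pointwise inverse of a function with bounded derivatives. -/
theorem Cb.inverse {f g : P → R} (hf : Cb f) (h1 : ∀ x, f x * g x = 1) (h2 : ∀ x, g x * f x = 1)
    (hg : ∃ C : ℝ, ∀ x, ‖g x‖ ≤ C) : Cb g := by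
  let u : P → Rˣ := fun x => ⟨f x, g x, h1 x, h2 x⟩
  have hgi : g = fun x => Ring.inverse (f x) := by
    ext1 x
    exact (Ring.inverse_unit (u x)).symm
  have hs : ContDiff ℝ ∞ g := by
    rw [hgi, contDiff_iff_contDiffAt]
    intro x
    exact (contDiffAt_ringInverse ℝ (u x)).comp x hf.smooth.contDiffAt
  let Bl : R →L[ℝ] (P →L[ℝ] R) →L[ℝ] (P →L[ℝ] R) :=
    (ContinuousLinearMap.compL ℝ P R R).comp (ContinuousLinearMap.mul ℝ R)
  let Br : R →L[ℝ] (P →L[ℝ] R) →L[ℝ] (P →L[ℝ] R) :=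
    (ContinuousLinearMap.compL ℝ P R R).comp (ContinuousLinearMap.mul ℝ R).flip
  -- The derivative -g f' g is written with the fixed bilinear maps `Bl` and `Br`, so that bounds
  -- for g up to order n yield bounds up to order n + 1.
  have hd : _root_.fderiv ℝ g = fun x => Bl (-g x) (Br (g x) (_root_.fderiv ℝ f x)) := by
    ext1 x
    have h3 := (hasFDerivAt_ringInverse (𝕜 := ℝ) (u x)).comp x
      (hf.smooth.differentiable (by simp) x).hasFDerivAt
    have h4 : HasFDerivAt g ((-ContinuousLinearMap.mulLeftRight ℝ R ↑(u x)⁻¹ ↑(u x)⁻¹).comp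
      (_root_.fderiv ℝ f x)) x := by
      conv => arg 1; rw [hgi]
      exact h3
    rw [h4.fderiv]
    ext v
    simp [Bl, Br, u, mul_assoc]
  refine ⟨hs, fun k => ?_⟩
  suffices ∀ n, BddTo n g from this k k le_rfl
  intro n
  induction n with
  | zero =>
    intro k hk
    obtain rfl : k = 0 := by omega
    simpa only [norm_iteratedFDeriv_zero] using hg
  | succ n ih =>
    refine BddTo.succ hg ?_
    rw [hd]
    have hgn : BddTo n (fun x => -g x) := by
      intro k hk
      obtain ⟨C, hC⟩ := ih k hk
      refine ⟨C, fun x => ?_⟩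
      have : iteratedFDeriv ℝ k (fun x => -g x) x = -iteratedFDeriv ℝ k g x :=
        iteratedFDeriv_neg_apply
      rw [this, norm_neg]
      exact hC x
    have hBr : ContDiff ℝ ∞ (fun x => Br (g x)) := contDiff_const.clm_apply hs
    exact BddTo.bilin Bl hs.neg (hBr.clm_apply hf.fderiv.smooth) hgn
      (BddTo.bilin Br hs hf.fderiv.smooth ih (hf.fderiv.bddTo n))

theorem Cb.inv {f : P → ℝ} (hf : Cb f) {c : ℝ} (hc : 0 < c) (h : ∀ x, c ≤ |f x|) :
    Cb (fun x => (f x)⁻¹) := by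
  have h0 : ∀ x, f x ≠ 0 := fun x hx => by have := h x; simp [hx] at this; linarith
  refine hf.inverse (fun x => mul_inv_cancel₀ (h0 x)) (fun x => inv_mul_cancel₀ (h0 x))
    ⟨c⁻¹, fun x => ?_⟩
  rw [norm_inv]
  exact inv_anti₀ hc (h x)

/-- The inverse of a diffeomorphism with bounded derivatives, if the inverses of the differentials
are bounded. -/
theorem Cb1.symm [CompleteSpace P] {Φ : P ≃ P} (hΦ : Cb1 Φ) (hs : ContDiff ℝ ∞ Φ.symm)
    {C : ℝ} (hC : ∀ y, ‖_root_.fderiv ℝ Φ.symm y‖ ≤ C) : Cb1 Φ.symm := by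
  have hdΦ := hΦ.smooth.differentiable (by simp)
  have hds := hs.differentiable (by simp)
  have e1 : ∀ x, _root_.fderiv ℝ Φ x * _root_.fderiv ℝ Φ.symm (Φ x) = 1 := by
    intro x
    have h := (hdΦ (Φ.symm (Φ x))).hasFDerivAt.comp (Φ x) (hds (Φ x)).hasFDerivAt
    have h2 : HasFDerivAt (Φ ∘ Φ.symm) (1 : P →L[ℝ] P) (Φ x) := by
      rw [show (Φ ∘ Φ.symm : P → P) = _root_.id from funext Φ.apply_symm_apply]
      exact hasFDerivAt_id _
    have h3 := h.unique h2
    rw [Φ.symm_apply_apply] at h3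
    exact h3
  have e2 : ∀ x, _root_.fderiv ℝ Φ.symm (Φ x) * _root_.fderiv ℝ Φ x = 1 := by
    intro x
    have h := (hds (Φ x)).hasFDerivAt.comp x (hdΦ x).hasFDerivAt
    have h2 : HasFDerivAt (Φ.symm ∘ Φ) (1 : P →L[ℝ] P) x := by
      rw [show (Φ.symm ∘ Φ : P → P) = _root_.id from funext Φ.symm_apply_apply]
      exact hasFDerivAt_id _
    exact h.unique h2
  -- The differential of Φ⁻¹ is T ∘ Φ⁻¹, where T is the pointwise inverse of the differential of Φ.
  -- Bounds for Φ⁻¹ up to some order therefore give bounds of one order more.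
  obtain ⟨T, hT, hd⟩ : ∃ T : P → P →L[ℝ] P, Cb T ∧
      _root_.fderiv ℝ Φ.symm = fun y => T (Φ.symm y) :=
    ⟨fun x => _root_.fderiv ℝ Φ.symm (Φ x), hΦ.fderiv.inverse e1 e2 ⟨C, fun x => hC _⟩,
      by ext1 y; simp⟩
  refine Cb1.of_fderiv hs ⟨contDiff_fderiv hs, fun k => ?_⟩
  suffices ∀ n, BddTo n (_root_.fderiv ℝ Φ.symm) from this k k le_rfl
  intro n
  induction n with
  | zero =>
    intro k hk
    obtain rfl : k = 0 := by omega
    exact ⟨C, fun x => by rw [norm_iteratedFDeriv_zero]; exact hC x⟩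
  | succ n ih =>
    rw [hd]
    refine BddTo.comp hT.smooth hs (hT.bddTo _) fun k h1 hk => ?_
    obtain ⟨C', hC'⟩ := ih (k - 1) (by omega)
    refine ⟨C', fun x => ?_⟩
    have := hC' x
    rwa [norm_iteratedFDeriv_fderiv, Nat.sub_add_cancel h1] at this

theorem Cb.ofReal {f : P → ℝ} (hf : Cb f) : Cb (fun x => (f x : ℂ)) := hf.clm Complex.ofRealCLM

theorem Cb.dd {f : P → ℂ} (hf : Cb f) (v : P) : Cb (dd v f) := hf.fderiv.clm_apply (Cb.const v)

end Cb

/-! ### Smooth dependence of integrals on parameters -/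

section param
variable {P H : Type} [NormedAddCommGroup P] [NormedSpace ℝ P] [FiniteDimensional ℝ P]
  [NormedAddCommGroup H] [NormedSpace ℝ H] [FiniteDimensional ℝ H] [MeasureSpace H] [BorelSpace H]

/-- Dominated differentiation needs a bound for the full differential, while the classes of
integrands only control finitely many directional derivatives at a time. -/
theorem norm_clm_le_sum : ∃ (n : ℕ) (v : Fin n → P) (C : ℝ), 0 ≤ C ∧ ∀ L : P →L[ℝ] ℂ,
    ‖L‖ ≤ C * ∑ i, ‖L (v i)‖ := by
  let b := Module.finBasis ℝ P
  refine ⟨_, b, Fintype.card (Fin (Module.finrank ℝ P)) * ‖b.equivFunL.toContinuousLinearMap‖,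
    by positivity, fun L => ?_⟩
  have := b.opNorm_le (u := L) (M := ∑ i, ‖L (b i)‖) (by positivity)
    (fun i => Finset.single_le_sum (f := fun i => ‖L (b i)‖) (fun _ _ => norm_nonneg _) (by simp))
  simpa using this

/-- Differentiation under the integral sign, for a class of integrands that is closed under
differentiation in the parameter and dominated locally uniformly. -/
theorem contDiff_integral_of_coind (R : (P × H → ℂ) → Prop)
    (h0 : ∀ F, R F → ContDiff ℝ ∞ F ∧ ∀ ρ : ℝ, ∃ bound : H → ℝ, Integrable bound ∧
      ∀ p : P, ‖p‖ < ρ → ∀ η, ‖F (p, η)‖ ≤ bound η)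
    (h1 : ∀ F, R F → ∀ v : P, R (dd (v, 0) F)) {F : P × H → ℂ} (hF : R F) :
    ContDiff ℝ ∞ (fun p => ∫ η, F (p, η)) ∧
      ∀ v, dd v (fun p => ∫ η, F (p, η)) = fun p => ∫ η, dd (v, 0) F (p, η) := by
  have hint : ∀ F, R F → ∀ p, Integrable (fun η => F (p, η)) := by
    intro F hF p
    obtain ⟨bd, hb, hbd⟩ := (h0 F hF).2 (‖p‖ + 1)
    exact hb.mono' (((h0 F hF).1.continuous.comp (by fun_prop)).aestronglyMeasurable)
      (Filter.Eventually.of_forall fun η => hbd p (by linarith) η)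
  have hD : ∀ F, R F → ∀ p, HasFDerivAt (fun p => ∫ η, F (p, η))
      (∫ η, (fderiv ℝ F (p, η)).comp (ContinuousLinearMap.inl ℝ P H)) p := by
    intro F hF p
    obtain ⟨n, v, C, hC, hL⟩ := norm_clm_le_sum (P := P)
    choose! bd hb hbd using fun i : Fin n => (h0 _ (h1 F hF (v i))).2 (‖p‖ + 1)
    have hF1 := (h0 F hF).1
    refine hasFDerivAt_integral_of_dominated_of_fderiv_le (𝕜 := ℝ) (s := Metric.ball 0 (‖p‖ + 1))
      (F := fun p η => F (p, η))
      (F' := fun p η => (fderiv ℝ F (p, η)).comp (ContinuousLinearMap.inl ℝ P H))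
      (bound := fun η => C * ∑ i, bd i η) (Metric.isOpen_ball.mem_nhds (by simp)) ?_ (hint F hF p) ?_
      ?_ ?_ ?_
    · exact Filter.Eventually.of_forall fun p =>
        (hF1.continuous.comp (by fun_prop)).aestronglyMeasurable
    · have : Continuous (fderiv ℝ F) := hF1.continuous_fderiv (by simp)
      exact (Continuous.clm_comp (this.comp (by fun_prop)) continuous_const).aestronglyMeasurable
    · refine Filter.Eventually.of_forall fun η y hy => (hL _).trans ?_
      gcongr with i hi
      have := hbd i y (by simpa using hy) η
      simpa [dd] using this
    · exact (integrable_finsetSum _ fun i _ => hb i).const_mul C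
    · refine Filter.Eventually.of_forall fun η y hy => ?_
      exact ((hF1.differentiable (by simp)) (y, η)).hasFDerivAt.comp y
        (hasFDerivAt_prodMk_left y η)
  have hdd : ∀ F, R F → ∀ v, dd v (fun p => ∫ η, F (p, η)) = fun p => ∫ η, dd (v, 0) F (p, η) := by
    intro F hF v
    ext p
    have hI : Integrable (fun η => (fderiv ℝ F (p, η)).comp (ContinuousLinearMap.inl ℝ P H)) := by
      obtain ⟨n, w, C, hC, hL⟩ := norm_clm_le_sum (P := P)
      have hF1 := (h0 F hF).1
      have : Continuous (fderiv ℝ F) := hF1.continuous_fderiv (by simp)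
      refine Integrable.mono' ((integrable_finsetSum (s := Finset.univ) fun i _ =>
        (hint _ (h1 F hF (w i)) p).norm).const_mul C)
        (Continuous.clm_comp (this.comp (by fun_prop)) continuous_const).aestronglyMeasurable
        (Filter.Eventually.of_forall fun η => ?_)
      refine (hL _).trans (le_of_eq ?_)
      simp [dd]
    unfold dd
    rw [(hD F hF p).fderiv, ContinuousLinearMap.integral_apply hI]
    simp
  refine ⟨?_, hdd F hF⟩
  rw [contDiff_infty]
  intro n
  -- The class is closed under differentiation, so each directional derivative of the integral is
  -- again an integral of a member.
  induction n generalizing F with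
  | zero =>
    have : Continuous (fun p => ∫ η, F (p, η)) :=
      continuous_iff_continuousAt.2 fun p => (hD F hF p).continuousAt
    exact_mod_cast contDiff_zero.2 this
  | succ n ih =>
    have : ContDiff ℝ ((n : ℕ∞) + 1) (fun p => ∫ η, F (p, η)) := by
      rw [contDiff_succ_iff_fderiv_apply]
      refine ⟨fun p => (hD F hF p).differentiableAt, by simp, fun v => ?_⟩
      have h2 := hdd F hF v
      unfold dd at h2
      rw [h2]
      exact ih (h1 F hF v)
    exact_mod_cast this

end param

/-! ### The Fourier transform of test functions -/

/-- The character `e^{2πit}`. -/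
def ee (t : ℝ) : ℂ := Complex.exp (2 * Real.pi * Complex.I * t)

theorem norm_ee (t : ℝ) : ‖ee t‖ = 1 := by
  rw [ee, show 2 * (Real.pi : ℂ) * Complex.I * t = ((2 * Real.pi * t : ℝ) : ℂ) * Complex.I by
    push_cast; ring]
  exact Complex.norm_exp_ofReal_mul_I _

theorem ee_add (s t : ℝ) : ee (s + t) = ee s * ee t := by
  simp only [ee, ← Complex.exp_add]; congr 1; push_cast; ring

theorem ee_zero : ee 0 = 1 := by simp [ee]

theorem ee_neg_mul (t : ℝ) : ee (-t) * ee t = 1 := by rw [← ee_add]; simp [ee_zero]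

theorem contDiff_ee : ContDiff ℝ ∞ ee := by
  unfold ee
  exact (contDiff_const.mul Complex.ofRealCLM.contDiff).cexp

theorem hasDerivAt_ee (t : ℝ) : HasDerivAt ee (2 * Real.pi * Complex.I * ee t) t := by
  have h1 : HasDerivAt (fun t : ℝ => 2 * (Real.pi : ℂ) * Complex.I * t)
      (2 * Real.pi * Complex.I) t := by
    simpa using (Complex.ofRealCLM.hasDerivAt (x := t)).const_mul (2 * (Real.pi : ℂ) * Complex.I)
  exact h1.cexp.congr_deriv (by unfold ee; ring)

theorem dd_ee {P : Type} [NormedAddCommGroup P] [NormedSpace ℝ P] {f : P → ℝ}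
    (hf : Differentiable ℝ f) (v : P) :
    dd v (fun p => ee (f p)) = fun p => 2 * Real.pi * Complex.I * (fderiv ℝ f p v : ℝ) * ee (f p) := by
  ext p
  have := (hasDerivAt_ee (f p)).hasFDerivAt.comp p (hf p).hasFDerivAt
  have h2 : HasFDerivAt (fun p => ee (f p)) ((2 * Real.pi * Complex.I * ee (f p)) •
    (Complex.ofRealCLM.comp (fderiv ℝ f p))) p := by
    refine this.congr_fderiv ?_
    ext v
    simp [mul_comm]
  simp only [dd, h2.fderiv]
  simp
  ring

/-- `f̂(-η)`, i.e. the inverse Fourier transform. -/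
def ft {d : ℕ} (f : E d → ℂ) (η : E d) : ℂ := ∫ w, f w * ee (inner ℝ w η)

/-- Smooth functions with compact support. -/
structure Cc {d : ℕ} (h : E d → ℂ) : Prop where
  smooth : ContDiff ℝ ∞ h
  supp : HasCompactSupport h

section Fourier
variable {d : ℕ}

theorem Cc.dd {h : E d → ℂ} (hh : Cc h) (v : E d) : Cc (dd v h) :=
  ⟨contDiff_dd hh.smooth v, hh.supp.fderiv_apply (𝕜 := ℝ) v⟩

theorem Cc.mul {h : E d → ℂ} (hh : Cc h) {g : E d → ℂ} (hg : ContDiff ℝ ∞ g) :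
    Cc (fun w => g w * h w) :=
  ⟨hg.mul hh.smooth, hh.supp.mul_left⟩

theorem Cc.sub {h g : E d → ℂ} (hh : Cc h) (hg : Cc g) : Cc (fun w => h w - g w) := by
  refine ⟨hh.smooth.sub hg.smooth, ?_⟩
  simpa [sub_eq_add_neg] using! hh.supp.add hg.supp.neg

theorem Cc.add {h g : E d → ℂ} (hh : Cc h) (hg : Cc g) : Cc (fun w => h w + g w) :=
  ⟨hh.smooth.add hg.smooth, hh.supp.add hg.supp⟩

theorem Cc.zero : Cc (fun _ : E d => (0 : ℂ)) := ⟨contDiff_const, HasCompactSupport.zero⟩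

theorem Cc.sum {ι : Type*} (s : Finset ι) {f : ι → E d → ℂ} (hf : ∀ i, Cc (f i)) :
    Cc (fun w => ∑ i ∈ s, f i w) := by
  classical
  induction s using Finset.induction_on with
  | empty => simpa using Cc.zero
  | insert i s hi ih => simpa only [Finset.sum_insert hi] using (hf i).add ih

theorem Cc.integrable {h : E d → ℂ} (hh : Cc h) : Integrable h :=
  hh.smooth.continuous.integrable_of_hasCompactSupport hh.supp

theorem contDiff_inner_left (η : E d) : ContDiff ℝ ∞ (fun w : E d => inner ℝ w η) :=
  contDiff_id.inner ℝ contDiff_const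

theorem Cc.mul_ee {h : E d → ℂ} (hh : Cc h) (η : E d) : Cc (fun w => h w * ee (inner ℝ w η)) :=
  ⟨hh.smooth.mul (contDiff_ee.comp (contDiff_inner_left η)), hh.supp.mul_right⟩

theorem ft_add {f g : E d → ℂ} (hf : Cc f) (hg : Cc g) (η : E d) :
    ft (fun w => f w + g w) η = ft f η + ft g η := by
  simp only [ft, add_mul]
  exact integral_add (hf.mul_ee η).integrable (hg.mul_ee η).integrable

theorem ft_sub {f g : E d → ℂ} (hf : Cc f) (hg : Cc g) (η : E d) :
    ft (fun w => f w - g w) η = ft f η - ft g η := by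
  simp only [ft, sub_mul]
  exact integral_sub (hf.mul_ee η).integrable (hg.mul_ee η).integrable

theorem ft_const_mul (c : ℂ) (f : E d → ℂ) (η : E d) :
    ft (fun w => c * f w) η = c * ft f η := by
  simp only [ft, mul_assoc]
  exact integral_const_mul c _

theorem ft_sum {ι : Type*} (s : Finset ι) {f : ι → E d → ℂ} (hf : ∀ i, Cc (f i)) (η : E d) :
    ft (fun w => ∑ i ∈ s, f i w) η = ∑ i ∈ s, ft (f i) η := by
  simp only [ft, Finset.sum_mul]
  exact integral_finsetSum _ fun i _ => ((hf i).mul_ee η).integrable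

theorem norm_ft_le (f : E d → ℂ) (η : E d) : ‖ft f η‖ ≤ ∫ w, ‖f w‖ := by
  refine (norm_integral_le_integral_norm _).trans (le_of_eq ?_)
  simp [norm_ee]

theorem fderiv_inner_left (η w v : E d) :
    fderiv ℝ (fun w : E d => inner ℝ w η) w v = inner ℝ v η := by
  have : HasFDerivAt (fun w : E d => inner ℝ w η) (innerSL ℝ η) w := by
    have := (innerSL ℝ η).hasFDerivAt (x := w)
    refine this.congr_of_eventuallyEq (Filter.Eventually.of_forall fun w => ?_)
    simp [real_inner_comm]
  rw [this.fderiv]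
  simp [real_inner_comm]

/-- Integration by parts. The sign is minus because `ft` has the kernel e^{+2πi w·η}. -/
theorem ft_dd {h : E d → ℂ} (hh : Cc h) (v η : E d) :
    ft (dd v h) η = -(2 * Real.pi * Complex.I * (inner ℝ v η : ℝ)) * ft h η := by
  have hdi : Differentiable ℝ (fun w : E d => inner ℝ w η) :=
    (contDiff_inner_left η).differentiable (by simp)
  have he := dd_ee hdi v
  have hsm : ContDiff ℝ ∞ (fun w : E d => ee (inner ℝ w η)) :=
    contDiff_ee.comp (contDiff_inner_left η)
  have h1 := integral_mul_fderiv_eq_neg_fderiv_mul_of_integrable (μ := (volume : Measure (E d)))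
    (f := fun w => ee (inner ℝ w η)) (g := h) (v := v)
    (hh.mul (contDiff_dd hsm v)).integrable ((hh.dd v).mul hsm).integrable (hh.mul hsm).integrable
    (fun x _ => (hsm.differentiable (by simp)) x)
    (fun x _ => (hh.smooth.differentiable (by simp)) x)
  have h2 : ∀ w, fderiv ℝ (fun w : E d => ee (inner ℝ w η)) w v * h w =
      (2 * Real.pi * Complex.I * (inner ℝ v η : ℝ)) * (h w * ee (inner ℝ w η)) := by
    intro w
    have := congrFun he w
    unfold dd at this
    rw [this, fderiv_inner_left]
    ring
  simp only [h2, integral_const_mul] at h1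
  unfold ft
  rw [neg_mul, ← h1]
  congr 1
  ext w
  simp only [dd]
  ring

/-- `1 - Δ/4π²`. -/
def bessel (h : E d → ℂ) : E d → ℂ := fun w =>
  h w - ∑ j, (4 * (Real.pi : ℂ) ^ 2)⁻¹ * dd (stdVec j) (dd (stdVec j) h) w

theorem Cc.bessel {h : E d → ℂ} (hh : Cc h) : Cc (bessel h) :=
  hh.sub (Cc.sum _ fun _ => ((hh.dd _).dd _).mul contDiff_const)

theorem Cc.bessel_iterate {h : E d → ℂ} (hh : Cc h) (L : ℕ) : Cc (MixedPDO.bessel^[L] h) := by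
  induction L with
  | zero => exact hh
  | succ L ih => rw [Function.iterate_succ_apply']; exact ih.bessel

theorem inner_stdVec (j : Fin (d + 1)) (η : E d) : inner ℝ (stdVec j) η = η j := by
  simp [stdVec, EuclideanSpace.inner_single_left]

theorem sum_sq_eq (η : E d) : ∑ j, η j ^ 2 = ‖η‖ ^ 2 := by
  rw [EuclideanSpace.norm_sq_eq]; simp

theorem ft_bessel {h : E d → ℂ} (hh : Cc h) (η : E d) :
    ft (bessel h) η = (1 + ‖η‖ ^ 2 : ℝ) * ft h η := by
  unfold bessel
  rw [ft_sub hh (Cc.sum _ fun j => ((hh.dd _).dd _).mul contDiff_const),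
    ft_sum _ fun j => ((hh.dd _).dd _).mul contDiff_const]
  simp only [ft_const_mul, ft_dd (hh.dd _), ft_dd hh, inner_stdVec]
  rw [← sum_sq_eq]
  push_cast
  rw [add_mul, one_mul, Finset.sum_mul, sub_eq_add_neg, ← Finset.sum_neg_distrib]
  congr 1
  refine Finset.sum_congr rfl fun j _ => ?_
  have hpi : (Real.pi : ℂ) ≠ 0 := by exact_mod_cast Real.pi_ne_zero
  field_simp
  ring_nf
  simp [Complex.I_sq]

theorem ft_bessel_iterate {h : E d → ℂ} (hh : Cc h) (L : ℕ) (η : E d) :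
    ft (bessel^[L] h) η = ((1 + ‖η‖ ^ 2 : ℝ) : ℂ) ^ L * ft h η := by
  induction L with
  | zero => simp
  | succ L ih =>
    rw [Function.iterate_succ_apply', ft_bessel (hh.bessel_iterate L), ih]
    ring

theorem one_add_sq_le (t : ℝ) : (1 + t) ^ 2 ≤ 2 * (1 + t ^ 2) := by nlinarith [sq_nonneg (1 - t)]

/-- Decay of the Fourier transform. -/
theorem norm_ft_decay {h : E d → ℂ} (hh : Cc h) (L : ℕ) (η : E d) :
    ‖ft h η‖ ≤ (2 ^ L * ∫ w, ‖bessel^[L] h w‖) * (1 + ‖η‖) ^ (-(2 * L : ℝ)) := by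
  have h1 := norm_ft_le (bessel^[L] h) η
  rw [ft_bessel_iterate hh, norm_mul, norm_pow, Complex.norm_real,
    Real.norm_of_nonneg (by positivity)] at h1
  have h2 : (1 + ‖η‖) ^ (2 * L) ≤ 2 ^ L * (1 + ‖η‖ ^ 2) ^ L := by
    rw [pow_mul, ← mul_pow]
    exact pow_le_pow_left₀ (by positivity) (one_add_sq_le _) L
  have h3 : (0 : ℝ) < (1 + ‖η‖) ^ (2 * L) := by positivity
  rw [Real.rpow_neg (by positivity), show (2 * L : ℝ) = ((2 * L : ℕ) : ℝ) by push_cast; ring,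
    Real.rpow_natCast, ← div_eq_mul_inv, le_div_iff₀ h3]
  calc ‖ft h η‖ * (1 + ‖η‖) ^ (2 * L) ≤ ‖ft h η‖ * (2 ^ L * (1 + ‖η‖ ^ 2) ^ L) := by gcongr
    _ = 2 ^ L * ((1 + ‖η‖ ^ 2) ^ L * ‖ft h η‖) := by ring
    _ ≤ _ := by gcongr

theorem ft_contDiff {h : E d → ℂ} (hh : Cc h) : ContDiff ℝ ∞ (ft h) ∧
    ∀ v, dd v (ft h) = ft (fun w => (2 * Real.pi * Complex.I * (inner ℝ w v : ℝ)) * h w) := by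
  -- Differentiation in η multiplies h by a linear function of w, which stays smooth with compact
  -- support. So these integrands form a class that is stable under parameter derivatives.
  let R : (E d × E d → ℂ) → Prop := fun F => ∃ h : E d → ℂ, Cc h ∧
    F = fun p => h p.2 * ee (inner ℝ p.2 p.1)
  have hdd : ∀ (h : E d → ℂ), Cc h → ∀ v : E d,
      dd (v, 0) (fun p : E d × E d => h p.2 * ee (inner ℝ p.2 p.1)) =
      fun p => ((2 * Real.pi * Complex.I * (inner ℝ p.2 v : ℝ)) * h p.2) * ee (inner ℝ p.2 p.1) := by
    intro h hh v
    have hi : ContDiff ℝ ∞ (fun p : E d × E d => inner ℝ p.2 p.1) :=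
      contDiff_snd.inner ℝ contDiff_fst
    have hh2 : ContDiff ℝ ∞ (fun p : E d × E d => h p.2) := hh.smooth.comp contDiff_snd
    have hei : ContDiff ℝ ∞ (fun p : E d × E d => ee (inner ℝ p.2 p.1)) := contDiff_ee.comp hi
    rw [dd_mul (hh2.differentiable (by simp)) (hei.differentiable (by simp)),
      dd_ee (hi.differentiable (by simp))]
    ext p
    have e1 : dd (v, 0) (fun p : E d × E d => h p.2) p = 0 := by
      have := ((hh.smooth.differentiable (by simp)) p.2).hasFDerivAt.comp p
        (hasFDerivAt_snd (𝕜 := ℝ) (p := p))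
      have h2 : HasFDerivAt (fun p : E d × E d => h p.2)
        ((fderiv ℝ h p.2).comp (ContinuousLinearMap.snd ℝ (E d) (E d))) p := this
      simp [dd, h2.fderiv]
    have e2 : fderiv ℝ (fun p : E d × E d => inner ℝ p.2 p.1) p (v, 0) = inner ℝ p.2 v := by
      rw [fderiv_inner_apply ℝ differentiableAt_snd differentiableAt_fst]
      simp [fderiv_fst, fderiv_snd]
    rw [e1]
    simp only [e2]
    ring
  have key := contDiff_integral_of_coind R ?_ ?_ (F := fun p => h p.2 * ee (inner ℝ p.2 p.1))
    ⟨h, hh, rfl⟩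
  · refine ⟨key.1, fun v => ?_⟩
    have := key.2 v
    rw [hdd h hh v] at this
    exact this
  · rintro F ⟨h, hh, rfl⟩
    refine ⟨(hh.smooth.comp contDiff_snd).mul (contDiff_ee.comp (contDiff_snd.inner ℝ contDiff_fst)),
      fun ρ => ⟨fun w => ‖h w‖, hh.integrable.norm, fun p _ η => ?_⟩⟩
    simp [norm_ee]
  · rintro F ⟨h, hh, rfl⟩ v
    exact ⟨_, hh.mul (contDiff_const.mul (Complex.ofRealCLM.contDiff.comp (contDiff_inner_left v))),
      hdd h hh v⟩

end Fourier

/-! ### Oscillatory integrals with uniform bounds -/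

section osc
variable {d : ℕ}

/-- The weights `(1 + |v|)^r` on `ℝ^N`, with no gain under differentiation. -/
def osys (Q : Type) (d : ℕ) : WSys Q (E d) where
  ι := Fin (d + 1)
  dir := stdVec
  shift _ := 0
  dom _ := Set.univ
  a _ p := 1 + ‖p‖
  b _ _ := 1
  a_pos _ p _ := by positivity
  b_pos _ _ _ := one_pos

variable {Q : Type}

theorem osys_w (μ : ℝ × ℝ) (q : Q) (p : E d) : (osys Q d).w μ q p = (1 + ‖p‖) ^ μ.1 := by
  simp [WSys.w, osys]

theorem osys_weaken {k : ℕ} {r s : ℝ} {f : Q → E d → ℂ} (hf : (osys Q d).Mem k (r, 0) f)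
    (h : r ≤ s) : (osys Q d).Mem k (s, 0) f := by
  refine hf.weaken 1 fun q p _ => ?_
  rw [osys_w]
  exact Real.rpow_le_one_of_one_le_of_nonpos (by linarith [norm_nonneg p]) (by simpa using h)

theorem dd_coord (j : Fin (d + 1)) (v : E d) :
    dd v (fun w : E d => ((w j : ℝ) : ℂ)) = fun _ => ((v j : ℝ) : ℂ) := by
  ext w
  have h : HasFDerivAt (fun w : E d => ((w j : ℝ) : ℂ))
      (Complex.ofRealCLM.comp (EuclideanSpace.proj j : E d →L[ℝ] ℝ)) w :=
    (Complex.ofRealCLM.comp (EuclideanSpace.proj j : E d →L[ℝ] ℝ)).hasFDerivAt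
  simp [dd, h.fderiv]

theorem contDiff_coord (j : Fin (d + 1)) : ContDiff ℝ ∞ (fun w : E d => ((w j : ℝ) : ℂ)) :=
  (Complex.ofRealCLM.comp (EuclideanSpace.proj j : E d →L[ℝ] ℝ)).contDiff

theorem osys_coord (k : ℕ) (j : Fin (d + 1)) :
    (osys Q d).Mem k (1, 0) (fun _ w => ((w j : ℝ) : ℂ)) := by
  have hd : (osys Q d).Dom (1, 0) (fun _ w => ((w j : ℝ) : ℂ)) := by
    refine ⟨1, fun q p _ => ?_⟩
    rw [osys_w, Complex.norm_real]
    have : ‖p j‖ ≤ ‖p‖ := PiLp.norm_apply_le p j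
    simp only [Real.rpow_one]
    linarith
  cases k with
  | zero => exact ⟨fun _ => contDiff_coord j, hd⟩
  | succ k =>
    refine ⟨fun _ => contDiff_coord j, hd, fun i => ?_⟩
    simp only [dd_coord]
    have := osys_weaken (s := 1) (WSys.mem_const (S := osys Q d) k
      (((stdVec i : E d) j : ℝ) : ℂ)) (by norm_num)
    exact this.cast (by simp [osys]) fun _ _ => rfl

theorem osys_bessel {k : ℕ} {μ : ℝ × ℝ} {f : Q → E d → ℂ} (hf : (osys Q d).Mem (k + 2) μ f) :
    (osys Q d).Mem k μ (fun q => bessel (f q)) := by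
  unfold bessel
  refine WSys.Mem.sub hf.pred.pred (WSys.Mem.sum _ fun j _ => WSys.Mem.const_mul ?_ _)
  exact ((hf.deriv j).deriv j).cast (by simp [osys]) fun _ _ => rfl

theorem osys_bessel_iterate {k : ℕ} {μ : ℝ × ℝ} {f : Q → E d → ℂ} (L : ℕ)
    (hf : (osys Q d).Mem (k + 2 * L) μ f) :
    (osys Q d).Mem k μ (fun q => bessel^[L] (f q)) := by
  induction L generalizing f with
  | zero => exact hf
  | succ L ih =>
    simp only [Function.iterate_succ_apply]
    exact ih (osys_bessel (f := f) hf)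

/-- `1 + |v|²`. -/
def jap2 (v : E d) : ℂ := ((1 + ‖v‖ ^ 2 : ℝ) : ℂ)

theorem jap2_ne_zero (v : E d) : jap2 v ≠ 0 := by
  unfold jap2
  exact_mod_cast (by positivity : (1 + ‖v‖ ^ 2 : ℝ) ≠ 0)

theorem contDiff_jap2 : ContDiff ℝ ∞ (jap2 : E d → ℂ) :=
  Complex.ofRealCLM.contDiff.comp (contDiff_const.add (contDiff_norm_sq ℝ))

theorem osys_jap2 (k : ℕ) : (osys Q d).Mem k (2, 0) (fun _ v => jap2 v) := by
  have h1 := osys_weaken (s := 2) (WSys.mem_const (S := osys Q d) k 1) (by norm_num)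
  refine (h1.add (WSys.Mem.sum Finset.univ fun j _ =>
    ((osys_coord k j).mul (osys_coord k j)).cast (ν := (2, 0)) (by norm_num)
      (fun _ _ => rfl))).cast rfl fun q p => ?_
  unfold jap2
  rw [← sum_sq_eq]
  push_cast
  simp [pow_two]

theorem norm_jap2 (v : E d) : ‖jap2 v‖ = 1 + ‖v‖ ^ 2 := by
  rw [jap2, Complex.norm_real, Real.norm_of_nonneg (by positivity)]

theorem osys_jap2_inv (k : ℕ) : (osys Q d).Mem k (-2, 0) (fun _ v => (jap2 v)⁻¹) := by
  refine ((osys_jap2 k).inv (fun _ v => jap2_ne_zero v) (1 / 2) (by norm_num) fun q p _ => ?_).cast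
    (by simp) fun _ _ => rfl
  rw [osys_w, norm_jap2]
  have := one_add_sq_le ‖p‖
  simp only [Real.rpow_two]
  linarith

theorem inner_stdVec_right (j : Fin (d + 1)) (w : E d) : inner ℝ w (stdVec j) = w j := by
  rw [real_inner_comm, inner_stdVec]

/-- Functions of polynomial growth. -/
def PG (β : E d → ℂ) : Prop := Continuous β ∧ ∃ C r : ℝ, ∀ ζ, ‖β ζ‖ ≤ C * (1 + ‖ζ‖) ^ r

theorem osys_pg {k : ℕ} {μ : ℝ × ℝ} {f : Q → E d → ℂ} (hf : (osys Q d).Mem k μ f) (q : Q) :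
    PG (f q) := by
  obtain ⟨C, hC⟩ := hf.dom
  exact ⟨(hf.smooth q).continuous, C, μ.1, fun ζ => by
    have := hC q ζ trivial; rwa [osys_w] at this⟩

theorem integrable_jap (r : ℝ) (hr : r < -(d + 1 : ℝ)) :
    Integrable (fun ζ : E d => (1 + ‖ζ‖) ^ r) := by
  have := integrable_one_add_norm (E := E d) (μ := volume) (r := -r) (by simp; linarith)
  simpa using this

theorem integrable_of_decay {β u : E d → ℂ} (hβ : PG β) (hu : Continuous u)
    (h : ∀ L : ℕ, ∃ C : ℝ, ∀ ζ, ‖u ζ‖ ≤ C * (1 + ‖ζ‖) ^ (-(2 * L : ℝ))) :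
    Integrable (fun ζ => β ζ * u ζ) := by
  obtain ⟨hc, C, r, hC⟩ := hβ
  obtain ⟨L, hL⟩ := exists_nat_gt (r + (d + 1))
  obtain ⟨C', hC'⟩ := h L
  refine Integrable.mono' ((integrable_jap (d := d) (r - 2 * L) ?_).const_mul (C * C'))
    (hc.mul hu).aestronglyMeasurable (Filter.Eventually.of_forall fun ζ => ?_)
  · have : (0 : ℝ) ≤ L := by positivity
    linarith
  · have hp : (0 : ℝ) < 1 + ‖ζ‖ := by positivity
    rw [norm_mul, sub_eq_add_neg, Real.rpow_add hp]
    calc ‖β ζ‖ * ‖u ζ‖ ≤ (C * (1 + ‖ζ‖) ^ r) * (C' * (1 + ‖ζ‖) ^ (-(2 * L : ℝ))) := by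
          gcongr
          · exact (norm_nonneg _).trans (hC ζ)
          · exact hC ζ
          · exact hC' ζ
      _ = _ := by ring

theorem integrable_mul_ft {β h : E d → ℂ} (hβ : PG β) (hh : Cc h) :
    Integrable (fun ζ => β ζ * ft h ζ) :=
  integrable_of_decay hβ (ft_contDiff hh).1.continuous fun L => ⟨_, norm_ft_decay hh L⟩

theorem Cc.const_mul {h : E d → ℂ} (hh : Cc h) (c : ℂ) : Cc (fun w => c * h w) :=
  hh.mul contDiff_const

theorem contDiff_inner_ofReal (v : E d) :
    ContDiff ℝ ∞ (fun w : E d => (2 * Real.pi * Complex.I * (inner ℝ w v : ℝ) : ℂ)) :=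
  contDiff_const.mul (Complex.ofRealCLM.contDiff.comp (contDiff_inner_left v))

/-- Integration by parts against a Fourier transform. -/
theorem integral_mul_ft_inner {β h : E d → ℂ} (hs : ContDiff ℝ ∞ β) (hβ : PG β) (v : E d)
    (hdβ : PG (dd v β)) (hh : Cc h) :
    ∫ ζ, β ζ * ft (fun w => (2 * Real.pi * Complex.I * (inner ℝ w v : ℝ)) * h w) ζ =
      -∫ ζ, dd v β ζ * ft h ζ := by
  have hd := (ft_contDiff hh).2 v
  have hh2 : Cc (fun w => (2 * Real.pi * Complex.I * (inner ℝ w v : ℝ) : ℂ) * h w) :=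
    hh.mul (contDiff_inner_ofReal v)
  rw [← hd]
  refine integral_mul_fderiv_eq_neg_fderiv_mul_of_integrable (integrable_mul_ft hdβ hh) ?_
    (integrable_mul_ft hβ hh) (fun x _ => (hs.differentiable (by simp)) x)
    (fun x _ => ((ft_contDiff hh).1.differentiable (by simp)) x)
  change Integrable (fun ζ => β ζ * dd v (ft h) ζ)
  rw [hd]
  exact integrable_mul_ft hβ hh2

/-- On the Fourier side multiplication by 1 + |w|² is the operator `bessel`, and two integrations by
parts move it to β. This trades growth in w for derivatives of β. -/
theorem integral_mul_ft_jap2 {β h : E d → ℂ} {μ : ℝ × ℝ} (hβ : (osys Unit d).Mem 2 μ (fun _ => β))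
    (hh : Cc h) :
    ∫ ζ, β ζ * ft (fun w => jap2 w * h w) ζ = ∫ ζ, bessel β ζ * ft h ζ := by
  have hP := osys_pg hβ ()
  have hs := hβ.smooth ()
  have hP1 : ∀ j, PG (dd (stdVec j) β) := fun j => osys_pg (hβ.deriv j) ()
  have hP2 : ∀ j, PG (dd (stdVec j) (dd (stdVec j) β)) :=
    fun j => osys_pg ((hβ.deriv j).deriv j) ()
  let c : E d → Fin (d + 1) → ℂ := fun w j => 2 * Real.pi * Complex.I * (inner ℝ w (stdVec j) : ℝ)
  have hc : ∀ j, ContDiff ℝ ∞ (fun w => c w j) := fun j => contDiff_inner_ofReal _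
  have e1 : (fun w => jap2 w * h w) =
      fun w => h w - ∑ j, (4 * (Real.pi : ℂ) ^ 2)⁻¹ * (c w j * (c w j * h w)) := by
    ext w
    have hpi : (Real.pi : ℂ) ≠ 0 := by exact_mod_cast Real.pi_ne_zero
    have : ∀ j, (4 * (Real.pi : ℂ) ^ 2)⁻¹ * (c w j * (c w j * h w)) = -((w j : ℂ) ^ 2 * h w) := by
      intro j
      simp only [c, inner_stdVec_right]
      field_simp
      simp only [Complex.I_sq]
      ring
    simp only [this, Finset.sum_neg_distrib, ← Finset.sum_mul, jap2, ← sum_sq_eq]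
    push_cast
    ring
  have hCc : ∀ j, Cc (fun w => (4 * (Real.pi : ℂ) ^ 2)⁻¹ * (c w j * (c w j * h w))) :=
    fun j => ((hh.mul (hc j)).mul (hc j)).const_mul _
  have hCs : Cc (fun w => ∑ j, (4 * (Real.pi : ℂ) ^ 2)⁻¹ * (c w j * (c w j * h w))) :=
    Cc.sum _ hCc
  have e2 : ∀ ζ, β ζ * ft (fun w => jap2 w * h w) ζ = β ζ * ft h ζ -
      ∑ j, (4 * (Real.pi : ℂ) ^ 2)⁻¹ * (β ζ * ft (fun w => c w j * (c w j * h w)) ζ) := by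
    intro ζ
    rw [e1, ft_sub hh hCs, ft_sum _ hCc, mul_sub, Finset.mul_sum]
    congr 1
    refine Finset.sum_congr rfl fun j _ => ?_
    rw [ft_const_mul]
    ring
  have e3 : ∀ ζ, bessel β ζ * ft h ζ = β ζ * ft h ζ -
      ∑ j, (4 * (Real.pi : ℂ) ^ 2)⁻¹ * (dd (stdVec j) (dd (stdVec j) β) ζ * ft h ζ) := by
    intro ζ
    unfold bessel
    rw [sub_mul, Finset.sum_mul]
    congr 1
    exact Finset.sum_congr rfl fun j _ => by ring
  simp only [e2, e3]
  rw [integral_sub (integrable_mul_ft hP hh) (integrable_finsetSum _ fun j _ =>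
      (integrable_mul_ft hP ((hh.mul (hc j)).mul (hc j))).const_mul _),
    integral_sub (integrable_mul_ft hP hh) (integrable_finsetSum _ fun j _ =>
      (integrable_mul_ft (hP2 j) hh).const_mul _),
    integral_finsetSum _ fun j _ =>
      (integrable_mul_ft hP ((hh.mul (hc j)).mul (hc j))).const_mul _,
    integral_finsetSum _ fun j _ => (integrable_mul_ft (hP2 j) hh).const_mul _]
  congr 1
  refine Finset.sum_congr rfl fun j _ => ?_
  rw [integral_const_mul, integral_const_mul]
  congr 1
  rw [integral_mul_ft_inner hs hP (stdVec j) (hP1 j) (hh.mul (hc j)),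
    integral_mul_ft_inner (contDiff_dd hs _) (hP1 j) (stdVec j) (hP2 j) hh, neg_neg]

theorem integral_mul_ft_jap2_pow {β h : E d → ℂ} {μ : ℝ × ℝ} (L : ℕ)
    (hβ : (osys Unit d).Mem (2 * L) μ (fun _ => β)) (hh : Cc h) :
    ∫ ζ, β ζ * ft (fun w => jap2 w ^ L * h w) ζ = ∫ ζ, bessel^[L] β ζ * ft h ζ := by
  induction L generalizing h with
  | zero => simp
  | succ L ih =>
    have h1 := ih (hβ.mono (by omega)) (hh.mul contDiff_jap2)
    simp only [pow_succ, mul_assoc]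
    rw [h1, Function.iterate_succ_apply']
    exact integral_mul_ft_jap2 (osys_bessel_iterate (k := 2) L (hβ.mono (by omega))) hh

theorem osys_mem_fiber {k : ℕ} {μ : ℝ × ℝ} {f : Q → E d → ℂ} (hf : (osys Q d).Mem k μ f) (q : Q) :
    (osys Unit d).Mem k μ (fun _ => f q) := by
  have hd : ∀ {μ : ℝ × ℝ} {f : Q → E d → ℂ}, (osys Q d).Dom μ f →
      (osys Unit d).Dom μ (fun _ => f q) := by
    rintro μ f ⟨C, hC⟩
    exact ⟨C, fun _ p hp => by have := hC q p hp; rwa [osys_w] at this ⊢⟩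
  induction k generalizing μ f with
  | zero => exact ⟨fun _ => hf.smooth q, hd hf.dom⟩
  | succ k ih => exact ⟨fun _ => hf.smooth q, hd hf.dom, fun i => ih (hf.deriv i)⟩

/-- Uniform bounds for the oscillatory integrals `∫∫ Ψ(v) β(ζ) e^{2πi v·ζ} dv dζ`. -/
theorem oscillatory_bound {Ψ β : Q → E d → ℂ} (hc : ∀ q, HasCompactSupport (Ψ q))
    (hΨ : ∀ k, ∃ r, (osys Q d).Mem k (r, 0) Ψ) {p : ℝ} (hβ : ∀ k, (osys Q d).Mem k (p, 0) β) :
    ∃ C : ℝ, ∀ q, ‖∫ ζ, β q ζ * ft (Ψ q) ζ‖ ≤ C := by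
  -- The order of choices matters. First 2L' derivatives of Ψ are reserved to beat the growth p of β
  -- in ζ. The growth r of these derivatives may depend on L', and L negative powers of 1 + |v|²
  -- then make them integrable. The price is 2L derivatives of β, all of which have the same growth
  -- p.
  obtain ⟨L', hL'⟩ := exists_nat_gt (p + (d + 1))
  obtain ⟨r, hr⟩ := hΨ (0 + 2 * L')
  obtain ⟨L, hL⟩ := exists_nat_gt (r + (d + 1))
  have hL0 : (0 : ℝ) ≤ L := by positivity
  have hL0' : (0 : ℝ) ≤ L' := by positivity
  let Ψ₁ : Q → E d → ℂ := fun q v => (jap2 v)⁻¹ ^ L * Ψ q v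
  have hΨ₁ : (osys Q d).Mem (0 + 2 * L') (r - 2 * L, 0) Ψ₁ :=
    (((osys_jap2_inv _).pow L).mul hr).cast (by ext <;> simp; ring) fun _ _ => rfl
  have hCc : ∀ q, Cc (Ψ₁ q) := fun q => ⟨hΨ₁.smooth q, (hc q).mul_left⟩
  obtain ⟨C₁, hC₁⟩ := (osys_bessel_iterate L' hΨ₁).dom
  obtain ⟨C₂, hC₂0, hC₂⟩ := (osys_bessel_iterate (k := 0) L (hβ _)).dom.bound
  have hI₁ := (integrable_jap (d := d) (r - 2 * L) (by linarith)).const_mul C₁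
  have hI₂ := integrable_jap (d := d) (p - 2 * L') (by linarith)
  let M : ℝ := ∫ ζ : E d, C₁ * (1 + ‖ζ‖) ^ (r - 2 * L)
  refine ⟨∫ ζ : E d, (C₂ * (2 ^ L' * M)) * (1 + ‖ζ‖) ^ (p - 2 * L'), fun q => ?_⟩
  have e : Ψ q = fun w => jap2 w ^ L * Ψ₁ q w := by
    ext w
    simp only [Ψ₁]
    rw [← mul_assoc, ← mul_pow, mul_inv_cancel₀ (jap2_ne_zero w), one_pow, one_mul]
  rw [e, integral_mul_ft_jap2_pow L (osys_mem_fiber (hβ _) q) (hCc q)]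
  refine norm_integral_le_of_norm_le (hI₂.const_mul _) (Filter.Eventually.of_forall fun ζ => ?_)
  have h1 := norm_ft_decay (hCc q) L' ζ
  have h2 : ∫ w, ‖bessel^[L'] (Ψ₁ q) w‖ ≤ M := by
    refine integral_mono_of_nonneg (Filter.Eventually.of_forall fun _ => norm_nonneg _) hI₁
      (Filter.Eventually.of_forall fun w => ?_)
    have := hC₁ q w trivial
    rwa [osys_w] at this
  have h3 := hC₂ q ζ trivial
  rw [osys_w] at h3
  have hp : (0 : ℝ) < 1 + ‖ζ‖ := by positivity
  rw [norm_mul, sub_eq_add_neg, Real.rpow_add hp]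
  calc _ ≤ (C₂ * (1 + ‖ζ‖) ^ p) * ((2 ^ L' * M) * (1 + ‖ζ‖) ^ (-(2 * L' : ℝ))) := by
        gcongr
        exact h1.trans (by gcongr)
    _ = _ := by ring

end osc

/-! ### Fourier transforms of compactly supported functions with parameters -/

section kernel
variable {d : ℕ} {P : Type} [NormedAddCommGroup P] [NormedSpace ℝ P] [FiniteDimensional ℝ P]

/-- Smooth functions `G(p, w)` supported in `|w| ≤ ρ`. -/
structure SuppIn (ρ : ℝ) (G : P × E d → ℂ) : Prop where
  smooth : ContDiff ℝ ∞ G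
  supp : ∀ p w, ρ < ‖w‖ → G (p, w) = 0

theorem SuppIn.dd {ρ : ℝ} {G : P × E d → ℂ} (hG : SuppIn ρ G) (v : P × E d) :
    SuppIn ρ (dd v G) := by
  refine ⟨contDiff_dd hG.smooth v, fun p w hw => ?_⟩
  have h1 : IsOpen {q : P × E d | ρ < ‖q.2‖} := isOpen_lt continuous_const (by fun_prop)
  have h2 : G =ᶠ[nhds (p, w)] fun _ => 0 := by
    filter_upwards [h1.mem_nhds (show (p, w) ∈ {q : P × E d | ρ < ‖q.2‖} from hw)] with q hq
    exact hG.supp q.1 q.2 hq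
  simp [MixedPDO.dd, h2.fderiv_eq]

theorem SuppIn.mul {ρ : ℝ} {G : P × E d → ℂ} (hG : SuppIn ρ G) {f : P × E d → ℂ}
    (hf : ContDiff ℝ ∞ f) : SuppIn ρ (fun q => f q * G q) :=
  ⟨hf.mul hG.smooth, fun p w hw => by simp [hG.supp p w hw]⟩

theorem SuppIn.sub {ρ : ℝ} {G G' : P × E d → ℂ} (hG : SuppIn ρ G) (hG' : SuppIn ρ G') :
    SuppIn ρ (fun q => G q - G' q) :=
  ⟨hG.smooth.sub hG'.smooth, fun p w hw => by simp [hG.supp p w hw, hG'.supp p w hw]⟩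

theorem SuppIn.sum {ρ : ℝ} {ι : Type*} (s : Finset ι) {G : ι → P × E d → ℂ}
    (hG : ∀ i, SuppIn ρ (G i)) : SuppIn ρ (fun q => ∑ i ∈ s, G i q) :=
  ⟨ContDiff.sum fun i _ => (hG i).smooth, fun p w hw =>
    Finset.sum_eq_zero fun i _ => (hG i).supp p w hw⟩

theorem SuppIn.cc {ρ : ℝ} {G : P × E d → ℂ} (hG : SuppIn ρ G) (p : P) : Cc (fun w => G (p, w)) := by
  refine ⟨hG.smooth.comp (contDiff_const.prodMk contDiff_id), ?_⟩
  refine HasCompactSupport.of_support_subset_isCompact (isCompact_closedBall 0 ρ) fun w hw => ?_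
  by_contra h
  exact hw (hG.supp p w (by simpa using h))

theorem dd_prod_left {H : Type} [NormedAddCommGroup H] [NormedSpace ℝ H] {F : P × H → ℂ}
    (hF : Differentiable ℝ F) (v : P) (η : H) :
    dd v (fun p => F (p, η)) = fun p => dd (v, 0) F (p, η) := by
  ext p
  have h2 : HasFDerivAt (fun p => F (p, η)) ((fderiv ℝ F (p, η)).comp
    (ContinuousLinearMap.inl ℝ P H)) p :=
    (hF (p, η)).hasFDerivAt.comp p (hasFDerivAt_prodMk_left p η)
  simp [dd, h2.fderiv]

theorem dd_prod_right {H : Type} [NormedAddCommGroup H] [NormedSpace ℝ H] {F : P × H → ℂ}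
    (hF : Differentiable ℝ F) (v : H) (p : P) :
    dd v (fun η => F (p, η)) = fun η => dd (0, v) F (p, η) := by
  ext η
  have h2 : HasFDerivAt (fun η => F (p, η)) ((fderiv ℝ F (p, η)).comp
    (ContinuousLinearMap.inr ℝ P H)) η :=
    (hF (p, η)).hasFDerivAt.comp η (hasFDerivAt_prodMk_right p η)
  simp [dd, h2.fderiv]

theorem SuppIn.bound {ρ : ℝ} {G : P × E d → ℂ} (hG : SuppIn ρ G) (r : ℝ) :
    ∃ C : ℝ, 0 ≤ C ∧ ∀ p, ‖p‖ ≤ r → ∀ w, ‖G (p, w)‖ ≤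
      (Metric.closedBall (0 : E d) ρ).indicator (fun _ => C) w := by
  have hK : IsCompact (Metric.closedBall (0 : P) r ×ˢ Metric.closedBall (0 : E d) ρ) :=
    (isCompact_closedBall _ _).prod (isCompact_closedBall _ _)
  obtain ⟨C, hC⟩ := hK.exists_bound_of_continuousOn hG.smooth.continuous.continuousOn
  refine ⟨max C 0, le_max_right _ _, fun p hp w => ?_⟩
  by_cases hw : w ∈ Metric.closedBall (0 : E d) ρ
  · rw [Set.indicator_of_mem hw]
    exact (hC (p, w) ⟨by simpa using hp, hw⟩).trans (le_max_left _ _)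
  · rw [Set.indicator_of_notMem hw, hG.supp p w (by simpa using hw), norm_zero]

theorem integrable_indicator_ball (ρ C : ℝ) :
    Integrable ((Metric.closedBall (0 : E d) ρ).indicator (fun _ => C)) :=
  (integrable_indicator_iff measurableSet_closedBall).2
    (integrableOn_const (isCompact_closedBall _ _).measure_lt_top.ne)

theorem SuppIn.contDiff_integral {ρ : ℝ} {G : P × E d → ℂ} (hG : SuppIn ρ G) :
    ContDiff ℝ ∞ (fun p => ∫ w, G (p, w)) ∧
      ∀ v, MixedPDO.dd v (fun p => ∫ w, G (p, w)) = fun p => ∫ w, MixedPDO.dd (v, 0) G (p, w) := by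
  refine contDiff_integral_of_coind (fun F : P × E d → ℂ => SuppIn ρ F) ?_ ?_ hG
  · intro F hF
    refine ⟨hF.smooth, fun r => ?_⟩
    obtain ⟨C, -, hC⟩ := hF.bound r
    exact ⟨_, integrable_indicator_ball ρ C, fun p hp w => hC p hp.le w⟩
  · intro F hF v
    exact hF.dd _

/-- Taking the iterate in w as a function of both variables keeps smoothness and the common support,
hence bounds that are locally uniform in p. -/
theorem SuppIn.bessel_iterate {ρ : ℝ} {G : P × E d → ℂ} (hG : SuppIn ρ G) (L : ℕ) :
    ∃ G' : P × E d → ℂ, SuppIn ρ G' ∧ ∀ p w, bessel^[L] (fun w => G (p, w)) w = G' (p, w) := by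
  induction L with
  | zero => exact ⟨G, hG, fun _ _ => rfl⟩
  | succ L ih =>
    obtain ⟨G', hG', h⟩ := ih
    refine ⟨fun q => G' q - ∑ j, (4 * (Real.pi : ℂ) ^ 2)⁻¹ *
      MixedPDO.dd (0, stdVec j) (MixedPDO.dd (0, stdVec j) G') q,
      hG'.sub (SuppIn.sum _ fun j => ((hG'.dd _).dd _).mul contDiff_const), fun p w => ?_⟩
    rw [Function.iterate_succ_apply', show bessel^[L] (fun w => G (p, w)) = fun w => G' (p, w) from
      funext (h p)]
    simp only [bessel]
    congr 1
    refine Finset.sum_congr rfl fun j _ => ?_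
    rw [dd_prod_right (hG'.smooth.differentiable (by simp)),
      dd_prod_right ((hG'.dd _).smooth.differentiable (by simp))]

/-- Functions `f(p, η)` with the weights `(1 + |η|)^r`, locally uniformly in `p`. -/
def ldsys (P : Type) [NormedAddCommGroup P] (d : ℕ) (R : ℝ) : WSys (E d) P where
  ι := P
  dir v := v
  shift _ := 0
  dom _ := {p | ‖p‖ < R}
  a η _ := 1 + ‖η‖
  b _ _ := 1
  a_pos η _ _ := by positivity
  b_pos _ _ _ := one_pos

theorem ldsys_w {R : ℝ} (μ : ℝ × ℝ) (η : E d) (p : P) :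
    (ldsys P d R).w μ η p = (1 + ‖η‖) ^ μ.1 := by
  simp [WSys.w, ldsys]

theorem contDiff_ee_inner (v : E d) : ContDiff ℝ ∞ (fun w : E d => ee (inner ℝ w v)) :=
  contDiff_ee.comp (contDiff_inner_left v)

theorem contDiff_ee_inner_prod :
    ContDiff ℝ ∞ (fun q : (P × E d) × E d => ee (inner ℝ q.2 q.1.2)) :=
  contDiff_ee.comp (contDiff_snd.inner ℝ contDiff_fst.snd)

theorem SuppIn.ft_contDiff {ρ : ℝ} {G : P × E d → ℂ} (hG : SuppIn ρ G) :
    ContDiff ℝ ∞ (fun q : P × E d => ft (fun w => G (q.1, w)) q.2) := by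
  have h : SuppIn (P := P × E d) ρ
      (fun q : (P × E d) × E d => G (q.1.1, q.2) * ee (inner ℝ q.2 q.1.2)) := by
    refine ⟨(hG.smooth.comp (contDiff_fst.fst.prodMk contDiff_snd)).mul contDiff_ee_inner_prod,
      fun p w hw => ?_⟩
    simp [hG.supp _ w hw]
  exact h.contDiff_integral.1

theorem SuppIn.dd_ft {ρ : ℝ} {G : P × E d → ℂ} (hG : SuppIn ρ G) (v : P) (η : E d) :
    MixedPDO.dd v (fun p => ft (fun w => G (p, w)) η) =
      fun p => ft (fun w => MixedPDO.dd (v, 0) G (p, w)) η := by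
  have hs : ContDiff ℝ ∞ (fun q : P × E d => ee (inner ℝ q.2 η)) :=
    (contDiff_ee_inner η).comp contDiff_snd
  have h : SuppIn ρ (fun q : P × E d => G q * ee (inner ℝ q.2 η)) :=
    ⟨hG.smooth.mul hs, fun p w hw => by simp [hG.supp _ w hw]⟩
  have h2 := h.contDiff_integral.2 v
  unfold ft
  rw [h2]
  ext p
  congr 1
  ext w
  rw [dd_mul (hG.smooth.differentiable (by simp)) (hs.differentiable (by simp))]
  have : MixedPDO.dd (v, 0) (fun q : P × E d => ee (inner ℝ q.2 η)) (p, w) = 0 := by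
    have := congrFun (dd_prod_left (hs.differentiable (by simp)) v w) p
    rw [← this]
    dsimp only
    rw [dd_const]
  simp [this]

/-- Rapid decrease in η, locally uniformly in p and for all p-derivatives. This is what lets `opU`
be differentiated under the integral sign. -/
theorem SuppIn.ft_mem {ρ : ℝ} {G : P × E d → ℂ} (hG : SuppIn ρ G) (R : ℝ) (L k : ℕ) :
    (ldsys P d R).Mem k (-(2 * L : ℝ), 0) (fun η p => ft (fun w => G (p, w)) η) := by
  refine WSys.mem_of_coind (fun μ f => μ = (-(2 * L : ℝ), 0) ∧ ∃ G : P × E d → ℂ, SuppIn ρ G ∧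
    f = fun η p => ft (fun w => G (p, w)) η) ?_ ?_ k ⟨rfl, G, hG, rfl⟩
  · rintro μ f ⟨rfl, G, hG, rfl⟩
    refine ⟨fun η => hG.ft_contDiff.comp (contDiff_id.prodMk contDiff_const), ?_⟩
    obtain ⟨G', hG', h⟩ := hG.bessel_iterate L
    obtain ⟨C, hC0, hC⟩ := hG'.bound R
    refine ⟨2 ^ L * ∫ w, (Metric.closedBall (0 : E d) ρ).indicator (fun _ => C) w,
      fun η p hp => ?_⟩
    rw [ldsys_w]
    refine (norm_ft_decay (hG.cc p) L η).trans ?_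
    have hI : ∫ w, ‖bessel^[L] (fun w => G (p, w)) w‖ ≤
        ∫ w, (Metric.closedBall (0 : E d) ρ).indicator (fun _ => C) w := by
      refine integral_mono_of_nonneg (Filter.Eventually.of_forall fun _ => norm_nonneg _)
        (integrable_indicator_ball ρ C) (Filter.Eventually.of_forall fun w => ?_)
      simp only [h]
      exact hC p (le_of_lt hp) w
    exact mul_le_mul_of_nonneg_right (mul_le_mul_of_nonneg_left hI (by positivity)) (by positivity)
  · rintro μ f ⟨rfl, G, hG, rfl⟩ v
    refine ⟨by simp [ldsys], _, hG.dd (v, 0), ?_⟩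
    ext1 η
    exact hG.dd_ft v η

end kernel

/-! ### The operators `opU` and their derivatives -/

section opU
variable {d : ℕ}

/-- The integrand of the kernel of `opU`. -/
def uAmp (ψ : E d × E d → ℂ) (g : E d × E d → E d) : (E d × E d) × E d → ℂ := fun q =>
  ψ (q.1.1, q.2) * ee (-(inner ℝ q.2 q.1.2) + inner ℝ (g (q.1.1, q.2)) q.1.2)

/-- The kernel of `opU`. -/
def uKer (ψ : E d × E d → ℂ) (g : E d × E d → E d) (p : E d × E d) (η : E d) : ℂ :=
  ft (fun w => uAmp ψ g (p, w)) η

/-- The operator `∫∫ ψ(x,w) b(x,η) e^{2πi(w·(η-θ) + g(x,w)·θ)} dw dη`. -/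
def opU (ψ : E d × E d → ℂ) (g : E d × E d → E d) (b : E d × E d → ℂ) (p : E d × E d) : ℂ :=
  ∫ η, b (p.1, η) * uKer ψ g p η

/-- Smooth functions `b(x, η)` whose derivatives in `x` grow at most polynomially in `η`. -/
structure XGrowth (b : E d × E d → ℂ) : Prop where
  smooth : ContDiff ℝ ∞ b
  growth : ∀ (R : ℝ) (k : ℕ), ∃ r, (ldsys (E d × E d) d R).Mem k (r, 0) (fun η p => b (p.1, η))

theorem XGrowth.pg {b : E d × E d → ℂ} (hb : XGrowth b) (x : E d) : PG (fun η => b (x, η)) := by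
  refine ⟨hb.smooth.continuous.comp (by fun_prop), ?_⟩
  obtain ⟨r, hr⟩ := hb.growth (‖x‖ + 1) 0
  obtain ⟨C, hC⟩ := hr.dom
  refine ⟨C, r, fun ζ => ?_⟩
  have := hC ζ (x, 0) (by simp [ldsys, Prod.norm_def]; positivity)
  rwa [ldsys_w] at this

theorem dd_comp_fst {b : E d × E d → ℂ} (hb : Differentiable ℝ b) (v : E d × E d) (η : E d) :
    dd v (fun p : E d × E d => b (p.1, η)) = fun p => dd (v.1, 0) b (p.1, η) := by
  ext p
  have h1 : HasFDerivAt (fun p : E d × E d => (p.1, η))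
      ((ContinuousLinearMap.fst ℝ (E d) (E d)).prod 0) p :=
    hasFDerivAt_fst.prodMk (hasFDerivAt_const _ _)
  have h2 : HasFDerivAt (fun p : E d × E d => b (p.1, η)) _ p :=
    (hb (p.1, η)).hasFDerivAt.comp p h1
  simp [dd, h2.fderiv]

theorem XGrowth.dd {b : E d × E d → ℂ} (hb : XGrowth b) (u : E d) : XGrowth (dd (u, 0) b) := by
  refine ⟨contDiff_dd hb.smooth _, fun R k => ?_⟩
  obtain ⟨r, hr⟩ := hb.growth R (k + 1)
  refine ⟨r, (hr.deriv (u, 0)).cast (by simp [ldsys]) fun η p => ?_⟩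
  have := congrFun (dd_comp_fst (hb.smooth.differentiable (by simp)) (u, 0) η) p
  exact this.symm

variable {ρ : ℝ} {ψ ψ' : E d × E d → ℂ} {g : E d × E d → E d} {b : E d × E d → ℂ}

theorem uPhase_contDiff (hg : ContDiff ℝ ∞ g) : ContDiff ℝ ∞ (fun q : (E d × E d) × E d =>
    -(inner ℝ q.2 q.1.2) + inner ℝ (g (q.1.1, q.2)) q.1.2) :=
  (contDiff_snd.inner ℝ contDiff_fst.snd).neg.add
    ((hg.comp (contDiff_fst.fst.prodMk contDiff_snd)).inner ℝ contDiff_fst.snd)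

theorem uAmp_suppIn (hψ : SuppIn ρ ψ) (hg : ContDiff ℝ ∞ g) : SuppIn ρ (uAmp ψ g) :=
  ⟨(hψ.smooth.comp (contDiff_fst.fst.prodMk contDiff_snd)).mul
    (contDiff_ee.comp (uPhase_contDiff hg)), fun p w hw => by simp [uAmp, hψ.supp _ w hw]⟩

theorem uKer_contDiff (hψ : SuppIn ρ ψ) (hg : ContDiff ℝ ∞ g) :
    ContDiff ℝ ∞ (fun q : (E d × E d) × E d => uKer ψ g q.1 q.2) :=
  (uAmp_suppIn hψ hg).ft_contDiff

theorem uKer_integrable (hψ : SuppIn ρ ψ) (hg : ContDiff ℝ ∞ g) (p : E d × E d)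
    {β : E d → ℂ} (hβ : PG β) : Integrable (fun η => β η * uKer ψ g p η) :=
  integrable_mul_ft hβ ((uAmp_suppIn hψ hg).cc p)

theorem uAmp_add (ψ ψ' : E d × E d → ℂ) : uAmp (fun q => ψ q + ψ' q) g =
    fun q => uAmp ψ g q + uAmp ψ' g q := by
  ext q; simp [uAmp, add_mul]

theorem opU_add (hψ : SuppIn ρ ψ) (hψ' : SuppIn ρ ψ') (hg : ContDiff ℝ ∞ g) (hb : XGrowth b)
    (p : E d × E d) : opU (fun q => ψ q + ψ' q) g b p = opU ψ g b p + opU ψ' g b p := by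
  unfold opU
  rw [← integral_add (uKer_integrable hψ hg p (hb.pg _)) (uKer_integrable hψ' hg p (hb.pg _))]
  congr 1
  ext η
  rw [uKer, uAmp_add, ft_add ((uAmp_suppIn hψ hg).cc p) ((uAmp_suppIn hψ' hg).cc p)]
  simp only [uKer]
  ring

/-- The derivatives of the amplitude of `opU`. -/
theorem dd_uAmp (hψ : ContDiff ℝ ∞ ψ) (hg : ContDiff ℝ ∞ g) (u v : E d) (p : E d × E d) (w : E d) :
    dd ((u, v), 0) (uAmp ψ g) (p, w) =
      uAmp (dd (u, 0) ψ) g (p, w) +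
      uAmp (fun q => 2 * Real.pi * Complex.I * (-(inner ℝ q.2 v) + inner ℝ (g q) v : ℝ) * ψ q) g
        (p, w) +
      ∑ j, ((p.2 j : ℝ) : ℂ) * uAmp (fun q => 2 * Real.pi * Complex.I *
        ((fderiv ℝ g q (u, 0) j : ℝ) : ℂ) * ψ q) g (p, w) := by
  have hψ2 : ContDiff ℝ ∞ (fun q : (E d × E d) × E d => ψ (q.1.1, q.2)) :=
    hψ.comp (contDiff_fst.fst.prodMk contDiff_snd)
  have hph := uPhase_contDiff hg
  have hee : ContDiff ℝ ∞ (fun q : (E d × E d) × E d =>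
    ee (-(inner ℝ q.2 q.1.2) + inner ℝ (g (q.1.1, q.2)) q.1.2)) := contDiff_ee.comp hph
  have hL : HasFDerivAt (fun q : (E d × E d) × E d => (q.1.1, q.2))
      (((ContinuousLinearMap.fst ℝ (E d) (E d)).comp (ContinuousLinearMap.fst ℝ _ _)).prod
        (ContinuousLinearMap.snd ℝ (E d × E d) (E d))) (p, w) :=
    ContinuousLinearMap.hasFDerivAt (((ContinuousLinearMap.fst ℝ (E d) (E d)).comp
      (ContinuousLinearMap.fst ℝ _ _)).prod (ContinuousLinearMap.snd ℝ (E d × E d) (E d)))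
  unfold uAmp
  rw [dd_mul (hψ2.differentiable (by simp)) (hee.differentiable (by simp)),
    dd_ee (hph.differentiable (by simp))]
  have e1 : dd ((u, v), 0) (fun q : (E d × E d) × E d => ψ (q.1.1, q.2)) (p, w) =
      dd (u, 0) ψ (p.1, w) := by
    have h2 : HasFDerivAt (fun q : (E d × E d) × E d => ψ (q.1.1, q.2)) _ (p, w) :=
      ((hψ.differentiable (by simp)) (p.1, w)).hasFDerivAt.comp (p, w) hL
    simp [dd, h2.fderiv]
  have e2 : fderiv ℝ (fun q : (E d × E d) × E d =>
      -(inner ℝ q.2 q.1.2) + inner ℝ (g (q.1.1, q.2)) q.1.2) (p, w) ((u, v), 0) =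
      (-(inner ℝ w v) + inner ℝ (g (p.1, w)) v) +
        ∑ j, p.2 j * fderiv ℝ g (p.1, w) (u, 0) j := by
    have h3 : HasFDerivAt (fun q : (E d × E d) × E d => g (q.1.1, q.2)) _ (p, w) :=
      ((hg.differentiable (by simp)) (p.1, w)).hasFDerivAt.comp (p, w) hL
    have h4 : HasFDerivAt (fun q : (E d × E d) × E d => q.1.2) _ (p, w) :=
      ContinuousLinearMap.hasFDerivAt ((ContinuousLinearMap.snd ℝ (E d) (E d)).comp
        (ContinuousLinearMap.fst ℝ (E d × E d) (E d)))
    have h5 : HasFDerivAt (fun q : (E d × E d) × E d =>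
      -(inner ℝ q.2 q.1.2) + inner ℝ (g (q.1.1, q.2)) q.1.2) _ (p, w) := ((hasFDerivAt_snd (𝕜 := ℝ) (p := (p, w))).inner ℝ h4).neg.add (h3.inner ℝ h4)
    rw [HasFDerivAt.fderiv h5]
    simp [PiLp.inner_apply]
    ring
  dsimp only
  rw [e1, e2]
  push_cast
  rw [mul_add (2 * (Real.pi : ℂ) * Complex.I), add_mul, mul_add, ← add_assoc]
  congr 1
  · ring
  · rw [Finset.mul_sum, Finset.sum_mul, Finset.mul_sum]
    exact Finset.sum_congr rfl fun j _ => by ring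

theorem contDiff_apply_coord {f : E d × E d → E d} (hf : ContDiff ℝ ∞ f) (j : Fin (d + 1)) :
    ContDiff ℝ ∞ (fun q => ((f q j : ℝ) : ℂ)) := (contDiff_coord j).comp hf

/-- `opU` is smooth, and its derivatives are again of this form. -/
theorem opU_contDiff (hψ : SuppIn ρ ψ) (hg : ContDiff ℝ ∞ g) (hb : XGrowth b) :
    ContDiff ℝ ∞ (opU ψ g b) ∧ ∀ u v, dd (u, v) (opU ψ g b) = fun p =>
      opU ψ g (dd (u, 0) b) p + opU (dd (u, 0) ψ) g b p +
      opU (fun q => 2 * Real.pi * Complex.I * (-(inner ℝ q.2 v) + inner ℝ (g q) v : ℝ) * ψ q) g b p +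
      ∑ j, ((p.2 j : ℝ) : ℂ) * opU (fun q => 2 * Real.pi * Complex.I *
        ((fderiv ℝ g q (u, 0) j : ℝ) : ℂ) * ψ q) g b p := by
  have hsup := uAmp_suppIn hψ hg
  have hker := uKer_contDiff hψ hg
  have hbs : ContDiff ℝ ∞ (fun q : (E d × E d) × E d => b (q.1.1, q.2)) :=
    hb.smooth.comp (contDiff_fst.fst.prodMk contDiff_snd)
  -- The class of integrands: all parameter derivatives are locally dominated by one integrable
  -- power (1 + |η|)^r. The exponent may depend on the compact set and on the number of derivatives.
  have key := contDiff_integral_of_coind (P := E d × E d) (H := E d)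
    (fun F => ContDiff ℝ ∞ F ∧ ∀ (R : ℝ) (k : ℕ), ∃ r < -(d + 1 : ℝ),
      (ldsys (E d × E d) d R).Mem k (r, 0) (fun η p => F (p, η)))
    (F := fun q => b (q.1.1, q.2) * uKer ψ g q.1 q.2) ?_ ?_ ?_
  · refine ⟨key.1, fun u v => ?_⟩
    have h1 := key.2 (u, v)
    unfold opU
    rw [h1]
    ext p
    have hψ1 : SuppIn ρ (dd (u, 0) ψ) := hψ.dd _
    have hψ2 : SuppIn ρ (fun q => 2 * Real.pi * Complex.I *
        (-(inner ℝ q.2 v) + inner ℝ (g q) v : ℝ) * ψ q) := hψ.mul (contDiff_const.mul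
      (Complex.ofRealCLM.contDiff.comp ((contDiff_snd.inner ℝ contDiff_const).neg.add
        (hg.inner ℝ contDiff_const))))
    have hψ3 : ∀ j, SuppIn ρ (fun q => 2 * Real.pi * Complex.I *
        ((fderiv ℝ g q (u, 0) j : ℝ) : ℂ) * ψ q) := fun j => hψ.mul (contDiff_const.mul
      (contDiff_apply_coord ((contDiff_fderiv hg).clm_apply contDiff_const) j))
    have i0 := uKer_integrable hψ hg p ((hb.dd u).pg p.1)
    have i1 := uKer_integrable hψ1 hg p (hb.pg p.1)
    have i2 := uKer_integrable hψ2 hg p (hb.pg p.1)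
    have i3 := fun j => (uKer_integrable (hψ3 j) hg p (hb.pg p.1)).const_mul ((p.2 j : ℝ) : ℂ)
    simp only [← integral_const_mul]
    have i01 : Integrable (fun η => dd (u, 0) b (p.1, η) * uKer ψ g p η +
      b (p.1, η) * uKer (dd (u, 0) ψ) g p η) := i0.add i1
    have i012 : Integrable (fun η => dd (u, 0) b (p.1, η) * uKer ψ g p η +
      b (p.1, η) * uKer (dd (u, 0) ψ) g p η + b (p.1, η) * uKer (fun q => 2 * Real.pi * Complex.I *
        (-(inner ℝ q.2 v) + inner ℝ (g q) v : ℝ) * ψ q) g p η) := i01.add i2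
    rw [← integral_finsetSum _ fun j _ => i3 j, ← integral_add i0 i1, ← integral_add i01 i2,
      ← integral_add i012 (integrable_finsetSum _ fun j _ => i3 j)]
    congr 1
    ext η
    rw [dd_mul (hbs.differentiable (by simp)) (hker.differentiable (by simp))]
    have e1 : dd ((u, v), 0) (fun q : (E d × E d) × E d => b (q.1.1, q.2)) (p, η) =
        dd (u, 0) b (p.1, η) := by
      have h2 := congrFun (dd_prod_left (hbs.differentiable (by simp)) (u, v) η) p
      rw [← h2]
      exact congrFun (dd_comp_fst (hb.smooth.differentiable (by simp)) (u, v) η) p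
    have e2 : dd ((u, v), 0) (fun q : (E d × E d) × E d => uKer ψ g q.1 q.2) (p, η) =
        uKer (dd (u, 0) ψ) g p η + uKer (fun q => 2 * Real.pi * Complex.I *
          (-(inner ℝ q.2 v) + inner ℝ (g q) v : ℝ) * ψ q) g p η +
        ∑ j, ((p.2 j : ℝ) : ℂ) * uKer (fun q => 2 * Real.pi * Complex.I *
          ((fderiv ℝ g q (u, 0) j : ℝ) : ℂ) * ψ q) g p η := by
      have h2 := congrFun (dd_prod_left (hker.differentiable (by simp)) (u, v) η) p
      rw [← h2]
      have h3 := congrFun (hsup.dd_ft (u, v) η) p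
      refine h3.trans ?_
      simp only [dd_uAmp hψ.smooth hg, uKer]
      have c1 := (uAmp_suppIn hψ1 hg).cc p
      have c2 := (uAmp_suppIn hψ2 hg).cc p
      have c3 := fun j => ((uAmp_suppIn (hψ3 j) hg).cc p).const_mul ((p.2 j : ℝ) : ℂ)
      rw [ft_add (c1.add c2) (Cc.sum _ c3), ft_add c1 c2, ft_sum _ c3]
      simp only [ft_const_mul]
    dsimp only
    rw [e1, e2, mul_add, mul_add, Finset.mul_sum]
    rw [← add_assoc, ← add_assoc]
    congr 1
    exact Finset.sum_congr rfl fun j _ => by ring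
  · rintro F ⟨hF, hFb⟩
    refine ⟨hF, fun R => ?_⟩
    obtain ⟨r, hr, h⟩ := hFb R 0
    obtain ⟨C, hC⟩ := h.dom
    refine ⟨_, (integrable_jap r hr).const_mul C, fun p hp η => ?_⟩
    have := hC η p hp
    rwa [ldsys_w] at this
  · rintro F ⟨hF, hFb⟩ v
    refine ⟨contDiff_dd hF _, fun R k => ?_⟩
    obtain ⟨r, hr, h⟩ := hFb R (k + 1)
    refine ⟨r, hr, (h.deriv v).cast (by simp [ldsys]) fun η p => ?_⟩
    exact (congrFun (dd_prod_left (hF.differentiable (by simp)) v η) p).symm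
  · refine ⟨hbs.mul hker, fun R k => ?_⟩
    obtain ⟨r, hr⟩ := hb.growth R k
    -- The kernel decreases faster than any power, so L is taken large enough to absorb the growth r
    -- of b and to leave integrability in dimension d + 1.
    obtain ⟨L, hL⟩ := exists_nat_gt (r + (d + 1))
    have hL0 : (0 : ℝ) ≤ L := by positivity
    exact ⟨r + -(2 * L : ℝ), by linarith, (hr.mul (hsup.ft_mem R L k)).cast (by simp) fun _ _ => rfl⟩

/-- Integration by parts in `η`. -/
theorem opU_inner_mul (hψ : SuppIn ρ ψ) (hg : ContDiff ℝ ∞ g) (hb : XGrowth b) (v : E d)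
    (hb' : XGrowth (dd (0, v) b)) (p : E d × E d) :
    opU (fun q => 2 * Real.pi * Complex.I * (inner ℝ q.2 v : ℝ) * ψ q) g b p =
      -opU ψ g (dd (0, v) b) p := by
  have hdd := dd_prod_right (hb.smooth.differentiable (by simp)) v p.1
  have := integral_mul_ft_inner (β := fun η => b (p.1, η))
    (hb.smooth.comp (contDiff_const.prodMk contDiff_id)) (hb.pg p.1) v
    (by rw [hdd]; exact hb'.pg p.1) ((uAmp_suppIn hψ hg).cc p)
  rw [hdd] at this
  unfold opU uKer
  rw [← this]
  simp only [uAmp, mul_assoc]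

end opU

/-! ### The anisotropic weights and the straightened symbol class -/

section weights
variable {d : ℕ}

/-- The first `N - 1` coordinates. -/
def horiz (θ : E d) : EuclideanSpace ℝ (Fin d) := WithLp.toLp 2 fun i => θ i.castSucc

theorem horiz_add (θ ζ : E d) : horiz (θ + ζ) = horiz θ + horiz ζ := by ext i; simp [horiz]

theorem norm_horiz_le (θ : E d) : ‖horiz θ‖ ≤ ‖θ‖ := by
  rw [EuclideanSpace.norm_eq, EuclideanSpace.norm_eq]
  refine Real.sqrt_le_sqrt ?_
  rw [Fin.sum_univ_castSucc]
  simp only [horiz]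
  nlinarith [sq_nonneg ‖θ (Fin.last d)‖]

/-- The weight `1 + |θ'| + |θ|^{1/2}`. -/
def lam (θ : E d) : ℝ := 1 + ‖horiz θ‖ + Real.sqrt ‖θ‖

theorem one_le_lam (θ : E d) : 1 ≤ lam θ := by
  unfold lam; linarith [norm_nonneg (horiz θ), Real.sqrt_nonneg ‖θ‖]

theorem lam_pos (θ : E d) : 0 < lam θ := one_pos.trans_le (one_le_lam θ)

theorem lam_le (θ : E d) : lam θ ≤ 2 * (1 + ‖θ‖) := by
  have h1 := norm_horiz_le θ
  have h2 := Real.sq_sqrt (norm_nonneg θ)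
  unfold lam
  nlinarith [sq_nonneg (Real.sqrt ‖θ‖ - 1), Real.sqrt_nonneg ‖θ‖, norm_nonneg θ]

/-- A gain of two in the second order is at least a gain of one in the first. This turns arbitrarily
low second order into rapid decrease. -/
theorem le_lam_sq (θ : E d) : 1 + ‖θ‖ ≤ lam θ ^ 2 := by
  have h2 := Real.sq_sqrt (norm_nonneg θ)
  have h3 : 1 + Real.sqrt ‖θ‖ ≤ lam θ := by unfold lam; linarith [norm_nonneg (horiz θ)]
  nlinarith [Real.sqrt_nonneg ‖θ‖, norm_nonneg θ]

theorem sqrt_le_lam (θ : E d) : Real.sqrt (1 + ‖θ‖) ≤ lam θ := by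
  rw [Real.sqrt_le_left (lam_pos θ).le]; exact le_lam_sq θ

/-- The exponent may have either sign, hence both comparisons. -/
theorem rpow_le_of_comparable {x y K : ℝ} (hx : 0 < x) (hy : 0 < y) (hK : 1 ≤ K) (h1 : x ≤ K * y)
    (h2 : y ≤ K * x) (m : ℝ) : x ^ m ≤ K ^ |m| * y ^ m := by
  have hK0 : 0 < K := by linarith
  rcases le_total 0 m with hm | hm
  · rw [abs_of_nonneg hm, ← Real.mul_rpow hK0.le hy.le]
    exact Real.rpow_le_rpow hx.le h1 hm
  · rw [abs_of_nonpos hm]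
    have h3 : (K * x) ^ m ≤ y ^ m := Real.rpow_le_rpow_of_nonpos hy h2 hm
    rw [Real.mul_rpow hK0.le hx.le] at h3
    calc x ^ m = K ^ (-m) * (K ^ m * x ^ m) := by
          rw [← mul_assoc, ← Real.rpow_add hK0]; simp
      _ ≤ _ := by gcongr

/-- The weights of the mixed symbols of the standard frame. -/
def ssys (d : ℕ) : WSys Unit (E d × E d) where
  ι := Fin (d + 1) ⊕ Fin (d + 1)
  dir := Sum.elim (fun i => (stdVec i, 0)) (fun j => (0, stdVec j))
  shift := Sum.elim (fun _ => 0) (fun j => if j = Fin.last d then (-1, 0) else (0, -1))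
  dom _ := Set.univ
  a _ p := 1 + ‖p.2‖
  b _ p := lam p.2
  a_pos _ p _ := by positivity
  b_pos _ p _ := lam_pos p.2

theorem ssys_w (μ : ℝ × ℝ) (p : E d × E d) :
    (ssys d).w μ () p = (1 + ‖p.2‖) ^ μ.1 * lam p.2 ^ μ.2 := rfl

/-- Mixed symbols with respect to the standard frame. -/
def SMem (m n : ℝ) (a : E d × E d → ℂ) : Prop := ∀ k, (ssys d).Mem k (m, n) (fun _ => a)

theorem ssys_w_le_of {s t : ℝ} (C : ℝ) (h : ∀ θ : E d, (1 + ‖θ‖) ^ s * lam θ ^ t ≤ C) {k : ℕ}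
    {μ ν : ℝ × ℝ} {f : Unit → E d × E d → ℂ} (hf : (ssys d).Mem k μ f)
    (hμ : μ - ν = (s, t)) : (ssys d).Mem k ν f :=
  hf.weaken C fun _ p _ => by rw [ssys_w, hμ]; exact h p.2

/-- A gain in the first order is better than a gain in the second. -/
theorem ssys_trade {k : ℕ} {m n : ℝ} {f : Unit → E d × E d → ℂ}
    (hf : (ssys d).Mem k (m - 1, n) f) : (ssys d).Mem k (m, n - 1) f := by
  refine ssys_w_le_of (s := -1) (t := 1) 2 (fun θ => ?_) hf (by ext <;> simp)
  rw [Real.rpow_neg_one, Real.rpow_one, inv_mul_le_iff₀ (by positivity)]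
  linarith [lam_le θ]

theorem dd_snd_coord (j : Fin (d + 1)) (v : E d × E d) :
    dd v (fun p : E d × E d => ((p.2 j : ℝ) : ℂ)) = fun _ => ((v.2 j : ℝ) : ℂ) := by
  ext w
  have h : HasFDerivAt (fun p : E d × E d => ((p.2 j : ℝ) : ℂ))
      (Complex.ofRealCLM.comp ((EuclideanSpace.proj j : E d →L[ℝ] ℝ).comp
        (ContinuousLinearMap.snd ℝ (E d) (E d)))) w :=
    ContinuousLinearMap.hasFDerivAt (Complex.ofRealCLM.comp
      ((EuclideanSpace.proj j : E d →L[ℝ] ℝ).comp (ContinuousLinearMap.snd ℝ (E d) (E d))))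
  simp [dd, h.fderiv]

theorem contDiff_snd_coord (j : Fin (d + 1)) :
    ContDiff ℝ ∞ (fun p : E d × E d => ((p.2 j : ℝ) : ℂ)) := (contDiff_coord j).comp contDiff_snd

theorem stdVec_apply (i j : Fin (d + 1)) : (stdVec i : E d) j = if j = i then 1 else 0 := by
  simp [stdVec]

/-- The coordinate functions `θ_j` have order `(1, 0)`. -/
theorem ssys_coord (k : ℕ) (j : Fin (d + 1)) :
    (ssys d).Mem k (1, 0) (fun _ p => ((p.2 j : ℝ) : ℂ)) := by
  have hd : (ssys d).Dom (1, 0) (fun _ p => ((p.2 j : ℝ) : ℂ)) := by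
    refine ⟨1, fun q p _ => ?_⟩
    rw [ssys_w, Complex.norm_real]
    have : ‖p.2 j‖ ≤ ‖p.2‖ := PiLp.norm_apply_le p.2 j
    simp only [Real.rpow_one, Real.rpow_zero]
    linarith
  cases k with
  | zero => exact ⟨fun _ => contDiff_snd_coord j, hd⟩
  | succ k =>
    refine ⟨fun _ => contDiff_snd_coord j, hd, fun i => ?_⟩
    simp only [dd_snd_coord]
    have h0 := WSys.mem_const (S := ssys d) k
    rcases i with i | i
    · refine (WSys.mem_zero k _).cast rfl fun _ _ => ?_
      simp [ssys]
    · by_cases hi : i = Fin.last d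
      · refine (h0 ((((0, stdVec i) : E d × E d).2 j : ℝ) : ℂ)).cast ?_ fun _ _ => ?_
        · simp [ssys, hi]; rfl
        · simp [ssys]
      · have h1 := ssys_trade (m := 1) (n := 0) (f := fun _ _ => _) ((h0
          ((((0, stdVec i) : E d × E d).2 j : ℝ) : ℂ)).cast (ν := (1 - 1, 0)) (by simp; rfl)
          fun _ _ => rfl)
        exact h1.cast (by simp [ssys, hi]) fun _ _ => by simp [ssys]

/-- The coordinate functions `θ_j`, `j < N`, have order `(0, 1)`. -/
theorem ssys_coord_horiz (k : ℕ) (j : Fin d) :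
    (ssys d).Mem k (0, 1) (fun _ p => ((p.2 j.castSucc : ℝ) : ℂ)) := by
  have hd : (ssys d).Dom (0, 1) (fun _ p => ((p.2 j.castSucc : ℝ) : ℂ)) := by
    refine ⟨1, fun q p _ => ?_⟩
    rw [ssys_w, Complex.norm_real]
    have : ‖p.2 j.castSucc‖ ≤ ‖horiz p.2‖ := PiLp.norm_apply_le (horiz p.2) j
    simp only [Real.rpow_one, Real.rpow_zero, lam]
    linarith [Real.sqrt_nonneg ‖p.2‖]
  cases k with
  | zero => exact ⟨fun _ => contDiff_snd_coord _, hd⟩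
  | succ k =>
    refine ⟨fun _ => contDiff_snd_coord _, hd, fun i => ?_⟩
    simp only [dd_snd_coord]
    rcases i with i | i
    · refine (WSys.mem_zero k _).cast rfl fun _ _ => ?_
      simp [ssys]
    · by_cases hi : i = Fin.last d
      · refine (WSys.mem_zero k _).cast rfl fun _ _ => ?_
        simp [ssys, hi, stdVec_apply, Fin.castSucc_ne_last]
      · exact (WSys.mem_const (S := ssys d) k _).cast (by simp [ssys, hi]; rfl) fun _ _ => rfl

/-- The θ-derivatives vanish identically and so have every order. -/
theorem Cb.smem {f : E d → ℂ} (hf : Cb f) : SMem 0 0 (fun p : E d × E d => f p.1) := by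
  intro k
  refine WSys.mem_of_coind (fun μ h => (μ = (0, 0) ∧ ∃ f : E d → ℂ, Cb f ∧ h = fun _ p => f p.1) ∨
    h = fun _ _ => 0) ?_ ?_ k (Or.inl ⟨rfl, f, hf, rfl⟩)
  · rintro μ h (⟨rfl, f, hf, rfl⟩ | rfl)
    · obtain ⟨C, hC0, hC⟩ := hf.bound
      exact ⟨fun _ => hf.smooth.comp contDiff_fst, C, fun q p _ => by
        rw [ssys_w]; simpa using hC p.1⟩
    · exact ⟨fun _ => contDiff_const, 0, by simp⟩
  · rintro μ h (⟨rfl, f, hf, rfl⟩ | rfl) i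
    · have hdd : ∀ v : E d × E d, MixedPDO.dd v (fun p : E d × E d => f p.1) = fun p => MixedPDO.dd v.1 f p.1 := by
        intro v
        ext p
        have h2 : HasFDerivAt (fun p : E d × E d => f p.1) _ p :=
          ((hf.smooth.differentiable (by simp)) p.1).hasFDerivAt.comp p hasFDerivAt_fst
        simp [MixedPDO.dd, h2.fderiv]
      rcases i with i | i
      · exact Or.inl ⟨by simp [ssys], _, hf.dd (stdVec i), by simp [ssys, hdd]⟩
      · right
        ext q p
        change MixedPDO.dd (0, stdVec i) (fun p : E d × E d => f p.1) p = 0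
        rw [hdd]
        simp [MixedPDO.dd]
    · right
      simp only [dd_const]

theorem SMem.mul {m n m' n' : ℝ} {a b : E d × E d → ℂ} (ha : SMem m n a) (hb : SMem m' n' b) :
    SMem (m + m') (n + n') (fun p => a p * b p) :=
  fun k => ((ha k).mul (hb k)).cast (by simp) fun _ _ => rfl

theorem SMem.smooth {m n : ℝ} {a : E d × E d → ℂ} (ha : SMem m n a) : ContDiff ℝ ∞ a :=
  (ha 0).smooth ()

theorem SMem.dx {m n : ℝ} {a : E d × E d → ℂ} (ha : SMem m n a) (i : Fin (d + 1)) :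
    SMem m n (dd (stdVec i, 0) a) :=
  fun k => ((ha (k + 1)).deriv (Sum.inl i)).cast (by simp [ssys]) fun _ _ => rfl

theorem SMem.dlast {m n : ℝ} {a : E d × E d → ℂ} (ha : SMem m n a) :
    SMem (m - 1) n (dd (0, stdVec (Fin.last d)) a) :=
  fun k => ((ha (k + 1)).deriv (Sum.inr (Fin.last d))).cast (by simp [ssys]; ring) fun _ _ => rfl

/-- For j = N the gain is in the first order, and `ssys_trade` exchanges it for one in the second.
This gives a rule that is uniform in j. -/
theorem SMem.dxi {m n : ℝ} {a : E d × E d → ℂ} (ha : SMem m n a) (j : Fin (d + 1)) :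
    SMem m (n - 1) (dd (0, stdVec j) a) := by
  intro k
  by_cases hj : j = Fin.last d
  · subst hj
    exact ssys_trade (f := fun _ => _) (ha.dlast k)
  · exact ((ha (k + 1)).deriv (Sum.inr j)).cast (by simp [ssys, hj]; ring) fun _ _ => rfl

theorem SMem.bound {m n : ℝ} {a : E d × E d → ℂ} (ha : SMem m n a) : ∃ C : ℝ, 0 < C ∧ ∀ p,
    ‖a p‖ ≤ C * ((1 + ‖p.2‖) ^ m * lam p.2 ^ n) := by
  obtain ⟨C, h0, hC⟩ := (ha 0).dom.bound
  exact ⟨C, h0, fun p => hC () p trivial⟩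

/-- Membership in the class of mixed symbols by coinduction. -/
theorem SMem.coind (R : ℝ → ℝ → (E d × E d → ℂ) → Prop)
    (h0 : ∀ m n f, R m n f → ContDiff ℝ ∞ f ∧ ∃ C : ℝ, ∀ p,
      ‖f p‖ ≤ C * ((1 + ‖p.2‖) ^ m * lam p.2 ^ n))
    (hx : ∀ m n f, R m n f → ∀ i, R m n (dd (stdVec i, 0) f))
    (hl : ∀ m n f, R m n f → R (m - 1) n (dd (0, stdVec (Fin.last d)) f))
    (hh : ∀ m n f, R m n f → ∀ j : Fin d, R m (n - 1) (dd (0, stdVec j.castSucc) f))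
    {m n : ℝ} {f : E d × E d → ℂ} (h : R m n f) : SMem m n f := by
  intro k
  refine WSys.mem_of_coind (fun μ h => ∃ f, R μ.1 μ.2 f ∧ h = fun _ => f) ?_ ?_ k ⟨f, h, rfl⟩
  · rintro μ _ ⟨f, hf, rfl⟩
    obtain ⟨h1, C, hC⟩ := h0 _ _ f hf
    exact ⟨fun _ => h1, C, fun _ p _ => hC p⟩
  · rintro μ _ ⟨f, hf, rfl⟩ i
    rcases i with i | i
    · exact ⟨_, by simpa [ssys] using hx _ _ f hf i, rfl⟩
    · induction i using Fin.lastCases with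
      | last => exact ⟨_, by simpa [ssys, sub_eq_add_neg] using hl _ _ f hf, rfl⟩
      | cast j =>
        exact ⟨_, by simpa [ssys, sub_eq_add_neg, Fin.castSucc_ne_last] using hh _ _ f hf j, rfl⟩

end weights

/-! ### Functions that vanish at w = 0 -/

section vanishing
variable {d : ℕ}

/-- The weights `(R⁻¹ + |w|)^s` that measure the vanishing of `f(x, w)` at `w = 0`. -/
def vsys (d : ℕ) : WSys {R : ℝ // 1 ≤ R} (E d × E d) where
  ι := Fin (d + 1) ⊕ Fin (d + 1)
  dir := Sum.elim (fun i => (stdVec i, 0)) (fun j => (0, stdVec j))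
  shift := Sum.elim (fun _ => 0) (fun _ => (-1, 0))
  dom _ := Set.univ
  a R p := (R : ℝ)⁻¹ + ‖p.2‖
  b _ _ := 1
  a_pos R p _ := by
    have : (0 : ℝ) < R := one_pos.trans_le R.2
    positivity
  b_pos _ _ _ := one_pos

theorem vsys_w (μ : ℝ × ℝ) (R : {R : ℝ // 1 ≤ R}) (p : E d × E d) :
    (vsys d).w μ R p = ((R : ℝ)⁻¹ + ‖p.2‖) ^ μ.1 := by
  simp [WSys.w, vsys]

/-- Functions that vanish to order `s` at `w = 0`. -/
def VMem (s : ℝ) (f : E d × E d → ℂ) : Prop := ∀ k, (vsys d).Mem k (s, 0) (fun _ => f)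

theorem VMem.mul {s t : ℝ} {f g : E d × E d → ℂ} (hf : VMem s f) (hg : VMem t g) :
    VMem (s + t) (fun p => f p * g p) :=
  fun k => ((hf k).mul (hg k)).cast (by simp) fun _ _ => rfl

theorem VMem.dx {s : ℝ} {f : E d × E d → ℂ} (hf : VMem s f) (i : Fin (d + 1)) :
    VMem s (dd (stdVec i, 0) f) :=
  fun k => ((hf (k + 1)).deriv (Sum.inl i)).cast (by simp [vsys]) fun _ _ => rfl

theorem VMem.dw {s : ℝ} {f : E d × E d → ℂ} (hf : VMem s f) (i : Fin (d + 1)) :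
    VMem (s - 1) (dd (0, stdVec i) f) :=
  fun k => ((hf (k + 1)).deriv (Sum.inr i)).cast (by simp [vsys]; ring) fun _ _ => rfl

theorem Cb.dd_zero_bound {f : E d × E d → ℂ} (hf : Cb f) :
    ∃ C : ℝ, 0 < C ∧ ∀ x w, ‖f (x, w) - f (x, 0)‖ ≤ C * ‖w‖ := by
  obtain ⟨C, h0, hC⟩ := hf.cb1.lipschitz
  refine ⟨C, h0, fun x w => (hC _ _).trans ?_⟩
  simp [Prod.norm_def]

/-- The term R⁻¹ keeps the weight |w|^s positive at w = 0, and R will be the scale (1 + |θ|)^{1/2}.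
Orders 1 and 2 are Taylor estimates. Non-positive orders hold because the weight is bounded below on
the support, uniformly in R. A derivative in w lowers the order of vanishing by one, through 2, 1, 0
and below. -/
theorem Cb.vmem {ρ : ℝ} (hρ : 0 ≤ ρ) {f : E d × E d → ℂ} {s : ℝ} (hf : Cb f) (hs : SuppIn ρ f)
    (h : s ≤ 0 ∨ (s = 1 ∧ ∀ x, f (x, 0) = 0) ∨
      (s = 2 ∧ (∀ x, f (x, 0) = 0) ∧ ∀ x v, MixedPDO.dd (0, v) f (x, 0) = 0)) : VMem s f := by
  intro k
  refine WSys.mem_of_coind (fun μ h => ∃ f : E d × E d → ℂ, Cb f ∧ SuppIn ρ f ∧ h = (fun _ => f) ∧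
    μ.2 = 0 ∧ (μ.1 ≤ 0 ∨ (μ.1 = 1 ∧ ∀ x, f (x, 0) = 0) ∨
      (μ.1 = 2 ∧ (∀ x, f (x, 0) = 0) ∧ ∀ x v, MixedPDO.dd (0, v) f (x, 0) = 0))) ?_ ?_ k
    ⟨f, hf, hs, rfl, rfl, h⟩
  · rintro μ _ ⟨f, hf, hs, rfl, h2, h⟩
    refine ⟨fun _ => hf.smooth, ?_⟩
    have hpos : ∀ (R : {R : ℝ // 1 ≤ R}) (w : E d), 0 < (R : ℝ)⁻¹ + ‖w‖ := fun R w => by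
      have : (0 : ℝ) < R := one_pos.trans_le R.2
      positivity
    have hle : ∀ (R : {R : ℝ // 1 ≤ R}) (w : E d), ‖w‖ ≤ (R : ℝ)⁻¹ + ‖w‖ := fun R w => by
      have : (0 : ℝ) < R := one_pos.trans_le R.2
      have : (0 : ℝ) < (R : ℝ)⁻¹ := by positivity
      linarith
    rcases h with h | ⟨h, hz⟩ | ⟨h, hz, hz'⟩
    · obtain ⟨C, h0, hC⟩ := hf.bound
      refine ⟨C * ((1 + ρ) ^ μ.1)⁻¹, fun R p _ => ?_⟩
      rw [vsys_w]
      change ‖f p‖ ≤ _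
      have hR : (R : ℝ)⁻¹ ≤ 1 := inv_le_one_of_one_le₀ R.2
      by_cases hp : ρ < ‖p.2‖
      · rw [show f p = 0 from hs.supp p.1 p.2 hp, norm_zero]
        have := Real.rpow_pos_of_pos (hpos R p.2) μ.1
        positivity
      · have h3 : (1 + ρ) ^ μ.1 ≤ ((R : ℝ)⁻¹ + ‖p.2‖) ^ μ.1 :=
          Real.rpow_le_rpow_of_nonpos (hpos R p.2) (by linarith) h
        have h4 : 0 < (1 + ρ) ^ μ.1 := Real.rpow_pos_of_pos (by linarith) _
        rw [mul_assoc]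
        refine (hC p).trans (le_mul_of_one_le_right h0.le ?_)
        rw [inv_mul_eq_div, one_le_div h4]
        exact h3
    · obtain ⟨C, h0, hC⟩ := hf.dd_zero_bound
      refine ⟨C, fun R p _ => ?_⟩
      rw [vsys_w, h, Real.rpow_one]
      have h1 := hC p.1 p.2
      rw [hz, sub_zero] at h1
      exact h1.trans (mul_le_mul_of_nonneg_left (hle R p.2) h0.le)
    · obtain ⟨C, h0, hC⟩ := hf.cb1.fderiv.cb1.lipschitz
      refine ⟨C, fun R p _ => ?_⟩
      rw [vsys_w, h, Real.rpow_two]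
      have hd : ∀ w : E d, HasFDerivAt (fun w => f (p.1, w)) ((_root_.fderiv ℝ f (p.1, w)).comp
          (ContinuousLinearMap.inr ℝ (E d) (E d))) w := fun w =>
        ((hf.smooth.differentiable (by simp)) (p.1, w)).hasFDerivAt.comp w
          (hasFDerivAt_prodMk_right p.1 w)
      have hz2 : (_root_.fderiv ℝ f (p.1, 0)).comp (ContinuousLinearMap.inr ℝ (E d) (E d)) = 0 := by
        ext v
        simpa [MixedPDO.dd] using hz' p.1 v
      have hb : ∀ w ∈ Metric.closedBall (0 : E d) ‖p.2‖, ‖(_root_.fderiv ℝ f (p.1, w)).comp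
          (ContinuousLinearMap.inr ℝ (E d) (E d))‖ ≤ C * ‖p.2‖ := by
        intro w hw
        have e : (_root_.fderiv ℝ f (p.1, w)).comp (ContinuousLinearMap.inr ℝ (E d) (E d)) =
            (_root_.fderiv ℝ f (p.1, w) - _root_.fderiv ℝ f (p.1, 0)).comp
              (ContinuousLinearMap.inr ℝ (E d) (E d)) := by
          rw [ContinuousLinearMap.sub_comp, hz2, sub_zero]
        rw [e]
        refine (ContinuousLinearMap.opNorm_comp_le _ _).trans ?_
        have h5 := hC (p.1, w) (p.1, 0)
        have h6 : ‖ContinuousLinearMap.inr ℝ (E d) (E d)‖ ≤ 1 :=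
          ContinuousLinearMap.norm_inr_le_one ℝ (E d) (E d)
        have h7 : ‖((p.1, w) : E d × E d) - (p.1, 0)‖ ≤ ‖p.2‖ := by
          simpa [Prod.norm_def] using hw
        calc _ ≤ (C * ‖p.2‖) * 1 := by
              gcongr
              exact h5.trans (by gcongr)
          _ = _ := mul_one _
      have h8 := (convex_closedBall (0 : E d) ‖p.2‖).norm_image_sub_le_of_norm_hasFDerivWithin_le
        (fun w _ => (hd w).hasFDerivWithinAt) hb (x := 0) (y := p.2) (by simp) (by simp)
      rw [show f (p.1, 0) = 0 from hz p.1, sub_zero, sub_zero] at h8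
      refine h8.trans ?_
      rw [mul_assoc, ← pow_two]
      exact mul_le_mul_of_nonneg_left (pow_le_pow_left₀ (norm_nonneg _) (hle R p.2) 2) h0.le
  · rintro μ _ ⟨f, hf, hs, rfl, h2, h⟩ i
    have hsd := hf.smooth.differentiable (by simp)
    rcases i with i | i
    · refine ⟨_, hf.dd (stdVec i, 0), hs.dd _, rfl, by simp [vsys, h2], ?_⟩
      -- Derivatives in x are tangential to w = 0, so vanishing there is preserved.
      have hx0 : ∀ (g : E d × E d → ℂ), Differentiable ℝ g → (∀ x, g (x, 0) = 0) →
          ∀ x u, MixedPDO.dd (u, 0) g (x, 0) = 0 := by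
        intro g hg hz x u
        have := congrFun (dd_prod_left hg u 0) x
        rw [← this]
        simp [hz, MixedPDO.dd]
      rcases h with h | ⟨h, hz⟩ | ⟨h, hz, hz'⟩
      · exact Or.inl (by simpa [vsys] using h)
      · exact Or.inr (Or.inl ⟨by simpa [vsys] using h, fun x => hx0 f hsd hz x _⟩)
      · refine Or.inr (Or.inr ⟨by simpa [vsys] using h, fun x => hx0 f hsd hz x _, fun x v => ?_⟩)
        rw [dd_comm hf.smooth]
        exact hx0 _ ((contDiff_dd hf.smooth _).differentiable (by simp)) (fun x => hz' x v) x _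
    · refine ⟨_, hf.dd (0, stdVec i), hs.dd _, rfl, by simp [vsys, h2], ?_⟩
      rcases h with h | ⟨h, hz⟩ | ⟨h, hz, hz'⟩
      · exact Or.inl (by simp [vsys]; linarith)
      · exact Or.inl (by simp [vsys]; linarith)
      · exact Or.inr (Or.inl ⟨by simp [vsys, h]; norm_num, fun x => hz' x _⟩)

end vanishing

/-- Change of the system of weights when there are no shifts, for functions that vanish near every
point outside the domains of the first system. -/
theorem WSys.Mem.transfer {Q P : Type} [NormedAddCommGroup P] [NormedSpace ℝ P] {S S' : WSys Q P}
    (hs : ∀ i, S.shift i = 0) (hs' : ∀ i, S'.shift i = 0) (hι : ∀ i, ∃ j, S.dir j = S'.dir i)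
    {μ ν : ℝ × ℝ} (c : Q → ℂ) (C : ℝ) (hw : ∀ q, ∀ p ∈ S.dom q, p ∈ S'.dom q →
      ‖c q‖ * S.w μ q p ≤ C * S'.w ν q p) {k : ℕ} {f : Q → P → ℂ} (hf : S.Mem k μ f)
    (h : ∀ q p, p ∉ S.dom q → ∀ᶠ y in nhds p, f q y = 0) :
    S'.Mem k ν (fun q p => c q * f q p) := by
  have hd : ∀ {f : Q → P → ℂ}, S.Dom μ f → (∀ q p, p ∉ S.dom q → ∀ᶠ y in nhds p, f q y = 0) →
      S'.Dom ν (fun q p => c q * f q p) := by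
    intro f hf h
    obtain ⟨C', hC0, hC'⟩ := hf.bound
    refine ⟨C' * |C|, fun q p hp => ?_⟩
    have h0 := (WSys.w_pos (S := S') ν hp).le
    by_cases hpS : p ∈ S.dom q
    · rw [norm_mul]
      calc ‖c q‖ * ‖f q p‖ ≤ ‖c q‖ * (C' * S.w μ q p) := by gcongr; exact hC' q p hpS
        _ = C' * (‖c q‖ * S.w μ q p) := by ring
        _ ≤ C' * (C * S'.w ν q p) := mul_le_mul_of_nonneg_left (hw q p hpS hp) hC0.le
        _ ≤ C' * (|C| * S'.w ν q p) := by gcongr; exact le_abs_self C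
        _ = _ := by ring
    · change ‖c q * f q p‖ ≤ _
      rw [(h q p hpS).self_of_nhds, mul_zero, norm_zero]
      positivity
  have hcs : ∀ {f : Q → P → ℂ}, (∀ q, ContDiff ℝ ∞ (f q)) →
      ∀ q, ContDiff ℝ ∞ (fun p => c q * f q p) := fun hf q => contDiff_const.mul (hf q)
  induction k generalizing f with
  | zero => exact ⟨hcs hf.smooth, hd hf.dom h⟩
  | succ k ih =>
    refine ⟨hcs hf.smooth, hd hf.dom h, fun i => ?_⟩
    obtain ⟨j, hj⟩ := hι i
    refine (ih (f := fun q => dd (S.dir j) (f q)) ((hf.deriv j).cast (by simp [hs])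
      fun _ _ => rfl) ?_).cast (by simp [hs']) fun q p => ?_
    · intro q p hp
      filter_upwards [(h q p hp).eventually_nhds] with y hy
      have : f q =ᶠ[nhds y] fun _ => 0 := hy
      simp [dd, this.fderiv_eq]
    · rw [dd_const_mul (hf.diff q), hj]

/-! ### The scale (1 + |θ|)^{1/2} -/

section rescaling
variable {d : ℕ}

/-- The scale `(1 + |θ|)^{1/2}`. -/
def rad (θ : E d) : ℝ := Real.sqrt (1 + ‖θ‖)

theorem rad_sq (θ : E d) : rad θ ^ 2 = 1 + ‖θ‖ := Real.sq_sqrt (by positivity)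

theorem one_le_rad (θ : E d) : 1 ≤ rad θ := Real.one_le_sqrt.2 (by linarith [norm_nonneg θ])

theorem rad_pos (θ : E d) : 0 < rad θ := one_pos.trans_le (one_le_rad θ)

theorem rad_rpow (θ : E d) (s : ℝ) : rad θ ^ s = (1 + ‖θ‖) ^ (s / 2) := by
  rw [rad, Real.sqrt_eq_rpow, ← Real.rpow_mul (by positivity)]
  congr 1; ring

/-- The square root grows by at most (r + |ζ|)/2, because r|ζ| is at most the square of this number.
-/
theorem lam_add_le (θ ζ : E d) {r : ℝ} (hr : 0 ≤ r) :
    lam (θ + r • ζ) ≤ lam θ + r * ‖ζ‖ + (r + ‖ζ‖) / 2 := by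
  have h1 : ‖horiz (θ + r • ζ)‖ ≤ ‖horiz θ‖ + r * ‖ζ‖ := by
    rw [horiz_add]
    refine (norm_add_le _ _).trans (add_le_add le_rfl ((norm_horiz_le _).trans ?_))
    rw [norm_smul, Real.norm_of_nonneg hr]
  have h2 : Real.sqrt ‖θ + r • ζ‖ ≤ Real.sqrt ‖θ‖ + (r + ‖ζ‖) / 2 := by
    rw [Real.sqrt_le_left (by positivity)]
    have h3 : ‖θ + r • ζ‖ ≤ ‖θ‖ + r * ‖ζ‖ := by
      refine (norm_add_le _ _).trans ?_
      rw [norm_smul, Real.norm_of_nonneg hr]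
    have h4 := Real.sq_sqrt (norm_nonneg θ)
    have h5 := Real.sqrt_nonneg ‖θ‖
    have h6 : 0 ≤ (r + ‖ζ‖) / 2 := by positivity
    nlinarith [sq_nonneg (r - ‖ζ‖), mul_nonneg h5 h6]
  unfold lam
  linarith

/-- Controls the scale at θ by the scale at the moved point, which makes the comparison of weights
two-sided. -/
theorem rad_le_of_smul (θ ζ : E d) : rad θ ≤ rad (θ + rad θ • ζ) * (1 + ‖ζ‖) := by
  have h1 : ‖θ‖ ≤ ‖θ + rad θ • ζ‖ + rad θ * ‖ζ‖ := by
    have := norm_sub_le (θ + rad θ • ζ) (rad θ • ζ)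
    rwa [add_sub_cancel_right, norm_smul, Real.norm_of_nonneg (rad_pos θ).le] at this
  have h2 := rad_sq θ
  have h3 := rad_sq (θ + rad θ • ζ)
  have h4 := one_le_rad θ
  have h5 := one_le_rad (θ + rad θ • ζ)
  have h6 := norm_nonneg ζ
  have h7 : rad θ ≤ rad (θ + rad θ • ζ) + ‖ζ‖ := by
    by_contra hc
    push Not at hc
    nlinarith
  nlinarith

/-- The weights are slowly varying at the scale `rad`. -/
theorem weight_comparable (θ ζ : E d) (m n : ℝ) :
    (1 + ‖θ + rad θ • ζ‖) ^ m * lam (θ + rad θ • ζ) ^ n ≤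
      3 ^ (|m| + |n|) * (1 + ‖ζ‖) ^ (2 * (|m| + |n|)) * ((1 + ‖θ‖) ^ m * lam θ ^ n) := by
  have hR := one_le_rad θ
  have hR2 := rad_sq θ
  have hz := norm_nonneg ζ
  have hl := rad_le_of_smul θ ζ
  have hη := one_le_rad (θ + rad θ • ζ)
  have hη2 := rad_sq (θ + rad θ • ζ)
  have hs : rad θ ≤ lam θ := sqrt_le_lam θ
  have hs' : rad (θ + rad θ • ζ) ≤ lam (θ + rad θ • ζ) := sqrt_le_lam _
  have hn1 : ‖θ + rad θ • ζ‖ ≤ ‖θ‖ + rad θ * ‖ζ‖ := by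
    refine (norm_add_le _ _).trans ?_
    rw [norm_smul, Real.norm_of_nonneg (rad_pos θ).le]
  have hn2 : ‖θ‖ ≤ ‖θ + rad θ • ζ‖ + rad θ * ‖ζ‖ := by
    have := norm_sub_le (θ + rad θ • ζ) (rad θ • ζ)
    rwa [add_sub_cancel_right, norm_smul, Real.norm_of_nonneg (rad_pos θ).le] at this
  have hl1 := lam_add_le θ ζ (rad_pos θ).le
  -- The reverse comparison: start at the moved point and go back by -ζ, still with the scale of θ.
  have hl2 := lam_add_le (θ + rad θ • ζ) (-ζ) (rad_pos θ).le
  rw [smul_neg, add_neg_cancel_right, norm_neg] at hl2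
  have hK : (1 : ℝ) ≤ 3 * (1 + ‖ζ‖) ^ 2 := by nlinarith
  have hl0 := one_le_lam θ
  have hl0' := one_le_lam (θ + rad θ • ζ)
  set z := ‖ζ‖
  set η := θ + rad θ • ζ
  have a1 : 1 + ‖η‖ ≤ 3 * (1 + z) ^ 2 * (1 + ‖θ‖) := by
    have : rad θ ≤ 1 + ‖θ‖ := by nlinarith
    nlinarith [mul_le_mul_of_nonneg_right this hz, mul_nonneg hz hz,
      mul_nonneg hz (norm_nonneg θ), mul_nonneg (mul_nonneg hz hz) (norm_nonneg θ), norm_nonneg θ]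
  have a2 : 1 + ‖θ‖ ≤ 3 * (1 + z) ^ 2 * (1 + ‖η‖) := by
    have : rad θ ≤ (1 + ‖η‖) * (1 + z) := hl.trans (by gcongr; nlinarith)
    nlinarith [mul_le_mul_of_nonneg_right this hz, mul_nonneg hz hz,
      mul_nonneg hz (norm_nonneg η), mul_nonneg (mul_nonneg hz hz) (norm_nonneg η), norm_nonneg η]
  have b1 : lam η ≤ 3 * (1 + z) ^ 2 * lam θ := by
    nlinarith [mul_le_mul_of_nonneg_right hs hz, mul_nonneg hz hz,
      mul_le_mul_of_nonneg_right hl0 hz, mul_nonneg (mul_nonneg hz hz) (zero_le_one.trans hl0)]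
  have b2 : lam θ ≤ 3 * (1 + z) ^ 2 * lam η := by
    have : rad θ ≤ lam η * (1 + z) := hl.trans (by gcongr)
    nlinarith [mul_le_mul_of_nonneg_right this hz, mul_nonneg hz hz,
      mul_le_mul_of_nonneg_right hl0' hz, mul_nonneg (mul_nonneg hz hz) (zero_le_one.trans hl0')]
  have hp : (0 : ℝ) < 1 + ‖η‖ := by positivity
  have hp' : (0 : ℝ) < 1 + ‖θ‖ := by positivity
  have c1 := rpow_le_of_comparable hp hp' hK a1 a2 m
  have c2 := rpow_le_of_comparable (lam_pos η) (lam_pos θ) hK b1 b2 n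
  have e : 3 ^ (|m| + |n|) * (1 + z) ^ (2 * (|m| + |n|)) =
      (3 * (1 + z) ^ 2) ^ |m| * (3 * (1 + z) ^ 2) ^ |n| := by
    rw [← Real.rpow_add (by positivity), Real.mul_rpow (by norm_num) (by positivity),
      ← Real.rpow_natCast (1 + z) 2, ← Real.rpow_mul (by positivity)]
    norm_num
  rw [e]
  calc _ ≤ ((3 * (1 + z) ^ 2) ^ |m| * (1 + ‖θ‖) ^ m) * ((3 * (1 + z) ^ 2) ^ |n| * lam θ ^ n) := by
        gcongr
    _ = _ := by ring

/-- The amplitude of `opU` at the scale `rad`. -/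
def resAmp (ψ : E d × E d → ℂ) (g : E d × E d → E d) (p : E d × E d) (v : E d) : ℂ :=
  ψ (p.1, (rad p.2)⁻¹ • v) * ee (inner ℝ (g (p.1, (rad p.2)⁻¹ • v)) p.2)

/-- Substitute w = v/R and η = θ + Rζ with R = `rad θ`. The two Jacobians cancel, and the shift of η
removes the linear phase -w·θ, so only g(x,v/R)·θ is left in the amplitude. -/
theorem integral_uKer_rescale (ψ : E d × E d → ℂ) (g : E d × E d → E d) (B : E d → ℂ)
    (p : E d × E d) :
    ∫ η, B η * uKer ψ g p η = ∫ ζ, B (p.2 + rad p.2 • ζ) * ft (resAmp ψ g p) ζ := by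
  have hR := rad_pos p.2
  set r := rad p.2
  have e1 : ∀ ζ, ft (resAmp ψ g p) ζ =
      ((r ^ Module.finrank ℝ (E d) : ℝ) : ℂ) * uKer ψ g p (p.2 + r • ζ) := by
    intro ζ
    have h := Measure.integral_comp_smul (volume : Measure (E d))
      (fun v => resAmp ψ g p v * ee (inner ℝ v ζ)) r
    have h2 : ∀ w, resAmp ψ g p (r • w) * ee (inner ℝ (r • w) ζ) =
        uAmp ψ g (p, w) * ee (inner ℝ w (p.2 + r • ζ)) := by
      intro w
      have : (rad p.2)⁻¹ • r • w = w := inv_smul_smul₀ hR.ne' w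
      rw [resAmp, uAmp, this, inner_add_right, ee_add, ee_add, real_inner_smul_left,
        real_inner_smul_right]
      have h3 := ee_neg_mul (inner ℝ w p.2)
      linear_combination (-(ψ (p.1, w) * ee (inner ℝ (g (p.1, w)) p.2) *
        ee (r * inner ℝ w ζ))) * h3
    simp only [h2] at h
    rw [uKer, ft, ft, h, abs_of_nonneg (by positivity), Complex.real_smul, ← mul_assoc,
      ← Complex.ofReal_mul, mul_inv_cancel₀ (by positivity), Complex.ofReal_one, one_mul]
  have h := Measure.integral_comp_smul (volume : Measure (E d))
    (fun η => B (p.2 + η) * uKer ψ g p (p.2 + η)) r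
  rw [integral_add_left_eq_self (fun η => B η * uKer ψ g p η) p.2,
    abs_of_nonneg (by positivity), Complex.real_smul] at h
  simp only [e1]
  calc _ = ((r ^ Module.finrank ℝ (E d) : ℝ) : ℂ) *
        ∫ ζ, B (p.2 + r • ζ) * uKer ψ g p (p.2 + r • ζ) := by
        rw [h, ← mul_assoc, ← Complex.ofReal_mul, mul_inv_cancel₀ (by positivity),
          Complex.ofReal_one, one_mul]
    _ = _ := by
        rw [← integral_const_mul]
        congr 1
        ext ζ
        ring

end rescaling

/-! ### Size of `opU`: the region where |η| is not small compared to |θ| -/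

section far
variable {d : ℕ}

theorem weight_le (η : E d) (m n : ℝ) :
    (1 + ‖η‖) ^ m * lam η ^ n ≤ 2 ^ |n| * (1 + ‖η‖) ^ (|m| + |n|) := by
  have h1 : (1 : ℝ) ≤ 1 + ‖η‖ := by linarith [norm_nonneg η]
  have h2 : lam η ^ n ≤ 2 ^ |n| * (1 + ‖η‖) ^ |n| := by
    rw [← Real.mul_rpow (by norm_num) (by positivity)]
    exact (Real.rpow_le_rpow_of_exponent_le (one_le_lam η) (le_abs_self n)).trans
      (Real.rpow_le_rpow (lam_pos η).le (lam_le η) (abs_nonneg n))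
  rw [Real.rpow_add (by positivity)]
  calc _ ≤ (1 + ‖η‖) ^ |m| * (2 ^ |n| * (1 + ‖η‖) ^ |n|) := by
        gcongr
        · exact (Real.rpow_pos_of_pos (lam_pos η) n).le
        · exact le_abs_self m
    _ = _ := by ring

theorem sum_coord_smul (u : E d) : ∑ j, u j • (stdVec j : E d) = u := by
  ext i
  simp [stdVec_apply]

theorem SMem.const_mul {m n : ℝ} {a : E d × E d → ℂ} (ha : SMem m n a) (c : ℂ) :
    SMem m n (fun p => c * a p) := fun k => (ha k).const_mul c

theorem SMem.cast_order {m n n' : ℝ} {a : E d × E d → ℂ} (ha : SMem m n a) (h : n = n') :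
    SMem m n' a := h ▸ ha

theorem SMem.sum {m n : ℝ} {ι : Type*} (s : Finset ι) {a : ι → E d × E d → ℂ}
    (ha : ∀ i ∈ s, SMem m n (a i)) : SMem m n (fun p => ∑ i ∈ s, a i p) :=
  fun k => WSys.Mem.sum s fun i hi => ha i hi k

theorem dd_left_eq (u : E d) (a : E d × E d → ℂ) :
    dd (u, 0) a = fun p => ∑ j, ((u j : ℝ) : ℂ) * dd (stdVec j, 0) a p := by
  have : ((u, 0) : E d × E d) = ∑ j, u j • ((stdVec j, 0) : E d × E d) := by
    conv_lhs => rw [← sum_coord_smul u]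
    ext1 <;> simp [Prod.fst_sum, Prod.snd_sum]
  rw [this, dd_sum_dir]
  simp only [dd_smul_dir]

theorem dd_right_eq (u : E d) (a : E d × E d → ℂ) :
    dd (0, u) a = fun p => ∑ j, ((u j : ℝ) : ℂ) * dd (0, stdVec j) a p := by
  have : ((0, u) : E d × E d) = ∑ j, u j • ((0, stdVec j) : E d × E d) := by
    conv_lhs => rw [← sum_coord_smul u]
    ext1 <;> simp [Prod.fst_sum, Prod.snd_sum]
  rw [this, dd_sum_dir]
  simp only [dd_smul_dir]

theorem SMem.dd_left {m n : ℝ} {a : E d × E d → ℂ} (ha : SMem m n a) (u : E d) :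
    SMem m n (dd (u, 0) a) := by
  rw [dd_left_eq]
  exact SMem.sum _ fun j _ => (ha.dx j).const_mul _

theorem SMem.xgrowth {m n : ℝ} {b : E d × E d → ℂ} (hb : SMem m n b) : XGrowth b := by
  refine ⟨hb.smooth, fun R k => ⟨|m| + |n|, ?_⟩⟩
  refine WSys.mem_of_coind (fun μ f => μ = (|m| + |n|, 0) ∧ ∃ b, SMem m n b ∧
    f = fun η (p : E d × E d) => b (p.1, η)) ?_ ?_ k ⟨rfl, b, hb, rfl⟩
  · rintro μ f ⟨rfl, b, hb, rfl⟩
    refine ⟨fun η => hb.smooth.comp (contDiff_fst.prodMk contDiff_const), ?_⟩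
    obtain ⟨C, h0, hC⟩ := hb.bound
    refine ⟨C * 2 ^ |n|, fun η p _ => ?_⟩
    rw [ldsys_w, mul_assoc]
    exact (hC (p.1, η)).trans (mul_le_mul_of_nonneg_left (weight_le η m n) h0.le)
  · rintro μ f ⟨rfl, b, hb, rfl⟩ v
    refine ⟨by simp [ldsys], _, hb.dd_left v.1, ?_⟩
    ext1 η
    exact dd_comp_fst (hb.smooth.differentiable (by simp)) v η

/-- The system of the weights of `b(x, θ + rad θ ζ)`, as functions of `ζ`. -/
def fsys (d : ℕ) : WSys (E d × E d) (E d) where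
  ι := Fin (d + 1)
  dir := stdVec
  shift _ := 0
  dom p := {ζ | rad p.2 ^ 2 / 16 ≤ ‖p.2 + rad p.2 • ζ‖}
  a p ζ := 1 + ‖p.2 + rad p.2 • ζ‖
  b p ζ := lam (p.2 + rad p.2 • ζ)
  a_pos _ _ _ := by positivity
  b_pos _ _ _ := lam_pos _

theorem fsys_w (μ : ℝ × ℝ) (p : E d × E d) (ζ : E d) : (fsys d).w μ p ζ =
    (1 + ‖p.2 + rad p.2 • ζ‖) ^ μ.1 * lam (p.2 + rad p.2 • ζ) ^ μ.2 := rfl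

theorem dd_comp_affine {f : E d → ℂ} (hf : Differentiable ℝ f) (c : E d) (r : ℝ) (v : E d) :
    dd v (fun ζ => f (c + r • ζ)) = fun ζ => (r : ℂ) * dd v f (c + r • ζ) := by
  have := dd_comp_linear hf (r • ContinuousLinearMap.id ℝ (E d)) c v
  simp only [_root_.smul_apply, ContinuousLinearMap.id_apply, dd_smul_dir] at this
  exact this

theorem contDiff_comp_affine {f : E d → ℂ} (hf : ContDiff ℝ ∞ f) (c : E d) (r : ℝ) :
    ContDiff ℝ ∞ (fun ζ : E d => f (c + r • ζ)) :=
  hf.comp (contDiff_const.add (contDiff_id.const_smul r))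

/-- Each ζ-derivative brings a factor `rad θ` and a gain of one in the second order at η = θ + `rad
θ` ζ. On the domain |η| ≥ `rad θ`²/16, hence `rad θ` ≤ 4 `lam η`, and the two balance. -/
theorem SMem.fsys_mem {m n : ℝ} {b : E d × E d → ℂ} (hb : SMem m n b) (k : ℕ) :
    (fsys d).Mem k (m, n) (fun p ζ => b (p.1, p.2 + rad p.2 • ζ)) := by
  refine WSys.mem_of_coind (fun μ f => μ = (m, n) ∧ ∃ (j : ℕ) (b : E d × E d → ℂ),
    SMem m (n - j) b ∧ f = fun p ζ => (rad p.2 : ℂ) ^ j * b (p.1, p.2 + rad p.2 • ζ)) ?_ ?_ k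
    ⟨rfl, 0, b, by simpa using hb, by simp⟩
  · rintro μ f ⟨rfl, j, b, hb, rfl⟩
    have hbs : ∀ x, ContDiff ℝ ∞ (fun η => b (x, η)) := fun x =>
      hb.smooth.comp (contDiff_const.prodMk contDiff_id)
    refine ⟨fun p => contDiff_const.mul (contDiff_comp_affine (hbs _) _ _), ?_⟩
    obtain ⟨C, h0, hC⟩ := hb.bound
    refine ⟨C * 4 ^ j, fun p ζ hζ => ?_⟩
    rw [fsys_w, norm_mul, norm_pow, Complex.norm_real, Real.norm_of_nonneg (rad_pos _).le]
    have hζ' : rad p.2 ^ 2 / 16 ≤ ‖p.2 + rad p.2 • ζ‖ := hζ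
    have h1 := hC (p.1, p.2 + rad p.2 • ζ)
    dsimp only at h1 ⊢
    set η := p.2 + rad p.2 • ζ
    have h2 : rad p.2 ≤ 4 * lam η := by
      have h3 := le_lam_sq η
      have h4 := lam_pos η
      have h5 := rad_pos p.2
      nlinarith
    have h6 : lam η ^ n = lam η ^ (n - j) * lam η ^ j := by
      rw [← Real.rpow_natCast, ← Real.rpow_add (lam_pos η)]
      congr 1; ring
    have h7 : 0 ≤ lam η ^ (n - j) := (Real.rpow_pos_of_pos (lam_pos η) _).le
    calc rad p.2 ^ j * ‖b (p.1, η)‖ ≤ (4 * lam η) ^ j *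
          (C * ((1 + ‖η‖) ^ m * lam η ^ (n - j))) := by
          have := rad_pos p.2
          have := lam_pos η
          gcongr
      _ = _ := by rw [h6, mul_pow]; ring
  · rintro μ f ⟨rfl, j, b, hb, rfl⟩ i
    refine ⟨by simp [fsys], j + 1, _, (hb.dxi i).cast_order ?_, ?_⟩
    · push_cast; ring
    · ext p ζ
      have hbs : Differentiable ℝ (fun η => b (p.1, η)) :=
        (hb.smooth.comp (contDiff_const.prodMk contDiff_id)).differentiable (by simp)
      change dd (stdVec i) _ ζ = _
      rw [dd_const_mul (by
        exact (contDiff_comp_affine (hb.smooth.comp (contDiff_const.prodMk contDiff_id)) _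
          _).differentiable (by simp)), dd_comp_affine hbs,
        dd_prod_right (hb.smooth.differentiable (by simp))]
      ring

/-- A cutoff that vanishes near the origin. -/
def farCut (d : ℕ) : E d → ℂ := fun η =>
  ((1 - (⟨1 / 12, 1 / 8, by norm_num, by norm_num⟩ : ContDiffBump (0 : E d)) η : ℝ) : ℂ)

theorem farCut_cb : Cb (farCut d) := by
  refine Cb.ofReal ((Cb.const (1 : ℝ)).sub (Cb.of_compact ?_ ?_))
  · exact ContDiffBump.contDiff _
  · exact ContDiffBump.hasCompactSupport _

theorem farCut_eq_zero {η : E d} (h : ‖η‖ ≤ 1 / 12) : farCut d η = 0 := by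
  rw [farCut, ContDiffBump.one_of_mem_closedBall _ (by simpa using h)]
  simp

theorem farCut_eq_one {η : E d} (h : 1 / 8 ≤ ‖η‖) : farCut d η = 1 := by
  rw [farCut, ContDiffBump.zero_of_le_dist _ (by simpa using h)]
  simp

/-- Each ζ-derivative brings a factor 1/`rad θ` ≤ 1, so nothing is lost. -/
theorem fsys_cut {h : E d → ℂ} (hh : Cb h) (k : ℕ) : (fsys d).Mem k 0 (fun p ζ =>
    h ((rad p.2 ^ 2)⁻¹ • p.2 + (rad p.2)⁻¹ • ζ)) := by
  refine WSys.mem_of_coind (fun μ f => μ = 0 ∧ ∃ (j : ℕ) (h : E d → ℂ), Cb h ∧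
    f = fun p ζ => ((rad p.2)⁻¹ : ℂ) ^ j * h ((rad p.2 ^ 2)⁻¹ • p.2 + (rad p.2)⁻¹ • ζ)) ?_ ?_ k
    ⟨rfl, 0, h, hh, by simp⟩
  · rintro μ f ⟨rfl, j, h, hh, rfl⟩
    refine ⟨fun p => contDiff_const.mul (contDiff_comp_affine hh.smooth _ _), ?_⟩
    obtain ⟨C, h0, hC⟩ := hh.bound
    refine ⟨C, fun p ζ _ => ?_⟩
    rw [WSys.w_zero, mul_one, norm_mul, norm_pow, norm_inv, Complex.norm_real,
      Real.norm_of_nonneg (rad_pos _).le]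
    have h1 : ((rad p.2)⁻¹) ^ j ≤ 1 := pow_le_one₀ (by have := rad_pos p.2; positivity)
      (inv_le_one_of_one_le₀ (one_le_rad _))
    calc _ ≤ 1 * C := mul_le_mul h1 (hC _) (norm_nonneg _) zero_le_one
      _ = C := one_mul C
  · rintro μ f ⟨rfl, j, h, hh, rfl⟩ i
    refine ⟨by simp [fsys], j + 1, _, hh.dd (stdVec i), ?_⟩
    ext p ζ
    change dd (stdVec i) _ ζ = _
    rw [dd_const_mul (by exact (contDiff_comp_affine hh.smooth _ _).differentiable (by simp)),
      dd_comp_affine (hh.smooth.differentiable (by simp))]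
    push_cast
    ring

/-- The symbol at the scale `rad`, cut off near the origin and normalised. -/
def farSymb (m n : ℝ) (b : E d × E d → ℂ) (p : E d × E d) (ζ : E d) : ℂ :=
  (((1 + ‖p.2‖) ^ m * lam p.2 ^ n : ℝ) : ℂ)⁻¹ * (b (p.1, p.2 + rad p.2 • ζ) *
    farCut d ((rad p.2 ^ 2)⁻¹ • (p.2 + rad p.2 • ζ)))

/-- By `weight_comparable`, dividing by the weight at θ leaves polynomial growth in ζ that is
uniform in θ, which is the hypothesis of `oscillatory_bound`. -/
theorem farSymb_mem {m n : ℝ} {b : E d × E d → ℂ} (hb : SMem m n b) (k : ℕ) :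
    (osys (E d × E d) d).Mem k (2 * (|m| + |n|), 0) (farSymb m n b) := by
  have e : ∀ (p : E d × E d) (ζ : E d), (rad p.2 ^ 2)⁻¹ • (p.2 + rad p.2 • ζ) =
      (rad p.2 ^ 2)⁻¹ • p.2 + (rad p.2)⁻¹ • ζ := by
    intro p ζ
    have := (rad_pos p.2).ne'
    rw [smul_add, smul_smul]
    congr 2
    field_simp
  have h1 : (fsys d).Mem k (m, n) (fun p ζ => b (p.1, p.2 + rad p.2 • ζ) *
      farCut d ((rad p.2 ^ 2)⁻¹ • (p.2 + rad p.2 • ζ))) :=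
    ((hb.fsys_mem k).mul (fsys_cut farCut_cb k)).cast (by simp) fun p ζ => by rw [e]
  refine WSys.Mem.transfer (S := fsys d) (S' := osys (E d × E d) d) (ν := (2 * (|m| + |n|), 0)) (fun _ => rfl)
    (fun _ => rfl) (fun i => ⟨i, rfl⟩) (fun p => (((1 + ‖p.2‖) ^ m * lam p.2 ^ n : ℝ) : ℂ)⁻¹)
    (3 ^ (|m| + |n|)) ?_ h1 ?_
  · intro p ζ _ _
    have hpos : 0 < (1 + ‖p.2‖) ^ m * lam p.2 ^ n :=
      mul_pos (Real.rpow_pos_of_pos (by positivity) _) (Real.rpow_pos_of_pos (lam_pos _) _)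
    rw [osys_w, fsys_w, norm_inv, Complex.norm_real, Real.norm_of_nonneg hpos.le,
      inv_mul_le_iff₀ hpos]
    refine (weight_comparable p.2 ζ m n).trans (le_of_eq ?_)
    ring
  · intro p ζ hζ
    have h2 : ‖p.2 + rad p.2 • ζ‖ < rad p.2 ^ 2 / 12 := by
      have h3 : ‖p.2 + rad p.2 • ζ‖ < rad p.2 ^ 2 / 16 := not_le.1 hζ
      have := rad_pos p.2
      nlinarith
    have h4 : Continuous fun ζ : E d => ‖p.2 + rad p.2 • ζ‖ := by fun_prop
    filter_upwards [h4.continuousAt.eventually_lt continuousAt_const h2] with y hy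
    rw [farCut_eq_zero, mul_zero]
    have := rad_pos p.2
    rw [norm_smul, norm_inv, norm_pow, Real.norm_of_nonneg this.le, inv_mul_le_iff₀ (by positivity)]
    linarith

/-- Phase corrections that vanish to second order at `w = 0`. -/
structure UPhase (ρ : ℝ) (g : E d × E d → E d) : Prop where
  rho_nonneg : 0 ≤ ρ
  cb : Cb g
  supp : ∀ x w, ρ < ‖w‖ → g (x, w) = 0
  zero : ∀ x, g (x, 0) = 0
  dzero : ∀ x v, fderiv ℝ g (x, 0) (0, v) = 0
  half : ∀ p v, ‖fderiv ℝ g p (0, v)‖ ≤ 1 / 2 * ‖v‖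

/-- Amplitudes that vanish to order `s` at `w = 0`. -/
structure UAmpl (ρ s : ℝ) (ψ : E d × E d → ℂ) : Prop where
  cb : Cb ψ
  supp : SuppIn ρ ψ
  van : VMem s ψ

theorem Cb.coord {P : Type} [NormedAddCommGroup P] [NormedSpace ℝ P] {g : P → E d} (hg : Cb g)
    (j : Fin (d + 1)) : Cb (fun q => ((g q j : ℝ) : ℂ)) :=
  (hg.clm (EuclideanSpace.proj j : E d →L[ℝ] ℝ)).ofReal

theorem dd_coord_comp {P : Type} [NormedAddCommGroup P] [NormedSpace ℝ P] {g : P → E d}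
    (hg : Differentiable ℝ g) (j : Fin (d + 1)) (v : P) :
    dd v (fun q => ((g q j : ℝ) : ℂ)) = fun q => ((fderiv ℝ g q v j : ℝ) : ℂ) := by
  ext q
  have h : HasFDerivAt (fun q => ((g q j : ℝ) : ℂ))
      ((Complex.ofRealCLM.comp (EuclideanSpace.proj j : E d →L[ℝ] ℝ)).comp (fderiv ℝ g q)) q :=
    (ContinuousLinearMap.hasFDerivAt
      (Complex.ofRealCLM.comp (EuclideanSpace.proj j : E d →L[ℝ] ℝ))).comp q (hg q).hasFDerivAt
  simp [dd, h.fderiv]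

variable {ρ s : ℝ} {ψ : E d × E d → ℂ} {g : E d × E d → E d}

theorem UPhase.coord (hg : UPhase ρ g) (j : Fin (d + 1)) :
    UAmpl ρ 2 (fun q => ((g q j : ℝ) : ℂ)) := by
  have h1 : Cb (fun q => ((g q j : ℝ) : ℂ)) := hg.cb.coord j
  have h2 : SuppIn ρ (fun q => ((g q j : ℝ) : ℂ)) :=
    ⟨h1.smooth, fun x w hw => by simp [hg.supp x w hw]⟩
  refine ⟨h1, h2, h1.vmem hg.rho_nonneg h2 (Or.inr (Or.inr ⟨rfl, fun x => ?_, fun x v => ?_⟩))⟩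
  · simp [hg.zero]
  · rw [dd_coord_comp (hg.cb.smooth.differentiable (by simp))]
    simp [hg.dzero]

/-- Functions that vanish to order `s`, at the scale `rad`. -/
theorem VMem.rescale {f : E d × E d → ℂ} (hf : VMem s f) (k : ℕ) :
    ∃ r, (osys (E d × E d) d).Mem k (r, 0)
      (fun p v => ((rad p.2 ^ s : ℝ) : ℂ) * f (p.1, (rad p.2)⁻¹ • v)) := by
  refine ⟨s, ?_⟩
  -- A derivative in v brings 1/`rad θ` and lowers the order of vanishing by one, so the exponent t
  -- of the prefactor follows the order of vanishing and only decreases.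
  refine WSys.mem_of_coind (fun μ F => μ = (s, 0) ∧ ∃ (t : ℝ) (f : E d × E d → ℂ), t ≤ s ∧
    VMem t f ∧ F = fun p v => ((rad p.2 ^ t : ℝ) : ℂ) * f (p.1, 0 + (rad p.2)⁻¹ • v)) ?_ ?_ k
    ⟨rfl, s, f, le_rfl, hf, by simp⟩
  · rintro μ F ⟨rfl, t, f, ht, hf, rfl⟩
    refine ⟨fun p => contDiff_const.mul (contDiff_comp_affine
      (((hf 0).smooth ⟨1, le_rfl⟩).comp (contDiff_const.prodMk contDiff_id)) _ _), ?_⟩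
    obtain ⟨C, h0, hC⟩ := (hf 0).dom.bound
    refine ⟨C, fun p v _ => ?_⟩
    have h1 := hC ⟨rad p.2, one_le_rad _⟩ (p.1, 0 + (rad p.2)⁻¹ • v) trivial
    have hR := rad_pos p.2
    rw [vsys_w] at h1
    dsimp only at h1
    rw [zero_add, norm_smul, norm_inv, Real.norm_of_nonneg hR.le,
      show (rad p.2)⁻¹ + (rad p.2)⁻¹ * ‖v‖ = (rad p.2)⁻¹ * (1 + ‖v‖) by ring,
      Real.mul_rpow (by positivity) (by positivity), Real.inv_rpow hR.le] at h1
    have hp := Real.rpow_pos_of_pos hR t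
    rw [osys_w, norm_mul, Complex.norm_real, Real.norm_of_nonneg hp.le, zero_add]
    calc _ ≤ rad p.2 ^ t * (C * ((rad p.2 ^ t)⁻¹ * (1 + ‖v‖) ^ t)) := by gcongr
      _ = C * (1 + ‖v‖) ^ t := by field_simp
      _ ≤ C * (1 + ‖v‖) ^ s := by
        gcongr
        linarith [norm_nonneg v]
  · rintro μ F ⟨rfl, t, f, ht, hf, rfl⟩ i
    refine ⟨by simp [osys], t - 1, _, by linarith, hf.dw i, ?_⟩
    have hs := (hf 0).smooth ⟨1, le_rfl⟩
    ext p v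
    change dd (stdVec i) _ v = _
    have h2 : ContDiff ℝ ∞ (fun w => f (p.1, w)) := hs.comp (contDiff_const.prodMk contDiff_id)
    rw [dd_const_mul (by exact (contDiff_comp_affine h2 _ _).differentiable (by simp)),
      dd_comp_affine (f := fun w => f (p.1, w)) (h2.differentiable (by simp)),
      dd_prod_right (hs.differentiable (by simp)), Real.rpow_sub_one (rad_pos _).ne']
    push_cast
    ring

/-- The exponential of a phase whose derivatives have quadratic growth. -/
theorem osys_ee {Q : Type} {Φ : Q → E d → ℝ}
    (hΦ : ∀ k, ∃ r, (osys Q d).Mem k (r, 0) (fun q v => (Φ q v : ℂ))) (hs : ∀ q, ContDiff ℝ ∞ (Φ q))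
    (k : ℕ) : ∃ r, (osys Q d).Mem k (r, 0) (fun q v => ee (Φ q v)) := by
  induction k with
  | zero => exact ⟨0, fun q => contDiff_ee.comp (hs q), 1, fun q v _ => by simp [norm_ee, osys_w]⟩
  | succ k ih =>
    -- Each derivative multiplies the exponential by a derivative of the phase, so the growth
    -- exponent increases with the number of derivatives. This is why it is quantified after k.
    obtain ⟨r, hr⟩ := ih
    obtain ⟨t, ht⟩ := hΦ (k + 1)
    refine ⟨max (t + r) 0, fun q => contDiff_ee.comp (hs q), ⟨1, fun q v _ => ?_⟩, fun i => ?_⟩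
    · rw [norm_ee, osys_w, one_mul]
      exact Real.one_le_rpow (by linarith [norm_nonneg v]) (le_max_right _ _)
    · have h1 := (((ht.deriv i).mul hr).const_mul (2 * Real.pi * Complex.I))
      have h2 : (osys Q d).Mem k (t + r, 0) (fun q => dd (stdVec i) (fun v => ee (Φ q v))) := by
        refine h1.cast (by simp [osys]) fun q v => ?_
        have hd := (hs q).differentiable (by simp)
        rw [dd_ee hd]
        have h3 : HasFDerivAt (fun v => (Φ q v : ℂ)) (Complex.ofRealCLM.comp (fderiv ℝ (Φ q) v)) v :=
          Complex.ofRealCLM.hasFDerivAt.comp v (hd v).hasFDerivAt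
        change _ = 2 * Real.pi * Complex.I * (dd (stdVec i) (fun v => (Φ q v : ℂ)) v * _)
        simp [dd, h3.fderiv]
        ring
      exact (osys_weaken h2 (le_max_left _ 0)).cast (by simp [osys]) fun _ _ => rfl

/-- With R = `rad θ` the phase g(x,v/R)·θ is the sum of (R² g_j(x,v/R))(θ_j/R²). The first factors
are controlled because g vanishes to order 2, the second are bounded by 1. -/
theorem resAmp_mem (hψ : VMem s ψ) (hg : UPhase ρ g) (k : ℕ) :
    ∃ r, (osys (E d × E d) d).Mem k (r, 0)
      (fun p v => ((rad p.2 ^ s : ℝ) : ℂ) * resAmp ψ g p v) := by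
  obtain ⟨r, hr⟩ := hψ.rescale k
  have h1 : ∀ k, ∃ r, (osys (E d × E d) d).Mem k (r, 0)
      (fun p v => ((inner ℝ (g (p.1, (rad p.2)⁻¹ • v)) p.2 : ℝ) : ℂ)) := by
    intro k
    choose r hr using fun j => (hg.coord j).van.rescale k
    obtain ⟨M, hM⟩ := Finite.exists_le r
    refine ⟨M, (WSys.Mem.sum Finset.univ fun j _ => ((WSys.mem_param (c := fun p : E d × E d =>
      ((rad p.2 ^ (2 : ℝ) : ℝ) : ℂ)⁻¹ * ((p.2 j : ℝ) : ℂ)) (μ := 0) k ⟨1, fun p v _ => ?_⟩).mul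
      (osys_weaken (hr j) (hM j))).cast (ν := (M, 0)) (by simp) fun _ _ => rfl).cast rfl
      fun p v => ?_⟩
    · rw [WSys.w_zero, norm_mul, norm_inv, Complex.norm_real, Complex.norm_real,
        Real.norm_of_nonneg (by have := rad_pos p.2; positivity), Real.rpow_two, rad_sq,
        inv_mul_le_iff₀ (by positivity)]
      have : ‖p.2 j‖ ≤ ‖p.2‖ := PiLp.norm_apply_le p.2 j
      linarith
    · have hR : ((rad p.2 ^ (2 : ℝ) : ℝ) : ℂ) ≠ 0 :=
        Complex.ofReal_ne_zero.2 (Real.rpow_pos_of_pos (rad_pos p.2) _).ne'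
      rw [PiLp.inner_apply, Complex.ofReal_sum]
      refine Finset.sum_congr rfl fun j _ => ?_
      rw [RCLike.inner_apply, Complex.ofReal_mul]
      simp only [conj_trivial]
      field_simp
  obtain ⟨t, ht⟩ := osys_ee h1 (fun p => ((hg.cb.smooth.comp (contDiff_const.prodMk
    (contDiff_id.const_smul _))).inner ℝ contDiff_const)) k
  exact ⟨r + t, (hr.mul ht).cast (by simp) fun p v => by simp [resAmp]; ring⟩

/-- After division by the weight at θ and multiplication by R^s, R = `rad θ`, the rescaled integral
falls under `oscillatory_bound`. Undoing the normalisation leaves R^{-s} = (1 + |θ|)^{-s/2}. -/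
theorem far_bound (hψ : UAmpl ρ s ψ) (hg : UPhase ρ g) {m n : ℝ} {b : E d × E d → ℂ}
    (hb : SMem m n b) : ∃ C : ℝ, ∀ p : E d × E d,
      ‖∫ η, (b (p.1, η) * farCut d ((rad p.2 ^ 2)⁻¹ • η)) * uKer ψ g p η‖ ≤
        C * ((1 + ‖p.2‖) ^ (m - s / 2) * lam p.2 ^ n) := by
  have hc : ∀ p : E d × E d, HasCompactSupport
      (fun v => ((rad p.2 ^ s : ℝ) : ℂ) * resAmp ψ g p v) := by
    intro p
    have h1 : Cc (fun w => ψ (p.1, w)) := hψ.supp.cc p.1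
    have h2 : HasCompactSupport (fun v : E d => ψ (p.1, (rad p.2)⁻¹ • v)) :=
      h1.supp.comp_smul (inv_ne_zero (rad_pos p.2).ne')
    exact (h2.mul_right (f' := fun v => ee (inner ℝ (g (p.1, (rad p.2)⁻¹ • v)) p.2))).mul_left
  obtain ⟨C, hC⟩ := oscillatory_bound hc (resAmp_mem hψ.van hg) (farSymb_mem hb)
  refine ⟨C, fun p => ?_⟩
  have hpos : 0 < (1 + ‖p.2‖) ^ m * lam p.2 ^ n :=
    mul_pos (Real.rpow_pos_of_pos (by positivity) _) (Real.rpow_pos_of_pos (lam_pos _) _)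
  have hRs := Real.rpow_pos_of_pos (rad_pos p.2) s
  rw [integral_uKer_rescale ψ g (fun η => b (p.1, η) * farCut d ((rad p.2 ^ 2)⁻¹ • η))]
  have e : ∀ ζ, (b (p.1, p.2 + rad p.2 • ζ) * farCut d ((rad p.2 ^ 2)⁻¹ •
      (p.2 + rad p.2 • ζ))) * ft (resAmp ψ g p) ζ =
      (((1 + ‖p.2‖) ^ m * lam p.2 ^ n * (rad p.2 ^ s)⁻¹ : ℝ) : ℂ) * (farSymb m n b p ζ *
        ft (fun v => ((rad p.2 ^ s : ℝ) : ℂ) * resAmp ψ g p v) ζ) := by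
    intro ζ
    have h1 := Complex.ofReal_ne_zero.2 hpos.ne'
    have h2 := Complex.ofReal_ne_zero.2 hRs.ne'
    rw [ft_const_mul, farSymb, Complex.ofReal_mul _ (_⁻¹), Complex.ofReal_inv]
    field_simp
  simp only [e]
  rw [integral_const_mul, norm_mul, Complex.norm_real, Real.norm_of_nonneg (by positivity)]
  calc _ ≤ ((1 + ‖p.2‖) ^ m * lam p.2 ^ n * (rad p.2 ^ s)⁻¹) * C := by
        gcongr
        exact hC p
    _ = _ := by
        rw [rad_rpow, Real.rpow_sub (by positivity)]
        ring

end far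

/-! ### Size of `opU`: the region where |η| is small compared to |θ| -/

section near
variable {d : ℕ} {ρ s : ℝ} {ψ : E d × E d → ℂ} {g : E d × E d → E d}

theorem integral_dd_eq_zero {h : E d → ℂ} (hh : Cc h) (v : E d) : ∫ w, dd v h w = 0 := by
  have := ft_dd hh v 0
  simpa [ft, ee_zero] using this

/-- The points where the phase of the kernel of `opU` has no critical point. -/
def NearPt (d : ℕ) : Type := {q : (E d × E d) × E d // 1 ≤ ‖q.1.2‖ ∧ ‖q.2‖ ≤ ‖q.1.2‖ / 4}

/-- Functions of `w` with parameters in `NearPt`, with weights the powers of `|θ|`. -/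
def nsys (d : ℕ) : WSys (NearPt d) (E d) where
  ι := Fin (d + 1)
  dir := stdVec
  shift _ := 0
  dom _ := Set.univ
  a q _ := ‖q.1.1.2‖
  b _ _ := 1
  a_pos q _ _ := one_pos.trans_le q.2.1
  b_pos _ _ _ := one_pos

theorem nsys_w (μ : ℝ × ℝ) (q : NearPt d) (w : E d) : (nsys d).w μ q w = ‖q.1.1.2‖ ^ μ.1 := by
  simp [WSys.w, nsys]

theorem nsys_cb {f : E d × E d → ℂ} (hf : Cb f) (k : ℕ) :
    (nsys d).Mem k 0 (fun q w => f (q.1.1.1, w)) := by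
  refine WSys.mem_of_coind (fun μ F => μ = 0 ∧ ∃ f : E d × E d → ℂ, Cb f ∧
    F = fun (q : NearPt d) w => f (q.1.1.1, w)) ?_ ?_ k ⟨rfl, f, hf, rfl⟩
  · rintro μ F ⟨rfl, f, hf, rfl⟩
    obtain ⟨C, h0, hC⟩ := hf.bound
    exact ⟨fun q => hf.smooth.comp (contDiff_const.prodMk contDiff_id), C, fun q w _ => by
      rw [WSys.w_zero, mul_one]; exact hC _⟩
  · rintro μ F ⟨rfl, f, hf, rfl⟩ i
    refine ⟨by simp [nsys], _, hf.dd (0, stdVec i), ?_⟩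
    ext1 q
    exact dd_prod_right (hf.smooth.differentiable (by simp)) _ _

/-- The phase of the kernel of `opU`. -/
def nPhase (g : E d × E d → E d) (q : (E d × E d) × E d) (w : E d) : ℝ :=
  -(inner ℝ w q.1.2) + inner ℝ (g (q.1.1, w)) q.1.2 + inner ℝ w q.2

/-- The gradient of `nPhase`. -/
def nGrad (g : E d × E d → E d) (j : Fin (d + 1)) (q : (E d × E d) × E d) (w : E d) : ℝ :=
  q.2 j - q.1.2 j + inner ℝ (fderiv ℝ g (q.1.1, w) (0, stdVec j)) q.1.2

theorem nPhase_contDiff (hg : ContDiff ℝ ∞ g) (q : (E d × E d) × E d) :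
    ContDiff ℝ ∞ (nPhase g q) :=
  ((contDiff_id.inner ℝ contDiff_const).neg.add
    ((hg.comp (contDiff_const.prodMk contDiff_id)).inner ℝ contDiff_const)).add
    (contDiff_id.inner ℝ contDiff_const)

theorem fderiv_nPhase (hg : ContDiff ℝ ∞ g) (q : (E d × E d) × E d) (w v : E d) :
    fderiv ℝ (nPhase g q) w v = inner ℝ v (q.2 - q.1.2) +
      inner ℝ (fderiv ℝ g (q.1.1, w) (0, v)) q.1.2 := by
  have h1 : HasFDerivAt (fun w => g (q.1.1, w)) ((fderiv ℝ g (q.1.1, w)).comp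
      (ContinuousLinearMap.inr ℝ (E d) (E d))) w :=
    ((hg.differentiable (by simp)) (q.1.1, w)).hasFDerivAt.comp w (hasFDerivAt_prodMk_right _ w)
  have h2 : HasFDerivAt (nPhase g q) _ w :=
    (((hasFDerivAt_id w).inner ℝ (hasFDerivAt_const q.1.2 w)).neg.add
      (h1.inner ℝ (hasFDerivAt_const q.1.2 w))).add
      ((hasFDerivAt_id w).inner ℝ (hasFDerivAt_const q.2 w))
  rw [h2.fderiv, inner_sub_right]
  simp
  ring

theorem nGrad_eq (hg : ContDiff ℝ ∞ g) (j : Fin (d + 1)) (q : (E d × E d) × E d) (w : E d) :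
    nGrad g j q w = fderiv ℝ (nPhase g q) w (stdVec j) := by
  rw [fderiv_nPhase hg, inner_stdVec, nGrad]
  simp

theorem nGrad_mem (hg : Cb g) (j : Fin (d + 1)) (k : ℕ) :
    (nsys d).Mem k (1, 0) (fun q w => (nGrad g j q.1 w : ℂ)) := by
  have hpar : ∀ c : NearPt d → ℂ, (∀ q, ‖c q‖ ≤ 2 * ‖q.1.1.2‖) →
      (nsys d).Mem k (1, 0) (fun q _ => c q) := fun c hc =>
    WSys.mem_param k ⟨2, fun q w _ => by rw [nsys_w, Real.rpow_one]; exact hc q⟩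
  have h1 := hpar (fun q => ((q.1.2 j - q.1.1.2 j : ℝ) : ℂ)) fun q => by
    rw [Complex.norm_real]
    have a1 : ‖q.1.2 j‖ ≤ ‖q.1.2‖ := PiLp.norm_apply_le _ j
    have a2 : ‖q.1.1.2 j‖ ≤ ‖q.1.1.2‖ := PiLp.norm_apply_le _ j
    have a3 := q.2.2
    have a4 := q.2.1
    refine (norm_sub_le _ _).trans ?_
    linarith
  have h2 : ∀ l, (nsys d).Mem k (1, 0) (fun q w =>
      ((fderiv ℝ g (q.1.1.1, w) (0, stdVec j) l : ℝ) : ℂ) * ((q.1.1.2 l : ℝ) : ℂ)) := fun l =>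
    ((nsys_cb (((hg.fderiv.clm_apply (Cb.const _)).coord l)) k).mul
      (hpar (fun q => ((q.1.1.2 l : ℝ) : ℂ)) fun q => by
        rw [Complex.norm_real]
        have a2 : ‖q.1.1.2 l‖ ≤ ‖q.1.1.2‖ := PiLp.norm_apply_le _ l
        linarith [norm_nonneg q.1.1.2])).cast (by simp) fun _ _ => rfl
  refine (h1.add (WSys.Mem.sum Finset.univ fun l _ => h2 l)).cast rfl fun q w => ?_
  rw [nGrad, PiLp.inner_apply, Complex.ofReal_add, Complex.ofReal_sum]
  congr 1
  refine Finset.sum_congr rfl fun l _ => ?_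
  rw [RCLike.inner_apply, Complex.ofReal_mul]
  simp [mul_comm]

/-- Test the gradient in the direction θ: it contributes -|θ|², and the other two terms are at most
|θ||η| ≤ |θ|²/4 and |θ|²/2, since |∂_w g| ≤ 1/2. So the gradient has length at least |θ|/4. -/
theorem nGrad_sq_ge (hg : UPhase ρ g) (q : NearPt d) (w : E d) :
    ‖q.1.1.2‖ ^ 2 / 16 ≤ ∑ j, nGrad g j q.1 w ^ 2 := by
  have hgs := hg.cb.smooth
  let a : E d := WithLp.toLp 2 fun j => nGrad g j q.1 w
  have ha : ∑ j, nGrad g j q.1 w ^ 2 = ‖a‖ ^ 2 := sum_sq_eq a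
  have hin : ∀ v, inner ℝ v a = fderiv ℝ (nPhase g q.1) w v := by
    intro v
    conv_rhs => rw [← sum_coord_smul v]
    rw [map_sum, PiLp.inner_apply]
    refine Finset.sum_congr rfl fun j _ => ?_
    rw [map_smul, ← nGrad_eq hgs]
    simp [a, mul_comm]
  have h1 := hin q.1.1.2
  rw [fderiv_nPhase hgs, inner_sub_right, real_inner_self_eq_norm_sq] at h1
  have h2 := hg.half (q.1.1.1, w) q.1.1.2
  have h3 := abs_real_inner_le_norm (fderiv ℝ g (q.1.1.1, w) (0, q.1.1.2)) q.1.1.2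
  have h4 := abs_real_inner_le_norm q.1.1.2 q.1.2
  have h5 := abs_real_inner_le_norm q.1.1.2 a
  have h6 := q.2.2
  have h7 := q.2.1
  rw [ha]
  have h8 : ‖q.1.1.2‖ ^ 2 / 4 ≤ ‖q.1.1.2‖ * ‖a‖ := by
    have := neg_abs_le (inner ℝ q.1.1.2 a)
    have := le_abs_self (inner ℝ q.1.1.2 q.1.2)
    have := le_abs_self (inner ℝ (fderiv ℝ g (q.1.1.1, w) (0, q.1.1.2)) q.1.1.2)
    have : ‖fderiv ℝ g (q.1.1.1, w) (0, q.1.1.2)‖ * ‖q.1.1.2‖ ≤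
      1 / 2 * ‖q.1.1.2‖ * ‖q.1.1.2‖ := by gcongr
    have : ‖q.1.1.2‖ * ‖q.1.2‖ ≤ ‖q.1.1.2‖ * (‖q.1.1.2‖ / 4) := by gcongr
    nlinarith
  have h9 : ‖q.1.1.2‖ / 4 ≤ ‖a‖ := by
    by_contra hc
    push Not at hc
    nlinarith
  nlinarith

/-- The inverse square of the length of the gradient of the phase. -/
def nInv (g : E d × E d → E d) (q : (E d × E d) × E d) (w : E d) : ℂ :=
  (∑ j, (nGrad g j q w : ℂ) * (nGrad g j q w : ℂ))⁻¹

theorem nSum_eq (q : (E d × E d) × E d) (w : E d) :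
    ∑ j, (nGrad g j q w : ℂ) * (nGrad g j q w : ℂ) = ((∑ j, nGrad g j q w ^ 2 : ℝ) : ℂ) := by
  rw [Complex.ofReal_sum]
  exact Finset.sum_congr rfl fun j _ => by push_cast; ring

theorem nSum_pos (hg : UPhase ρ g) (q : NearPt d) (w : E d) : 0 < ∑ j, nGrad g j q.1 w ^ 2 := by
  have := nGrad_sq_ge hg q w
  have := q.2.1
  nlinarith

theorem nSum_ne (hg : UPhase ρ g) (q : NearPt d) (w : E d) :
    ∑ j, (nGrad g j q.1 w : ℂ) * (nGrad g j q.1 w : ℂ) ≠ 0 := by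
  rw [nSum_eq]
  exact Complex.ofReal_ne_zero.2 (nSum_pos hg q w).ne'

theorem nInv_mem (hg : UPhase ρ g) (k : ℕ) :
    (nsys d).Mem k (-2, 0) (fun q w => nInv g q.1 w) := by
  have h1 : (nsys d).Mem k (2, 0)
      (fun q w => ∑ j, (nGrad g j q.1 w : ℂ) * (nGrad g j q.1 w : ℂ)) :=
    WSys.Mem.sum Finset.univ fun j _ => ((nGrad_mem hg.cb j k).mul (nGrad_mem hg.cb j k)).cast
      (by norm_num) fun _ _ => rfl
  refine (h1.inv (nSum_ne hg) (1 / 16) (by norm_num) fun q w _ => ?_).cast (by simp) fun _ _ => rfl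
  rw [nSum_eq, nsys_w, Complex.norm_real, Real.norm_of_nonneg (nSum_pos hg q w).le]
  have := nGrad_sq_ge hg q w
  simp only [Real.rpow_two]
  linarith

/-- Non-stationary phase. -/
theorem nonstationary (hg : UPhase ρ g) (M : ℕ) {r : ℝ} {f : NearPt d → E d → ℂ}
    (hf : ∀ k, (nsys d).Mem k (r, 0) f) (hs : ∀ q w, ρ < ‖w‖ → f q w = 0) :
    ∃ C : ℝ, ∀ q, ‖∫ w, f q w * ee (nPhase g q.1 w)‖ ≤ C * ‖q.1.1.2‖ ^ (r - M) := by
  have hgs := hg.cb.smooth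
  have hCc : ∀ {r : ℝ} {f : NearPt d → E d → ℂ}, (∀ k, (nsys d).Mem k (r, 0) f) →
      (∀ q w, ρ < ‖w‖ → f q w = 0) → ∀ q, Cc (f q) := fun hf hs q =>
    (SuppIn.mk (P := E d) (ρ := ρ) (G := fun p => _) (((hf 0).smooth q).comp contDiff_snd)
      (fun _ w hw => hs q w hw)).cc 0
  induction M generalizing r f with
  | zero =>
    obtain ⟨C, h0, hC⟩ := (hf 0).dom.bound
    refine ⟨∫ w : E d, (Metric.closedBall (0 : E d) ρ).indicator (fun _ => C) w, fun q => ?_⟩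
    rw [← integral_mul_const]
    refine norm_integral_le_of_norm_le ((integrable_indicator_ball ρ C).mul_const _)
      (Filter.Eventually.of_forall fun w => ?_)
    rw [norm_mul, norm_ee, mul_one]
    by_cases hw : w ∈ Metric.closedBall (0 : E d) ρ
    · rw [Set.indicator_of_mem hw]
      have := hC q w trivial
      rw [nsys_w] at this
      simpa using this
    · rw [Set.indicator_of_notMem hw, hs q w (by simpa using hw), norm_zero, zero_mul]
  | succ M ih =>
    -- The field h = f ∇Φ/|∇Φ|², with Φ the phase. The divergence of e^{2πiΦ} h integrates to zero
    -- and equals e^{2πiΦ}(div h + 2πi f), so f can be replaced by a multiple of div h, which is of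
    -- one order less in |θ|.
    let h : Fin (d + 1) → NearPt d → E d → ℂ := fun j q w =>
      f q w * ((nGrad g j q.1 w : ℂ) * nInv g q.1 w)
    have hh : ∀ j k, (nsys d).Mem k (r - 1, 0) (h j) := fun j k =>
      ((hf k).mul ((nGrad_mem hg.cb j k).mul (nInv_mem hg k))).cast (by ext <;> simp; ring)
        fun _ _ => rfl
    have hhs : ∀ j q w, ρ < ‖w‖ → h j q w = 0 := fun j q w hw => by simp [h, hs q w hw]
    have hdd : ∀ j k, (nsys d).Mem k (r - 1, 0) (fun q => dd (stdVec j) (h j q)) := fun j k =>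
      ((hh j (k + 1)).deriv j).cast (by simp [nsys]) fun _ _ => rfl
    have hdds : ∀ j q w, ρ < ‖w‖ → dd (stdVec j) (h j q) w = 0 := by
      intro j q w hw
      have h2 : h j q =ᶠ[nhds w] fun _ => 0 := by
        filter_upwards [(isOpen_lt continuous_const continuous_norm).mem_nhds hw] with y hy
        exact hhs j q y hy
      simp [dd, h2.fderiv_eq]
    obtain ⟨C, hC⟩ := ih (r := r - 1) (f := fun q w => -(2 * Real.pi * Complex.I)⁻¹ *
      ∑ j, dd (stdVec j) (h j q) w) (fun k => (WSys.Mem.sum _ fun j _ => hdd j k).const_mul _)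
      (fun q w hw => by rw [Finset.sum_eq_zero fun j _ => hdds j q w hw, mul_zero])
    refine ⟨C, fun q => ?_⟩
    have hph := nPhase_contDiff hgs q.1
    have hee : ContDiff ℝ ∞ (fun w => ee (nPhase g q.1 w)) := contDiff_ee.comp hph
    have hcc : ∀ j, Cc (fun w => ee (nPhase g q.1 w) * h j q w) := fun j =>
      (hCc (hh j) (hhs j) q).mul hee
    have e1 : ∀ w, ∑ j, dd (stdVec j) (fun w => ee (nPhase g q.1 w) * h j q w) w =
        (∑ j, dd (stdVec j) (h j q) w) * ee (nPhase g q.1 w) +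
          2 * Real.pi * Complex.I * (f q w * ee (nPhase g q.1 w)) := by
      intro w
      have e2 : ∀ j, dd (stdVec j) (fun w => ee (nPhase g q.1 w) * h j q w) w =
          dd (stdVec j) (h j q) w * ee (nPhase g q.1 w) + 2 * Real.pi * Complex.I * (f q w *
            ee (nPhase g q.1 w)) * (((nGrad g j q.1 w : ℂ) * (nGrad g j q.1 w : ℂ)) *
              nInv g q.1 w) := by
        intro j
        rw [dd_mul (hee.differentiable (by simp)) (((hh j 0).smooth q).differentiable (by simp)),
          dd_ee (hph.differentiable (by simp))]
        simp only [← nGrad_eq hgs, h]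
        ring
      simp only [e2]
      rw [Finset.sum_add_distrib, ← Finset.sum_mul, ← Finset.mul_sum, ← Finset.sum_mul, nInv,
        mul_inv_cancel₀ (nSum_ne hg q w), mul_one]
    have e3 : ∫ w, ∑ j, dd (stdVec j) (fun w => ee (nPhase g q.1 w) * h j q w) w = 0 := by
      rw [integral_finsetSum _ fun j _ => ((hcc j).dd _).integrable]
      exact Finset.sum_eq_zero fun j _ => integral_dd_eq_zero (hcc j) _
    have hpi : (2 * Real.pi * Complex.I : ℂ) ≠ 0 := by simp [Real.pi_ne_zero]
    have i1 : Integrable (fun w => (∑ j, dd (stdVec j) (h j q) w) * ee (nPhase g q.1 w)) := by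
      simp only [mul_comm _ (ee _)]
      exact ((Cc.sum _ fun j => (hCc (hh j) (hhs j) q).dd _).mul hee).integrable
    have i2 : Integrable (fun w => f q w * ee (nPhase g q.1 w)) := by
      simp only [mul_comm _ (ee _)]
      exact ((hCc hf hs q).mul hee).integrable
    simp only [e1] at e3
    rw [integral_add i1 (i2.const_mul _), integral_const_mul] at e3
    have e4 : ∫ w, f q w * ee (nPhase g q.1 w) = ∫ w, (-(2 * Real.pi * Complex.I)⁻¹ *
        ∑ j, dd (stdVec j) (h j q) w) * ee (nPhase g q.1 w) := by
      simp only [mul_assoc (-(2 * Real.pi * Complex.I : ℂ)⁻¹)]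
      rw [integral_const_mul]
      field_simp
      linear_combination e3
    rw [e4]
    refine (hC q).trans (le_of_eq ?_)
    congr 2
    push_cast
    ring

/-- The kernel of `opU` is rapidly decreasing where `|η|` is small compared to `|θ|`. -/
theorem uKer_near (hψ : UAmpl ρ s ψ) (hg : UPhase ρ g) (M : ℕ) : ∃ C : ℝ, 0 < C ∧
    ∀ (p : E d × E d) (η : E d), ‖η‖ ≤ (1 + ‖p.2‖) / 8 →
      ‖uKer ψ g p η‖ ≤ C * (1 + ‖p.2‖) ^ (-(M : ℝ)) := by
  have heq : ∀ p η, uKer ψ g p η = ∫ w, ψ (p.1, w) * ee (nPhase g (p, η) w) := by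
    intro p η
    unfold uKer ft uAmp nPhase
    congr 1
    ext w
    rw [ee_add _ (inner ℝ w η)]
    ring
  obtain ⟨C₁, hC₁⟩ := nonstationary hg M (r := 0) (f := fun q w => ψ (q.1.1.1, w))
    (nsys_cb hψ.cb) (fun q w hw => hψ.supp.supp _ w hw)
  obtain ⟨C₂, h0, hC₂⟩ := hψ.cb.bound
  let I : ℝ := ∫ w : E d, (Metric.closedBall (0 : E d) ρ).indicator (fun _ => C₂) w
  have hI : ∀ p η, ‖uKer ψ g p η‖ ≤ I := by
    intro p η
    rw [heq]
    refine norm_integral_le_of_norm_le (integrable_indicator_ball ρ C₂)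
      (Filter.Eventually.of_forall fun w => ?_)
    rw [norm_mul, norm_ee, mul_one]
    by_cases hw : w ∈ Metric.closedBall (0 : E d) ρ
    · rw [Set.indicator_of_mem hw]
      exact hC₂ _
    · rw [Set.indicator_of_notMem hw, hψ.supp.supp _ w (by simpa using hw), norm_zero]
  have hI0 : 0 ≤ I := (norm_nonneg _).trans (hI 0 0)
  refine ⟨2 ^ M * (|C₁| + I + 1), by positivity, fun p η hη => ?_⟩
  have hp : (0 : ℝ) < 1 + ‖p.2‖ := by positivity
  rw [Real.rpow_neg hp.le, Real.rpow_natCast, mul_assoc]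
  -- For |θ| ≥ 1 one has (1 + |θ|)/8 ≤ |θ|/4, as non-stationary phase requires. For |θ| < 1 the
  -- trivial bound of the kernel is enough.
  rcases le_or_gt 1 ‖p.2‖ with h1 | h1
  · have h2 := hC₁ ⟨(p, η), h1, by dsimp only; linarith⟩
    rw [heq]
    refine h2.trans ?_
    dsimp only
    rw [zero_sub, Real.rpow_neg (norm_nonneg _), Real.rpow_natCast]
    have h3 : (‖p.2‖ ^ M)⁻¹ ≤ 2 ^ M * ((1 + ‖p.2‖) ^ M)⁻¹ := by
      rw [← div_eq_mul_inv, le_div_iff₀ (by positivity), inv_mul_le_iff₀ (by positivity),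
        mul_comm, ← mul_pow]
      gcongr
      linarith
    calc C₁ * (‖p.2‖ ^ M)⁻¹ ≤ (|C₁| + I + 1) * (2 ^ M * ((1 + ‖p.2‖) ^ M)⁻¹) := by
          gcongr
          linarith [le_abs_self C₁]
      _ = _ := by ring
  · have h3 : 1 ≤ 2 ^ M * ((1 + ‖p.2‖) ^ M)⁻¹ := by
      rw [← div_eq_mul_inv, one_le_div (by positivity)]
      gcongr
      linarith
    calc _ ≤ I := hI p η
      _ ≤ (|C₁| + I + 1) * 1 := by linarith [abs_nonneg C₁]
      _ ≤ (|C₁| + I + 1) * (2 ^ M * ((1 + ‖p.2‖) ^ M)⁻¹) := by gcongr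
      _ = _ := by ring

/-- Every weight is bounded below by a negative power of 1 + |θ|, so rapid decrease is better than
any order. -/
theorem rpow_neg_le_weight (M : ℝ) (θ : E d) {m n : ℝ} (h : |m| + |n| ≤ M) :
    (1 + ‖θ‖) ^ (-M) ≤ 2 ^ |n| * ((1 + ‖θ‖) ^ m * lam θ ^ n) := by
  have h1 := weight_le θ (-m) (-n)
  have hp : (0 : ℝ) < 1 + ‖θ‖ := by positivity
  have ha := Real.rpow_pos_of_pos hp m
  have hb := Real.rpow_pos_of_pos (lam_pos θ) n
  rw [Real.rpow_neg hp.le, Real.rpow_neg (lam_pos θ).le, abs_neg, abs_neg, ← mul_inv,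
    inv_le_iff_one_le_mul₀ (by positivity)] at h1
  have h2 : (1 + ‖θ‖) ^ (-M) * (1 + ‖θ‖) ^ (|m| + |n|) ≤ 1 := by
    rw [← Real.rpow_add hp]
    exact Real.rpow_le_one_of_one_le_of_nonpos (by linarith [norm_nonneg θ]) (by linarith)
  have h3 := Real.rpow_pos_of_pos hp (-M)
  calc (1 + ‖θ‖) ^ (-M) ≤ (1 + ‖θ‖) ^ (-M) * (2 ^ |n| * (1 + ‖θ‖) ^ (|m| + |n|) *
        ((1 + ‖θ‖) ^ m * lam θ ^ n)) := le_mul_of_one_le_right h3.le h1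
    _ = ((1 + ‖θ‖) ^ (-M) * (1 + ‖θ‖) ^ (|m| + |n|)) *
        (2 ^ |n| * ((1 + ‖θ‖) ^ m * lam θ ^ n)) := by ring
    _ ≤ 1 * (2 ^ |n| * ((1 + ‖θ‖) ^ m * lam θ ^ n)) := by gcongr
    _ = _ := one_mul _

theorem near_bound (hψ : UAmpl ρ s ψ) (hg : UPhase ρ g) {m n : ℝ} {b : E d × E d → ℂ}
    (hb : SMem m n b) (m' n' : ℝ) : ∃ C : ℝ, ∀ p : E d × E d,
      ‖∫ η, (b (p.1, η) * (1 - farCut d ((rad p.2 ^ 2)⁻¹ • η))) * uKer ψ g p η‖ ≤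
        C * ((1 + ‖p.2‖) ^ m' * lam p.2 ^ n') := by
  obtain ⟨C₁, hCb0, hCb⟩ := hb.bound
  obtain ⟨Cf, hCf0, hCf⟩ := ((Cb.const (1 : ℂ)).sub (farCut_cb (d := d))).bound
  -- The decay of the kernel in θ has to pay for the growth of b, for the integrable factor (1 +
  -- |η|)^{-(d+2)} and for the prescribed weight. Powers of 1 + |η| convert into powers of 1 + |θ|
  -- because |η| ≤ (1 + |θ|)/8 where the integrand is not zero.
  obtain ⟨M, hM⟩ := exists_nat_gt (|m| + |n| + (d + 2) + (|m'| + |n'|))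
  obtain ⟨Ck, hCk0, hCk⟩ := uKer_near hψ hg M
  have hint := integrable_jap (d := d) (-(d + 2 : ℝ)) (by linarith)
  let J : ℝ := ∫ η : E d, (1 + ‖η‖) ^ (-(d + 2 : ℝ))
  let K : ℝ := 2 ^ (|m| + |n| + (d + 2))
  refine ⟨(C₁ * 2 ^ |n| * Cf * Ck) * K * J * 2 ^ |n'|, fun p => ?_⟩
  have hp : (0 : ℝ) < 1 + ‖p.2‖ := by positivity
  have key : ∀ η, ‖(b (p.1, η) * (1 - farCut d ((rad p.2 ^ 2)⁻¹ • η))) * uKer ψ g p η‖ ≤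
      (C₁ * 2 ^ |n| * Cf * Ck) * K * (1 + ‖p.2‖) ^ (-(|m'| + |n'|)) *
        (1 + ‖η‖) ^ (-(d + 2 : ℝ)) := by
    intro η
    have hη0 : (0 : ℝ) < 1 + ‖η‖ := by positivity
    by_cases hη : ‖η‖ ≤ (1 + ‖p.2‖) / 8
    · have h1 := (hCb (p.1, η)).trans (mul_le_mul_of_nonneg_left (weight_le η m n) hCb0.le)
      have h2 := hCf ((rad p.2 ^ 2)⁻¹ • η)
      have h3 := hCk p η hη
      rw [norm_mul, norm_mul]
      have h4 : (1 + ‖η‖) ^ (|m| + |n|) = (1 + ‖η‖) ^ (|m| + |n| + (d + 2)) *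
          (1 + ‖η‖) ^ (-(d + 2 : ℝ)) := by
        rw [← Real.rpow_add hη0]
        congr 1; ring
      have h5 : (1 + ‖η‖) ^ (|m| + |n| + (d + 2)) * (1 + ‖p.2‖) ^ (-(M : ℝ)) ≤
          K * (1 + ‖p.2‖) ^ (-(|m'| + |n'|)) := by
        calc _ ≤ (2 * (1 + ‖p.2‖)) ^ (|m| + |n| + (d + 2)) * (1 + ‖p.2‖) ^ (-(M : ℝ)) := by
              gcongr
              linarith [norm_nonneg p.2]
          _ = K * (1 + ‖p.2‖) ^ (|m| + |n| + (d + 2) + -(M : ℝ)) := by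
              rw [Real.mul_rpow (by norm_num) hp.le, Real.rpow_add hp _ (-(M : ℝ)), mul_assoc]
          _ ≤ _ := by
              gcongr
              · linarith [norm_nonneg p.2]
              · linarith
      calc _ ≤ (C₁ * (2 ^ |n| * (1 + ‖η‖) ^ (|m| + |n|))) * Cf *
            (Ck * (1 + ‖p.2‖) ^ (-(M : ℝ))) := by gcongr
        _ = (C₁ * 2 ^ |n| * Cf * Ck) * ((1 + ‖η‖) ^ (|m| + |n| + (d + 2)) *
            (1 + ‖p.2‖) ^ (-(M : ℝ))) * (1 + ‖η‖) ^ (-(d + 2 : ℝ)) := by rw [h4]; ring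
        _ ≤ (C₁ * 2 ^ |n| * Cf * Ck) * (K * (1 + ‖p.2‖) ^ (-(|m'| + |n'|))) *
            (1 + ‖η‖) ^ (-(d + 2 : ℝ)) := by gcongr
        _ = _ := by ring
    · have h1 : farCut d ((rad p.2 ^ 2)⁻¹ • η) = 1 := by
        apply farCut_eq_one
        rw [norm_smul, norm_inv, norm_pow, Real.norm_of_nonneg (rad_pos _).le, rad_sq,
          le_inv_mul_iff₀ hp]
        linarith
      rw [h1, sub_self, mul_zero, zero_mul, norm_zero]
      positivity
  calc _ ≤ ∫ η : E d, (C₁ * 2 ^ |n| * Cf * Ck) * K * (1 + ‖p.2‖) ^ (-(|m'| + |n'|)) *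
        (1 + ‖η‖) ^ (-(d + 2 : ℝ)) :=
        norm_integral_le_of_norm_le (hint.const_mul _) (Filter.Eventually.of_forall key)
    _ = (C₁ * 2 ^ |n| * Cf * Ck) * K * J * (1 + ‖p.2‖) ^ (-(|m'| + |n'|)) := by
        rw [integral_const_mul]; ring
    _ ≤ (C₁ * 2 ^ |n| * Cf * Ck) * K * J * (2 ^ |n'| * ((1 + ‖p.2‖) ^ m' * lam p.2 ^ n')) := by
        have hJ : 0 ≤ J := integral_nonneg fun η => by positivity
        exact mul_le_mul_of_nonneg_left (rpow_neg_le_weight _ p.2 le_rfl) (by positivity)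
    _ = _ := by ring

/-- The size of `opU`. -/
theorem opU_bound (hψ : UAmpl ρ s ψ) (hg : UPhase ρ g) {m n : ℝ} {b : E d × E d → ℂ}
    (hb : SMem m n b) : ∃ C : ℝ, ∀ p : E d × E d,
      ‖opU ψ g b p‖ ≤ C * ((1 + ‖p.2‖) ^ (m - s / 2) * lam p.2 ^ n) := by
  obtain ⟨C, hC⟩ := far_bound hψ hg hb
  obtain ⟨C', hC'⟩ := near_bound hψ hg hb (m - s / 2) n
  refine ⟨C + C', fun p => ?_⟩
  have hcont : Continuous fun η : E d => farCut d ((rad p.2 ^ 2)⁻¹ • η) :=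
    farCut_cb.smooth.continuous.comp (by fun_prop)
  have hcut : ∀ {c : E d → ℂ} {K : ℝ}, Continuous c → (∀ η, ‖c η‖ ≤ K) →
      PG (fun η => b (p.1, η) * c η) := by
    intro c K hc hK
    obtain ⟨h1, C, r, h2⟩ := hb.xgrowth.pg p.1
    refine ⟨h1.mul hc, C * K, r, fun η => ?_⟩
    rw [norm_mul]
    calc _ ≤ (C * (1 + ‖η‖) ^ r) * K := mul_le_mul (h2 η) (hK η) (norm_nonneg _)
          ((norm_nonneg _).trans (h2 η))
      _ = _ := by ring
  obtain ⟨K, -, hK⟩ := (farCut_cb (d := d)).bound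
  obtain ⟨K', -, hK'⟩ := ((Cb.const (1 : ℂ)).sub (farCut_cb (d := d))).bound
  have e : opU ψ g b p = (∫ η, (b (p.1, η) * farCut d ((rad p.2 ^ 2)⁻¹ • η)) * uKer ψ g p η) +
      ∫ η, (b (p.1, η) * (1 - farCut d ((rad p.2 ^ 2)⁻¹ • η))) * uKer ψ g p η := by
    rw [← integral_add (uKer_integrable hψ.supp hg.cb.smooth p (hcut hcont fun η => hK _))
      (uKer_integrable hψ.supp hg.cb.smooth p (hcut
        (c := fun η => 1 - farCut d ((rad p.2 ^ 2)⁻¹ • η)) (continuous_const.sub hcont)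
        fun η => hK' _))]
    unfold opU
    congr 1
    ext η
    ring
  rw [e, add_mul]
  exact (norm_add_le _ _).trans (add_le_add (hC p) (hC' p))

end near

/-! ### The operators `opU` act on the symbol classes -/

section main
variable {d : ℕ} {ρ s t : ℝ} {ψ χ : E d × E d → ℂ} {g : E d × E d → E d}

theorem UAmpl.mul (hψ : UAmpl ρ s ψ) (hχ : UAmpl ρ t χ) : UAmpl ρ (s + t) (fun p => ψ p * χ p) :=
  ⟨hψ.cb.mul hχ.cb, hχ.supp.mul hψ.cb.smooth, hψ.van.mul hχ.van⟩

theorem UAmpl.dx (hψ : UAmpl ρ s ψ) (i : Fin (d + 1)) : UAmpl ρ s (dd (stdVec i, 0) ψ) :=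
  ⟨hψ.cb.dd _, hψ.supp.dd _, hψ.van.dx i⟩

theorem UPhase.coord_dx (hg : UPhase ρ g) (i j : Fin (d + 1)) :
    UAmpl ρ 2 (fun q => ((fderiv ℝ g q (stdVec i, 0) j : ℝ) : ℂ)) := by
  have := (hg.coord j).dx i
  rwa [dd_coord_comp (hg.cb.smooth.differentiable (by simp))] at this

theorem opU_const_mul (c : ℂ) (b : E d × E d → ℂ) (p : E d × E d) :
    opU (fun q => c * ψ q) g b p = c * opU ψ g b p := by
  unfold opU uKer
  rw [← integral_const_mul]
  congr 1
  ext η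
  have : (fun w => uAmp (fun q => c * ψ q) g (p, w)) = fun w => c * uAmp ψ g (p, w) := by
    ext w; simp [uAmp, mul_assoc]
  rw [this, ft_const_mul]
  ring

theorem opU_zero_left (b : E d × E d → ℂ) (p : E d × E d) :
    opU (fun _ => 0) g b p = 0 := by
  simpa using opU_const_mul (ψ := fun _ => 0) (g := g) 0 b p

theorem opU_zero_right (p : E d × E d) : opU ψ g (fun _ => 0) p = 0 := by simp [opU]

theorem dd_zero_dir {P : Type} [NormedAddCommGroup P] [NormedSpace ℝ P] (f : P → ℂ) :
    dd 0 f = fun _ => 0 := by ext p; simp [dd]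

theorem opU_dx (hψ : SuppIn ρ ψ) (hg : ContDiff ℝ ∞ g) {b : E d × E d → ℂ} (hb : XGrowth b)
    (u : E d) (p : E d × E d) : dd (u, 0) (opU ψ g b) p =
      opU ψ g (dd (u, 0) b) p + opU (dd (u, 0) ψ) g b p +
      ∑ j, ((p.2 j : ℝ) : ℂ) * (2 * Real.pi * Complex.I *
        opU (fun q => ((fderiv ℝ g q (u, 0) j : ℝ) : ℂ) * ψ q) g b p) := by
  rw [(opU_contDiff hψ hg hb).2 u 0]
  simp only [inner_zero_right, neg_zero, add_zero, Complex.ofReal_zero, mul_zero, zero_mul,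
    opU_zero_left, mul_assoc (2 * (Real.pi : ℂ) * Complex.I), opU_const_mul]

/-- Differentiating the phase gives the factor 2πi(-w_j + g_j). The part -w_j is an integration by
parts in η and puts the derivative on b. -/
theorem opU_dxi (hψ : SuppIn ρ ψ) (hg : ContDiff ℝ ∞ g) {m n : ℝ} {b : E d × E d → ℂ}
    (hb : SMem m n b) (j : Fin (d + 1)) (p : E d × E d) : dd (0, stdVec j) (opU ψ g b) p =
      opU ψ g (dd (0, stdVec j) b) p +
        2 * Real.pi * Complex.I * opU (fun q => ((g q j : ℝ) : ℂ) * ψ q) g b p := by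
  rw [(opU_contDiff hψ hg hb.xgrowth).2 0 (stdVec j)]
  have e0 : ((0, 0) : E d × E d) = 0 := rfl
  have h1 := opU_inner_mul hψ hg hb.xgrowth (stdVec j) (hb.dxi j).xgrowth p
  have c1 : ContDiff ℝ ∞ fun q : E d × E d => (2 * Real.pi * Complex.I * (q.2 j : ℝ) : ℂ) :=
    contDiff_const.mul (contDiff_snd_coord j)
  have c2 : ContDiff ℝ ∞ fun q : E d × E d => (2 * Real.pi * Complex.I * (g q j : ℝ) : ℂ) :=
    contDiff_const.mul (contDiff_apply_coord hg j)
  have s1 : SuppIn ρ fun q : E d × E d => (-1 : ℂ) * (2 * Real.pi * Complex.I * (q.2 j : ℝ) * ψ q) :=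
    (hψ.mul c1).mul contDiff_const
  have s2 : SuppIn ρ fun q : E d × E d => (2 * Real.pi * Complex.I * (g q j : ℝ) * ψ q : ℂ) :=
    hψ.mul c2
  have h2 := opU_add s1 s2 hg hb.xgrowth p
  simp only [inner_stdVec_right] at h1 ⊢
  simp only [e0, dd_zero_dir, map_zero, opU_zero_right, opU_zero_left, PiLp.zero_apply,
    Complex.ofReal_zero, mul_zero, zero_mul, Finset.sum_const_zero, add_zero, zero_add]
  rw [opU_const_mul, h1] at h2
  have e : (fun q : E d × E d => (2 * Real.pi * Complex.I * ((-q.2 j + g q j : ℝ) : ℂ) * ψ q : ℂ)) =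
      fun q => (-1 : ℂ) * (2 * Real.pi * Complex.I * (q.2 j : ℝ) * ψ q) +
        2 * Real.pi * Complex.I * (g q j : ℝ) * ψ q := by
    ext q
    push_cast
    ring
  rw [e, h2]
  simp only [mul_assoc (2 * (Real.pi : ℂ) * Complex.I), opU_const_mul]
  ring

/-- The operators `opU` act on mixed symbols. -/
theorem opU_smem (hg : UPhase ρ g) (hψ : UAmpl ρ s ψ) {m n : ℝ} {b : E d × E d → ℂ}
    (hb : SMem m n b) : SMem (m - s / 2) n (opU ψ g b) := by
  intro k
  have hgs := hg.cb.smooth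
  have hsm : ∀ {s : ℝ} {ψ : E d × E d → ℂ} {m n : ℝ} {b : E d × E d → ℂ}, UAmpl ρ s ψ →
      SMem m n b → ContDiff ℝ ∞ (opU ψ g b) ∧ (ssys d).Dom (m - s / 2, n) (fun _ => opU ψ g b) := by
    intro s ψ m n b hψ hb
    obtain ⟨C, hC⟩ := opU_bound hψ hg hb
    exact ⟨(opU_contDiff hψ.supp hgs hb.xgrowth).1, C, fun _ p _ => hC p⟩
  induction k generalizing s ψ m n b with
  | zero => exact ⟨fun _ => (hsm hψ hb).1, (hsm hψ hb).2⟩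
  | succ k ih =>
    refine ⟨fun _ => (hsm hψ hb).1, (hsm hψ hb).2, fun i => ?_⟩
    rcases i with i | j
    -- The factor θ_j has order (1, 0), while the amplitude (∂_x g_j)ψ vanishes to order s + 2 and
    -- gains (-1, 0).
    · have h4 := fun j => (((ssys_coord k j).mul ((ih ((hg.coord_dx i j).mul hψ) hb).const_mul
        (2 * Real.pi * Complex.I))).cast (ν := (m - s / 2, n)) (by ext <;> simp; ring)
        fun _ _ => rfl)
      refine (((ih hψ (hb.dx i)).add (ih (hψ.dx i) hb)).add (WSys.Mem.sum Finset.univ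
        fun j _ => h4 j)).cast (by simp [ssys]) fun q p => ?_
      exact opU_dx hψ.supp hgs hb.xgrowth _ p
    -- The amplitude g_j ψ vanishes to order s + 2 and gains (-1, 0). This suffices for j = N
    -- directly and for j < N after `ssys_trade`.
    · have h2 := (ih ((hg.coord j).mul hψ) hb).const_mul (2 * Real.pi * Complex.I)
      have h2' := h2.cast (ν := (m - s / 2 - 1, n)) (by ext <;> simp; ring) fun _ _ => rfl
      by_cases hj : j = Fin.last d
      · subst hj
        refine (((ih hψ hb.dlast).cast (ν := (m - s / 2 - 1, n)) (by ext <;> simp; ring)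
          fun _ _ => rfl).add h2').cast (by simp [ssys]; ring) fun q p => ?_
        exact opU_dxi hψ.supp hgs hb _ p
      · refine ((ih hψ (hb.dxi j)).add (ssys_trade h2')).cast (by simp [ssys, hj]; ring)
          fun q p => ?_
        exact opU_dxi hψ.supp hgs hb _ p

end main

/-! ### Pairing `opU` with rapidly decreasing functions -/

section fubini
variable {d : ℕ} {ρ : ℝ} {ψ : E d × E d → ℂ} {g : E d × E d → E d}

/-- Continuous rapidly decreasing functions. -/
structure RD (H : E d → ℂ) : Prop where
  cont : Continuous H
  decay : ∀ L : ℕ, ∃ C : ℝ, ∀ θ, ‖H θ‖ ≤ C * (1 + ‖θ‖) ^ (-(2 * L : ℝ))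

theorem RD.integrable_mul {H : E d → ℂ} (hH : RD H) {β : E d → ℂ} (hβ : PG β) :
    Integrable (fun θ => β θ * H θ) := integrable_of_decay hβ hH.cont hH.decay

theorem PG.const (c : ℂ) : PG (fun _ : E d => c) := ⟨continuous_const, ‖c‖, 0, by simp⟩

theorem RD.integrable {H : E d → ℂ} (hH : RD H) : Integrable H := by
  simpa using hH.integrable_mul (PG.const 1)

theorem Cc.rd_ft {h : E d → ℂ} (hh : Cc h) : RD (ft h) :=
  ⟨(ft_contDiff hh).1.continuous, fun L => ⟨_, norm_ft_decay hh L⟩⟩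

/-- The coefficients in the derivatives in `w` of the amplitude of `opU`. -/
def uAmpCoeff (ψ : E d × E d → ℂ) (g : E d × E d → E d) (j l : Fin (d + 1)) (q : E d × E d) : ℂ :=
  2 * Real.pi * Complex.I *
    (((-(stdVec j : E d) + fderiv ℝ g q (0, stdVec j)) l : ℝ) : ℂ) * ψ q

theorem dd_uAmp_right (hψ : ContDiff ℝ ∞ ψ) (hg : ContDiff ℝ ∞ g) (j : Fin (d + 1))
    (p : E d × E d) (w : E d) : dd (stdVec j) (fun w => uAmp ψ g (p, w)) w =
      uAmp (dd (0, stdVec j) ψ) g (p, w) +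
        ∑ l, ((p.2 l : ℝ) : ℂ) * uAmp (uAmpCoeff ψ g j l) g (p, w) := by
  have hph : ContDiff ℝ ∞ (fun w => -(inner ℝ w p.2) + inner ℝ (g (p.1, w)) p.2) :=
    (contDiff_id.inner ℝ contDiff_const).neg.add
      ((hg.comp (contDiff_const.prodMk contDiff_id)).inner ℝ contDiff_const)
  have hfd : fderiv ℝ (fun w => -(inner ℝ w p.2) + inner ℝ (g (p.1, w)) p.2) w (stdVec j) =
      ∑ l, (-(stdVec j : E d) + fderiv ℝ g (p.1, w) (0, stdVec j)) l * p.2 l := by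
    have h4 : HasFDerivAt (fun w => g (p.1, w)) ((fderiv ℝ g (p.1, w)).comp
        (ContinuousLinearMap.inr ℝ (E d) (E d))) w :=
      ((hg.differentiable (by simp)) (p.1, w)).hasFDerivAt.comp w
        (hasFDerivAt_prodMk_right _ w)
    have h5 : HasFDerivAt (fun w => -(inner ℝ w p.2) + inner ℝ (g (p.1, w)) p.2) _ w :=
      ((hasFDerivAt_id w).inner ℝ (hasFDerivAt_const p.2 w)).neg.add
        (h4.inner ℝ (hasFDerivAt_const p.2 w))
    rw [h5.fderiv]
    simp only [PiLp.add_apply, PiLp.neg_apply, add_mul, Finset.sum_add_distrib, neg_mul,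
      Finset.sum_neg_distrib]
    simp [PiLp.inner_apply, mul_comm]
  have e : (fun w => uAmp ψ g (p, w)) = fun w => (fun w => ψ (p.1, w)) w *
      (fun w => ee (-(inner ℝ w p.2) + inner ℝ (g (p.1, w)) p.2)) w := rfl
  have hψ1 : ContDiff ℝ ∞ (fun w => ψ (p.1, w)) := hψ.comp (contDiff_const.prodMk contDiff_id)
  have hee : ContDiff ℝ ∞ (fun w => ee (-(inner ℝ w p.2) + inner ℝ (g (p.1, w)) p.2)) :=
    contDiff_ee.comp hph
  rw [e, dd_mul (hψ1.differentiable (by simp)) (hee.differentiable (by simp)),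
    dd_ee (hph.differentiable (by simp)), dd_prod_right (hψ.differentiable (by simp))]
  dsimp only
  rw [hfd]
  unfold uAmp
  congr 1
  rw [Complex.ofReal_sum, Finset.mul_sum, Finset.sum_mul, Finset.mul_sum]
  refine Finset.sum_congr rfl fun l _ => ?_
  simp only [uAmpCoeff]
  push_cast
  ring

/-- The derivatives in `w` of the amplitude of `opU` grow polynomially in `θ`. -/
theorem uAmp_mem (hg : Cb g) (k : ℕ) : ∀ {ψ : E d × E d → ℂ}, Cb ψ →
    (osys (E d × E d) d).Mem k (0, 0)
      (fun p w => (((1 + ‖p.2‖) ^ k : ℝ) : ℂ)⁻¹ * uAmp ψ g (p, w)) := by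
  have hsm : ∀ {ψ : E d × E d → ℂ}, Cb ψ → ∀ p, ContDiff ℝ ∞ (fun w => uAmp ψ g (p, w)) :=
    fun hψ p => ((hψ.smooth.comp (contDiff_fst.fst.prodMk contDiff_snd)).mul
      (contDiff_ee.comp (uPhase_contDiff hg.smooth))).comp (contDiff_const.prodMk contDiff_id)
  have hdom : ∀ (k : ℕ) {ψ : E d × E d → ℂ}, Cb ψ → (osys (E d × E d) d).Dom (0, 0)
      (fun p w => (((1 + ‖p.2‖) ^ k : ℝ) : ℂ)⁻¹ * uAmp ψ g (p, w)) := by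
    intro k ψ hψ
    obtain ⟨C, h0, hC⟩ := hψ.bound
    refine ⟨C, fun p w _ => ?_⟩
    rw [osys_w, Real.rpow_zero, norm_mul, uAmp, norm_mul, norm_ee, norm_inv, Complex.norm_real,
      Real.norm_of_nonneg (by positivity), mul_one, inv_mul_le_iff₀ (by positivity), mul_one]
    refine (hC _).trans (le_mul_of_one_le_left h0.le ?_)
    exact one_le_pow₀ (by linarith [norm_nonneg p.2])
  induction k with
  | zero => exact fun hψ => ⟨fun p => contDiff_const.mul (hsm hψ p), hdom 0 hψ⟩
  | succ k ih =>
    intro ψ hψ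
    refine ⟨fun p => contDiff_const.mul (hsm hψ p), hdom (k + 1) hψ, fun (j : Fin (d + 1)) => ?_⟩
    have hχ : ∀ l, Cb (uAmpCoeff ψ g j l) := fun l => ((Cb.const _).mul
      (((Cb.const _).add (hg.fderiv.clm_apply (Cb.const _))).coord l)).mul hψ
    have h1 : ∀ c : E d × E d → ℂ, (∀ p, ‖c p‖ ≤ 1 + ‖p.2‖) → (osys (E d × E d) d).Mem k (0, 0)
        (fun p _ => ((1 + ‖p.2‖ : ℝ) : ℂ)⁻¹ * c p) := fun c hc =>
      WSys.mem_param k ⟨1, fun p w _ => by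
        rw [osys_w, norm_mul, norm_inv, Complex.norm_real, Real.norm_of_nonneg (by positivity),
          Real.rpow_zero, inv_mul_le_iff₀ (by positivity)]
        simpa using hc p⟩
    have h2 := (h1 (fun _ => 1) (by simp)).mul (ih (hψ.dd (0, stdVec j)))
    have h3 := fun l => (h1 (fun p => ((p.2 l : ℝ) : ℂ)) fun p => by
      rw [Complex.norm_real]
      have : ‖p.2 l‖ ≤ ‖p.2‖ := PiLp.norm_apply_le _ l
      linarith).mul (ih (hχ l))
    refine (h2.add (WSys.Mem.sum Finset.univ fun l _ => h3 l)).cast (by simp [osys]) fun p w => ?_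
    change dd (stdVec j) (fun w => _ * uAmp ψ g (p, w)) w = _
    rw [dd_const_mul ((hsm hψ p).differentiable (by simp))]
    dsimp only
    rw [dd_uAmp_right hψ.smooth hg.smooth, mul_add, Finset.mul_sum]
    push_cast
    rw [pow_succ, mul_inv]
    congr 1
    · ring
    · exact Finset.sum_congr rfl fun l _ => by ring

/-- Decay in η is bought with w-derivatives of the amplitude, each of which costs at most one power
of 1 + |θ|. This crude bound, uniform in x, is what Fubini needs. -/
theorem uKer_growth (hψ : Cb ψ) (hs : SuppIn ρ ψ) (hg : Cb g) (L : ℕ) : ∃ C : ℝ, 0 ≤ C ∧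
    ∀ p η, ‖uKer ψ g p η‖ ≤ C * (1 + ‖p.2‖) ^ (2 * L) * (1 + ‖η‖) ^ (-(2 * L : ℝ)) := by
  let f : E d × E d → E d → ℂ := fun p w => (((1 + ‖p.2‖) ^ (2 * L) : ℝ) : ℂ)⁻¹ * uAmp ψ g (p, w)
  have hm : (osys (E d × E d) d).Mem (0 + 2 * L) (0, 0) f := by
    rw [zero_add]; exact uAmp_mem hg (2 * L) hψ
  obtain ⟨C, h0, hC⟩ := (osys_bessel_iterate L hm).dom.bound
  let I : ℝ := ∫ w : E d, (Metric.closedBall (0 : E d) ρ).indicator (fun _ => C) w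
  have hI : 0 ≤ I := integral_nonneg fun w => Set.indicator_nonneg (fun _ _ => h0.le) w
  refine ⟨2 ^ L * I, by positivity, fun p η => ?_⟩
  have hp : (0 : ℝ) < (1 + ‖p.2‖) ^ (2 * L) := by positivity
  have hS : SuppIn (P := E d) ρ (fun q => f p q.2) :=
    ⟨(hm.smooth p).comp contDiff_snd, fun _ w hw => by
      simp [f, (uAmp_suppIn hs hg.smooth).supp p w hw]⟩
  have h1 := norm_ft_decay (hS.cc 0) L η
  have h2 : ft (f p) η = (((1 + ‖p.2‖) ^ (2 * L) : ℝ) : ℂ)⁻¹ * uKer ψ g p η := ft_const_mul _ _ _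
  obtain ⟨G', hG', hGe⟩ := hS.bessel_iterate L
  have h3 : ∫ w, ‖bessel^[L] (f p) w‖ ≤ I := by
    refine integral_mono_of_nonneg (Filter.Eventually.of_forall fun _ => norm_nonneg _)
      (integrable_indicator_ball ρ C) (Filter.Eventually.of_forall fun w => ?_)
    by_cases hw : w ∈ Metric.closedBall (0 : E d) ρ
    · have := hC p w trivial
      rw [osys_w, Real.rpow_zero, mul_one] at this
      dsimp only
      rwa [Set.indicator_of_mem hw]
    · have := hGe 0 w
      rw [hG'.supp 0 w (by simpa using hw)] at this
      dsimp only
      rw [Set.indicator_of_notMem hw, this, norm_zero]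
  rw [h2, norm_mul, norm_inv, Complex.norm_real, Real.norm_of_nonneg hp.le,
    inv_mul_le_iff₀ hp] at h1
  refine h1.trans ?_
  calc _ ≤ (1 + ‖p.2‖) ^ (2 * L) * (2 ^ L * I * (1 + ‖η‖) ^ (-(2 * L : ℝ))) := by
        gcongr
    _ = _ := by ring

/-- Composition of `opU` with an oscillatory integral. -/
theorem integral_opU_mul (hψ : Cb ψ) (hs : SuppIn ρ ψ) (hg : Cb g) {b : E d × E d → ℂ}
    (hb : XGrowth b) {H : E d → ℂ} (hH : RD H) (x : E d) :
    ∫ θ, opU ψ g b (x, θ) * H θ = ∫ η, b (x, η) * ft (fun w => ψ (x, w) *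
      ∫ θ, H θ * ee (-(inner ℝ (w - g (x, w)) θ))) η := by
  obtain ⟨hbc, C, r, hr⟩ := hb.pg x
  obtain ⟨L, hL⟩ := exists_nat_gt (r + (d + 1))
  obtain ⟨K, hK0, hK⟩ := uKer_growth hψ hs hg L
  have hL0 : (0 : ℝ) ≤ L := by positivity
  have hker := (uKer_contDiff hs hg.smooth).continuous
  -- The growth (1 + |θ|)^{2L} is absorbed by H, and the kernel's factor (1 + |η|)^{-2L} beats the
  -- growth r of b.
  have hJ : Integrable (fun q : E d × E d => b (x, q.2) * uKer ψ g (x, q.1) q.2 * H q.1)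
      (volume.prod volume) := by
    have i1 : Integrable (fun θ : E d => (1 + ‖θ‖) ^ (2 * L) * ‖H θ‖) := by
      have hpg : PG (fun θ : E d => (((1 + ‖θ‖) ^ (2 * L) : ℝ) : ℂ)) :=
        ⟨by fun_prop, 1, (2 * L : ℕ), fun θ => by
          rw [Real.rpow_natCast, Complex.norm_real, Real.norm_of_nonneg (by positivity), one_mul]⟩
      refine (hH.integrable_mul hpg).norm.congr (Filter.Eventually.of_forall fun θ => ?_)
      dsimp only
      rw [norm_mul, Complex.norm_real, Real.norm_of_nonneg (by positivity)]
    have i2 := (integrable_jap (d := d) (r - 2 * L) (by linarith)).const_mul (C * K)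
    refine (i1.mul_prod i2).mono' ?_ (Filter.Eventually.of_forall fun q => ?_)
    · refine Continuous.aestronglyMeasurable ?_
      exact ((hbc.comp continuous_snd).mul (hker.comp (by fun_prop : Continuous
        fun q : E d × E d => ((x, q.1), q.2)))).mul (hH.cont.comp continuous_fst)
    · rw [norm_mul, norm_mul]
      have h2 : (0 : ℝ) < 1 + ‖q.2‖ := by positivity
      calc _ ≤ (C * (1 + ‖q.2‖) ^ r) * (K * (1 + ‖q.1‖) ^ (2 * L) *
            (1 + ‖q.2‖) ^ (-(2 * L : ℝ))) * ‖H q.1‖ := by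
            gcongr
            · exact (norm_nonneg _).trans (hr q.2)
            · exact hr q.2
            · exact hK (x, q.1) q.2
        _ = (1 + ‖q.1‖) ^ (2 * L) * ‖H q.1‖ * (C * K * ((1 + ‖q.2‖) ^ r *
            (1 + ‖q.2‖) ^ (-(2 * L : ℝ)))) := by ring
        _ = _ := by rw [← Real.rpow_add h2, sub_eq_add_neg]
  have h1 : ∫ θ, opU ψ g b (x, θ) * H θ = ∫ θ, ∫ η, b (x, η) * uKer ψ g (x, θ) η * H θ := by
    congr 1
    ext θ
    rw [integral_mul_const]
    rfl
  rw [h1, integral_integral_swap hJ]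
  congr 1
  ext η
  simp only [mul_assoc (b (x, η))]
  rw [integral_const_mul]
  congr 1
  have hJ2 : Integrable (fun q : E d × E d => uAmp ψ g ((x, q.1), q.2) * ee (inner ℝ q.2 η) * H q.1)
      (volume.prod volume) := by
    obtain ⟨K, -, hK⟩ := hs.bound ‖x‖
    refine (hH.integrable.norm.mul_prod (integrable_indicator_ball ρ K)).mono' ?_
      (Filter.Eventually.of_forall fun q => ?_)
    · refine Continuous.aestronglyMeasurable ?_
      have c1 := (uAmp_suppIn hs hg.smooth).smooth.continuous
      have c2 := (contDiff_ee_inner (d := d) η).continuous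
      exact ((c1.comp (by fun_prop : Continuous fun q : E d × E d => ((x, q.1), q.2))).mul
        (c2.comp continuous_snd)).mul (hH.cont.comp continuous_fst)
    · rw [norm_mul, norm_mul, uAmp, norm_mul, norm_ee, norm_ee, mul_one, mul_one, mul_comm]
      gcongr
      exact hK x le_rfl q.2
  calc ∫ θ, uKer ψ g (x, θ) η * H θ
      = ∫ θ, ∫ w, uAmp ψ g ((x, θ), w) * ee (inner ℝ w η) * H θ := by
        congr 1
        ext θ
        rw [integral_mul_const]
        rfl
    _ = ∫ w, ∫ θ, uAmp ψ g ((x, θ), w) * ee (inner ℝ w η) * H θ := integral_integral_swap hJ2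
    _ = _ := by
        unfold ft
        congr 1
        ext w
        rw [mul_assoc, mul_comm (∫ θ, _), ← mul_assoc, ← integral_const_mul]
        congr 1
        ext θ
        rw [uAmp]
        dsimp only
        rw [inner_sub_left, show -(inner ℝ w θ - inner ℝ (g (x, w)) θ) =
          -(inner ℝ w θ) + inner ℝ (g (x, w)) θ by ring]
        ring

end fubini

/-! ### Fourier inversion -/

section inversion
variable {d : ℕ}

theorem ft_eq_fourierInv (f : E d → ℂ) : ft f = 𝓕⁻ f := by
  ext η
  rw [Real.fourierInv_eq']
  unfold ft ee
  congr 1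
  ext w
  rw [smul_eq_mul, mul_comm]
  congr 2
  push_cast
  ring

theorem fourier_eq_integral_ee (f : E d → ℂ) (w : E d) :
    𝓕 f w = ∫ η, f η * ee (-(inner ℝ w η)) := by
  rw [Real.fourier_eq']
  unfold ee
  congr 1
  ext η
  rw [smul_eq_mul, mul_comm, real_inner_comm]
  congr 2
  push_cast
  ring

theorem integral_ft_mul_ee {f : E d → ℂ} (hc : Continuous f) (hf : Integrable f)
    (hF : Integrable (ft f)) (w : E d) : ∫ η, ft f η * ee (-(inner ℝ w η)) = f w := by
  rw [← fourier_eq_integral_ee]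
  rw [ft_eq_fourierInv] at hF ⊢
  have h2 : Integrable (𝓕 f) := by
    refine hF.comp_neg.congr (Filter.Eventually.of_forall fun w => ?_)
    dsimp only
    rw [Real.fourierInv_eq_fourier_neg, neg_neg]
  rw [hc.fourier_fourierInv_eq hf h2]

theorem Cc.integral_ft_mul_ee {h : E d → ℂ} (hh : Cc h) (w : E d) :
    ∫ η, ft h η * ee (-(inner ℝ w η)) = h w :=
  MixedPDO.integral_ft_mul_ee hh.smooth.continuous hh.integrable hh.rd_ft.integrable w

theorem Cc.integral_ft {h : E d → ℂ} (hh : Cc h) : ∫ η, ft h η = h 0 := by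
  simpa [ee_zero] using hh.integral_ft_mul_ee 0

end inversion

/-! ### Flat amplitudes act as multiplication operators modulo lower orders -/

section flat
variable {d : ℕ} {ρ : ℝ} {ψ : E d × E d → ℂ}

/-- Amplitudes that are constant in `w` near `w = 0`. -/
structure Flat (ρ : ℝ) (ψ : E d × E d → ℂ) : Prop where
  cb : Cb ψ
  supp : SuppIn ρ ψ
  flat : ∃ r : ℝ, 0 < r ∧ ∀ x w, ‖w‖ < r → ψ (x, w) = ψ (x, 0)

theorem Flat.dx (hψ : Flat ρ ψ) (u : E d) : Flat ρ (dd (u, 0) ψ) := by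
  obtain ⟨r, hr, h⟩ := hψ.flat
  refine ⟨hψ.cb.dd _, hψ.supp.dd _, r, hr, fun x w hw => ?_⟩
  have hd := hψ.cb.smooth.differentiable (by simp)
  rw [← congrFun (dd_prod_left hd u w) x, ← congrFun (dd_prod_left hd u 0) x]
  congr 1
  ext y
  exact h y w hw

theorem Flat.dd_right_eq_zero (hψ : Flat ρ ψ) (v : E d) : ∃ r : ℝ, 0 < r ∧ ∀ x w, ‖w‖ < r →
    dd (0, v) ψ (x, w) = 0 := by
  obtain ⟨r, hr, h⟩ := hψ.flat
  refine ⟨r, hr, fun x w hw => ?_⟩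
  rw [← congrFun (dd_prod_right (hψ.cb.smooth.differentiable (by simp)) v x) w]
  have h2 : (fun w => ψ (x, w)) =ᶠ[nhds w] fun _ => ψ (x, 0) := by
    filter_upwards [(isOpen_lt continuous_norm continuous_const).mem_nhds hw] with y hy
    exact h x y hy
  simp [dd, h2.fderiv_eq]

/-- The amplitude whose Fourier transform is `ζ_j` times that of `ψ`. -/
def momAmp (j : Fin (d + 1)) (ψ : E d × E d → ℂ) : E d × E d → ℂ :=
  fun q => -(2 * Real.pi * Complex.I : ℂ)⁻¹ * dd (0, stdVec j) ψ q

theorem Flat.mom (hψ : Flat ρ ψ) (j : Fin (d + 1)) : Flat ρ (momAmp j ψ) := by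
  obtain ⟨r, hr, h⟩ := hψ.dd_right_eq_zero (stdVec j)
  refine ⟨(Cb.const _).mul (hψ.cb.dd _), (hψ.supp.dd _).mul contDiff_const, r, hr,
    fun x w hw => ?_⟩
  simp [momAmp, h x w hw, h x 0 (by simpa using hr)]

theorem Flat.mom_zero (hψ : Flat ρ ψ) (j : Fin (d + 1)) (x : E d) : momAmp j ψ (x, 0) = 0 := by
  obtain ⟨r, hr, h⟩ := hψ.dd_right_eq_zero (stdVec j)
  simp [momAmp, h x 0 (by simpa using hr)]

theorem ft_momAmp (hψ : SuppIn ρ ψ) (j : Fin (d + 1)) (x ζ : E d) :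
    ft (fun w => momAmp j ψ (x, w)) ζ = ((ζ j : ℝ) : ℂ) * ft (fun w => ψ (x, w)) ζ := by
  have hd := dd_prod_right (hψ.smooth.differentiable (by simp)) (stdVec j) x
  have h2 := ft_dd (hψ.cc x) (stdVec j) ζ
  rw [hd, inner_stdVec] at h2
  have hpi : (2 * Real.pi * Complex.I : ℂ) ≠ 0 := by simp [Real.pi_ne_zero]
  simp only [momAmp, ft_const_mul, h2]
  field_simp

/-- Without phase correction the kernel depends on η - θ only, so `opU` averages b around θ. -/
theorem uKer_zero (p : E d × E d) (η : E d) :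
    uKer ψ (fun _ => 0) p η = ft (fun w => ψ (p.1, w)) (η - p.2) := by
  unfold uKer ft uAmp
  congr 1
  ext w
  dsimp only
  rw [inner_zero_left, add_zero, mul_assoc, ← ee_add, inner_sub_right]
  congr 2
  ring

/-- The average of `b(x, θ + tζ)` with respect to the Fourier transform of `ψ`. -/
def avg (ψ b : E d × E d → ℂ) (p : E d × E d) (t : ℝ) : ℂ :=
  ∫ ζ, b (p.1, p.2 + t • ζ) * ft (fun w => ψ (p.1, w)) ζ

theorem opU_zero_phase (b : E d × E d → ℂ) (p : E d × E d) :
    opU ψ (fun _ => 0) b p = avg ψ b p 1 := by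
  unfold opU avg
  rw [← integral_add_left_eq_self _ p.2]
  simp [uKer_zero]

theorem avg_zero (hψ : SuppIn ρ ψ) (b : E d × E d → ℂ) (p : E d × E d) :
    avg ψ b p 0 = ψ (p.1, 0) * b p := by
  unfold avg
  simp only [zero_smul, add_zero]
  rw [integral_const_mul, (hψ.cc p.1).integral_ft, mul_comm]

/-- A translation by tζ is a translation at the scale `rad θ` by the vector tζ/`rad θ`, which is no
longer than 2|ζ|. -/
theorem weight_comparable_smul (θ ζ : E d) (m n : ℝ) {t : ℝ} (ht : |t| ≤ 2) :
    (1 + ‖θ + t • ζ‖) ^ m * lam (θ + t • ζ) ^ n ≤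
      3 ^ (|m| + |n|) * 2 ^ (2 * (|m| + |n|)) * (1 + ‖ζ‖) ^ (2 * (|m| + |n|)) *
        ((1 + ‖θ‖) ^ m * lam θ ^ n) := by
  have h1 := weight_comparable θ ((rad θ)⁻¹ • t • ζ) m n
  rw [smul_inv_smul₀ (rad_pos θ).ne'] at h1
  have hpos : 0 ≤ (1 + ‖θ‖) ^ m * lam θ ^ n := mul_nonneg (by positivity)
    (Real.rpow_nonneg (lam_pos θ).le _)
  refine h1.trans (mul_le_mul_of_nonneg_right ?_ hpos)
  rw [mul_assoc, ← Real.mul_rpow (by norm_num) (by positivity)]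
  gcongr
  rw [norm_smul, norm_smul, norm_inv, Real.norm_of_nonneg (rad_pos θ).le, Real.norm_eq_abs]
  have h2 : (rad θ)⁻¹ ≤ 1 := inv_le_one_of_one_le₀ (one_le_rad θ)
  have h3 := (rad_pos θ)
  have h4 : (rad θ)⁻¹ * (|t| * ‖ζ‖) ≤ 1 * (2 * ‖ζ‖) := by gcongr
  linarith [norm_nonneg ζ]

theorem ft_decay_unif (hψ : Cb ψ) (hs : SuppIn ρ ψ) (L : ℕ) : ∃ C : ℝ, 0 ≤ C ∧
    ∀ x ζ, ‖ft (fun w => ψ (x, w)) ζ‖ ≤ C * (1 + ‖ζ‖) ^ (-(2 * L : ℝ)) := by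
  obtain ⟨C, h0, hC⟩ := uKer_growth hψ hs (Cb.const (0 : E d)) L
  refine ⟨C, h0, fun x ζ => ?_⟩
  have := hC (x, 0) ζ
  rw [uKer_zero] at this
  simpa using this

/-- The dominating function of the integrand of `avg`. -/
theorem avg_dominated (hψ : Cb ψ) (hs : SuppIn ρ ψ) {m n : ℝ} {b : E d × E d → ℂ}
    (hb : SMem m n b) : ∃ D : E d → ℝ, Integrable D ∧ ∀ (p : E d × E d) (t : ℝ), |t| ≤ 2 → ∀ ζ,
      ‖b (p.1, p.2 + t • ζ) * ft (fun w => ψ (p.1, w)) ζ‖ ≤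
        D ζ * ((1 + ‖p.2‖) ^ m * lam p.2 ^ n) := by
  obtain ⟨C, h0, hC⟩ := hb.bound
  obtain ⟨L, hL⟩ := exists_nat_gt (2 * (|m| + |n|) + (d + 1))
  obtain ⟨K, hK0, hK⟩ := ft_decay_unif hψ hs L
  have hL0 : (0 : ℝ) ≤ L := by positivity
  have hint := integrable_jap (d := d) (2 * (|m| + |n|) - 2 * L) (by linarith)
  refine ⟨_, hint.const_mul (C * (3 ^ (|m| + |n|) * 2 ^ (2 * (|m| + |n|))) * K),
    fun p t ht ζ => ?_⟩
  have hz : (0 : ℝ) < 1 + ‖ζ‖ := by positivity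
  have h1 := weight_comparable_smul p.2 ζ m n ht
  rw [norm_mul]
  calc _ ≤ (C * (3 ^ (|m| + |n|) * 2 ^ (2 * (|m| + |n|)) * (1 + ‖ζ‖) ^ (2 * (|m| + |n|)) *
        ((1 + ‖p.2‖) ^ m * lam p.2 ^ n))) * (K * (1 + ‖ζ‖) ^ (-(2 * L : ℝ))) := by
        refine mul_le_mul ((hC _).trans (mul_le_mul_of_nonneg_left h1 h0.le)) (hK _ _)
          (norm_nonneg _) ?_
        have := lam_pos p.2
        positivity
    _ = C * (3 ^ (|m| + |n|) * 2 ^ (2 * (|m| + |n|))) * K * ((1 + ‖ζ‖) ^ (2 * (|m| + |n|)) *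
        (1 + ‖ζ‖) ^ (-(2 * L : ℝ))) * ((1 + ‖p.2‖) ^ m * lam p.2 ^ n) := by ring
    _ = _ := by rw [← Real.rpow_add hz, sub_eq_add_neg]

/-- The t-derivative brings down ζ_j ∂_j b, and the moment ζ_j is absorbed into the amplitude, which
stays flat. The range |t| < 2 is an open neighbourhood of [0, 1]. -/
theorem avg_hasDerivAt (hψ : Flat ρ ψ) {m n : ℝ} {b : E d × E d → ℂ} (hb : SMem m n b)
    (p : E d × E d) {t : ℝ} (ht : |t| < 2) :
    HasDerivAt (avg ψ b p) (∑ j, avg (momAmp j ψ) (dd (0, stdVec j) b) p t) t := by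
  have hcont : ∀ {b : E d × E d → ℂ}, ContDiff ℝ ∞ b → ∀ {ψ : E d × E d → ℂ}, SuppIn ρ ψ →
      ∀ t : ℝ, AEStronglyMeasurable
        (fun ζ => b (p.1, p.2 + t • ζ) * ft (fun w => ψ (p.1, w)) ζ) volume := by
    intro b hb ψ hψ t
    exact ((hb.continuous.comp (by fun_prop)).mul
      (ft_contDiff (hψ.cc p.1)).1.continuous).aestronglyMeasurable
  choose D hDi hD using fun j => avg_dominated (hψ.mom j).cb (hψ.mom j).supp (hb.dxi j)
  obtain ⟨D0, hD0i, hD0⟩ := avg_dominated hψ.cb hψ.supp hb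
  have hi : ∀ t : ℝ, |t| ≤ 2 → ∀ j, Integrable (fun ζ => dd (0, stdVec j) b (p.1, p.2 + t • ζ) *
      ft (fun w => momAmp j ψ (p.1, w)) ζ) := fun t ht j =>
    ((hDi j).mul_const _).mono' (hcont (hb.dxi j).smooth (hψ.mom j).supp t)
      (Filter.Eventually.of_forall (hD j p t ht))
  have key := hasDerivAt_integral_of_dominated_loc_of_deriv_le (μ := volume) (𝕜 := ℝ)
    (F := fun t ζ => b (p.1, p.2 + t • ζ) * ft (fun w => ψ (p.1, w)) ζ)
    (F' := fun t ζ => ∑ j, dd (0, stdVec j) b (p.1, p.2 + t • ζ) *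
      ft (fun w => momAmp j ψ (p.1, w)) ζ) (x₀ := t)
    (bound := fun ζ => ∑ j, D j ζ * ((1 + ‖p.2‖) ^ m * lam p.2 ^ (n - 1)))
    (s := {t | |t| < 2}) ((isOpen_lt continuous_abs continuous_const).mem_nhds ht)
    (Filter.Eventually.of_forall (hcont hb.smooth hψ.supp))
    ((hD0i.mul_const _).mono' (hcont hb.smooth hψ.supp t)
      (Filter.Eventually.of_forall (hD0 p t ht.le)))
    (integrable_finsetSum _ fun j _ => hi t ht.le j).aestronglyMeasurable
    (Filter.Eventually.of_forall fun ζ s hs => (norm_sum_le _ _).trans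
      (Finset.sum_le_sum fun j _ => hD j p s (le_of_lt hs) ζ))
    (integrable_finsetSum _ fun j _ => (hDi j).mul_const _)
    (Filter.Eventually.of_forall fun ζ s hs => ?_)
  · have h2 := key.2
    rw [integral_finsetSum _ fun j _ => hi t ht.le j] at h2
    exact h2
  · have h1 : HasDerivAt (fun s : ℝ => (p.1, p.2 + s • ζ)) ((0, ζ) : E d × E d) s := by
      refine (hasDerivAt_const s p.1).prodMk ?_
      simpa using ((hasDerivAt_id s).smul_const ζ).const_add p.2
    have h2 := ((hb.smooth.differentiable (by simp)) (p.1, p.2 + s • ζ)).hasFDerivAt.comp_hasDerivAt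
      s h1
    have h3 : HasDerivAt (fun s : ℝ => b (p.1, p.2 + s • ζ))
      (dd (0, ζ) b (p.1, p.2 + s • ζ)) s := h2
    refine (h3.mul_const _).congr_deriv ?_
    rw [dd_right_eq, Finset.sum_mul]
    refine Finset.sum_congr rfl fun j _ => ?_
    rw [ft_momAmp hψ.supp]
    ring

/-- Taylor's formula in t. The amplitudes `momAmp j ψ` vanish at w = 0, so in the inductive step the
subtracted term is zero and the t-derivative inherits the bound for ∂_j b, which has one order less.
-/
theorem avg_bound (k : ℕ) : ∀ {ψ : E d × E d → ℂ} {m n : ℝ} {b : E d × E d → ℂ}, Flat ρ ψ →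
    SMem m n b → ∃ C : ℝ, ∀ (p : E d × E d) (t : ℝ), 0 ≤ t → t ≤ 1 →
      ‖avg ψ b p t - ψ (p.1, 0) * b p‖ ≤ C * ((1 + ‖p.2‖) ^ m * lam p.2 ^ (n - k)) := by
  induction k with
  | zero =>
    intro ψ m n b hψ hb
    obtain ⟨D, hDi, hD⟩ := avg_dominated hψ.cb hψ.supp hb
    refine ⟨∫ ζ, (D ζ + D ζ), fun p t h0 h1 => ?_⟩
    have hav : ∀ t, |t| ≤ 2 → ‖avg ψ b p t‖ ≤ (∫ ζ, D ζ) * ((1 + ‖p.2‖) ^ m * lam p.2 ^ n) := by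
      intro t ht
      rw [← integral_mul_const]
      exact norm_integral_le_of_norm_le (hDi.mul_const _)
        (Filter.Eventually.of_forall (hD p t ht))
    rw [← avg_zero hψ.supp, integral_add hDi hDi, add_mul]
    simp only [Nat.cast_zero, sub_zero]
    exact (norm_sub_le _ _).trans (add_le_add (hav t (by rw [abs_of_nonneg h0]; linarith))
      (hav 0 (by simp)))
  | succ k ih =>
    intro ψ m n b hψ hb
    choose C hC using fun j => ih (hψ.mom j) (hb.dxi j)
    refine ⟨∑ j, |C j|, fun p t h0 h1 => ?_⟩
    have hw : 0 ≤ (1 + ‖p.2‖) ^ m * lam p.2 ^ (n - (k + 1 : ℕ)) := mul_nonneg (by positivity)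
      (Real.rpow_nonneg (lam_pos p.2).le _)
    have h2 := norm_image_sub_le_of_norm_deriv_le_segment' (f := avg ψ b p) (a := 0) (b := 1)
      (f' := fun t => ∑ j, avg (momAmp j ψ) (dd (0, stdVec j) b) p t)
      (C := (∑ j, |C j|) * ((1 + ‖p.2‖) ^ m * lam p.2 ^ (n - (k + 1 : ℕ))))
      (fun t ht => (avg_hasDerivAt hψ hb p (by rw [abs_of_nonneg ht.1]; linarith [ht.2])
        ).hasDerivWithinAt) (fun t ht => ?_) t ⟨h0, h1⟩
    · rw [avg_zero hψ.supp] at h2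
      refine h2.trans ?_
      rw [sub_zero]
      exact mul_le_of_le_one_right (by positivity) h1
    · refine (norm_sum_le _ _).trans ?_
      rw [Finset.sum_mul]
      refine Finset.sum_le_sum fun j _ => ?_
      have h3 := hC j p t ht.1 ht.2.le
      rw [hψ.mom_zero, zero_mul, sub_zero, show n - 1 - (k : ℝ) = n - (k + 1 : ℕ) by
        push_cast; ring] at h3
      exact h3.trans (mul_le_mul_of_nonneg_right (le_abs_self _) hw)

theorem dd_smul_fst (hψ : ContDiff ℝ ∞ ψ) {b : E d × E d → ℂ} (hb : ContDiff ℝ ∞ b)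
    (u v : E d) : dd (u, v) (fun p : E d × E d => ψ (p.1, 0) * b p) =
      fun p => dd (u, 0) ψ (p.1, 0) * b p + ψ (p.1, 0) * dd (u, v) b p := by
  have h1 : ContDiff ℝ ∞ (fun p : E d × E d => ψ (p.1, 0)) :=
    hψ.comp (contDiff_fst.prodMk contDiff_const)
  rw [dd_mul (h1.differentiable (by simp)) (hb.differentiable (by simp)),
    dd_comp_fst (hψ.differentiable (by simp))]

/-- An amplitude that is constant near `w = 0` acts as multiplication, up to lower orders. -/
theorem Flat.opU_sub_smem (hψ : Flat ρ ψ) {m n : ℝ} {b : E d × E d → ℂ} (hb : SMem m n b)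
    (l : ℕ) : SMem m (n - l) (fun p => opU ψ (fun _ => 0) b p - ψ (p.1, 0) * b p) := by
  intro k
  have hg : ContDiff ℝ ∞ (fun _ : E d × E d => (0 : E d)) := contDiff_const
  have hsm : ∀ {ψ : E d × E d → ℂ} {m n : ℝ} {b : E d × E d → ℂ}, Flat ρ ψ → SMem m n b →
      ContDiff ℝ ∞ (fun p => opU ψ (fun _ => 0) b p - ψ (p.1, 0) * b p) ∧
      (ssys d).Dom (m, n - l) (fun _ p => opU ψ (fun _ => 0) b p - ψ (p.1, 0) * b p) := by
    intro ψ m n b hψ hb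
    obtain ⟨C, hC⟩ := avg_bound l hψ hb
    refine ⟨(opU_contDiff hψ.supp hg hb.xgrowth).1.sub ((hψ.cb.smooth.comp
      (contDiff_fst.prodMk contDiff_const)).mul hb.smooth), C, fun _ p _ => ?_⟩
    dsimp only
    rw [opU_zero_phase]
    exact hC p 1 zero_le_one le_rfl
  induction k generalizing ψ m n b with
  | zero => exact ⟨fun _ => (hsm hψ hb).1, (hsm hψ hb).2⟩
  | succ k ih =>
    refine ⟨fun _ => (hsm hψ hb).1, (hsm hψ hb).2, fun i => ?_⟩
    have hd1 := (opU_contDiff hψ.supp hg hb.xgrowth).1.differentiable (by simp)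
    have hψb : ContDiff ℝ ∞ (fun p : E d × E d => ψ (p.1, 0) * b p) :=
      (hψ.cb.smooth.comp (contDiff_fst.prodMk contDiff_const)).mul hb.smooth
    have hd2 : Differentiable ℝ (fun p : E d × E d => -1 * (ψ (p.1, 0) * b p)) :=
      (contDiff_const.mul hψb).differentiable (by simp)
    have e : ∀ v : E d × E d, dd v (fun p => opU ψ (fun _ => 0) b p - ψ (p.1, 0) * b p) =
        fun p => dd v (opU ψ (fun _ => 0) b) p -
          (dd (v.1, 0) ψ (p.1, 0) * b p + ψ (p.1, 0) * dd v b p) := by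
      intro v
      have e1 : (fun p => opU ψ (fun _ => 0) b p - ψ (p.1, 0) * b p) =
          fun p => opU ψ (fun _ => 0) b p + -1 * (ψ (p.1, 0) * b p) := by ext p; ring
      rw [e1, dd_add hd1 hd2, dd_const_mul (hψb.differentiable (by simp))]
      have := dd_smul_fst hψ.cb.smooth hb.smooth v.1 v.2
      ext p
      have h2 := congrFun this p
      dsimp only at h2 ⊢
      rw [show (v.1, v.2) = v from rfl] at h2
      rw [h2]
      ring
    -- The difference is compatible with all derivatives: ∂_x falls on b or on ψ, keeping ψ flat,
    -- and ∂_θ passes to b because the phase correction is zero.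
    rcases i with i | j
    · refine ((ih hψ (hb.dx i)).add (ih (hψ.dx (stdVec i)) hb)).cast (by simp [ssys])
        fun q p => ?_
      change dd (stdVec i, 0) _ p = _
      rw [e]
      dsimp only
      rw [opU_dx hψ.supp hg hb.xgrowth]
      simp [opU_zero_left]
      ring
    · have e2 : ∀ p, dd (0, stdVec j) (fun p => opU ψ (fun _ => 0) b p - ψ (p.1, 0) * b p) p =
          opU ψ (fun _ => 0) (dd (0, stdVec j) b) p - ψ (p.1, 0) * dd (0, stdVec j) b p := by
        intro p
        rw [e]
        dsimp only
        rw [opU_dxi hψ.supp hg hb]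
        have : dd ((0, 0) : E d × E d) ψ = fun _ => 0 := dd_zero_dir ψ
        simp [opU_zero_left, this]
      by_cases hj : j = Fin.last d
      · subst hj
        refine (ih hψ hb.dlast).cast (by simp [ssys]; ring) fun q p => ?_
        exact e2 p
      · refine (ih hψ (hb.dxi j)).cast (by simp [ssys, hj]; ring) fun q p => ?_
        exact e2 p

end flat

/-! ### Rapidly decreasing functions and their partial Fourier transform -/

section rapid
variable {d : ℕ}

/-- The weights `(1 + |θ|)^r`, without shifts. -/
def tsys (d : ℕ) : WSys Unit (E d × E d) where
  ι := Fin (d + 1) ⊕ Fin (d + 1)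
  dir := Sum.elim (fun i => (stdVec i, 0)) (fun j => (0, stdVec j))
  shift _ := 0
  dom _ := Set.univ
  a _ p := 1 + ‖p.2‖
  b _ _ := 1
  a_pos _ p _ := by positivity
  b_pos _ _ _ := one_pos

theorem tsys_w (μ : ℝ × ℝ) (q : Unit) (p : E d × E d) :
    (tsys d).w μ q p = (1 + ‖p.2‖) ^ μ.1 := by simp [WSys.w, tsys]

/-- Smooth functions `f(x, θ)` whose derivatives are all dominated by `(1 + |θ|)^r`. -/
def TMem (r : ℝ) (f : E d × E d → ℂ) : Prop := ∀ k, (tsys d).Mem k (r, 0) (fun _ => f)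

/-- Smooth functions `f(x, θ)` all of whose derivatives are rapidly decreasing in `θ`, uniformly in
`x`. -/
def RS (f : E d × E d → ℂ) : Prop := ∀ r, TMem r f

theorem tsys_weaken {k : ℕ} {r s : ℝ} {f : Unit → E d × E d → ℂ} (hf : (tsys d).Mem k (r, 0) f)
    (h : r ≤ s) : (tsys d).Mem k (s, 0) f := by
  refine hf.weaken 1 fun q p _ => ?_
  rw [tsys_w]
  exact Real.rpow_le_one_of_one_le_of_nonpos (by linarith [norm_nonneg p.2]) (by simpa using h)

theorem TMem.of_le {r s : ℝ} {f : E d × E d → ℂ} (hf : TMem r f) (h : r ≤ s) : TMem s f :=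
  fun k => tsys_weaken (hf k) h

/-- The basis directions of `ℝ^N × ℝ^N`. -/
def IsDir (v : E d × E d) : Prop := ∃ i, v = (stdVec i, 0) ∨ v = (0, stdVec i)

theorem tsys_succ {k : ℕ} {r : ℝ} {f : E d × E d → ℂ} (hs : ContDiff ℝ ∞ f)
    (hd : ∃ C : ℝ, ∀ p, ‖f p‖ ≤ C * (1 + ‖p.2‖) ^ r)
    (h : ∀ v, IsDir v → (tsys d).Mem k (r, 0) (fun _ => dd v f)) :
    (tsys d).Mem (k + 1) (r, 0) (fun _ => f) := by
  obtain ⟨C, hC⟩ := hd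
  refine ⟨fun _ => hs, ⟨C, fun q p _ => by rw [tsys_w]; exact hC p⟩, fun i => ?_⟩
  rcases i with i | i
  · exact (h (stdVec i, 0) ⟨i, Or.inl rfl⟩).cast (by simp [tsys]) fun _ _ => rfl
  · exact (h (0, stdVec i) ⟨i, Or.inr rfl⟩).cast (by simp [tsys]) fun _ _ => rfl

theorem tsys_zero {r : ℝ} {f : E d × E d → ℂ} (hs : ContDiff ℝ ∞ f)
    (hd : ∃ C : ℝ, ∀ p, ‖f p‖ ≤ C * (1 + ‖p.2‖) ^ r) : (tsys d).Mem 0 (r, 0) (fun _ => f) := by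
  obtain ⟨C, hC⟩ := hd
  exact ⟨fun _ => hs, C, fun q p _ => by rw [tsys_w]; exact hC p⟩

theorem TMem.bound {r : ℝ} {f : E d × E d → ℂ} (hf : TMem r f) :
    ∃ C : ℝ, 0 < C ∧ ∀ p, ‖f p‖ ≤ C * (1 + ‖p.2‖) ^ r := by
  obtain ⟨C, h0, hC⟩ := (hf 0).dom.bound
  exact ⟨C, h0, fun p => by have := hC () p trivial; rwa [tsys_w] at this⟩

theorem TMem.smooth {r : ℝ} {f : E d × E d → ℂ} (hf : TMem r f) : ContDiff ℝ ∞ f :=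
  (hf 0).smooth ()

theorem TMem.ddDir {r : ℝ} {f : E d × E d → ℂ} (hf : TMem r f) {v : E d × E d} (hv : IsDir v) :
    TMem r (dd v f) := by
  obtain ⟨i, rfl | rfl⟩ := hv
  · exact fun k => ((hf (k + 1)).deriv (Sum.inl i)).cast (by simp [tsys]) fun _ _ => rfl
  · exact fun k => ((hf (k + 1)).deriv (Sum.inr i)).cast (by simp [tsys]) fun _ _ => rfl

theorem TMem.coind (r : ℝ) (R : (E d × E d → ℂ) → Prop)
    (h0 : ∀ f, R f → ContDiff ℝ ∞ f ∧ ∃ C : ℝ, ∀ p, ‖f p‖ ≤ C * (1 + ‖p.2‖) ^ r)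
    (h1 : ∀ f, R f → ∀ v, IsDir v → R (dd v f)) {f : E d × E d → ℂ} (h : R f) : TMem r f := by
  intro k
  induction k generalizing f with
  | zero => exact tsys_zero (h0 f h).1 (h0 f h).2
  | succ k ih => exact tsys_succ (h0 f h).1 (h0 f h).2 fun v hv => ih (h1 f h v hv)

theorem TMem.mul {r s : ℝ} {f g : E d × E d → ℂ} (hf : TMem r f) (hg : TMem s g) :
    TMem (r + s) (fun p => f p * g p) :=
  fun k => ((hf k).mul (hg k)).cast (by simp) fun _ _ => rfl

theorem TMem.add {r : ℝ} {f g : E d × E d → ℂ} (hf : TMem r f) (hg : TMem r g) :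
    TMem r (fun p => f p + g p) := fun k => (hf k).add (hg k)

theorem TMem.sum {r : ℝ} {ι : Type*} (s : Finset ι) {f : ι → E d × E d → ℂ}
    (hf : ∀ i ∈ s, TMem r (f i)) : TMem r (fun p => ∑ i ∈ s, f i p) :=
  fun k => WSys.Mem.sum s fun i hi => hf i hi k

theorem TMem.const (c : ℂ) : TMem (0 : ℝ) (fun _ : E d × E d => c) := fun k => WSys.mem_const k c

theorem TMem.const_mul {r : ℝ} {f : E d × E d → ℂ} (hf : TMem r f) (c : ℂ) :
    TMem r (fun p => c * f p) := fun k => (hf k).const_mul c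

theorem TMem.dd_all {r : ℝ} {f : E d × E d → ℂ} (hf : TMem r f) (v : E d × E d) :
    TMem r (dd v f) := by
  have h : dd v f = fun p => dd (v.1, 0) f p + dd (0, v.2) f p := by
    rw [← dd_add_dir]
    simp
  rw [h, dd_left_eq, dd_right_eq]
  exact (TMem.sum _ fun j _ => (hf.ddDir ⟨j, Or.inl rfl⟩).const_mul _).add
    (TMem.sum _ fun j _ => (hf.ddDir ⟨j, Or.inr rfl⟩).const_mul _)

theorem Cb.tmem {f : E d × E d → ℂ} (hf : Cb f) : TMem 0 f := by
  refine TMem.coind 0 (fun f => Cb f) ?_ (fun f hf v _ => hf.dd v) hf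
  intro f hf
  obtain ⟨C, -, hC⟩ := hf.bound
  exact ⟨hf.smooth, C, by simpa using hC⟩

theorem SMem.tmem {m n : ℝ} {f : E d × E d → ℂ} (hf : SMem m n f) : TMem (|m| + |n|) f := by
  have key : ∀ m' n', m' ≤ m → n' ≤ n → ∀ θ : E d, (1 + ‖θ‖) ^ m' * lam θ ^ n' ≤
      2 ^ |n| * (1 + ‖θ‖) ^ (|m| + |n|) := by
    intro m' n' hm hn θ
    refine le_trans ?_ (weight_le θ m n)
    have h1 := one_le_lam θ
    have h2 := norm_nonneg θ
    gcongr
    linarith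
  refine TMem.coind _ (fun f => ∃ m' n', m' ≤ m ∧ n' ≤ n ∧ SMem m' n' f) ?_ ?_
    ⟨m, n, le_rfl, le_rfl, hf⟩
  · rintro f ⟨m', n', hm, hn, hf⟩
    obtain ⟨C, h0, hC⟩ := hf.bound
    refine ⟨hf.smooth, C * 2 ^ |n|, fun p => (hC p).trans ?_⟩
    rw [mul_assoc]
    exact mul_le_mul_of_nonneg_left (key m' n' hm hn p.2) h0.le
  · rintro f ⟨m', n', hm, hn, hf⟩ v ⟨i, rfl | rfl⟩
    · exact ⟨m', n', hm, hn, hf.dx i⟩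
    · exact ⟨m', n' - 1, hm, by linarith, hf.dxi i⟩

/-- Since `lam` is at least (1 + |θ|)^{1/2}, a negative second order n is worth n/2 in the first. -/
theorem SMem.tmem_of_neg {m n : ℝ} (hn : n ≤ 0) {f : E d × E d → ℂ} (hf : SMem m n f) :
    TMem (m + n / 2) f := by
  refine TMem.coind _ (fun f => ∃ n', n' ≤ n ∧ SMem m n' f) ?_ ?_ ⟨n, le_rfl, hf⟩
  · rintro f ⟨n', hn', hf⟩
    obtain ⟨C, h0, hC⟩ := hf.bound
    refine ⟨hf.smooth, C, fun p => (hC p).trans (mul_le_mul_of_nonneg_left ?_ h0.le)⟩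
    have hp : (0 : ℝ) < 1 + ‖p.2‖ := by positivity
    rw [Real.rpow_add hp]
    gcongr
    calc lam p.2 ^ n' ≤ lam p.2 ^ n := Real.rpow_le_rpow_of_exponent_le (one_le_lam _) hn'
      _ ≤ rad p.2 ^ n := Real.rpow_le_rpow_of_nonpos (rad_pos _) (sqrt_le_lam _) hn
      _ = _ := rad_rpow _ _
  · rintro f ⟨n', hn', hf⟩ v ⟨i, rfl | rfl⟩
    · exact ⟨n', hn', hf.dx i⟩
    · exact ⟨n' - 1, by linarith, hf.dxi i⟩

/-- Each unit of second order is worth half a power of 1 + |θ|, so l larger than |n| + 2|m - r|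
gives the decay r. -/
theorem RS.of_smem {m n : ℝ} {f : E d × E d → ℂ} (hf : ∀ l : ℕ, SMem m (n - l) f) : RS f := by
  intro r
  obtain ⟨l, hl⟩ := exists_nat_gt (|n| + 2 * |m - r|)
  have h1 := le_abs_self n
  have h2 := le_abs_self (m - r)
  have h3 := abs_nonneg (m - r)
  exact ((hf l).tmem_of_neg (by linarith)).of_le (by linarith)

theorem RS.smem {f : E d × E d → ℂ} (hf : RS f) (m n : ℝ) : SMem m n f := by
  refine SMem.coind (fun _ _ f => RS f) ?_ ?_ ?_ ?_ hf
  · intro m n f hf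
    obtain ⟨C, h0, hC⟩ := (hf (-(|m| + |n|))).bound
    refine ⟨(hf 0).smooth, C * 2 ^ |n|, fun p => (hC p).trans ?_⟩
    rw [mul_assoc]
    exact mul_le_mul_of_nonneg_left (rpow_neg_le_weight _ p.2 le_rfl) h0.le
  · exact fun m n f hf i r => (hf r).dd_all _
  · exact fun m n f hf r => (hf r).dd_all _
  · exact fun m n f hf j r => (hf r).dd_all _

theorem RS.mul {r : ℝ} {f g : E d × E d → ℂ} (hf : RS f) (hg : TMem r g) :
    RS (fun p => g p * f p) := fun s => by
  have := hg.mul (hf (s - r))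
  rwa [add_sub_cancel] at this

theorem RS.dd {f : E d × E d → ℂ} (hf : RS f) (v : E d × E d) : RS (dd v f) :=
  fun r => (hf r).dd_all v

theorem RS.add {f g : E d × E d → ℂ} (hf : RS f) (hg : RS g) : RS (fun p => f p + g p) :=
  fun r => (hf r).add (hg r)

theorem RS.smooth {f : E d × E d → ℂ} (hf : RS f) : ContDiff ℝ ∞ f := (hf 0).smooth

theorem tmem_coord (j : Fin (d + 1)) : TMem 1 (fun p : E d × E d => ((p.2 j : ℝ) : ℂ)) := by
  have : SMem 1 0 (fun p : E d × E d => ((p.2 j : ℝ) : ℂ)) := fun k => ssys_coord k j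
  simpa using this.tmem

theorem RS.rd {f : E d × E d → ℂ} (hf : RS f) (x : E d) : RD (fun θ => f (x, θ)) :=
  ⟨hf.smooth.continuous.comp (by fun_prop), fun L => by
    obtain ⟨C, -, hC⟩ := (hf (-(2 * L : ℝ))).bound
    exact ⟨C, fun θ => hC (x, θ)⟩⟩

/-- Derivatives of compositions. -/
theorem dd_comp {f : E d × E d → ℂ} (hf : Differentiable ℝ f) {Ψ : E d × E d → E d × E d}
    (hΨ : Differentiable ℝ Ψ) (v : E d × E d) : dd v (fun p => f (Ψ p)) = fun p =>
      ∑ j, (((fderiv ℝ Ψ p v).1 j : ℝ) : ℂ) * dd (stdVec j, 0) f (Ψ p) +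
      ∑ j, (((fderiv ℝ Ψ p v).2 j : ℝ) : ℂ) * dd (0, stdVec j) f (Ψ p) := by
  ext p
  have h : HasFDerivAt (fun p => f (Ψ p)) _ p := (hf (Ψ p)).hasFDerivAt.comp p (hΨ p).hasFDerivAt
  have e1 : dd v (fun p => f (Ψ p)) p = dd (fderiv ℝ Ψ p v) f (Ψ p) := by
    simp [dd, h.fderiv]
  have e2 : dd (fderiv ℝ Ψ p v) f =
      fun q => dd ((fderiv ℝ Ψ p v).1, 0) f q + dd (0, (fderiv ℝ Ψ p v).2) f q := by
    rw [← dd_add_dir]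
    simp
  rw [e1, e2, dd_left_eq, dd_right_eq]

/-- Compositions of rapidly decreasing functions. -/
theorem RS.comp {f : E d × E d → ℂ} (hf : RS f) {Ψ : E d × E d → E d × E d} (hs : ContDiff ℝ ∞ Ψ)
    {K : ℝ} (hK : ∀ p, 1 + ‖p.2‖ ≤ K * (1 + ‖(Ψ p).2‖))
    (h1 : ∀ v, IsDir v → ∀ j, ∃ r, TMem r (fun p => (((fderiv ℝ Ψ p v).1 j : ℝ) : ℂ)))
    (h2 : ∀ v, IsDir v → ∀ j, ∃ r, TMem r (fun p => (((fderiv ℝ Ψ p v).2 j : ℝ) : ℂ))) :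
    RS (fun p => f (Ψ p)) := by
  -- Evaluate the comparison at p = 0, where the left side is 1.
  have hK1 : 0 < K := by
    by_contra h
    have := hK 0
    simp only [Prod.snd_zero, norm_zero, add_zero] at this
    nlinarith [norm_nonneg (Ψ 0).2, mul_nonneg (neg_nonneg.2 (not_lt.1 h)) (norm_nonneg (Ψ 0).2)]
  have hb : ∀ {f : E d × E d → ℂ}, RS f → ∀ r : ℝ, ContDiff ℝ ∞ (fun p => f (Ψ p)) ∧
      ∃ C : ℝ, ∀ p, ‖f (Ψ p)‖ ≤ C * (1 + ‖p.2‖) ^ r := by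
    intro f hf r
    obtain ⟨C, h0, hC⟩ := (hf (-|r|)).bound
    refine ⟨hf.smooth.comp hs, C * K ^ |r|, fun p => (hC _).trans ?_⟩
    rw [mul_assoc]
    refine mul_le_mul_of_nonneg_left ?_ h0.le
    have hp : (0 : ℝ) < 1 + ‖p.2‖ := by positivity
    have hp' : (0 : ℝ) < 1 + ‖(Ψ p).2‖ := by positivity
    have h3 : (1 + ‖p.2‖) ^ |r| ≤ K ^ |r| * (1 + ‖(Ψ p).2‖) ^ |r| := by
      rw [← Real.mul_rpow hK1.le hp'.le]
      exact Real.rpow_le_rpow hp.le (hK p) (abs_nonneg r)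
    have h4 : (1 + ‖p.2‖) ^ (-|r|) ≤ (1 + ‖p.2‖) ^ r := Real.rpow_le_rpow_of_exponent_le
      (by linarith [norm_nonneg p.2]) (neg_abs_le r)
    calc (1 + ‖(Ψ p).2‖) ^ (-|r|) ≤ K ^ |r| * (1 + ‖p.2‖) ^ (-|r|) := by
          rw [Real.rpow_neg hp'.le, Real.rpow_neg hp.le, ← div_eq_mul_inv,
            le_div_iff₀ (by positivity), inv_mul_le_iff₀ (by positivity)]
          linarith
      _ ≤ _ := by gcongr
  intro r k
  induction k generalizing f r with
  | zero => exact tsys_zero (hb hf r).1 (hb hf r).2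
  | succ k ih =>
    refine tsys_succ (hb hf r).1 (hb hf r).2 fun v hv => ?_
    rw [dd_comp (hf.smooth.differentiable (by simp)) (hs.differentiable (by simp))]
    refine WSys.Mem.add (WSys.Mem.sum _ fun j _ => ?_) (WSys.Mem.sum _ fun j _ => ?_)
    · obtain ⟨s, hsj⟩ := h1 v hv j
      exact ((hsj k).mul (ih (hf.dd (stdVec j, 0)) (r - s))).cast (by simp) fun _ _ => rfl
    · obtain ⟨s, hsj⟩ := h2 v hv j
      exact ((hsj k).mul (ih (hf.dd (0, stdVec j)) (r - s))).cast (by simp) fun _ _ => rfl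

/-- The Fourier transform in the second variable. -/
def ft2 (e : E d × E d → ℂ) (p : E d × E d) : ℂ := ft (fun ξ => e (p.1, ξ)) p.2

theorem ft2_contDiff {e : E d × E d → ℂ} (he : RS e) : ContDiff ℝ ∞ (ft2 e) ∧
    ∀ u v, dd (u, v) (ft2 e) = ft2 (fun p => dd (u, 0) e p +
      2 * Real.pi * Complex.I * (inner ℝ p.2 v : ℝ) * e p) := by
  have hcl : ∀ {e : E d × E d → ℂ}, RS e → ∀ u v, RS (fun p => dd (u, 0) e p +
      2 * Real.pi * Complex.I * (inner ℝ p.2 v : ℝ) * e p) := by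
    intro e he u v
    have h1 : TMem 1 (fun p : E d × E d => 2 * Real.pi * Complex.I * (inner ℝ p.2 v : ℝ)) := by
      have : (fun p : E d × E d => 2 * Real.pi * Complex.I * (inner ℝ p.2 v : ℝ)) =
          fun p => 2 * Real.pi * Complex.I * ∑ j, ((v j : ℝ) : ℂ) * ((p.2 j : ℝ) : ℂ) := by
        ext p
        rw [PiLp.inner_apply]
        push_cast
        simp
      rw [this]
      exact (TMem.sum _ fun j _ => (tmem_coord j).const_mul _).const_mul _
    exact (he.dd _).add (he.mul h1)
  have hee : ∀ e : E d × E d → ℂ, RS e → ContDiff ℝ ∞ (fun q : (E d × E d) × E d =>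
      e (q.1.1, q.2) * ee (inner ℝ q.2 q.1.2)) := fun e he =>
    (he.smooth.comp (contDiff_fst.fst.prodMk contDiff_snd)).mul contDiff_ee_inner_prod
  have hdd : ∀ e : E d × E d → ℂ, RS e → ∀ u v : E d, dd ((u, v), 0) (fun q : (E d × E d) × E d =>
      e (q.1.1, q.2) * ee (inner ℝ q.2 q.1.2)) = fun q => (fun p => dd (u, 0) e p +
      2 * Real.pi * Complex.I * (inner ℝ p.2 v : ℝ) * e p) (q.1.1, q.2) *
        ee (inner ℝ q.2 q.1.2) := by
    intro e he u v
    have h1 : ContDiff ℝ ∞ (fun q : (E d × E d) × E d => e (q.1.1, q.2)) :=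
      he.smooth.comp (contDiff_fst.fst.prodMk contDiff_snd)
    have h2 : ContDiff ℝ ∞ (fun q : (E d × E d) × E d => inner ℝ q.2 q.1.2) :=
      contDiff_snd.inner ℝ contDiff_fst.snd
    rw [dd_mul (h1.differentiable (by simp)) (contDiff_ee_inner_prod.differentiable (by simp)),
      dd_ee (h2.differentiable (by simp))]
    ext q
    have e1 : dd ((u, v), 0) (fun q : (E d × E d) × E d => e (q.1.1, q.2)) q =
        dd (u, 0) e (q.1.1, q.2) := by
      have h3 := congrFun (dd_prod_left (h1.differentiable (by simp)) (u, v) q.2) q.1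
      exact h3.symm.trans (congrFun (dd_comp_fst (he.smooth.differentiable (by simp)) (u, v) q.2)
        q.1)
    have e2 : fderiv ℝ (fun q : (E d × E d) × E d => inner ℝ q.2 q.1.2) q ((u, v), 0) =
        inner ℝ q.2 v := by
      have h4 : HasFDerivAt (fun q : (E d × E d) × E d => q.1.2) _ q :=
        ContinuousLinearMap.hasFDerivAt ((ContinuousLinearMap.snd ℝ (E d) (E d)).comp
          (ContinuousLinearMap.fst ℝ (E d × E d) (E d)))
      have h5 : HasFDerivAt (fun q : (E d × E d) × E d => inner ℝ q.2 q.1.2) _ q :=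
        (hasFDerivAt_snd (𝕜 := ℝ) (p := q)).inner ℝ h4
      rw [h5.fderiv]
      simp
    dsimp only
    rw [e1, e2]
    ring
  have key := contDiff_integral_of_coind (P := E d × E d) (H := E d)
    (fun F => ∃ e : E d × E d → ℂ, RS e ∧ F = fun q => e (q.1.1, q.2) * ee (inner ℝ q.2 q.1.2))
    ?_ ?_ ⟨e, he, rfl⟩
  · refine ⟨key.1, fun u v => ?_⟩
    have := key.2 (u, v)
    rw [hdd e he] at this
    exact this
  · rintro F ⟨e, he, rfl⟩
    refine ⟨hee e he, fun R => ?_⟩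
    obtain ⟨C, -, hC⟩ := (he (-(d + 2 : ℝ))).bound
    exact ⟨_, (integrable_jap (d := d) (-(d + 2 : ℝ)) (by linarith)).const_mul C, fun p _ η => by
      rw [norm_mul, norm_ee, mul_one]; exact hC (p.1, η)⟩
  · rintro F ⟨e, he, rfl⟩ v
    exact ⟨_, hcl he v.1 v.2, hdd e he v.1 v.2⟩

/-- Integration by parts in the Fourier variable; it converts factors of the dual variable into
derivatives of e. -/
theorem ft2_coord_mul {e : E d × E d → ℂ} (he : RS e) (j : Fin (d + 1)) (p : E d × E d) :
    ((p.2 j : ℝ) : ℂ) * ft2 e p =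
      -(2 * Real.pi * Complex.I)⁻¹ * ft2 (dd (0, stdVec j) e) p := by
  have hdi : ContDiff ℝ ∞ (fun w : E d => inner ℝ w p.2) := contDiff_inner_left p.2
  have hsm : ContDiff ℝ ∞ (fun w : E d => ee (inner ℝ w p.2)) := contDiff_ee.comp hdi
  have hd := dd_prod_right (he.smooth.differentiable (by simp)) (stdVec j) p.1
  have hddee := dd_ee (hdi.differentiable (by simp)) (stdVec j)
  simp only [fderiv_inner_left, inner_stdVec] at hddee
  have hpg : ∀ c : ℂ, PG (fun w : E d => c * ee (inner ℝ w p.2)) := fun c =>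
    ⟨continuous_const.mul hsm.continuous, ‖c‖, 0, fun w => by simp [norm_ee]⟩
  have h1 := integral_mul_fderiv_eq_neg_fderiv_mul_of_integrable (μ := (volume : Measure (E d)))
    (f := fun w => ee (inner ℝ w p.2)) (g := fun ξ => e (p.1, ξ)) (v := stdVec j) ?_ ?_ ?_
    (fun x _ => (hsm.differentiable (by simp)) x)
    (fun x _ => ((he.smooth.comp (contDiff_const.prodMk contDiff_id)).differentiable (by simp)) x)
  · change ∫ x, ee (inner ℝ x p.2) * dd (stdVec j) (fun ξ => e (p.1, ξ)) x =
      -∫ x, dd (stdVec j) (fun w => ee (inner ℝ w p.2)) x * e (p.1, x) at h1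
    rw [hd, hddee] at h1
    have h2 : ft2 (dd (0, stdVec j) e) p = ∫ x, ee (inner ℝ x p.2) * dd (0, stdVec j) e (p.1, x) :=
      integral_congr_ae (Filter.Eventually.of_forall fun x => mul_comm _ _)
    have h3 : ∫ x, 2 * Real.pi * Complex.I * ((p.2 j : ℝ) : ℂ) * ee (inner ℝ x p.2) * e (p.1, x) =
        2 * Real.pi * Complex.I * ((p.2 j : ℝ) : ℂ) * ft2 e p := by
      unfold ft2 ft
      rw [← integral_const_mul]
      congr 1
      ext x
      ring
    rw [h2, h1, h3]
    have hpi : (2 * Real.pi * Complex.I : ℂ) ≠ 0 := by simp [Real.pi_ne_zero]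
    field_simp
  · change Integrable (fun x => dd (stdVec j) (fun w => ee (inner ℝ w p.2)) x * e (p.1, x))
    rw [hddee]
    exact (he.rd p.1).integrable_mul (hpg _)
  · change Integrable (fun x => ee (inner ℝ x p.2) * dd (stdVec j) (fun ξ => e (p.1, ξ)) x)
    rw [hd]
    simpa using ((he.dd (0, stdVec j)).rd p.1).integrable_mul (hpg 1)
  · simpa using (he.rd p.1).integrable_mul (hpg 1)

theorem norm_le_sum_coord (z : E d) : ‖z‖ ≤ ∑ j, ‖z j‖ := by
  conv_lhs => rw [← sum_coord_smul z]
  refine (norm_sum_le _ _).trans (Finset.sum_le_sum fun j _ => ?_)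
  rw [norm_smul]
  simp [stdVec]

theorem ft2_bound (M : ℕ) : ∀ {e : E d × E d → ℂ}, RS e →
    ∃ C : ℝ, ∀ p : E d × E d, (1 + ‖p.2‖) ^ M * ‖ft2 e p‖ ≤ C := by
  induction M with
  | zero =>
    intro e he
    obtain ⟨C, -, hC⟩ := (he (-(d + 2 : ℝ))).bound
    refine ⟨∫ ξ : E d, C * (1 + ‖ξ‖) ^ (-(d + 2 : ℝ)), fun p => ?_⟩
    rw [pow_zero, one_mul]
    exact norm_integral_le_of_norm_le ((integrable_jap (d := d) (-(d + 2 : ℝ))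
      (by linarith)).const_mul C) (Filter.Eventually.of_forall fun ξ => by
        rw [norm_mul, norm_ee, mul_one]; exact hC (p.1, ξ))
  | succ M ih =>
    intro e he
    obtain ⟨C, hC⟩ := ih he
    choose C' hC' using fun j => ih (he.dd (0, stdVec j))
    refine ⟨C + ∑ j, ‖(2 * Real.pi * Complex.I : ℂ)⁻¹‖ * C' j, fun p => ?_⟩
    have h1 := norm_le_sum_coord p.2
    have h2 : ‖p.2‖ * ‖ft2 e p‖ ≤
        ∑ j, ‖(2 * Real.pi * Complex.I : ℂ)⁻¹‖ * ‖ft2 (dd (0, stdVec j) e) p‖ := by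
      calc _ ≤ (∑ j, ‖p.2 j‖) * ‖ft2 e p‖ := by gcongr
        _ = _ := by
          rw [Finset.sum_mul]
          refine Finset.sum_congr rfl fun j _ => ?_
          have := congrArg norm (ft2_coord_mul he j p)
          rwa [norm_mul, norm_mul, norm_neg, Complex.norm_real] at this
    calc (1 + ‖p.2‖) ^ (M + 1) * ‖ft2 e p‖
        = (1 + ‖p.2‖) ^ M * ‖ft2 e p‖ + (1 + ‖p.2‖) ^ M * (‖p.2‖ * ‖ft2 e p‖) := by ring
      _ ≤ C + (1 + ‖p.2‖) ^ M * ∑ j, ‖(2 * Real.pi * Complex.I : ℂ)⁻¹‖ *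
          ‖ft2 (dd (0, stdVec j) e) p‖ := by
          gcongr
          exact hC p
      _ = C + ∑ j, ‖(2 * Real.pi * Complex.I : ℂ)⁻¹‖ *
          ((1 + ‖p.2‖) ^ M * ‖ft2 (dd (0, stdVec j) e) p‖) := by
          rw [Finset.mul_sum]
          congr 1
          exact Finset.sum_congr rfl fun j _ => by ring
      _ ≤ _ := by
          gcongr with j
          exact hC' j p

/-- Derivatives of the transform multiply e by polynomials, and powers of the dual variable
differentiate e. Both operations stay within the class. So symbols in S^{-∞} and rapidly decreasing
kernels correspond to each other. -/
theorem RS.ft2 {e : E d × E d → ℂ} (he : RS e) : RS (ft2 e) := by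
  intro r
  refine TMem.coind r (fun F => ∃ e, RS e ∧ F = MixedPDO.ft2 e) ?_ ?_ ⟨e, he, rfl⟩
  · rintro F ⟨e, he, rfl⟩
    obtain ⟨M, hM⟩ := exists_nat_gt (-r)
    obtain ⟨C, hC⟩ := ft2_bound M he
    refine ⟨(ft2_contDiff he).1, C, fun p => ?_⟩
    have hp : (0 : ℝ) < (1 + ‖p.2‖) ^ M := by positivity
    have h1 : ‖MixedPDO.ft2 e p‖ ≤ C * (1 + ‖p.2‖) ^ (-(M : ℝ)) := by
      rw [Real.rpow_neg (by positivity), Real.rpow_natCast, ← div_eq_mul_inv, le_div_iff₀ hp,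
        mul_comm]
      exact hC p
    have hC0 : 0 ≤ C := (by positivity : (0 : ℝ) ≤ _).trans (hC 0)
    refine h1.trans (mul_le_mul_of_nonneg_left ?_ hC0)
    exact Real.rpow_le_rpow_of_exponent_le (by linarith [norm_nonneg p.2]) (by linarith)
  · rintro F ⟨e, he, rfl⟩ v hv
    refine ⟨_, ?_, (ft2_contDiff he).2 v.1 v.2⟩
    obtain ⟨i, rfl | rfl⟩ := hv
    · refine (he.dd (stdVec i, 0)).add (he.mul (r := 0) ?_)
      simpa using TMem.const 0
    · refine (he.dd _).add (he.mul (r := 1) ?_)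
      simp only [inner_stdVec_right]
      exact (tmem_coord i).const_mul _

end rapid

/-! ### Matrix functions with bounded derivatives and block triangular matrices -/

section matrices
variable {d : ℕ}

/-- Square matrices of size `N = d + 1`. -/
abbrev Mat (d : ℕ) : Type := Matrix (Fin (d + 1)) (Fin (d + 1)) ℝ

/-- The linear map of a matrix. -/
def mv (M : Mat d) : E d →L[ℝ] E d := Matrix.toEuclideanCLM (𝕜 := ℝ) M

theorem mv_apply (M : Mat d) (θ : E d) (i : Fin (d + 1)) : mv M θ i = ∑ j, M i j * θ j := rfl

theorem mv_mul (M N : Mat d) (θ : E d) : mv (M * N) θ = mv M (mv N θ) := by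
  simp [mv, map_mul]

theorem mv_one (θ : E d) : mv (1 : Mat d) θ = θ := by simp [mv]

theorem mv_inv_mv {M : Mat d} (h : M.det ≠ 0) (θ : E d) : mv M⁻¹ (mv M θ) = θ := by
  rw [← mv_mul, Matrix.nonsing_inv_mul _ (isUnit_iff_ne_zero.2 h), mv_one]

theorem mv_mv_inv {M : Mat d} (h : M.det ≠ 0) (θ : E d) : mv M (mv M⁻¹ θ) = θ := by
  rw [← mv_mul, Matrix.mul_nonsing_inv _ (isUnit_iff_ne_zero.2 h), mv_one]

theorem mv_eq_sum (M : Mat d) : mv M = ∑ i, ∑ j, M i j •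
    (EuclideanSpace.proj j : E d →L[ℝ] ℝ).smulRight (stdVec i : E d) := by
  ext θ k
  simp [mv_apply, stdVec_apply]

theorem inner_mv (M : Mat d) (u θ : E d) : inner ℝ (mv M u) θ = inner ℝ u (mv M.transpose θ) := by
  simp only [PiLp.inner_apply, mv_apply, Finset.mul_sum, Finset.sum_mul, RCLike.inner_apply,
    conj_trivial, Matrix.transpose_apply]
  rw [Finset.sum_comm]
  exact Finset.sum_congr rfl fun i _ => Finset.sum_congr rfl fun j _ => by ring

theorem det_mv (M : Mat d) : (mv M).det = M.det := by
  have : (mv M : E d →ₗ[ℝ] E d) = Matrix.toEuclideanLin M :=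
    Matrix.coe_toEuclideanCLM_eq_toEuclideanLin M
  rw [ContinuousLinearMap.det, this, Matrix.toEuclideanLin, Matrix.toLpLin_eq_toLin,
    LinearMap.det_toLin]

variable {P P' : Type} [NormedAddCommGroup P] [NormedSpace ℝ P] [NormedAddCommGroup P']
  [NormedSpace ℝ P']

/-- Matrices of smooth functions with all derivatives bounded. -/
def CbMat (M : P → Mat d) : Prop := ∀ i j, Cb (fun x => M x i j)

theorem CbMat.mv {M : P → Mat d} (hM : CbMat M) : Cb (fun x => mv (M x)) := by
  simp_rw [mv_eq_sum]
  exact Cb.sum _ fun i _ => Cb.sum _ fun j _ => (hM i j).smul (Cb.const _)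

theorem CbMat.mul {M N : P → Mat d} (hM : CbMat M) (hN : CbMat N) :
    CbMat (fun x => M x * N x) := fun i j => by
  simp_rw [Matrix.mul_apply]
  exact Cb.sum _ fun k _ => (hM i k).mul (hN k j)

theorem CbMat.transpose {M : P → Mat d} (hM : CbMat M) : CbMat (fun x => (M x).transpose) :=
  fun i j => hM j i

theorem CbMat.comp {M : P' → Mat d} (hM : CbMat M) {f : P → P'} (hf : Cb1 f) :
    CbMat (fun x => M (f x)) := fun i j => (hM i j).comp hf

theorem CbMat.det {M : P → Mat d} (hM : CbMat M) : Cb (fun x => (M x).det) := by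
  simp_rw [Matrix.det_apply']
  exact Cb.sum _ fun σ _ => (Cb.const _).mul (Cb.prod _ fun i _ => hM _ _)

theorem CbMat.adjugate {M : P → Mat d} (hM : CbMat M) : CbMat (fun x => (M x).adjugate) := by
  intro i j
  simp_rw [Matrix.adjugate_apply]
  refine CbMat.det fun k l => ?_
  by_cases h : k = j
  · subst h
    simp only [Matrix.updateRow_self]
    exact Cb.const _
  · simp only [Matrix.updateRow_ne h]
    exact hM k l

/-- Matrices of smooth functions with all derivatives bounded and with determinant bounded away
from zero. -/
structure CbGL (M : P → Mat d) : Prop where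
  cb : CbMat M
  det : ∃ c : ℝ, 0 < c ∧ ∀ x, c ≤ |(M x).det|

theorem CbGL.ne {M : P → Mat d} (hM : CbGL M) (x : P) : (M x).det ≠ 0 := by
  obtain ⟨c, h0, h⟩ := hM.det
  exact abs_pos.1 (h0.trans_le (h x))

theorem CbGL.inv {M : P → Mat d} (hM : CbGL M) : CbGL (fun x => (M x)⁻¹) := by
  obtain ⟨c, h0, h⟩ := hM.det
  refine ⟨fun i j => ?_, ?_⟩
  · simp_rw [Matrix.inv_def, Matrix.smul_apply, Ring.inverse_eq_inv']
    exact (hM.cb.det.inv h0 h).smul (hM.cb.adjugate i j)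
  · obtain ⟨C, hC, hb⟩ := hM.cb.det.bound
    refine ⟨C⁻¹, by positivity, fun x => ?_⟩
    rw [Matrix.det_nonsing_inv, Ring.inverse_eq_inv', abs_inv]
    exact inv_anti₀ (abs_pos.2 (hM.ne x)) (hb x)

theorem CbGL.mul {M N : P → Mat d} (hM : CbGL M) (hN : CbGL N) : CbGL (fun x => M x * N x) := by
  obtain ⟨c, h0, h⟩ := hM.det
  obtain ⟨c', h0', h'⟩ := hN.det
  refine ⟨hM.cb.mul hN.cb, c * c', by positivity, fun x => ?_⟩
  rw [Matrix.det_mul, abs_mul]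
  exact mul_le_mul (h x) (h' x) h0'.le (abs_nonneg _)

theorem CbGL.transpose {M : P → Mat d} (hM : CbGL M) : CbGL (fun x => (M x).transpose) :=
  ⟨hM.cb.transpose, by simpa only [Matrix.det_transpose] using hM.det⟩

theorem CbGL.comp {M : P' → Mat d} (hM : CbGL M) {f : P → P'} (hf : Cb1 f) :
    CbGL (fun x => M (f x)) := by
  obtain ⟨c, h0, h⟩ := hM.det
  exact ⟨hM.cb.comp hf, c, h0, fun x => h _⟩

theorem CbGL.one : CbGL (fun _ : P => (1 : Mat d)) := ⟨fun _ _ => Cb.const _, 1, one_pos, by simp⟩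

theorem CbMat.norm_le {M : P → Mat d} (hM : CbMat M) :
    ∃ K : ℝ, 1 ≤ K ∧ ∀ x θ, ‖MixedPDO.mv (M x) θ‖ ≤ K * ‖θ‖ := by
  obtain ⟨C, -, hC⟩ := hM.mv.bound
  refine ⟨max C 1, le_max_right _ _, fun x θ => (ContinuousLinearMap.le_opNorm _ _).trans ?_⟩
  gcongr
  exact (hC x).trans (le_max_left _ _)

theorem IsAdaptedFrame.gl {D : Distr d} {A : Frame d} (h : IsAdaptedFrame D A) : CbGL A :=
  ⟨fun i j => ⟨h.smooth i j, h.bounded i j⟩, h.det_bound⟩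

/-- Matrices that preserve the last axis. -/
def BlockTri (M : P → Mat d) : Prop := ∀ (x : P) (k : Fin d), M x k.castSucc (Fin.last d) = 0

/-- The first N - 1 components of Mθ do not involve θ_N, so θ may be replaced by its horizontal
part. -/
theorem horiz_mv_le {M : P → Mat d} (hM : CbMat M) (ht : BlockTri M) :
    ∃ K : ℝ, 1 ≤ K ∧ ∀ x θ, ‖horiz (MixedPDO.mv (M x) θ)‖ ≤ K * ‖horiz θ‖ := by
  obtain ⟨K, hK, h⟩ := hM.norm_le
  refine ⟨K, hK, fun x θ => ?_⟩
  set θ' : E d := WithLp.toLp 2 (Fin.snoc (fun i => θ i.castSucc) 0 : Fin (d + 1) → ℝ) with hθ'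
  have h1 : horiz (MixedPDO.mv (M x) θ) = horiz (MixedPDO.mv (M x) θ') := by
    ext k
    simp [horiz, mv_apply, Fin.sum_univ_castSucc, ht x k, θ']
  have h2 : ‖θ'‖ = ‖horiz θ‖ := by
    rw [EuclideanSpace.norm_eq, EuclideanSpace.norm_eq]
    congr 1
    rw [Fin.sum_univ_castSucc]
    simp [horiz, θ']
  rw [h1, ← h2]
  exact (norm_horiz_le _).trans (h x θ')

/-- Preservation of the last axis is exactly what keeps |θ'|, and with it `lam`, under control. -/
theorem lam_mv_le {M : P → Mat d} (hM : CbMat M) (ht : BlockTri M) :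
    ∃ K : ℝ, 1 ≤ K ∧ ∀ x θ, lam (MixedPDO.mv (M x) θ) ≤ K * lam θ ∧
      1 + ‖MixedPDO.mv (M x) θ‖ ≤ K * (1 + ‖θ‖) := by
  obtain ⟨K, hK, h⟩ := hM.norm_le
  obtain ⟨K', hK', h'⟩ := horiz_mv_le hM ht
  refine ⟨K + K', by linarith, fun x θ => ⟨?_, ?_⟩⟩
  · have h1 : Real.sqrt ‖MixedPDO.mv (M x) θ‖ ≤ K * Real.sqrt ‖θ‖ := by
      refine (Real.sqrt_le_sqrt (h x θ)).trans ?_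
      rw [Real.sqrt_mul (by linarith)]
      gcongr
      exact Real.sqrt_le_iff.2 ⟨by linarith, by nlinarith⟩
    have h2 := h' x θ
    have h3 := norm_nonneg (horiz θ)
    have h4 := Real.sqrt_nonneg ‖θ‖
    unfold lam
    nlinarith
  · nlinarith [h x θ, norm_nonneg θ]

end matrices

/-! ### Invariance of the classes under changes of the fibre variable -/

section fibre
variable {d : ℕ}

/-- The map `(x, θ) ↦ (Ψ x, Q x θ)`. -/
def fibMap (Ψ : E d → E d) (Q : E d → Mat d) (p : E d × E d) : E d × E d := (Ψ p.1, mv (Q p.1) p.2)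

theorem fibMap_contDiff {Ψ : E d → E d} {Q : E d → Mat d} (hΨ : ContDiff ℝ ∞ Ψ) (hQ : CbMat Q) :
    ContDiff ℝ ∞ (fibMap Ψ Q) :=
  (hΨ.comp contDiff_fst).prodMk ((hQ.mv.smooth.comp contDiff_fst).clm_apply contDiff_snd)

theorem fderiv_fibMap {Ψ : E d → E d} {Q : E d → Mat d} (hΨ : ContDiff ℝ ∞ Ψ) (hQ : CbMat Q)
    (p v : E d × E d) : fderiv ℝ (fibMap Ψ Q) p v =
      (fderiv ℝ Ψ p.1 v.1, fderiv ℝ (fun x => mv (Q x)) p.1 v.1 p.2 + mv (Q p.1) v.2) := by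
  have h1 : HasFDerivAt (fun p : E d × E d => Ψ p.1) _ p :=
    (hΨ.differentiable (by simp) p.1).hasFDerivAt.comp p hasFDerivAt_fst
  have h2 : HasFDerivAt (fun p : E d × E d => mv (Q p.1)) _ p :=
    (hQ.mv.smooth.differentiable (by simp) p.1).hasFDerivAt.comp p hasFDerivAt_fst
  have h3 := h1.prodMk (h2.clm_apply hasFDerivAt_snd)
  change HasFDerivAt (fibMap Ψ Q) _ p at h3
  rw [h3.fderiv]
  simp [add_comm]

theorem fderiv_mv_coord {Q : E d → Mat d} (hQ : CbMat Q) (x v θ : E d) (k : Fin (d + 1)) :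
    (fderiv ℝ (fun x => mv (Q x)) x v θ) k = ∑ l, fderiv ℝ (fun x => Q x k l) x v * θ l := by
  have h1 : HasFDerivAt (fun x => (EuclideanSpace.proj k : E d →L[ℝ] ℝ) (mv (Q x) θ)) _ x :=
    (EuclideanSpace.proj k : E d →L[ℝ] ℝ).hasFDerivAt.comp x
      ((hQ.mv.smooth.differentiable (by simp) x).hasFDerivAt.clm_apply (hasFDerivAt_const θ x))
  have h2 : HasFDerivAt (fun x => ∑ l, Q x k l * θ l) _ x := HasFDerivAt.fun_sum fun l _ =>
    (((hQ k l).smooth.differentiable (by simp) x).hasFDerivAt.mul_const (θ l))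
  have h3 := congrArg (fun L => L v) (h1.unique h2)
  simpa [mul_comm] using h3

theorem ssys_succ {k : ℕ} {m n : ℝ} {f : E d × E d → ℂ} (hs : ContDiff ℝ ∞ f)
    (hd : ∃ C : ℝ, ∀ p, ‖f p‖ ≤ C * ((1 + ‖p.2‖) ^ m * lam p.2 ^ n))
    (hx : ∀ i, (ssys d).Mem k (m, n) (fun _ => dd (stdVec i, 0) f))
    (hl : (ssys d).Mem k (m - 1, n) (fun _ => dd (0, stdVec (Fin.last d)) f))
    (hh : ∀ j : Fin d, (ssys d).Mem k (m, n - 1) (fun _ => dd (0, stdVec j.castSucc) f)) :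
    (ssys d).Mem (k + 1) (m, n) (fun _ => f) := by
  obtain ⟨C, hC⟩ := hd
  refine ⟨fun _ => hs, ⟨C, fun q p _ => hC p⟩, fun i => ?_⟩
  rcases i with i | i
  · exact (hx i).cast (by simp [ssys]) fun _ _ => rfl
  · induction i using Fin.lastCases with
    | last => exact hl.cast (by simp [ssys, sub_eq_add_neg]) fun _ _ => rfl
    | cast j =>
      exact (hh j).cast (by simp [ssys, sub_eq_add_neg, Fin.castSucc_ne_last]) fun _ _ => rfl

/-- Invariance of the mixed symbols under changes of the base point and block triangular changes of
the covariable. -/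
theorem SMem.fib {Ψ : E d → E d} (hΨ : Cb1 Ψ) {Q R : E d → Mat d} (hQ : CbMat Q) (hR : CbMat R)
    (hQt : BlockTri Q) (hRt : BlockTri R) (hRQ : ∀ x, R x * Q x = 1) {m n : ℝ}
    {a : E d × E d → ℂ} (ha : SMem m n a) : SMem m n (fun p => a (fibMap Ψ Q p)) := by
  have hs := fibMap_contDiff hΨ.smooth hQ
  have hb : ∀ {m n : ℝ} {a : E d × E d → ℂ}, SMem m n a → ∃ C : ℝ, ∀ p,
      ‖a (fibMap Ψ Q p)‖ ≤ C * ((1 + ‖p.2‖) ^ m * lam p.2 ^ n) := by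
    intro m n a ha
    obtain ⟨C, h0, hC⟩ := ha.bound
    obtain ⟨K, hK, h1⟩ := lam_mv_le hQ hQt
    obtain ⟨K', hK', h2⟩ := lam_mv_le hR hRt
    have hinv : ∀ x θ, mv (R x) (mv (Q x) θ) = θ := fun x θ => by rw [← mv_mul, hRQ, mv_one]
    have e1 : ∀ p : E d × E d, (1 + ‖mv (Q p.1) p.2‖) ^ m ≤ (max K K') ^ |m| * (1 + ‖p.2‖) ^ m := by
      intro p
      refine rpow_le_of_comparable (by positivity) (by positivity) (hK.trans (le_max_left _ _))
        ((h1 p.1 p.2).2.trans ?_) ?_ m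
      · gcongr; exact le_max_left _ _
      · have := (h2 p.1 (mv (Q p.1) p.2)).2
        rw [hinv] at this
        refine this.trans ?_
        gcongr; exact le_max_right _ _
    have e2 : ∀ p : E d × E d, lam (mv (Q p.1) p.2) ^ n ≤ (max K K') ^ |n| * lam p.2 ^ n := by
      intro p
      have p1 := lam_pos p.2
      have p2 := lam_pos (mv (Q p.1) p.2)
      refine rpow_le_of_comparable p2 p1 (hK.trans (le_max_left _ _))
        ((h1 p.1 p.2).1.trans ?_) ?_ n
      · gcongr; exact le_max_left _ _
      · have := (h2 p.1 (mv (Q p.1) p.2)).1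
        rw [hinv] at this
        refine this.trans ?_
        gcongr; exact le_max_right _ _
    refine ⟨C * ((max K K') ^ |m| * (max K K') ^ |n|), fun p => (hC _).trans ?_⟩
    rw [mul_assoc]
    refine mul_le_mul_of_nonneg_left ?_ h0.le
    have p1 := lam_pos p.2
    have p2 := lam_pos (mv (Q p.1) p.2)
    have hm : 0 < max K K' := by linarith [le_max_left K K']
    calc _ ≤ ((max K K') ^ |m| * (1 + ‖p.2‖) ^ m) * ((max K K') ^ |n| * lam p.2 ^ n) :=
          mul_le_mul (e1 p) (e2 p) (by positivity) (by positivity)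
      _ = _ := by ring
  intro k
  induction k generalizing a m n with
  | zero =>
    obtain ⟨C, hC⟩ := hb ha
    exact ⟨fun _ => ha.smooth.comp hs, C, fun _ p _ => hC p⟩
  | succ k ih =>
    have hdc := dd_comp (ha.smooth.differentiable (by simp)) (hs.differentiable (by simp))
    simp only [fderiv_fibMap hΨ.smooth hQ] at hdc
    have hc : ∀ {f : E d → ℝ}, Cb f → (ssys d).Mem k 0 (fun _ p => ((f p.1 : ℝ) : ℂ)) :=
      fun hf => hf.ofReal.smem k
    have hcol : ∀ l, dd (0, stdVec l) (fun p => a (fibMap Ψ Q p)) = fun p =>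
        ∑ j, ((Q p.1 j l : ℝ) : ℂ) * dd (0, stdVec j) a (fibMap Ψ Q p) := by
      intro l
      rw [hdc]
      ext p
      simp [mv_apply, stdVec_apply]
    refine ssys_succ (ha.smooth.comp hs) (hb ha) (fun i => ?_) ?_ fun j => ?_
    · rw [hdc]
      refine WSys.Mem.add (WSys.Mem.sum _ fun j _ => ?_) ?_
      · refine ((hc ((hΨ.fderiv.clm_apply (Cb.const (stdVec i))).clm
          (EuclideanSpace.proj j : E d →L[ℝ] ℝ))).mul (ih (ha.dx j))).cast (by simp) fun _ _ => rfl
      · simp only [map_zero, add_zero, fderiv_mv_coord hQ]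
        have hq : ∀ j l, Cb (fun x => fderiv ℝ (fun x => Q x j l) x (stdVec i)) := fun j l =>
          (hQ j l).fderiv.clm_apply (Cb.const _)
        refine WSys.Mem.sum _ fun j _ => ?_
        push_cast
        simp only [Finset.sum_mul]
        refine WSys.Mem.sum _ fun l _ => ?_
        -- The chain rule produces (∂_x Q)_{jl} θ_l ∂_j a. For j = N, θ_l costs (1, 0) and ∂_N gains
        -- it back. For j < N the coefficient with l = N vanishes identically, and for l < N the
        -- cost (0, 1) of θ_l is offset by ∂_j.
        induction j using Fin.lastCases with
        | last =>
          exact (((hc (hq _ l)).mul (ssys_coord k l)).mul (ih ha.dlast)).cast (by simp)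
            fun _ _ => rfl
        | cast j =>
          induction l using Fin.lastCases with
          | last =>
            refine (WSys.mem_zero k _).cast rfl fun _ p => ?_
            have : (fun x => Q x j.castSucc (Fin.last d)) = fun _ => 0 := funext fun x => hQt x j
            simp [this]
          | cast l =>
            exact (((hc (hq _ _)).mul (ssys_coord_horiz k l)).mul (ih (ha.dxi j.castSucc))).cast
              (by simp) fun _ _ => rfl
    · rw [hcol]
      refine WSys.Mem.sum _ fun j _ => ?_
      -- The last column of Q has only its last entry, so ∂/∂θ_N of the composition involves only
      -- ∂_N a and keeps the full gain.
      induction j using Fin.lastCases with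
      | last => exact ((hc (hQ _ _)).mul (ih ha.dlast)).cast (by simp) fun _ _ => rfl
      | cast j => exact (WSys.mem_zero k _).cast rfl fun _ p => by simp [hQt p.1 j]
    · rw [hcol]
      exact WSys.Mem.sum _ fun l _ =>
        ((hc (hQ _ _)).mul (ih (ha.dxi l))).cast (by simp) fun _ _ => rfl

/-- Invariance of the rapidly decreasing functions. -/
theorem RS.fib {Q R : E d → Mat d} (hQ : CbMat Q) (hR : CbMat R) (hRQ : ∀ x, R x * Q x = 1)
    {a : E d × E d → ℂ} (ha : RS a) : RS (fun p => a (fibMap id Q p)) := by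
  have hs := fibMap_contDiff contDiff_id hQ
  obtain ⟨K, hK, h1⟩ := hR.norm_le
  have hc : ∀ {f : E d → ℝ}, Cb f → TMem 0 (fun p : E d × E d => ((f p.1 : ℝ) : ℂ)) :=
    fun hf => (hf.ofReal.comp Cb1.fst).tmem
  refine ha.comp hs (K := K) (fun p => ?_) (fun v _ j => ⟨0, ?_⟩) (fun v _ j => ⟨1, ?_⟩)
  · have := h1 p.1 (mv (Q p.1) p.2)
    rw [← mv_mul, hRQ, mv_one] at this
    change 1 + ‖p.2‖ ≤ K * (1 + ‖mv (Q p.1) p.2‖)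
    linarith
  · simp only [fderiv_fibMap contDiff_id hQ, fderiv_id, ContinuousLinearMap.id_apply]
    exact TMem.const _
  · simp only [fderiv_fibMap contDiff_id hQ, PiLp.add_apply, fderiv_mv_coord hQ, mv_apply]
    push_cast
    refine TMem.add (TMem.sum _ fun l _ => ?_) (TMem.sum _ fun l _ => ?_)
    · have := (hc ((hQ j l).fderiv.clm_apply (Cb.const v.1))).mul (tmem_coord l)
      simpa using this
    · exact ((hc (hQ j l)).mul (TMem.const ((v.2 l : ℝ) : ℂ))).of_le (by simp)

end fibre

/-! ### From the frame definition of symbols to the straightened class -/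

section frames
variable {d : ℕ}

/-- A symbol as a function of a single variable. -/
def unc (a : Symb d) : E d × E d → ℂ := fun p => a p.1 p.2

/-- The symbol in the coordinates `θ = A(x) ξ`. -/
def sharp (A : Frame d) (a : Symb d) : E d × E d → ℂ := fun p => a p.1 (mv (A p.1)⁻¹ p.2)

theorem dXi_eq {a : Symb d} (ha : ContDiff ℝ ∞ (unc a)) (j : Fin (d + 1)) :
    unc (dXi j a) = dd (0, stdVec j) (unc a) := by
  ext p
  exact congrFun (dd_prod_right (ha.differentiable (by simp)) (stdVec j) p.1) p.2

theorem dX_eq {a : Symb d} (ha : ContDiff ℝ ∞ (unc a)) (i : Fin (d + 1)) :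
    unc (dX i a) = dd (stdVec i, 0) (unc a) := by
  ext p
  exact congrFun (dd_prod_left (ha.differentiable (by simp)) (stdVec i) p.2) p.1

theorem dXi_smooth {a : Symb d} (ha : ContDiff ℝ ∞ (unc a)) (j : Fin (d + 1)) :
    ContDiff ℝ ∞ (unc (dXi j a)) := by
  rw [dXi_eq ha]; exact contDiff_dd ha _

theorem dX_smooth {a : Symb d} (ha : ContDiff ℝ ∞ (unc a)) (i : Fin (d + 1)) :
    ContDiff ℝ ∞ (unc (dX i a)) := by
  rw [dX_eq ha]; exact contDiff_dd ha _

theorem foldr_dXi_smooth {a : Symb d} (ha : ContDiff ℝ ∞ (unc a)) (α : List (Fin (d + 1))) :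
    ContDiff ℝ ∞ (unc (α.foldr dXi a)) := by
  induction α with
  | nil => exact ha
  | cons j α ih => exact dXi_smooth ih j

theorem sum_stdVec_mul (i : Fin (d + 1)) (f : Fin (d + 1) → ℂ) :
    ∑ j, (((stdVec i : E d) j : ℝ) : ℂ) * f j = f i := by
  rw [Finset.sum_eq_single i (fun b _ hb => by simp [stdVec_apply, hb]) (by simp)]
  simp [stdVec_apply]

variable {A : Frame d}

theorem sharp_eq (A : Frame d) (a : Symb d) :
    sharp A a = fun p => unc a (fibMap id (fun x => (A x)⁻¹) p) := rfl

theorem sharp_smooth (hA : CbGL A) {a : Symb d} (ha : ContDiff ℝ ∞ (unc a)) :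
    ContDiff ℝ ∞ (sharp A a) := ha.comp (fibMap_contDiff contDiff_id hA.inv.cb)

/-- The derivative `∑ j, B_j^l ∂/∂ξ_j`. -/
def frameXi (A : Frame d) (l : Fin (d + 1)) (a : Symb d) : Symb d := fun x ξ =>
  ∑ j, (invFrame A x j l : ℂ) * dXi j a x ξ

theorem dd_sharp (hA : CbGL A) {a : Symb d} (ha : ContDiff ℝ ∞ (unc a)) (v : E d × E d) :
    dd v (sharp A a) = fun p => ∑ j, ((v.1 j : ℝ) : ℂ) * sharp A (dX j a) p +
      ∑ j, (((fderiv ℝ (fun x => mv (A x)⁻¹) p.1 v.1 p.2 + mv (A p.1)⁻¹ v.2) j : ℝ) : ℂ) *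
        sharp A (dXi j a) p := by
  rw [sharp_eq, dd_comp (ha.differentiable (by simp))
    ((fibMap_contDiff contDiff_id hA.inv.cb).differentiable (by simp))]
  simp only [fderiv_fibMap contDiff_id hA.inv.cb, sharp_eq, dX_eq ha, dXi_eq ha, fderiv_id,
    ContinuousLinearMap.id_apply]

theorem sharp_frameXi (hA : CbGL A) {a : Symb d} (ha : ContDiff ℝ ∞ (unc a)) (l : Fin (d + 1)) :
    sharp A (frameXi A l a) = dd (0, stdVec l) (sharp A a) := by
  rw [dd_sharp hA ha]
  ext p
  simp [sharp, frameXi, invFrame, mv_apply, stdVec_apply]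

/-- With ξ = Bθ and B = A⁻¹, moving x at fixed θ moves ξ by (∂B)θ = (∂B)Aξ. The correction term in
D_i is exactly this motion. -/
theorem sharp_goodX (hA : CbGL A) {a : Symb d} (ha : ContDiff ℝ ∞ (unc a)) (i : Fin (d + 1)) :
    sharp A (goodX A i a) = dd (stdVec i, 0) (sharp A a) := by
  rw [dd_sharp hA ha]
  ext p
  simp only [map_zero, add_zero, sum_stdVec_mul]
  simp only [sharp, goodX]
  congr 1
  refine Finset.sum_congr rfl fun k _ => ?_
  have e : ∀ q, p.2 q = ∑ l, A p.1 q l * mv (A p.1)⁻¹ p.2 l := fun q =>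
    congrArg (fun v : E d => v q) (mv_mv_inv (hA.ne p.1) p.2).symm
  rw [fderiv_mv_coord hA.inv.cb]
  push_cast
  rw [Finset.sum_mul]
  refine Finset.sum_congr rfl fun q _ => ?_
  rw [e q]
  push_cast
  rw [Finset.mul_sum, Finset.sum_mul]
  refine Finset.sum_congr rfl fun l _ => ?_
  simp only [invFrame]
  ring

/-- A general ∂/∂ξ_j mixes all ∂/∂θ_i, including those with i < N, so it only has the gain of the
second order. -/
theorem sharp_dXi (hA : CbGL A) {a : Symb d} (ha : ContDiff ℝ ∞ (unc a)) (j : Fin (d + 1)) :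
    sharp A (dXi j a) = fun p => ∑ i, ((A p.1 i j : ℝ) : ℂ) * dd (0, stdVec i) (sharp A a) p := by
  have h : ∀ p, ∑ i, ((A p.1 i j : ℝ) : ℂ) * dd (0, stdVec i) (sharp A a) p =
      dd (0, mv (A p.1) (stdVec j)) (sharp A a) p := by
    intro p
    rw [dd_right_eq]
    simp [mv_apply, stdVec_apply]
  ext p
  rw [h, dd_sharp hA ha]
  dsimp only
  rw [mv_inv_mv (hA.ne p.1), map_zero, zero_apply, zero_add, sum_stdVec_mul]
  simp

/-- The symbol whose representation in the coordinates `θ = A(x) ξ` is `F`. -/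
def flat (A : Frame d) (F : E d × E d → ℂ) : Symb d := fun x ξ => F (x, mv (A x) ξ)

theorem sharp_flat (hA : CbGL A) (F : E d × E d → ℂ) : sharp A (flat A F) = F := by
  ext p
  simp [sharp, flat, mv_mv_inv (hA.ne p.1)]

theorem flat_sharp (hA : CbGL A) (a : Symb d) : flat A (sharp A a) = a := by
  ext x ξ
  simp [sharp, flat, mv_inv_mv (hA.ne x)]

theorem flat_smooth (hA : CbGL A) {F : E d × E d → ℂ} (hF : ContDiff ℝ ∞ F) :
    ContDiff ℝ ∞ (unc (flat A F)) := hF.comp (fibMap_contDiff contDiff_id hA.cb)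

theorem smooth_of_sharp (hA : CbGL A) {a : Symb d} (h : ContDiff ℝ ∞ (sharp A a)) :
    ContDiff ℝ ∞ (unc a) := by
  rw [← flat_sharp hA a]
  exact flat_smooth hA h

theorem SMem.dXi (hA : CbGL A) {m n : ℝ} {a : Symb d} (ha : SMem m n (sharp A a))
    (j : Fin (d + 1)) : SMem m (n - 1) (sharp A (dXi j a)) := by
  rw [sharp_dXi hA (smooth_of_sharp hA ha.smooth)]
  refine SMem.sum _ fun i _ => ?_
  have := (hA.cb i j).ofReal.smem.mul (ha.dxi i)
  simpa using this

theorem SMem.foldr_dXi (hA : CbGL A) {m n : ℝ} {a : Symb d} (ha : SMem m n (sharp A a))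
    (α : List (Fin (d + 1))) : SMem m (n - α.length) (sharp A (α.foldr MixedPDO.dXi a)) := by
  induction α with
  | nil => simpa using ha
  | cons j α ih =>
    refine (ih.dXi hA j).cast_order ?_
    simp only [List.length_cons]
    push_cast
    ring

theorem SMem.goodXi_iterate (hA : CbGL A) {m n : ℝ} {a : Symb d} (ha : SMem m n (sharp A a))
    (β : ℕ) : SMem (m - β) n (sharp A ((goodXi A)^[β] a)) := by
  induction β with
  | zero => simpa using ha
  | succ β ih =>
    rw [Function.iterate_succ_apply']
    change SMem _ _ (sharp A (frameXi A (Fin.last d) ((goodXi A)^[β] a)))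
    rw [sharp_frameXi hA (smooth_of_sharp hA ih.smooth)]
    have := ih.dlast
    push_cast
    rwa [sub_sub] at this

theorem SMem.foldr_goodX (hA : CbGL A) {m n : ℝ} {a : Symb d} (ha : SMem m n (sharp A a))
    (I : List (Fin (d + 1))) : SMem m n (sharp A (I.foldr (goodX A) a)) := by
  induction I with
  | nil => exact ha
  | cons i I ih =>
    change SMem m n (sharp A (goodX A i (I.foldr (goodX A) a)))
    rw [sharp_goodX hA (smooth_of_sharp hA ih.smooth)]
    exact ih.dx i

theorem rho_eq (A : Frame d) (x ξ : E d) : rho A x ξ = ‖horiz (mv (A x) ξ)‖ := by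
  rw [EuclideanSpace.norm_eq]
  simp [rho, horiz, mv_apply]

/-- The weights in the two coordinate systems are comparable. -/
theorem frame_weight (hA : CbGL A) : ∃ K : ℝ, 1 ≤ K ∧ ∀ (m n : ℝ) (x ξ : E d),
    (1 + ‖ξ‖) ^ m * (1 + rho A x ξ + Real.sqrt ‖ξ‖) ^ n ≤
      K ^ (|m| + |n|) * ((1 + ‖mv (A x) ξ‖) ^ m * lam (mv (A x) ξ) ^ n) ∧
    (1 + ‖mv (A x) ξ‖) ^ m * lam (mv (A x) ξ) ^ n ≤
      K ^ (|m| + |n|) * ((1 + ‖ξ‖) ^ m * (1 + rho A x ξ + Real.sqrt ‖ξ‖) ^ n) := by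
  obtain ⟨K1, hK1, h1⟩ := hA.cb.norm_le
  obtain ⟨K2, hK2, h2⟩ := hA.inv.cb.norm_le
  have hK : 1 ≤ max K1 K2 := hK1.trans (le_max_left _ _)
  set K := max K1 K2 with hKdef
  have hs : ∀ {s t : ℝ}, 0 ≤ s → s ≤ K * t → Real.sqrt s ≤ K * Real.sqrt t := by
    intro s t _ h
    refine (Real.sqrt_le_sqrt h).trans ?_
    rw [Real.sqrt_mul (by linarith)]
    gcongr
    exact Real.sqrt_le_iff.2 ⟨by linarith, by nlinarith⟩
  refine ⟨K, hK, fun m n x ξ => ?_⟩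
  have n1 : ‖mv (A x) ξ‖ ≤ K * ‖ξ‖ := (h1 x ξ).trans (by gcongr; exact le_max_left _ _)
  have n2 : ‖ξ‖ ≤ K * ‖mv (A x) ξ‖ := by
    have := h2 x (mv (A x) ξ)
    rw [mv_inv_mv (hA.ne x)] at this
    exact this.trans (by gcongr; exact le_max_right _ _)
  have s1 := hs (norm_nonneg _) n1
  have s2 := hs (norm_nonneg _) n2
  have p1 := lam_pos (mv (A x) ξ)
  rw [rho_eq]
  unfold lam at *
  set t := mv (A x) ξ
  have hr := norm_nonneg (horiz t)
  have p2 : 0 < 1 + ‖horiz t‖ + Real.sqrt ‖ξ‖ := by positivity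
  have hr' : ‖horiz t‖ ≤ K * ‖horiz t‖ := le_mul_of_one_le_left hr hK
  have c1 : 1 + ‖ξ‖ ≤ K * (1 + ‖t‖) := by linarith
  have c2 : 1 + ‖t‖ ≤ K * (1 + ‖ξ‖) := by linarith
  have c3 : 1 + ‖horiz t‖ + Real.sqrt ‖ξ‖ ≤ K * (1 + ‖horiz t‖ + Real.sqrt ‖t‖) := by linarith
  have c4 : 1 + ‖horiz t‖ + Real.sqrt ‖t‖ ≤ K * (1 + ‖horiz t‖ + Real.sqrt ‖ξ‖) := by linarith
  have hK0 : 0 < K := by linarith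
  rw [Real.rpow_add hK0]
  constructor
  · calc _ ≤ (K ^ |m| * (1 + ‖t‖) ^ m) * (K ^ |n| * (1 + ‖horiz t‖ + Real.sqrt ‖t‖) ^ n) :=
          mul_le_mul (rpow_le_of_comparable (by positivity) (by positivity) hK c1 c2 m)
            (rpow_le_of_comparable p2 p1 hK c3 c4 n) (by positivity) (by positivity)
      _ = _ := by ring
  · calc _ ≤ (K ^ |m| * (1 + ‖ξ‖) ^ m) * (K ^ |n| * (1 + ‖horiz t‖ + Real.sqrt ‖ξ‖) ^ n) :=
          mul_le_mul (rpow_le_of_comparable (by positivity) (by positivity) hK c2 c1 m)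
            (rpow_le_of_comparable p1 p2 hK c4 c3 n) (by positivity) (by positivity)
      _ = _ := by ring

theorem isFrameSymbol_of_smem (hA : CbGL A) {m n : ℝ} {a : Symb d} (ha : SMem m n (sharp A a)) :
    IsFrameSymbol A m n a := by
  refine ⟨smooth_of_sharp hA ha.smooth, fun α β I => ?_⟩
  obtain ⟨C, h0, hC⟩ := (((ha.foldr_goodX hA I).goodXi_iterate hA β).foldr_dXi hA α).bound
  obtain ⟨K, hK, hw⟩ := frame_weight hA
  refine ⟨C * K ^ (|m - β| + |n - α.length|), fun x ξ => ?_⟩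
  have h1 := hC (x, mv (A x) ξ)
  simp only [sharp, mv_inv_mv (hA.ne x)] at h1
  refine h1.trans ?_
  rw [mul_assoc, mul_assoc]
  exact mul_le_mul_of_nonneg_left (hw _ _ x ξ).2 h0.le

/-- Symbols all of whose derivatives in the fibre satisfy the bounds of order `(m, n)`. -/
def FibreBound (A : Frame d) (m n : ℝ) (a : Symb d) : Prop := ContDiff ℝ ∞ (unc a) ∧
  ∀ α : List (Fin (d + 1)), ∃ C : ℝ, ∀ x ξ : E d, ‖(α.foldr dXi a) x ξ‖ ≤
    C * ((1 + ‖ξ‖) ^ m * (1 + rho A x ξ + Real.sqrt ‖ξ‖) ^ (n - α.length))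

/-- The coefficients depend on x alone, so they commute with derivatives in the fibre. -/
theorem foldr_dXi_sum {c : Fin (d + 1) → E d → ℂ} {h : Fin (d + 1) → Symb d}
    (hh : ∀ j, ContDiff ℝ ∞ (unc (h j))) (α : List (Fin (d + 1))) :
    α.foldr dXi (fun x ξ => ∑ j, c j x * h j x ξ) =
      fun x ξ => ∑ j, c j x * (α.foldr dXi (h j)) x ξ := by
  induction α with
  | nil => rfl
  | cons i α ih =>
    rw [List.foldr_cons, ih]
    funext x ξ
    have hs : ∀ j, Differentiable ℝ (fun η => (α.foldr dXi (h j)) x η) := fun j =>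
      ((foldr_dXi_smooth (hh j) α).comp (contDiff_const.prodMk contDiff_id)).differentiable
        (by simp)
    exact (congrFun (dd_sum Finset.univ (fun j => (hs j).const_mul (c j x)) (stdVec i)) ξ).trans
      (Finset.sum_congr rfl fun j _ => congrFun (dd_const_mul (hs j) (c j x) (stdVec i)) ξ)

theorem frameXi_smooth (hA : CbGL A) {a : Symb d} (ha : ContDiff ℝ ∞ (unc a)) (l : Fin (d + 1)) :
    ContDiff ℝ ∞ (unc (frameXi A l a)) := by
  change ContDiff ℝ ∞ (fun p : E d × E d =>
    ∑ j, ((invFrame A p.1 j l : ℝ) : ℂ) * unc (dXi j a) p)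
  exact ContDiff.sum fun j _ => (Complex.ofRealCLM.contDiff.comp
    ((hA.inv.cb j l).smooth.comp contDiff_fst)).mul (dXi_smooth ha j)

theorem FibreBound.frameXi (hA : CbGL A) {m n : ℝ} {a : Symb d} (ha : FibreBound A m n a)
    (l : Fin (d + 1)) : FibreBound A m (n - 1) (frameXi A l a) := by
  refine ⟨frameXi_smooth hA ha.1 l, fun α => ?_⟩
  have h1 : α.foldr dXi (MixedPDO.frameXi A l a) = _ :=
    foldr_dXi_sum (c := fun j x => (invFrame A x j l : ℂ)) (fun j => dXi_smooth ha.1 j) α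
  choose C hC using fun j => ha.2 (α ++ [j])
  choose B hB0 hB using fun j => (hA.inv.cb j l).bound
  refine ⟨∑ j, B j * C j, fun x ξ => ?_⟩
  rw [h1, Finset.sum_mul]
  refine (norm_sum_le _ _).trans (Finset.sum_le_sum fun j _ => ?_)
  rw [norm_mul, mul_assoc, Complex.norm_real]
  have h2 := hC j x ξ
  rw [List.foldr_append] at h2
  have e : n - ((α ++ [j]).length : ℝ) = n - 1 - α.length := by
    rw [List.length_append]
    simp
    ring
  rw [e] at h2
  exact mul_le_mul (hB j x) h2 (norm_nonneg _) (hB0 j).le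

/-- In the coordinates (x, θ) all derivatives have constant coefficients and commute, so a new one
can be moved to its place in a fixed order. -/
theorem foldr_dd_comm {ι : Type} (u : ι → E d × E d) (v : E d × E d) {G : E d × E d → ℂ}
    (hG : ContDiff ℝ ∞ G) (L : List ι) : ContDiff ℝ ∞ (L.foldr (fun j => dd (u j)) G) ∧
      dd v (L.foldr (fun j => dd (u j)) G) = L.foldr (fun j => dd (u j)) (dd v G) := by
  induction L with
  | nil => exact ⟨hG, rfl⟩
  | cons j L ih =>
    refine ⟨contDiff_dd ih.1 _, ?_⟩
    simp only [List.foldr_cons]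
    rw [dd_comm ih.1, ih.2]

theorem iterate_dd_comm (u v : E d × E d) {G : E d × E d → ℂ} (hG : ContDiff ℝ ∞ G) (β : ℕ) :
    ContDiff ℝ ∞ ((dd u)^[β] G) ∧ dd v ((dd u)^[β] G) = (dd u)^[β] (dd v G) := by
  induction β with
  | zero => exact ⟨hG, rfl⟩
  | succ β ih =>
    rw [Function.iterate_succ_apply', Function.iterate_succ_apply']
    exact ⟨contDiff_dd ih.1 _, by rw [dd_comm ih.1, ih.2]⟩

theorem sharp_goodXi_iterate (hA : CbGL A) {a : Symb d} (ha : ContDiff ℝ ∞ (unc a)) (β : ℕ) :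
    sharp A ((goodXi A)^[β] a) = (dd (0, stdVec (Fin.last d)))^[β] (sharp A a) ∧
      ContDiff ℝ ∞ (unc ((goodXi A)^[β] a)) := by
  induction β with
  | zero => exact ⟨rfl, ha⟩
  | succ β ih =>
    rw [Function.iterate_succ_apply', Function.iterate_succ_apply']
    exact ⟨(sharp_frameXi hA ih.2 (Fin.last d)).trans (by rw [ih.1]), frameXi_smooth hA ih.2 _⟩

theorem sharp_foldr_goodX (hA : CbGL A) {a : Symb d} (ha : ContDiff ℝ ∞ (unc a))
    (I : List (Fin (d + 1))) : sharp A (I.foldr (goodX A) a) =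
      I.foldr (fun i => dd (stdVec i, 0)) (sharp A a) ∧
        ContDiff ℝ ∞ (unc (I.foldr (goodX A) a)) := by
  induction I with
  | nil => exact ⟨rfl, ha⟩
  | cons i I ih =>
    have h : sharp A ((i :: I).foldr (goodX A) a) = _ := sharp_goodX hA ih.2 i
    refine ⟨by rw [h, ih.1]; rfl, smooth_of_sharp hA ?_⟩
    rw [h]
    exact contDiff_dd (sharp_smooth hA ih.2) _

/-- The definition bounds derivatives only in the order ∂_ξ^α D_ξ^β D^I. Since coordinate
derivatives in (x, θ) commute, each one can be brought to that order, the horizontal ones outermost.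
A horizontal ∂/∂θ_j is a combination of the ∂/∂ξ_k with coefficients depending on x, which
`FibreBound` accommodates. -/
theorem smem_of_isFrameSymbol (hA : CbGL A) {m n : ℝ} {a : Symb d} (ha : IsFrameSymbol A m n a) :
    SMem m n (sharp A a) := by
  have hs : ContDiff ℝ ∞ (unc a) := ha.smooth
  have hsh := sharp_smooth hA hs
  have hI : ∀ I : List (Fin (d + 1)),
      ContDiff ℝ ∞ (I.foldr (fun i => dd (stdVec i, 0)) (sharp A a)) := fun I =>
    (foldr_dd_comm _ 0 hsh I).1
  have hβ : ∀ (β : ℕ) (I : List (Fin (d + 1))), ContDiff ℝ ∞ ((dd (0, stdVec (Fin.last d)))^[β]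
      (I.foldr (fun i => dd (stdVec i, 0)) (sharp A a))) := fun β I =>
    (iterate_dd_comm _ 0 (hI I) β).1
  refine SMem.coind (fun m' n' F => ∃ (L : List (Fin d)) (β : ℕ) (I : List (Fin (d + 1))),
    m' = m - β ∧ n' = n - L.length ∧ F = L.foldr (fun j => dd (0, stdVec j.castSucc))
      ((dd (0, stdVec (Fin.last d)))^[β] (I.foldr (fun i => dd (stdVec i, 0)) (sharp A a))))
    ?_ ?_ ?_ ?_ ⟨[], 0, [], by simp, by simp, rfl⟩
  · rintro _ _ _ ⟨L, β, I, rfl, rfl, rfl⟩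
    have key : ∃ g : Symb d, FibreBound A (m - β) (n - L.length) g ∧
        sharp A g = L.foldr (fun j => dd (0, stdVec j.castSucc))
          ((dd (0, stdVec (Fin.last d)))^[β] (I.foldr (fun i => dd (stdVec i, 0)) (sharp A a))) := by
      induction L with
      | nil =>
        obtain ⟨h1, h2⟩ := sharp_foldr_goodX hA hs I
        obtain ⟨h3, h4⟩ := sharp_goodXi_iterate hA h2 β
        refine ⟨(goodXi A)^[β] (I.foldr (goodX A) a), ⟨h4, fun α => ?_⟩, by rw [h3, h1]; rfl⟩
        obtain ⟨C, hC⟩ := ha.bound α β I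
        exact ⟨C, fun x ξ => (hC x ξ).trans_eq (by simp [mul_assoc])⟩
      | cons j L ih =>
        obtain ⟨g, hg, e⟩ := ih
        refine ⟨MixedPDO.frameXi A j.castSucc g, ?_, ?_⟩
        · have := hg.frameXi hA j.castSucc
          rw [sub_sub] at this
          simpa using this
        · rw [sharp_frameXi hA hg.1, e]
          rfl
    refine ⟨(foldr_dd_comm _ 0 (hβ β I) L).1, ?_⟩
    obtain ⟨g, hg, e⟩ := key
    obtain ⟨C, hC⟩ := hg.2 []
    obtain ⟨K, hK, hw⟩ := frame_weight hA
    refine ⟨|C| * K ^ (|m - β| + |n - L.length|), fun p => ?_⟩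
    rw [← e]
    refine (hC p.1 _).trans ?_
    have h1 := (hw (m - β) (n - L.length) p.1 (mv (A p.1)⁻¹ p.2)).1
    rw [mv_mv_inv (hA.ne p.1)] at h1
    have hr : 0 ≤ rho A p.1 (mv (A p.1)⁻¹ p.2) := Real.sqrt_nonneg _
    simp only [List.length_nil, Nat.cast_zero, sub_zero]
    rw [mul_assoc]
    exact (mul_le_mul_of_nonneg_right (le_abs_self C) (by positivity)).trans
      (mul_le_mul_of_nonneg_left h1 (abs_nonneg C))
  · rintro _ _ _ ⟨L, β, I, rfl, rfl, rfl⟩ i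
    refine ⟨L, β, i :: I, rfl, rfl, ?_⟩
    rw [(foldr_dd_comm _ _ (hβ β I) L).2, (iterate_dd_comm _ _ (hI I) β).2]
    rfl
  · rintro _ _ _ ⟨L, β, I, rfl, rfl, rfl⟩
    refine ⟨L, β + 1, I, by push_cast; ring, rfl, ?_⟩
    rw [(foldr_dd_comm _ _ (hβ β I) L).2, Function.iterate_succ_apply']
  · rintro _ _ _ ⟨L, β, I, rfl, rfl, rfl⟩ j
    exact ⟨j :: L, β, I, rfl, by simp; ring, rfl⟩

theorem isFrameSymbol_iff (hA : CbGL A) {m n : ℝ} {a : Symb d} :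
    IsFrameSymbol A m n a ↔ SMem m n (sharp A a) :=
  ⟨smem_of_isFrameSymbol hA, isFrameSymbol_of_smem hA⟩

/-- Row i of A A'⁻¹ holds the coefficients of X_i in the basis X'_l. For i < N both frames span D by
their first N - 1 vectors, so the coefficient of X'_N is zero. -/
theorem blockTri_of_adapted {D : Distr d} {A A' : Frame d} (hA : IsAdaptedFrame D A)
    (hA' : IsAdaptedFrame D A') : BlockTri (fun x => A x * (A' x)⁻¹) := by
  intro x k
  have h1 : frameVec A k.castSucc x ∈ Submodule.span ℝ
      (Set.range fun i : Fin d => frameVec A' i.castSucc x) := by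
    rw [← hA'.span_eq, hA.span_eq]
    exact Submodule.subset_span ⟨k, rfl⟩
  have h2 : ∀ v ∈ Submodule.span ℝ (Set.range fun i : Fin d => frameVec A' i.castSucc x),
      ∑ j, v j * (A' x)⁻¹ j (Fin.last d) = 0 := by
    intro v hv
    induction hv using Submodule.span_induction with
    | mem v hv =>
      obtain ⟨i, rfl⟩ := hv
      have h3 := congrFun (congrFun (Matrix.mul_nonsing_inv (A' x)
        (isUnit_iff_ne_zero.2 (hA'.gl.ne x))) i.castSucc) (Fin.last d)
      rw [Matrix.mul_apply] at h3
      simpa [frameVec, Matrix.one_apply, Fin.castSucc_ne_last] using h3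
    | zero => simp
    | add v w _ _ hv hw => simp [add_mul, Finset.sum_add_distrib, hv, hw]
    | smul c v _ hv => simp [mul_assoc, ← Finset.mul_sum, hv]
  simpa [Matrix.mul_apply, frameVec] using h2 _ h1

/-- The transplants of a by the two frames differ by θ = A A'⁻¹ θ', a block triangular change of
variable with block triangular inverse. -/
theorem isFrameSymbol_of_adapted {D : Distr d} {A A' : Frame d} (hA : IsAdaptedFrame D A)
    (hA' : IsAdaptedFrame D A') {m n : ℝ} {a : Symb d} (ha : IsFrameSymbol A m n a) :
    IsFrameSymbol A' m n a := by
  rw [isFrameSymbol_iff hA.gl] at ha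
  rw [isFrameSymbol_iff hA'.gl]
  have h1 := ha.fib Cb1.id (hA.gl.mul hA'.gl.inv).cb (hA'.gl.mul hA.gl.inv).cb
    (blockTri_of_adapted hA hA') (blockTri_of_adapted hA' hA) (fun x => by
      rw [Matrix.mul_assoc, ← Matrix.mul_assoc (A x)⁻¹, Matrix.nonsing_inv_mul _
        (isUnit_iff_ne_zero.2 (hA.gl.ne x)), Matrix.one_mul, Matrix.mul_nonsing_inv _
        (isUnit_iff_ne_zero.2 (hA'.gl.ne x))])
  convert h1 using 1
  ext p
  simp [sharp, fibMap, mv_mul, mv_inv_mv (hA.gl.ne p.1)]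

/-- By independence of the frame, membership can be tested in whichever adapted frame suits the
problem. -/
theorem mem_mixedSymbols_iff {D : Distr d} {A : Frame d} (hA : IsAdaptedFrame D A) {m n : ℝ}
    {a : Symb d} : a ∈ mixedSymbols D m n ↔ SMem m n (sharp A a) := by
  rw [← isFrameSymbol_iff hA.gl]
  exact ⟨fun ⟨A', hA', ha⟩ => isFrameSymbol_of_adapted hA' hA ha, fun ha => ⟨A, hA, ha⟩⟩

theorem constDistr_adapted : IsAdaptedFrame (constDistr d) (fun _ => 1) := by
  have h := CbGL.one (P := E d) (d := d)
  refine ⟨fun i j => (h.cb i j).smooth, fun i j => (h.cb i j).bdd, h.det, fun x => ?_⟩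
  have hv : ∀ i, frameVec (fun _ => (1 : Mat d)) i x = stdVec i := by
    intro i
    ext j
    simp [frameVec, Matrix.one_apply, stdVec_apply, eq_comm]
  simp only [hv]
  refine le_antisymm (fun v hv => ?_) (Submodule.span_le.2 ?_)
  · have h0 : v (Fin.last d) = 0 := hv
    rw [← sum_coord_smul v, Fin.sum_univ_castSucc, h0, zero_smul, add_zero]
    exact Submodule.sum_mem _ fun i _ => Submodule.smul_mem _ _ (Submodule.subset_span ⟨i, rfl⟩)
  · rintro _ ⟨i, rfl⟩
    change (stdVec i.castSucc : E d) (Fin.last d) = 0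
    simp [stdVec_apply, (Fin.castSucc_ne_last i).symm]

theorem mem_mixedSymbols_const {m n : ℝ} {a : Symb d} :
    a ∈ mixedSymbols (constDistr d) m n ↔ SMem m n (unc a) := by
  have h : sharp (fun _ => (1 : Mat d)) a = unc a := by
    ext p
    change a p.1 (mv (1 : Mat d)⁻¹ p.2) = _
    rw [inv_one, mv_one]
    rfl
  rw [mem_mixedSymbols_iff constDistr_adapted, h]

theorem unc_foldr_dX {a : Symb d} (ha : ContDiff ℝ ∞ (unc a)) (I : List (Fin (d + 1))) :
    unc (I.foldr dX a) = I.foldr (fun i => dd (stdVec i, 0)) (unc a) ∧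
      ContDiff ℝ ∞ (unc (I.foldr dX a)) := by
  induction I with
  | nil => exact ⟨rfl, ha⟩
  | cons i I ih => exact ⟨(dX_eq ih.2 i).trans (by rw [ih.1]; rfl), dX_smooth ih.2 i⟩

theorem unc_foldr_dXi {a : Symb d} (ha : ContDiff ℝ ∞ (unc a)) (I : List (Fin (d + 1))) :
    unc (I.foldr dXi a) = I.foldr (fun i => dd (0, stdVec i)) (unc a) := by
  induction I with
  | nil => rfl
  | cons i I ih => exact (dXi_eq (foldr_dXi_smooth ha I) i).trans (by rw [ih]; rfl)

theorem RS.foldr {f : E d × E d → ℂ} (hf : RS f) (u : Fin (d + 1) → E d × E d)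
    (I : List (Fin (d + 1))) : RS (I.foldr (fun i => MixedPDO.dd (u i)) f) := by
  induction I with
  | nil => exact hf
  | cons i I ih => exact ih.dd _

/-- When every power of decay is available, the extra gain |α| in the definition carries no
information. -/
theorem mem_smoothingSymbols_iff {e : Symb d} : e ∈ smoothingSymbols d ↔ RS (unc e) := by
  constructor
  · intro he r
    have hs : ContDiff ℝ ∞ (unc e) := (he 0).1
    refine TMem.coind r (fun F => ∃ α I : List (Fin (d + 1)), F =
      α.foldr (fun i => dd (0, stdVec i)) (I.foldr (fun i => dd (stdVec i, 0)) (unc e)))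
      ?_ ?_ ⟨[], [], rfl⟩
    · rintro _ ⟨α, I, rfl⟩
      obtain ⟨m, hm⟩ := exists_nat_gt (-r)
      obtain ⟨C, hC⟩ := (he m).2 α I
      obtain ⟨h1, h2⟩ := unc_foldr_dX hs I
      refine ⟨(foldr_dd_comm _ 0 (foldr_dd_comm _ 0 hs I).1 α).1, C, fun p => ?_⟩
      rw [← h1, ← unc_foldr_dXi h2]
      refine (hC p.1 p.2).trans ?_
      have hp : (0 : ℝ) < (1 + ‖p.2‖) ^ (-(m : ℝ) - α.length) := by positivity
      have hC0 : 0 ≤ C := nonneg_of_mul_nonneg_left ((norm_nonneg _).trans (hC p.1 p.2)) hp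
      gcongr
      · linarith [norm_nonneg p.2]
      · have : (0 : ℝ) ≤ α.length := Nat.cast_nonneg _
        linarith
    · rintro _ ⟨α, I, rfl⟩ v ⟨i, rfl | rfl⟩
      · refine ⟨α, i :: I, ?_⟩
        rw [(foldr_dd_comm _ _ (foldr_dd_comm _ 0 hs I).1 α).2]
        rfl
      · exact ⟨i :: α, I, rfl⟩
  · intro he m
    refine ⟨he.smooth, fun α I => ?_⟩
    obtain ⟨h1, h2⟩ := unc_foldr_dX he.smooth I
    obtain ⟨C, -, hC⟩ := (((he.foldr _ I).foldr (fun i => (0, stdVec i)) α)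
      (-(m : ℝ) - α.length)).bound
    refine ⟨C, fun x ξ => ?_⟩
    have h3 := hC (x, ξ)
    rwa [← h1, ← unc_foldr_dXi h2] at h3

theorem RS.sharp (hA : CbGL A) {e : Symb d} (he : RS (unc e)) : RS (sharp A e) :=
  he.fib hA.inv.cb hA.cb fun x => Matrix.mul_nonsing_inv _ (isUnit_iff_ne_zero.2 (hA.ne x))

theorem RS.flat (hA : CbGL A) {e : E d × E d → ℂ} (he : RS e) : RS (unc (flat A e)) :=
  he.fib hA.cb hA.inv.cb fun x => Matrix.nonsing_inv_mul _ (isUnit_iff_ne_zero.2 (hA.ne x))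

end frames

/-! ### Determinants of differentials -/

section determinants
variable {d : ℕ} {P : Type} [NormedAddCommGroup P] [NormedSpace ℝ P]

/-- The matrix of a linear map. -/
def toMat (L : E d →L[ℝ] E d) : Mat d := Matrix.of fun i j => L (stdVec j) i

theorem mv_toMat (L : E d →L[ℝ] E d) : mv (toMat L) = L := by
  ext θ i
  conv_rhs => rw [← sum_coord_smul θ]
  simp [mv_apply, toMat, mul_comm]

theorem det_toMat (L : E d →L[ℝ] E d) : (toMat L).det = L.det := by rw [← det_mv, mv_toMat]

theorem Cb.toMat {L : P → E d →L[ℝ] E d} (hL : Cb L) : CbMat (fun x => toMat (L x)) := fun i j =>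
  (hL.clm_apply (Cb.const (stdVec j))).clm (EuclideanSpace.proj i : E d →L[ℝ] ℝ)

theorem Cb.det {L : P → E d →L[ℝ] E d} (hL : Cb L) : Cb (fun x => (L x).det) := by
  simp_rw [← det_toMat]
  exact hL.toMat.det

/-- A continuous function without zeros on a connected space has constant sign. -/
theorem Cb.abs {f : P → ℝ} (hf : Cb f) (h0 : ∀ x, f x ≠ 0) : Cb (fun x => |f x|) := by
  by_cases h : ∃ a, f a ≤ 0
  · have h1 : ∀ x, f x < 0 := by
      intro x
      by_contra hx
      obtain ⟨y, hy⟩ := mem_range_of_exists_le_of_exists_ge hf.smooth.continuous h ⟨x, not_lt.1 hx⟩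
      exact h0 y hy
    simpa only [abs_of_neg (h1 _)] using hf.neg
  · have h1 : ∀ x, 0 < f x := fun x => by
      by_contra hx
      exact h ⟨x, not_lt.1 hx⟩
    simpa only [abs_of_pos (h1 _)] using hf

end determinants

/-! ### Operators in frame coordinates; smoothing operators -/

section operators
variable {d : ℕ}

/-- Change of variables. -/
theorem integral_comp_bij {F : Type} [NormedAddCommGroup F] [NormedSpace ℝ F] {Φ : E d → E d}
    {Φ' : E d → E d →L[ℝ] E d} (hb : Function.Bijective Φ) (hd : ∀ x, HasFDerivAt Φ (Φ' x) x)
    (f : E d → F) : ∫ y, f y = ∫ x, |(Φ' x).det| • f (Φ x) := by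
  have := integral_image_eq_integral_abs_det_fderiv_smul (volume : Measure (E d))
    MeasurableSet.univ (fun x _ => (hd x).hasFDerivWithinAt) hb.1.injOn f
  rwa [Set.image_univ, hb.2.range_eq, Measure.restrict_univ] at this

theorem mv_bijective {M : Mat d} (hM : M.det ≠ 0) : Function.Bijective (mv M) :=
  ⟨Function.LeftInverse.injective (mv_inv_mv hM), Function.RightInverse.surjective (mv_mv_inv hM)⟩

theorem integral_comp_mv {F : Type} [NormedAddCommGroup F] [NormedSpace ℝ F] {M : Mat d}
    (hM : M.det ≠ 0) (f : E d → F) : ∫ y, f y = ∫ x, |M.det| • f (mv M x) := by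
  rw [integral_comp_bij (mv_bijective hM) (fun x => (mv M).hasFDerivAt) f]
  simp only [det_mv]

theorem integral_mul_ft_comm {a b : E d → ℂ} (ha : Integrable a) (hb : Integrable b) :
    ∫ ξ, a ξ * ft b ξ = ∫ z, ft a z * b z := by
  have h1 : Integrable (Function.uncurry fun ξ z => a ξ * (b z * ee (inner ℝ z ξ)))
      (volume.prod volume) := by
    refine (ha.mul_prod hb).mono ?_ (Filter.Eventually.of_forall fun p => ?_)
    · have h : Continuous (fun p : E d × E d => ee (inner ℝ p.2 p.1)) :=
        contDiff_ee.continuous.comp (continuous_snd.inner continuous_fst)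
      refine ((ha.mul_prod hb).aestronglyMeasurable.mul h.aestronglyMeasurable).congr
        (Filter.Eventually.of_forall fun p => ?_)
      simp [Function.uncurry, mul_assoc]
    · simp [Function.uncurry, norm_ee]
  have h2 := integral_integral_swap h1
  unfold ft
  simp_rw [← integral_const_mul, ← integral_mul_const]
  rw [h2]
  refine integral_congr_ae (Filter.Eventually.of_forall fun z => integral_congr_ae
    (Filter.Eventually.of_forall fun ξ => ?_))
  dsimp only
  rw [real_inner_comm]
  ring

/-- The factor e^{2πi x·ξ} recentres f at x. This form is the one in which frames and phases are
compared. -/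
theorem opT_eq (a : Symb d) (f : E d → ℂ) (x : E d) :
    opT a f x = ∫ ξ, a x ξ * ft (fun z => f (x - z)) ξ := by
  refine integral_congr_ae (Filter.Eventually.of_forall fun ξ => ?_)
  dsimp only
  have h : 𝓕 f ξ * ee (inner ℝ x ξ) = ft (fun z => f (x - z)) ξ := by
    unfold ft
    rw [fourier_eq_integral_ee, ← integral_mul_const,
      ← integral_sub_left_eq_self (fun z => f (x - z) * ee (inner ℝ z ξ)) volume x]
    refine integral_congr_ae (Filter.Eventually.of_forall fun y => ?_)
    dsimp only
    rw [mul_assoc, ← ee_add, sub_sub_cancel, inner_sub_left, real_inner_comm ξ y]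
    congr 2
    ring
  rw [← h, mul_assoc]
  rfl

theorem ft_comp_mv {M : Mat d} (hM : M.det ≠ 0) (G : E d → ℂ) (ξ : E d) :
    ft G ξ = |M.det| * ft (fun u => G (mv M.transpose u)) (mv M ξ) := by
  unfold ft
  rw [integral_comp_mv (M := M.transpose) (by rwa [Matrix.det_transpose]), ← integral_const_mul]
  refine integral_congr_ae (Filter.Eventually.of_forall fun u => ?_)
  dsimp only
  rw [inner_mv, Matrix.transpose_transpose, Matrix.det_transpose, Complex.real_smul]

/-- Substitute θ = A(x)ξ; the dual substitution z = Aᵀu in space compensates the Jacobian. -/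
theorem opT_sharp {A : Frame d} (hA : CbGL A) (a : Symb d) (f : E d → ℂ) (x : E d) :
    opT a f x = ∫ θ, sharp A a (x, θ) * ft (fun u => f (x - mv (A x).transpose u)) θ := by
  rw [opT_eq]
  symm
  rw [integral_comp_mv (hA.ne x)]
  refine integral_congr_ae (Filter.Eventually.of_forall fun ξ => ?_)
  dsimp only
  rw [ft_comp_mv (hA.ne x) (fun z => f (x - z)), sharp, mv_inv_mv (hA.ne x), Complex.real_smul]
  ring

theorem Cb1.hasTemperateGrowth {g : E d → E d} (hg : Cb1 g) : g.HasTemperateGrowth := by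
  refine ⟨hg.smooth, fun n => ?_⟩
  rcases n with _ | n
  · obtain ⟨C, h0, hC⟩ := hg.lipschitz
    refine ⟨1, C + ‖g 0‖, fun x => ?_⟩
    have h1 := hC x 0
    rw [sub_zero] at h1
    have h2 := norm_sub_norm_le (g x) (g 0)
    rw [norm_iteratedFDeriv_zero, pow_one]
    nlinarith [norm_nonneg x, norm_nonneg (g 0), mul_nonneg (norm_nonneg (g 0)) (norm_nonneg x)]
  · obtain ⟨C, hC⟩ := hg.bdd (n + 1) (by omega)
    exact ⟨0, C, fun x => by simpa using hC x⟩

theorem exists_schwartz_comp {g : E d → E d} (hg : Cb1 g) {K : ℝ}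
    (hK : ∀ x, ‖x‖ ≤ K * (1 + ‖g x‖)) (f : 𝓢(E d, ℂ)) : ∃ h : 𝓢(E d, ℂ), ∀ x, h x = f (g x) :=
  ⟨SchwartzMap.compCLM ℝ hg.hasTemperateGrowth ⟨1, K, by simpa using hK⟩ f, fun _ => rfl⟩

theorem exists_schwartz_affine {M : Mat d} (hM : M.det ≠ 0) (f : 𝓢(E d, ℂ)) (x : E d) :
    ∃ h : 𝓢(E d, ℂ), ∀ u, h u = f (x - mv M u) := by
  refine exists_schwartz_comp ((Cb.const x).cb1.sub (Cb1.clm (mv M))) (K := ‖mv M⁻¹‖ * (1 + ‖x‖))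
    (fun u => ?_) f
  have h1 := ContinuousLinearMap.le_opNorm (mv M⁻¹) (mv M u)
  rw [mv_inv_mv hM] at h1
  refine h1.trans ?_
  rw [mul_assoc]
  refine mul_le_mul_of_nonneg_left ?_ (norm_nonneg _)
  have h2 : ‖mv M u‖ ≤ ‖x‖ + ‖x - mv M u‖ := by
    have := norm_sub_le x (x - mv M u)
    rwa [sub_sub_cancel] at this
  nlinarith [norm_nonneg x, norm_nonneg (x - mv M u),
    mul_nonneg (norm_nonneg x) (norm_nonneg (x - mv M u))]

theorem rd_ft_schwartz (f : 𝓢(E d, ℂ)) : RD (ft f) := by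
  have h : ft f = (𝓕⁻ f : 𝓢(E d, ℂ)) := by rw [ft_eq_fourierInv, SchwartzMap.fourierInv_coe]
  rw [h]
  refine ⟨SchwartzMap.continuous _, fun L => ⟨2 ^ (2 * L) * (Finset.Iic (2 * L, 0)).sup
    (fun m => SchwartzMap.seminorm ℝ m.1 m.2) (𝓕⁻ f : 𝓢(E d, ℂ)), fun θ => ?_⟩⟩
  have h1 := SchwartzMap.one_add_le_sup_seminorm_apply (𝕜 := ℝ) (m := (2 * L, 0)) le_rfl le_rfl
    (𝓕⁻ f : 𝓢(E d, ℂ)) θ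
  rw [norm_iteratedFDeriv_zero] at h1
  have hp : (0 : ℝ) < (1 + ‖θ‖) ^ (2 * L) := by positivity
  have e : (1 + ‖θ‖) ^ (-(2 * L : ℝ)) = ((1 + ‖θ‖) ^ (2 * L))⁻¹ := by
    rw [Real.rpow_neg (by positivity)]
    norm_cast
  rw [e, ← div_eq_mul_inv, le_div_iff₀ hp, mul_comm]
  exact h1

theorem schwartz_integral_ft_mul_ee (f : 𝓢(E d, ℂ)) (w : E d) :
    ∫ η, ft f η * ee (-(inner ℝ w η)) = f w :=
  integral_ft_mul_ee f.continuous f.integrable (rd_ft_schwartz f).integrable w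

/-- The kernel of a smoothing operator. -/
theorem opT_kernel {e : Symb d} (he : RS (unc e)) {f : E d → ℂ} (hf : Integrable f) (x : E d) :
    opT e f x = ∫ z, ft2 (unc e) (x, z) * f (x - z) := by
  rw [opT_eq]
  exact integral_mul_ft_comm (he.rd x).integrable (hf.comp_sub_left x)

theorem RS.comp_cb1 {f : E d × E d → ℂ} (hf : RS f) {Ψ : E d × E d → E d × E d} (hΨ : Cb1 Ψ)
    {K : ℝ} (hK : ∀ p, 1 + ‖p.2‖ ≤ K * (1 + ‖(Ψ p).2‖)) : RS (fun p => f (Ψ p)) := by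
  refine hf.comp hΨ.smooth hK (fun v _ j => ⟨0, ?_⟩) (fun v _ j => ⟨0, ?_⟩)
  · exact (((hΨ.fderiv.clm_apply (Cb.const v)).clm
      (ContinuousLinearMap.fst ℝ (E d) (E d))).coord j).tmem
  · exact (((hΨ.fderiv.clm_apply (Cb.const v)).clm
      (ContinuousLinearMap.snd ℝ (E d) (E d))).coord j).tmem

/-- Smoothing operators after a change of coordinates. -/
theorem smoothing_change {Φ : E d ≃ E d} (hΦ : Cb1 Φ) (hΨ : Cb1 Φ.symm) {e : Symb d}
    (he : RS (unc e)) : ∃ e' : Symb d, RS (unc e') ∧ ∀ (f : E d → ℂ), Integrable f →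
      Integrable (fun y => f (Φ.symm y)) → ∀ x,
        opT e f x = opT e' (fun y => f (Φ.symm y)) (Φ x) := by
  have hdd : ∀ y, HasFDerivAt Φ.symm (fderiv ℝ Φ.symm y) y := fun y =>
    (hΨ.smooth.differentiable (by simp) y).hasFDerivAt
  have hne : ∀ y, (fderiv ℝ Φ.symm y).det ≠ 0 := by
    intro y
    have h1 : HasFDerivAt (fun y => Φ (Φ.symm y)) ((fderiv ℝ Φ (Φ.symm y)).comp
        (fderiv ℝ Φ.symm y)) y :=
      (hΦ.smooth.differentiable (by simp) _).hasFDerivAt.comp y (hdd y)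
    simp only [Equiv.apply_symm_apply] at h1
    have h2 := h1.unique (hasFDerivAt_id y)
    have h3 : LinearMap.det ((fderiv ℝ Φ (Φ.symm y) : E d →ₗ[ℝ] E d) ∘ₗ
        (fderiv ℝ Φ.symm y : E d →ₗ[ℝ] E d)) = 1 := by
      have := congrArg (fun L : E d →L[ℝ] E d => LinearMap.det (L : E d →ₗ[ℝ] E d)) h2
      exact this.trans LinearMap.det_id
    rw [LinearMap.det_comp] at h3
    exact right_ne_zero_of_mul_eq_one h3
  have hJ : Cb (fun y => |(fderiv ℝ Φ.symm y).det|) := hΨ.fderiv.det.abs hne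
  obtain ⟨C, hC0, hC⟩ := hΦ.lipschitz
  have hsub : Cb1 (fun p : E d × E d => p.1 - p.2) := Cb1.fst.sub Cb1.snd
  have hmap : Cb1 (fun p : E d × E d => (Φ.symm p.1, Φ.symm p.1 - Φ.symm (p.1 - p.2))) :=
    (hΨ.comp Cb1.fst).prodMk ((hΨ.comp Cb1.fst).sub (hΨ.comp hsub))
  -- The kernel in the new coordinates, written in the variables y and z with the second point at y
  -- - z. It is rapidly decreasing in z because Φ is Lipschitz: |z| ≤ C|Φ⁻¹(y) - Φ⁻¹(y - z)|.
  have hK : RS (fun p : E d × E d => ((|(fderiv ℝ Φ.symm (p.1 - p.2)).det| : ℝ) : ℂ) *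
      ft2 (unc e) (Φ.symm p.1, Φ.symm p.1 - Φ.symm (p.1 - p.2))) := by
    refine (he.ft2.comp_cb1 hmap (K := 1 + C) fun p => ?_).mul (hJ.comp hsub).ofReal.tmem
    have := hC (Φ.symm p.1) (Φ.symm (p.1 - p.2))
    simp only [Equiv.apply_symm_apply, sub_sub_cancel] at this
    dsimp only
    nlinarith [norm_nonneg (Φ.symm p.1 - Φ.symm (p.1 - p.2))]
  set K' := fun p : E d × E d => ((|(fderiv ℝ Φ.symm (p.1 - p.2)).det| : ℝ) : ℂ) *
      ft2 (unc e) (Φ.symm p.1, Φ.symm p.1 - Φ.symm (p.1 - p.2)) with hK'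
  have hneg : Cb1 (fun p : E d × E d => (p.1, -p.2)) :=
    Cb1.fst.prodMk (Cb1.clm (-ContinuousLinearMap.snd ℝ (E d) (E d)))
  have he' : RS (fun p : E d × E d => ft2 K' (p.1, -p.2)) :=
    hK.ft2.comp_cb1 hneg (K := 1) fun p => by simp
  refine ⟨fun y ξ => ft2 K' (y, -ξ), he', fun f hf hf' x => ?_⟩
  -- The new symbol is the reflected transform of the kernel, so that its own kernel is recovered by
  -- Fourier inversion.
  have hinv : ∀ p, ft2 (fun p : E d × E d => ft2 K' (p.1, -p.2)) p = K' p := by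
    intro p
    have h1 := integral_ft_mul_ee (hK.rd p.1).cont (hK.rd p.1).integrable
      (hK.ft2.rd p.1).integrable p.2
    rw [← integral_neg_eq_self] at h1
    refine Eq.trans (integral_congr_ae (Filter.Eventually.of_forall fun ξ => ?_)) h1
    dsimp only
    rw [inner_neg_right, neg_neg, real_inner_comm]
    rfl
  rw [opT_kernel he hf, opT_kernel he' hf']
  change _ = ∫ z, ft2 (fun p : E d × E d => ft2 K' (p.1, -p.2)) (Φ x, z) * f (Φ.symm (Φ x - z))
  simp only [hinv]
  rw [← integral_sub_left_eq_self (fun z => ft2 (unc e) (x, z) * f (x - z)) volume x,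
    integral_comp_bij Φ.symm.bijective hdd,
    ← integral_sub_left_eq_self (fun z => K' (Φ x, z) * f (Φ.symm (Φ x - z))) volume (Φ x)]
  refine integral_congr_ae (Filter.Eventually.of_forall fun y => ?_)
  simp only [hK', sub_sub_cancel, Equiv.symm_apply_apply, Complex.real_smul]
  ring

end operators

/-! ### Cutoff functions -/

section cutoffs
variable {d : ℕ}

/-- A cutoff that equals `1` on `|u| ≤ r` and vanishes on `|u| ≥ 2r`. -/
def cutR (r : ℝ) (u : E d) : ℝ :=
  (⟨1, 2, by norm_num, by norm_num⟩ : ContDiffBump (0 : E d)) (r⁻¹ • u)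

theorem cutR_one {r : ℝ} (hr : 0 < r) {u : E d} (h : ‖u‖ ≤ r) : cutR r u = 1 := by
  refine ContDiffBump.one_of_mem_closedBall _ ?_
  rw [mem_closedBall_zero_iff, norm_smul, norm_inv, Real.norm_of_nonneg hr.le, inv_mul_le_iff₀ hr]
  simpa using h

theorem cutR_zero {r : ℝ} (hr : 0 < r) {u : E d} (h : 2 * r ≤ ‖u‖) : cutR r u = 0 := by
  refine ContDiffBump.zero_of_le_dist _ ?_
  rw [dist_zero_right, norm_smul, norm_inv, Real.norm_of_nonneg hr.le, le_inv_mul_iff₀ hr]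
  simpa [mul_comm] using h

theorem cutR_cb (r : ℝ) : Cb (cutR r : E d → ℝ) :=
  (Cb.of_compact (ContDiffBump.contDiff _) (ContDiffBump.hasCompactSupport _)).comp
    (Cb1.clm (r⁻¹ • ContinuousLinearMap.id ℝ (E d)))

theorem abs_cutR_le (r : ℝ) (u : E d) : ‖cutR r u‖ ≤ 1 := by
  unfold cutR
  rw [Real.norm_of_nonneg (ContDiffBump.nonneg _)]
  exact ContDiffBump.le_one _

theorem fderiv_cutR : ∃ L : ℝ, 0 < L ∧ ∀ r : ℝ, 0 < r → ∀ u v : E d,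
    ‖fderiv ℝ (cutR r) u v‖ ≤ L / r * ‖v‖ := by
  set b : ContDiffBump (0 : E d) := ⟨1, 2, by norm_num, by norm_num⟩ with hb
  have hcb : Cb (fun u => b u) := Cb.of_compact (ContDiffBump.contDiff _)
    (ContDiffBump.hasCompactSupport _)
  obtain ⟨L, hL, h⟩ := hcb.fderiv.bound
  refine ⟨L, hL, fun r hr u v => ?_⟩
  have h1 : HasFDerivAt (cutR r) ((fderiv ℝ (fun u => b u) (r⁻¹ • u)).comp
      (r⁻¹ • ContinuousLinearMap.id ℝ (E d))) u :=
    (hcb.smooth.differentiable (by simp) (r⁻¹ • u)).hasFDerivAt.comp u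
      (r⁻¹ • ContinuousLinearMap.id ℝ (E d)).hasFDerivAt
  rw [h1.fderiv]
  simp only [ContinuousLinearMap.comp_apply, smul_apply,
    ContinuousLinearMap.id_apply]
  refine (ContinuousLinearMap.le_of_opNorm_le _ (h _) _).trans_eq ?_
  rw [norm_smul, norm_inv, Real.norm_of_nonneg hr.le]
  ring

/-- A bounded modification of the identity that equals it on `|u| ≤ r`. -/
def cutVec (r : ℝ) (u : E d) : E d := cutR r u • u

theorem cutVec_eq {r : ℝ} (hr : 0 < r) {u : E d} (h : ‖u‖ ≤ r) : cutVec r u = u := by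
  rw [cutVec, cutR_one hr h, one_smul]

theorem cutVec_cb {r : ℝ} (hr : 0 < r) : Cb (cutVec r : E d → E d) := by
  refine Cb.of_compact ((cutR_cb r).smooth.smul contDiff_id) ?_
  refine HasCompactSupport.of_support_subset_isCompact (isCompact_closedBall (0 : E d) (2 * r)) ?_
  intro u hu
  rw [mem_closedBall_zero_iff]
  by_contra h
  exact hu (by simp [cutVec, cutR_zero hr (not_le.1 h).le])

/-- Products of a cutoff and a function on an open set with bounded derivatives. -/
theorem Cb.of_cutoff {P F : Type} [NormedAddCommGroup P] [NormedSpace ℝ P] [NormedAddCommGroup F]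
    [NormedSpace ℝ F] {U : Set P} (hU : IsOpen U) {f : P → F} (hf : ContDiffOn ℝ ∞ f U)
    (hb : ∀ k : ℕ, ∃ C : ℝ, ∀ x ∈ U, ‖iteratedFDeriv ℝ k f x‖ ≤ C) {χ : P → ℝ} (hχ : Cb χ)
    (hs : tsupport χ ⊆ U) : Cb (fun x => χ x • f x) := by
  have hz : ∀ x, x ∉ tsupport χ → (fun x => χ x • f x) =ᶠ[nhds x] fun _ => 0 := fun x hx =>
    (notMem_tsupport_iff_eventuallyEq.1 hx).mono fun y hy => by
      simp only [Pi.zero_apply] at hy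
      simp [hy]
  refine ⟨contDiff_iff_contDiffAt.2 fun x => ?_, fun k => ?_⟩
  · by_cases hx : x ∈ tsupport χ
    · exact hχ.smooth.contDiffAt.smul (hf.contDiffAt (hU.mem_nhds (hs hx)))
    · exact contDiffAt_const.congr_of_eventuallyEq (hz x hx)
  · choose C hC using hb
    choose B hB using hχ.bdd
    refine ⟨max 0 (∑ i ∈ Finset.range (k + 1), (k.choose i : ℝ) * |B i| * |C (k - i)|),
      fun x => ?_⟩
    by_cases hx : x ∈ tsupport χ
    · refine le_trans ?_ (le_max_right _ _)
      have hxU := hs hx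
      have h1 := norm_iteratedFDerivWithin_smul_le (n := k) (N := ∞) hχ.smooth.contDiffOn hf
        hU.uniqueDiffOn hxU (mod_cast le_top)
      simp only [iteratedFDerivWithin_of_isOpen _ hU hxU] at h1
      refine h1.trans (Finset.sum_le_sum fun i _ => ?_)
      gcongr
      · exact (hB i x).trans (le_abs_self _)
      · exact (hC (k - i) x hxU).trans (le_abs_self _)
    · refine le_trans (le_of_eq ?_) (le_max_left _ _)
      rw [((hz x hx).iteratedFDeriv ℝ k).eq_of_nhds]
      simp

end cutoffs

/-! ### Phase corrections and their inversion -/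

section phases
variable {d : ℕ}

theorem fderiv_partial {F : Type} [NormedAddCommGroup F] [NormedSpace ℝ F] {f : E d × E d → F}
    (hf : Differentiable ℝ f) (x u v : E d) :
    fderiv ℝ f (x, u) (0, v) = fderiv ℝ (fun u => f (x, u)) u v := by
  have h : HasFDerivAt (fun u => f (x, u)) _ u :=
    (hf (x, u)).hasFDerivAt.comp u ((hasFDerivAt_const x u).prodMk (hasFDerivAt_id u))
  simp [h.fderiv]

/-- Cutting off the difference between the identity and a phase function. -/
theorem exists_uphase {δ K M : ℝ} (hδ : 0 < δ) (hK : 0 < K) (hM : 0 < M) : ∃ r : ℝ, 0 < r ∧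
    ∀ Θ : E d × E d → E d, Cb Θ → ∀ T : E d → E d →L[ℝ] E d, Cb T → (∀ x, ‖T x‖ ≤ M) →
      (∀ x, Θ (x, x) = 0) → (∀ x v, fderiv ℝ Θ (x, x) (0, T x v) = -v) →
      (∀ x y v, ‖x - y‖ < δ →
        ‖fderiv ℝ Θ (x, y) (0, v) - fderiv ℝ Θ (x, x) (0, v)‖ ≤ K * ‖x - y‖ * ‖v‖) →
      ∃ p : E d × E d → E d, UPhase (2 * r) p ∧ (∀ q v, ‖fderiv ℝ p q (0, v)‖ ≤ 1 / 4 * ‖v‖) ∧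
        ∀ x u, ‖u‖ ≤ r → p (x, u) = u - Θ (x, x - T x u) := by
  obtain ⟨L, hL, hcut⟩ := fderiv_cutR (d := d)
  set D := K * M ^ 2 with hD
  have hD0 : 0 < D := by positivity
  -- The first bound keeps Tu in the range |Tu| < δ when |u| < 4r. The second makes the differential
  -- of the cut-off correction at most 1/4: on |u| < 4r it is bounded by 16LDr from the cutoff plus
  -- 4Dr from the function.
  set r := min (δ / (8 * M)) ((4 * (D * (16 * L + 4)))⁻¹) with hr
  have hr0 : 0 < r := by positivity
  have hr1 : M * (4 * r) < δ := by
    have : r ≤ δ / (8 * M) := min_le_left _ _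
    rw [le_div_iff₀ (by positivity)] at this
    nlinarith
  have hr2 : D * r * (16 * L + 4) ≤ 1 / 4 := by
    have h1 : r ≤ (4 * (D * (16 * L + 4)))⁻¹ := min_le_right _ _
    rw [le_inv_comm₀ hr0 (by positivity)] at h1
    have h2 : r * r⁻¹ = 1 := mul_inv_cancel₀ hr0.ne'
    nlinarith
  refine ⟨r, hr0, fun Θ hΘ T hT hTM h0 h1 h2 => ?_⟩
  have hs := cutVec_cb (d := d) (r := 4 * r) (by positivity)
  -- The inner truncation keeps T(x)u bounded, so that the composition has bounded derivatives. It
  -- is the identity wherever the outer cutoff is not zero.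
  set p : E d × E d → E d := fun q => cutR r q.2 •
    (cutVec (4 * r) q.2 - Θ (q.1, q.1 - T q.1 (cutVec (4 * r) q.2))) with hp
  have hin : Cb1 (fun q : E d × E d => (q.1, q.1 - T q.1 (cutVec (4 * r) q.2))) :=
    Cb1.fst.prodMk (Cb1.fst.sub ((hT.comp Cb1.fst).clm_apply (hs.comp Cb1.snd)).cb1)
  have hcb : Cb p := ((cutR_cb r).comp Cb1.snd).smul ((hs.comp Cb1.snd).sub (hΘ.comp hin))
  have hsupp : ∀ x u, 2 * r < ‖u‖ → p (x, u) = 0 := fun x u hu => by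
    simp [hp, cutR_zero hr0 hu.le]
  have hval : ∀ x u, ‖u‖ ≤ 4 * r → p (x, u) = cutR r u • (u - Θ (x, x - T x u)) := fun x u hu => by
    simp only [hp]
    rw [cutVec_eq (by positivity) hu]
  have hΘd := hΘ.smooth.differentiable (by simp)
  have hq : ∀ x u, HasFDerivAt (fun u => u - Θ (x, x - T x u)) (ContinuousLinearMap.id ℝ (E d) +
      ((fderiv ℝ Θ (x, x - T x u)).comp (ContinuousLinearMap.inr ℝ (E d) (E d))).comp (T x)) u := by
    intro x u
    have e1 : HasFDerivAt (fun u => (x, x - T x u)) ((0 : E d →L[ℝ] E d).prod (-T x)) u := by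
      have := (hasFDerivAt_const x u).prodMk ((T x).hasFDerivAt.const_sub x (x := u))
      exact this
    have e2 := (hasFDerivAt_id u).sub ((hΘd (x, x - T x u)).hasFDerivAt.comp u e1)
    refine e2.congr_fderiv ?_
    ext1 v
    have : ((0 : E d), -T x v) = -(0, T x v) := by simp
    simp [this, -Prod.neg_mk]
  -- The differential of u - Θ(x, x - Tu) vanishes at u = 0 by the choice of T, and it is Lipschitz
  -- in u with constant D = KM².
  have hqd : ∀ x u v, ‖u‖ < 4 * r → ‖(ContinuousLinearMap.id ℝ (E d) +
      ((fderiv ℝ Θ (x, x - T x u)).comp (ContinuousLinearMap.inr ℝ (E d) (E d))).comp (T x)) v‖ ≤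
        D * ‖u‖ * ‖v‖ := by
    intro x u v hu
    have e1 : ‖T x u‖ ≤ M * ‖u‖ := ContinuousLinearMap.le_of_opNorm_le _ (hTM x) _
    have e2 : ‖T x v‖ ≤ M * ‖v‖ := ContinuousLinearMap.le_of_opNorm_le _ (hTM x) _
    have e3 := h2 x (x - T x u) (T x v) (by
      rw [sub_sub_cancel]
      nlinarith)
    rw [sub_sub_cancel, h1] at e3
    have e4 : (ContinuousLinearMap.id ℝ (E d) + ((fderiv ℝ Θ (x, x - T x u)).comp
        (ContinuousLinearMap.inr ℝ (E d) (E d))).comp (T x)) v =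
          fderiv ℝ Θ (x, x - T x u) (0, T x v) - -v := by simp [add_comm]
    rw [e4]
    refine e3.trans ?_
    calc K * ‖T x u‖ * ‖T x v‖ ≤ K * (M * ‖u‖) * (M * ‖v‖) := by gcongr
      _ = D * ‖u‖ * ‖v‖ := by rw [hD]; ring
  have hqv : ∀ x u, ‖u‖ < 4 * r → ‖u - Θ (x, x - T x u)‖ ≤ D * ‖u‖ * ‖u‖ := by
    intro x u hu
    have e1 := Convex.norm_image_sub_le_of_norm_hasFDerivWithin_le (C := D * ‖u‖)
      (f := fun u => u - Θ (x, x - T x u)) (s := Metric.closedBall 0 ‖u‖) (x := 0) (y := u)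
      (fun w _ => (hq x w).hasFDerivWithinAt) (fun w hw => ?_) (convex_closedBall 0 ‖u‖)
      (by simp) (by simp)
    · simpa [h0] using e1
    · rw [mem_closedBall_zero_iff] at hw
      refine ContinuousLinearMap.opNorm_le_bound _ (by positivity) fun v => ?_
      refine (hqd x w v (hw.trans_lt hu)).trans ?_
      gcongr
  have hder : ∀ x u v, ‖u‖ < 4 * r → ‖fderiv ℝ p (x, u) (0, v)‖ ≤
      (L / r * D * ‖u‖ * ‖u‖ + D * ‖u‖) * ‖v‖ := by
    intro x u v hu
    rw [fderiv_partial (hcb.smooth.differentiable (by simp))]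
    have e1 : (fun u => p (x, u)) =ᶠ[nhds u] fun u => cutR r u • (u - Θ (x, x - T x u)) := by
      filter_upwards [(isOpen_lt continuous_norm continuous_const).mem_nhds hu] with w hw
      exact hval x w (le_of_lt hw)
    have e2 : HasFDerivAt (fun u => cutR r u • (u - Θ (x, x - T x u))) _ u :=
      (((cutR_cb r).smooth.differentiable (by simp) u).hasFDerivAt).smul (hq x u)
    rw [e1.fderiv_eq, e2.fderiv]
    simp only [add_apply, smul_apply,
      ContinuousLinearMap.smulRight_apply]
    refine (norm_add_le _ _).trans ?_
    rw [norm_smul, norm_smul]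
    have e3 := hqd x u v hu
    simp only [add_apply] at e3
    calc _ ≤ 1 * (D * ‖u‖ * ‖v‖) + L / r * ‖v‖ * (D * ‖u‖ * ‖u‖) := by
          gcongr
          · exact abs_cutR_le _ _
          · exact hcut r hr0 u v
          · exact hqv x u hu
      _ = _ := by ring
  have hquart : ∀ q v, ‖fderiv ℝ p q (0, v)‖ ≤ 1 / 4 * ‖v‖ := by
    rintro ⟨x, u⟩ v
    by_cases hu : ‖u‖ < 4 * r
    · refine (hder x u v hu).trans ?_
      gcongr
      have e1 : L / r * D * ‖u‖ * ‖u‖ ≤ L / r * D * (4 * r) * (4 * r) := by gcongr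
      have e2 : L / r * D * (4 * r) * (4 * r) = 16 * L * D * r := by field_simp; ring
      nlinarith
    · have e1 : p =ᶠ[nhds (x, u)] fun _ => 0 := by
        have : 2 * r < ‖u‖ := by linarith [not_lt.1 hu]
        filter_upwards [(isOpen_lt continuous_const continuous_snd.norm).mem_nhds this] with w hw
        exact hsupp w.1 w.2 hw
      rw [e1.fderiv_eq]
      simp
  refine ⟨p, ⟨by positivity, hcb, hsupp, fun x => ?_, fun x v => ?_, fun q v => ?_⟩, hquart,
    fun x u hu => ?_⟩
  · rw [hval x 0 (by simp; positivity)]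
    simp [h0]
  · have := hder x 0 v (by simp; positivity)
    simpa using this
  · exact (hquart q v).trans (by gcongr; norm_num)
  · rw [hval x u (by linarith), cutR_one hr0 hu, one_smul]

variable {ρ : ℝ} {p : E d × E d → E d}

theorem quarter_lipschitz (hp : ContDiff ℝ ∞ p)
    (hq : ∀ q v, ‖fderiv ℝ p q (0, v)‖ ≤ 1 / 4 * ‖v‖) (x u w : E d) :
    ‖p (x, u) - p (x, w)‖ ≤ 1 / 4 * ‖u - w‖ := by
  have hd := hp.differentiable (by simp)
  refine Convex.norm_image_sub_le_of_norm_fderiv_le (𝕜 := ℝ) (f := fun u => p (x, u))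
    (s := Set.univ) (fun v _ => ((hp.comp (contDiff_const.prodMk contDiff_id)).differentiable
      (by simp) v)) (fun v _ => ?_) convex_univ trivial trivial
  refine ContinuousLinearMap.opNorm_le_bound _ (by norm_num) fun z => ?_
  rw [← fderiv_partial hd]
  exact hq _ z

/-- Inversion of `u ↦ u - p(x, u)`. -/
theorem UPhase.inverse (hp : UPhase ρ p) (hq : ∀ q v, ‖fderiv ℝ p q (0, v)‖ ≤ 1 / 4 * ‖v‖) :
    ∃ g : E d × E d → E d, UPhase (2 * ρ) g ∧ (∀ x u, g (x, u - p (x, u)) = -p (x, u)) ∧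
      ∀ x w, g (x, w) = -p (x, w - g (x, w)) := by
  have hlip := quarter_lipschitz hp.cb.smooth hq
  have hpd := hp.cb.smooth.differentiable (by simp)
  have hinj : ∀ x, Function.Injective fun u => u - p (x, u) := by
    intro x u w h
    have h1 : u - w = p (x, u) - p (x, w) := by
      have : u - p (x, u) = w - p (x, w) := h
      rw [sub_eq_sub_iff_sub_eq_sub] at this
      exact this
    have h2 := hlip x u w
    rw [← h1] at h2
    have : ‖u - w‖ = 0 := by linarith [norm_nonneg (u - w)]
    exact sub_eq_zero.1 (norm_eq_zero.1 this)
  have hsurj : ∀ x, Function.Surjective fun u => u - p (x, u) := by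
    intro x v
    -- Solving u - p(x,u) = v is a fixed point problem for a contraction with constant 1/4.
    have hc : ContractingWith (1 / 4) (fun u => v + p (x, u)) := by
      refine ⟨by norm_num, LipschitzWith.of_dist_le_mul fun u w => ?_⟩
      rw [dist_eq_norm, dist_eq_norm, add_sub_add_left_eq_sub]
      simpa using hlip x u w
    refine ⟨ContractingWith.fixedPoint _ hc, ?_⟩
    have := hc.fixedPoint_isFixedPt
    rw [Function.IsFixedPt] at this
    exact sub_eq_iff_eq_add.2 this.symm
  let 𝒱 : E d × E d ≃ E d × E d := Equiv.ofBijective (fun q => (q.1, q.2 - p q)) ⟨by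
    rintro ⟨x, u⟩ ⟨y, w⟩ h
    obtain ⟨h1, h2⟩ := Prod.mk.inj h
    dsimp only at h1 h2
    subst h1
    exact congrArg (Prod.mk x) (hinj x h2), by
    rintro ⟨x, v⟩
    obtain ⟨u, hu⟩ := hsurj x v
    exact ⟨(x, u), congrArg (Prod.mk x) hu⟩⟩
  have hV : Cb1 𝒱 := Cb1.fst.prodMk (Cb1.snd.sub hp.cb.cb1)
  have hfst : ∀ q, (𝒱.symm q).1 = q.1 := fun q => by
    have h : (𝒱 (𝒱.symm q)).1 = q.1 := by rw [𝒱.apply_symm_apply]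
    exact h
  have hsnd : ∀ q, (𝒱.symm q).2 - p (𝒱.symm q) = q.2 := fun q => by
    have h : (𝒱 (𝒱.symm q)).2 = q.2 := by rw [𝒱.apply_symm_apply]
    exact h
  obtain ⟨K, hK, hKp⟩ := hp.cb.cb1.lipschitz
  -- The contraction absorbs the difference of the second components, which leaves a global
  -- Lipschitz bound for the inverse. The bound yields continuity of the inverse and bounds its
  -- differential.
  have hLip : ∀ q q', ‖𝒱.symm q - 𝒱.symm q'‖ ≤ (3 + 2 * K) * ‖q - q'‖ := by
    intro q q'
    have e1 := hfst q
    have e2 := hfst q'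
    have e3 := hsnd q
    have e4 := hsnd q'
    set a := 𝒱.symm q
    set b := 𝒱.symm q'
    have f1 : ‖q.1 - q'.1‖ ≤ ‖q - q'‖ := norm_fst_le (q - q')
    have f2 : ‖q.2 - q'.2‖ ≤ ‖q - q'‖ := norm_snd_le (q - q')
    have g1 : ‖p a - p b‖ ≤ K * ‖q.1 - q'.1‖ + 1 / 4 * ‖a.2 - b.2‖ := by
      have h1 := hKp a (b.1, a.2)
      have h2 := hlip b.1 a.2 b.2
      have h3 : ‖a - (b.1, a.2)‖ = ‖q.1 - q'.1‖ := by
        rw [← e1, ← e2]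
        simp [Prod.norm_def]
      rw [h3] at h1
      calc ‖p a - p b‖ = ‖(p a - p (b.1, a.2)) + (p (b.1, a.2) - p (b.1, b.2))‖ := by
            rw [sub_add_sub_cancel]
        _ ≤ _ := (norm_add_le _ _).trans (add_le_add h1 h2)
    have g2 : ‖a.2 - b.2‖ ≤ ‖q.2 - q'.2‖ + ‖p a - p b‖ := by
      have : a.2 - b.2 = (q.2 - q'.2) + (p a - p b) := by rw [← e3, ← e4]; abel
      rw [this]
      exact norm_add_le _ _
    have g3 : ‖a.1 - b.1‖ = ‖q.1 - q'.1‖ := by rw [e1, e2]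
    rw [Prod.norm_def]
    refine max_le ?_ ?_
    · change ‖a.1 - b.1‖ ≤ _
      nlinarith [norm_nonneg (q - q')]
    · change ‖a.2 - b.2‖ ≤ _
      nlinarith [norm_nonneg (q - q'), mul_le_mul_of_nonneg_left f1 hK.le]
  have hcont : Continuous 𝒱.symm := by
    refine (LipschitzWith.of_dist_le_mul (K := ⟨3 + 2 * K, by positivity⟩) fun q q' => ?_).continuous
    rw [dist_eq_norm, dist_eq_norm]
    exact hLip q q'
  have hVd : ∀ q, ∃ L : (E d × E d) ≃L[ℝ] (E d × E d), HasFDerivAt 𝒱 (L : _ →L[ℝ] _) q := by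
    intro q
    have h1 : HasFDerivAt (fun q : E d × E d => (q.1, q.2 - p q))
        ((ContinuousLinearMap.fst ℝ (E d) (E d)).prod
          (ContinuousLinearMap.snd ℝ (E d) (E d) - fderiv ℝ p q)) q :=
      hasFDerivAt_fst.prodMk (hasFDerivAt_snd.sub (hpd q).hasFDerivAt)
    set L := (ContinuousLinearMap.fst ℝ (E d) (E d)).prod
      (ContinuousLinearMap.snd ℝ (E d) (E d) - fderiv ℝ p q)
    have h2 : Function.Injective (L : (E d × E d) →ₗ[ℝ] (E d × E d)) := by
      rw [← LinearMap.ker_eq_bot, LinearMap.ker_eq_bot']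
      rintro ⟨a, b⟩ hab
      obtain ⟨e1, e2⟩ := Prod.mk.inj (hab : (a, b - fderiv ℝ p q (a, b)) = (0, 0))
      subst e1
      have e3 := hq q b
      have e4 : b - fderiv ℝ p q (0, b) = 0 := e2
      rw [← sub_eq_zero.1 e4] at e3
      have : ‖b‖ = 0 := by linarith [norm_nonneg b]
      rw [norm_eq_zero.1 this]
      rfl
    exact ⟨(LinearEquiv.ofInjectiveEndo _ h2).toContinuousLinearEquiv,
      h1.congr_fderiv (ContinuousLinearMap.ext fun v => rfl)⟩
  choose L hL using hVd
  have hsm : ContDiff ℝ ∞ 𝒱.symm := by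
    let h : E d × E d ≃ₜ E d × E d := ⟨𝒱, hV.smooth.continuous, hcont⟩
    exact h.contDiff_symm (f₀' := L) hL hV.smooth
  have hs1 : Cb1 𝒱.symm := hV.symm hsm (C := 3 + 2 * K) fun q => by
    refine norm_fderiv_le_of_lipschitz ℝ (C := ⟨3 + 2 * K, by positivity⟩)
      (LipschitzWith.of_dist_le_mul fun q q' => ?_)
    rw [dist_eq_norm, dist_eq_norm]
    exact hLip q q'
  set g : E d × E d → E d := fun q => -p (𝒱.symm q) with hg
  have hΓ : ∀ x w, 𝒱.symm (x, w) = (x, w - g (x, w)) := by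
    intro x w
    refine Prod.ext (hfst (x, w)) ?_
    have := hsnd (x, w)
    simp only [hg, sub_neg_eq_add]
    exact sub_eq_iff_eq_add.1 this
  have hgcb : Cb g := (hp.cb.comp hs1).neg
  have hid : ∀ x w, g (x, w) = -p (x, w - g (x, w)) := fun x w => by
    rw [← hΓ]
  have hgd := hgcb.smooth.differentiable (by simp)
  have hg0 : ∀ x, g (x, 0) = 0 := by
    intro x
    have : 𝒱.symm (x, 0) = (x, 0) := by
      rw [Equiv.symm_apply_eq]
      change _ = (x, 0 - p (x, 0))
      rw [hp.zero, sub_zero]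
    simp [hg, this, hp.zero]
  -- Implicit differentiation of g = -p(x, w - g). With |∂p| ≤ 1/4 it gives |∂g v| ≤ |v - ∂g v|/4,
  -- hence |∂g| ≤ 1/3.
  have hder : ∀ x w v, fderiv ℝ g (x, w) (0, v) =
      -fderiv ℝ p (x, w - g (x, w)) (0, v - fderiv ℝ g (x, w) (0, v)) := by
    intro x w v
    have e1 : HasFDerivAt (fun w => g (x, w)) ((fderiv ℝ g (x, w)).comp
        (ContinuousLinearMap.inr ℝ (E d) (E d))) w :=
      (hgd (x, w)).hasFDerivAt.comp w ((hasFDerivAt_const x w).prodMk (hasFDerivAt_id w))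
    have e2 : HasFDerivAt (fun w => -p (x, w - g (x, w))) _ w :=
      ((hpd (x, w - g (x, w))).hasFDerivAt.comp w
        ((hasFDerivAt_const x w).prodMk ((hasFDerivAt_id w).sub e1))).neg
    have e3 : (fun w => g (x, w)) = fun w => -p (x, w - g (x, w)) := funext fun w => hid x w
    rw [← e3] at e2
    have e4 := congrArg (fun M => M v) (e1.unique e2)
    simpa using e4
  refine ⟨g, ⟨by linarith [hp.rho_nonneg], hgcb, fun x w hw => ?_, hg0, fun x v => ?_,
    fun q v => ?_⟩, fun x u => ?_, hid⟩
  · rw [hid, neg_eq_zero]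
    refine hp.supp _ _ ?_
    by_contra hc
    have e1 := hlip x (w - g (x, w)) 0
    rw [hp.zero, sub_zero, sub_zero] at e1
    have e2 : ‖g (x, w)‖ ≤ 1 / 4 * ‖w - g (x, w)‖ := by
      conv_lhs => rw [hid, norm_neg]
      exact e1
    have e3 := norm_sub_norm_le w (g (x, w))
    linarith [not_lt.1 hc, hp.rho_nonneg]
  · rw [hder, hg0, sub_zero, hp.dzero, neg_zero]
  · have e1 := hder q.1 q.2 v
    have e2 := hq (q.1, q.2 - g q) (v - fderiv ℝ g q (0, v))
    have e3 : ‖fderiv ℝ g q (0, v)‖ ≤ 1 / 4 * ‖v - fderiv ℝ g q (0, v)‖ := by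
      have : fderiv ℝ g q (0, v) = _ := e1
      conv_lhs => rw [this, norm_neg]
      exact e2
    have e4 := norm_sub_le v (fderiv ℝ g q (0, v))
    linarith [norm_nonneg v]
  · have : 𝒱.symm (x, u - p (x, u)) = (x, u) := by
      rw [Equiv.symm_apply_eq]
      rfl
    simp [hg, this]

end phases

/-! ### Quantitative bounds for inverse matrices and determinants -/

section matrixBounds
variable {d : ℕ}

theorem abs_det_le {M : Mat d} {b : ℝ} (h : ∀ i j, |M i j| ≤ b) :
    |M.det| ≤ ((d + 1).factorial : ℝ) * b ^ (d + 1) := by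
  have := Matrix.det_le (A := M) (abv := AbsoluteValue.abs) (x := b) h
  simpa using this

theorem norm_coord_le (v : E d) (i : Fin (d + 1)) : |v i| ≤ ‖v‖ := PiLp.norm_apply_le v i

theorem norm_stdVec (i : Fin (d + 1)) : ‖(stdVec i : E d)‖ = 1 := by simp [stdVec]

theorem norm_mv_le {M : Mat d} {b : ℝ} (h : ∀ i j, |M i j| ≤ b) :
    ‖mv M‖ ≤ ((d : ℝ) + 1) ^ 2 * b := by
  have hb : 0 ≤ b := (abs_nonneg _).trans (h 0 0)
  refine ContinuousLinearMap.opNorm_le_bound _ (by positivity) fun u => ?_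
  calc ‖mv M u‖ ≤ ∑ i, ‖mv M u i‖ := norm_le_sum_coord _
    _ ≤ ∑ _i : Fin (d + 1), ∑ _j : Fin (d + 1), b * ‖u‖ := by
      refine Finset.sum_le_sum fun i _ => ?_
      rw [mv_apply]
      refine (norm_sum_le _ _).trans (Finset.sum_le_sum fun j _ => ?_)
      rw [norm_mul]
      exact mul_le_mul (h i j) (norm_coord_le u j) (norm_nonneg _) hb
    _ = _ := by
      simp
      ring

theorem abs_inv_le {M : Mat d} {b c : ℝ} (hb : 1 ≤ b) (hc : 0 < c) (h : ∀ i j, |M i j| ≤ b)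
    (hd : c ≤ |M.det|) (i j : Fin (d + 1)) :
    |M⁻¹ i j| ≤ c⁻¹ * (((d + 1).factorial : ℝ) * b ^ (d + 1)) := by
  rw [Matrix.inv_def, Matrix.smul_apply, Ring.inverse_eq_inv', smul_eq_mul, abs_mul, abs_inv,
    Matrix.adjugate_apply]
  have h1 : |(M.updateRow j (Pi.single i 1)).det| ≤ ((d + 1).factorial : ℝ) * b ^ (d + 1) := by
    refine abs_det_le fun k l => ?_
    by_cases hk : k = j
    · subst hk
      rw [Matrix.updateRow_self]
      by_cases hl : l = i
      · subst hl
        simpa using hb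
      · simp only [ne_eq, hl, not_false_eq_true, Pi.single_eq_of_ne, abs_zero]
        linarith
    · rw [Matrix.updateRow_ne hk]
      exact h k l
  have h2 : |M.det|⁻¹ ≤ c⁻¹ := inv_anti₀ hc hd
  exact mul_le_mul h2 h1 (abs_nonneg _) (by positivity)

/-- The hypothesis bounds the entries of M⁻¹ by 1/c, hence its determinant from above. -/
theorem det_lower {M : Mat d} {c : ℝ} (hc : 0 < c) (h : ∀ v, c * ‖v‖ ≤ ‖mv M v‖) :
    (((d + 1).factorial : ℝ) * c⁻¹ ^ (d + 1))⁻¹ ≤ |M.det| := by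
  have h0 : M.det ≠ 0 := by
    intro h0
    obtain ⟨v, hv, hv'⟩ := Matrix.exists_mulVec_eq_zero_iff.2 h0
    have h1 : mv M (WithLp.toLp 2 v) = 0 := by
      ext i
      exact congrFun hv' i
    have h2 := h (WithLp.toLp 2 v)
    rw [h1, norm_zero] at h2
    have h3 : ‖(WithLp.toLp 2 v : E d)‖ = 0 := by nlinarith [norm_nonneg (WithLp.toLp 2 v : E d)]
    rw [norm_eq_zero] at h3
    exact hv (funext fun i => congrArg (fun w : E d => w i) h3)
  have h1 : ∀ i j, |M⁻¹ i j| ≤ c⁻¹ := by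
    intro i j
    have h2 := h (mv M⁻¹ (stdVec j))
    rw [mv_mv_inv h0, norm_stdVec] at h2
    have h3 : mv M⁻¹ (stdVec j) i = M⁻¹ i j := by simp [mv_apply, stdVec_apply]
    rw [← h3, ← one_div c, le_div_iff₀ hc]
    exact (mul_comm _ _).trans_le ((mul_le_mul_of_nonneg_left (norm_coord_le _ i) hc.le).trans h2)
  have h2 := abs_det_le h1
  rw [Matrix.det_nonsing_inv, Ring.inverse_eq_inv', abs_inv] at h2
  exact inv_le_of_inv_le₀ (abs_pos.2 h0) h2

end matrixBounds

/-! ### The Jacobian of u ↦ u - p(x,u) -/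

section jacobian
variable {d : ℕ} {ρ : ℝ} {p : E d × E d → E d}

/-- The derivative of `u ↦ u - p(x, u)`. -/
def dV (p : E d × E d → E d) (q : E d × E d) : E d →L[ℝ] E d :=
  ContinuousLinearMap.id ℝ (E d) - (fderiv ℝ p q).comp (ContinuousLinearMap.inr ℝ (E d) (E d))

theorem hasFDerivAt_V (hp : ContDiff ℝ ∞ p) (x u : E d) :
    HasFDerivAt (fun u => u - p (x, u)) (dV p (x, u)) u :=
  (hasFDerivAt_id u).sub ((hp.differentiable (by simp) (x, u)).hasFDerivAt.comp u
    ((hasFDerivAt_const x u).prodMk (hasFDerivAt_id u)))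

theorem dV_cb (hp : Cb p) : Cb (dV p) := (Cb.const _).sub (hp.fderiv.clm_comp (Cb.const _))

/-- Since |∂p| ≤ 1/4, the differential of u - p(x,u) shortens no vector below 3/4 of its length. -/
theorem dV_det_lower (hq : ∀ q v, ‖fderiv ℝ p q (0, v)‖ ≤ 1 / 4 * ‖v‖) :
    ∃ c : ℝ, 0 < c ∧ ∀ q, c ≤ |(dV p q).det| := by
  refine ⟨(((d + 1).factorial : ℝ) * (3 / 4 : ℝ)⁻¹ ^ (d + 1))⁻¹, by positivity, fun q => ?_⟩
  rw [← det_toMat]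
  refine det_lower (c := 3 / 4) (by norm_num) fun v => ?_
  rw [mv_toMat]
  have h1 := hq q v
  have h2 := norm_sub_norm_le v (fderiv ℝ p q (0, v))
  have h3 : dV p q v = v - fderiv ℝ p q (0, v) := rfl
  rw [h3]
  linarith

end jacobian

/-! ### Representation of operators by phase functions -/

section representation
variable {d : ℕ}

theorem UPhase.mono {ρ ρ' : ℝ} {g : E d × E d → E d} (hg : UPhase ρ g) (h : ρ ≤ ρ') :
    UPhase ρ' g :=
  ⟨hg.rho_nonneg.trans h, hg.cb, fun x w hw => hg.supp x w (h.trans_lt hw), hg.zero, hg.dzero,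
    hg.half⟩

theorem UAmpl.of_cb {ρ : ℝ} (hρ : 0 ≤ ρ) {ψ : E d × E d → ℂ} (h : Cb ψ)
    (hs : ∀ x w, ρ < ‖w‖ → ψ (x, w) = 0) : UAmpl ρ 0 ψ :=
  ⟨h, ⟨h.smooth, hs⟩, h.vmem hρ ⟨h.smooth, hs⟩ (Or.inl le_rfl)⟩

theorem UAmpl.opU_smem {ρ : ℝ} {ψ : E d × E d → ℂ} {g : E d × E d → E d} (hψ : UAmpl ρ 0 ψ)
    (hg : UPhase ρ g) {m n : ℝ} {b : E d × E d → ℂ} (hb : SMem m n b) : SMem m n (opU ψ g b) := by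
  have := MixedPDO.opU_smem hg hψ hb
  simpa using this

/-- The x-derivatives of T(x)u grow with u. On the support of φ(T(x)u) the variable u is bounded, so
it may be truncated without changing the function. -/
theorem cut_comp_cb {φ : E d → ℂ} (hφ : Cb φ) {T : E d → E d →L[ℝ] E d} (hT : Cb T) {r : ℝ}
    (hr : 0 < r) (h : ∀ x u, φ (T x u) ≠ 0 → ‖u‖ ≤ r) :
    Cb (fun q : E d × E d => φ (T q.1 q.2)) := by
  have h1 : Cb (fun q : E d × E d => (cutR r q.2 : ℂ) * φ (T q.1 (cutVec (2 * r) q.2))) :=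
    ((cutR_cb r).comp Cb1.snd).ofReal.mul (hφ.comp
      ((hT.comp Cb1.fst).clm_apply ((cutVec_cb (by positivity)).comp Cb1.snd)).cb1)
  convert h1 using 1
  ext q
  by_cases h2 : ‖q.2‖ ≤ 2 * r
  · rw [cutVec_eq (by positivity) h2]
    by_cases h3 : φ (T q.1 q.2) = 0
    · simp [h3]
    · simp [cutR_one hr (h _ _ h3)]
  · rw [cutR_zero hr (not_le.1 h2).le]
    by_contra h3
    have := h q.1 q.2 (by simpa using h3)
    linarith

/-- A frame `A` and a phase function `Θ` with `Θ(x, x - Aᵀu) = u - p(x, u)` on the support of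
`φ(Aᵀu)`, together with the inverse `w ↦ w - g(x, w)` of `u ↦ u - p(x, u)`. -/
structure PhaseData (A : Frame d) (Θ : E d → E d → E d) (φ : E d → ℂ) (ρ : ℝ)
    (p g : E d × E d → E d) : Prop where
  gl : CbGL A
  pos : 0 < ρ
  p_phase : UPhase ρ p
  quarter : ∀ q v, ‖fderiv ℝ p q (0, v)‖ ≤ 1 / 4 * ‖v‖
  g_phase : UPhase ρ g
  left : ∀ x u, g (x, u - p (x, u)) = -p (x, u)
  right : ∀ x w, g (x, w) = -p (x, w - g (x, w))
  smooth : Cb φ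
  supp : ∀ x u, φ (mv (A x).transpose u) ≠ 0 → ‖u‖ ≤ ρ / 2
  eq : ∀ x u, φ (mv (A x).transpose u) ≠ 0 → Θ x (x - mv (A x).transpose u) = u - p (x, u)
  one : ∃ s : ℝ, 0 < s ∧ ∀ x u, ‖u‖ < s → φ (mv (A x).transpose u) = 1

variable {A : Frame d} {Θ : E d → E d → E d} {φ : E d → ℂ} {ρ : ℝ} {p g : E d × E d → E d}

/-- The amplitude `φ(Aᵀu)`. -/
def cutAmp (A : Frame d) (φ : E d → ℂ) (q : E d × E d) : ℂ := φ (mv (A q.1).transpose q.2)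

/-- The amplitude `|det A| φ(Aᵀu) / |det ∂(u - p)/∂u|` at `u = w - g(x, w)`. -/
def outAmp (A : Frame d) (φ : E d → ℂ) (p g : E d × E d → E d) (q : E d × E d) : ℂ :=
  ((|(A q.1).det| * |(dV p (q.1, q.2 - g q)).det|⁻¹ : ℝ) : ℂ) * cutAmp A φ (q.1, q.2 - g q)

/-- The amplitude `φ(Aᵀu) |det ∂(u - p)/∂u| / |det A|`. -/
def inAmp (A : Frame d) (φ : E d → ℂ) (p : E d × E d → E d) (q : E d × E d) : ℂ :=
  ((|(dV p q).det| * |(A q.1).det|⁻¹ : ℝ) : ℂ) * cutAmp A φ q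

theorem abs_det_cb (hA : CbGL A) : Cb (fun x => |(A x).det|) := hA.cb.det.abs hA.ne

theorem abs_det_inv_cb (hA : CbGL A) : Cb (fun x => |(A x).det|⁻¹) := by
  obtain ⟨c, h0, h⟩ := hA.det
  exact (abs_det_cb hA).inv h0 (by simpa using h)

namespace PhaseData

theorem dV_ne (h : PhaseData A Θ φ ρ p g) (q : E d × E d) : (dV p q).det ≠ 0 := by
  obtain ⟨c, h0, hc⟩ := dV_det_lower h.quarter
  exact abs_pos.1 (h0.trans_le (hc q))

theorem cutAmp_cb (h : PhaseData A Θ φ ρ p g) : Cb (cutAmp A φ) :=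
  cut_comp_cb h.smooth h.gl.transpose.cb.mv (half_pos h.pos) h.supp

theorem cutAmp_supp (h : PhaseData A Θ φ ρ p g) (x u : E d) (hu : ρ / 2 < ‖u‖) :
    cutAmp A φ (x, u) = 0 := by
  by_contra hc
  linarith [h.supp x u hc]

theorem abs_dV_cb (h : PhaseData A Θ φ ρ p g) : Cb (fun q => |(dV p q).det|) :=
  (dV_cb h.p_phase.cb).det.abs h.dV_ne

theorem inAmp_ampl (h : PhaseData A Θ φ ρ p g) : UAmpl ρ 0 (inAmp A φ p) := by
  refine UAmpl.of_cb h.pos.le ((h.abs_dV_cb.mul ((abs_det_inv_cb h.gl).comp Cb1.fst)).ofReal.mul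
    h.cutAmp_cb) fun x w hw => ?_
  rw [inAmp, h.cutAmp_supp x w (by linarith [h.pos]), mul_zero]

theorem inv_cb1 (h : PhaseData A Θ φ ρ p g) : Cb1 (fun q : E d × E d => (q.1, q.2 - g q)) :=
  Cb1.fst.prodMk (Cb1.snd.sub h.g_phase.cb.cb1)

theorem outAmp_ampl (h : PhaseData A Θ φ ρ p g) : UAmpl ρ 0 (outAmp A φ p g) := by
  obtain ⟨c, h0, hc⟩ := dV_det_lower h.quarter
  refine UAmpl.of_cb h.pos.le (((((abs_det_cb h.gl).comp Cb1.fst).mul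
    ((h.abs_dV_cb.inv h0 (by simpa using hc)).comp h.inv_cb1)).ofReal).mul
      (h.cutAmp_cb.comp h.inv_cb1)) fun x w hw => ?_
  rw [outAmp]
  refine mul_eq_zero_of_right _ (h.cutAmp_supp x _ ?_)
  by_contra hle
  have e1 := quarter_lipschitz h.p_phase.cb.smooth h.quarter x (w - g (x, w)) 0
  rw [h.p_phase.zero, sub_zero, sub_zero] at e1
  have e2 : ‖w‖ ≤ ‖w - g (x, w)‖ + ‖g (x, w)‖ := by
    conv_lhs => rw [← sub_add_cancel w (g (x, w))]
    exact norm_add_le _ _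
  have e3 : ‖g (x, w)‖ = ‖p (x, w - g (x, w))‖ := by
    conv_lhs => rw [h.right, norm_neg]
  simp only [not_lt] at hle
  linarith [h.pos]

theorem outAmp_V (h : PhaseData A Θ φ ρ p g) (x u : E d) :
    outAmp A φ p g (x, u - p (x, u)) =
      ((|(A x).det| * |(dV p (x, u)).det|⁻¹ : ℝ) : ℂ) * cutAmp A φ (x, u) := by
  have e : u - p (x, u) - g (x, u - p (x, u)) = u := by rw [h.left]; abel
  simp only [outAmp, e]

/-- Substitute y = x - Aᵀu and then w = u - p(x,u). The phase becomes the linear one w·ξ, and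
`outAmp` collects the cutoff and both Jacobians. -/
theorem phaseInner_eq (h : PhaseData A Θ φ ρ p g) (a : Symb d) (f : E d → ℂ) (x ξ : E d) :
    phaseInner Θ φ a f x ξ = a x ξ * ft (fun w => outAmp A φ p g (x, w) *
      f (x - mv (A x).transpose (w - g (x, w)))) ξ := by
  have hdet : (A x).transpose.det ≠ 0 := by
    rw [Matrix.det_transpose]
    exact h.gl.ne x
  have hb : Function.Bijective (fun u => u - p (x, u)) := by
    refine ⟨Function.LeftInverse.injective (g := fun w => w - g (x, w)) fun u => ?_,
      Function.RightInverse.surjective (g := fun w => w - g (x, w)) fun w => ?_⟩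
    · dsimp only
      rw [h.left]
      abel
    · have := neg_eq_iff_eq_neg.2 (h.right x w)
      dsimp only
      rw [← this]
      abel
  have hR := integral_comp_bij hb (hasFDerivAt_V h.p_phase.cb.smooth x) (fun w =>
    outAmp A φ p g (x, w) * f (x - mv (A x).transpose (w - g (x, w))) * ee (inner ℝ w ξ))
  unfold phaseInner ft
  rw [hR, ← integral_sub_left_eq_self _ volume x, integral_comp_mv hdet, ← integral_const_mul]
  refine integral_congr_ae (Filter.Eventually.of_forall fun u => ?_)
  have e : u - p (x, u) - g (x, u - p (x, u)) = u := by rw [h.left]; abel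
  dsimp only
  rw [h.outAmp_V, e, sub_sub_cancel, Matrix.det_transpose, cutAmp]
  dsimp only
  -- Off the support of the cutoff Θ is not related to p, but both sides vanish.
  by_cases h0 : φ (mv (A x).transpose u) = 0
  · simp [h0]
  · rw [h.eq x u h0, Complex.real_smul, Complex.real_smul]
    have hne : ((|(dV p (x, u)).det| : ℝ) : ℂ) ≠ 0 := by
      rw [Complex.ofReal_ne_zero, abs_ne_zero]
      exact h.dV_ne _
    rw [ee]
    push_cast
    field_simp

theorem inner_cc (h : PhaseData A Θ φ ρ p g) (f : 𝓢(E d, ℂ)) (x : E d) :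
    Cc (fun w => outAmp A φ p g (x, w) * f (x - mv (A x).transpose (w - g (x, w)))) := by
  have h1 := h.outAmp_ampl.supp.cc x
  have h2 : ContDiff ℝ ∞ (fun w : E d => f (x - mv (A x).transpose (w - g (x, w)))) :=
    (f.smooth ⊤).comp (contDiff_const.sub ((mv (A x).transpose).contDiff.comp
      (contDiff_id.sub (h.g_phase.cb.smooth.comp (contDiff_const.prodMk contDiff_id)))))
  convert h1.mul h2 using 2
  exact mul_comm _ _

theorem integrable_phaseInner (h : PhaseData A Θ φ ρ p g) {m n : ℝ} {a : Symb d}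
    (ha : SMem m n (unc a)) (f : 𝓢(E d, ℂ)) (x : E d) : Integrable (phaseInner Θ φ a f x) := by
  rw [funext (h.phaseInner_eq a f x)]
  exact integrable_mul_ft (ha.xgrowth.pg x) (h.inner_cc f x)

theorem exists_F (h : PhaseData A Θ φ ρ p g) (f : 𝓢(E d, ℂ)) (x : E d) :
    ∃ F : 𝓢(E d, ℂ), ∀ u, F u = f (x - mv (A x).transpose u) :=
  exists_schwartz_affine (by rw [Matrix.det_transpose]; exact h.gl.ne x) f x

/-- By `integral_opU_mul`, the substitution found in `phaseInner_eq` is the action of `opU` with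
phase correction g on the symbol. No error term occurs. -/
theorem phaseOp_eq (h : PhaseData A Θ φ ρ p g) {m n : ℝ} {a : Symb d} (ha : SMem m n (unc a))
    (f : 𝓢(E d, ℂ)) (x : E d) : phaseOp Θ φ a f x =
      ∫ θ, opU (outAmp A φ p g) g (unc a) (x, θ) *
        ft (fun u => f (x - mv (A x).transpose u)) θ := by
  obtain ⟨F, hF⟩ := h.exists_F f x
  simp only [← hF]
  rw [integral_opU_mul h.outAmp_ampl.cb h.outAmp_ampl.supp h.g_phase.cb ha.xgrowth
    (rd_ft_schwartz F) x]
  simp only [schwartz_integral_ft_mul_ee, hF]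
  exact integral_congr_ae (Filter.Eventually.of_forall fun ξ => h.phaseInner_eq a f x ξ)

theorem sq_flat (h : PhaseData A Θ φ ρ p g) :
    Flat ρ (fun q => cutAmp A φ q * cutAmp A φ q) := by
  have hcb := h.cutAmp_cb.mul h.cutAmp_cb
  obtain ⟨s, h0, hs⟩ := h.one
  refine ⟨hcb, ⟨hcb.smooth, fun x w hw => ?_⟩, s, h0, fun x w hw => ?_⟩
  · rw [h.cutAmp_supp x w (by linarith [h.pos]), mul_zero]
  · simp only [cutAmp]
    rw [hs x w hw, hs x 0 (by simpa using h0)]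

/-- The substitutions by p and by g are inverse to each other. The Jacobians in `inAmp` and `outAmp`
cancel, which leaves the linear phase and the square of the cutoff. -/
theorem phaseOp_inAmp (h : PhaseData A Θ φ ρ p g) {m n : ℝ} {b : E d × E d → ℂ}
    (hb : SMem m n b) (f : 𝓢(E d, ℂ)) (x : E d) :
    phaseOp Θ φ (fun x ξ => opU (inAmp A φ p) p b (x, ξ)) f x =
      ∫ θ, opU (fun q => cutAmp A φ q * cutAmp A φ q) (fun _ => 0) b (x, θ) *
        ft (fun u => f (x - mv (A x).transpose u)) θ := by
  obtain ⟨F, hF⟩ := h.exists_F f x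
  have h1 : ∀ ξ, phaseInner Θ φ (fun x ξ => opU (inAmp A φ p) p b (x, ξ)) f x ξ = _ :=
    h.phaseInner_eq _ f x
  have h2 : phaseOp Θ φ (fun x ξ => opU (inAmp A φ p) p b (x, ξ)) f x = _ :=
    integral_congr_ae (Filter.Eventually.of_forall h1)
  have hcc := h.inner_cc f x
  rw [h2]
  simp only [← hF]
  rw [integral_opU_mul h.inAmp_ampl.cb h.inAmp_ampl.supp h.p_phase.cb hb.xgrowth
    (by simpa only [← hF] using hcc.rd_ft) x,
    integral_opU_mul h.sq_flat.cb h.sq_flat.supp (Cb.const 0) hb.xgrowth (rd_ft_schwartz F) x]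
  simp only [hF]
  simp only [hcc.integral_ft_mul_ee, sub_zero]
  simp only [← hF]
  simp only [schwartz_integral_ft_mul_ee]
  congr 1
  ext η
  congr 2
  ext u
  have e : u - p (x, u) - g (x, u - p (x, u)) = u := by rw [h.left]; abel
  rw [h.outAmp_V, e, inAmp]
  have hne : ((|(dV p (x, u)).det| : ℝ) : ℂ) ≠ 0 := by
    rw [Complex.ofReal_ne_zero, abs_ne_zero]
    exact h.dV_ne _
  have hne' : ((|(A x).det| : ℝ) : ℂ) ≠ 0 := by
    rw [Complex.ofReal_ne_zero, abs_ne_zero]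
    exact h.gl.ne _
  push_cast
  field_simp

theorem integrable_sharp (h : PhaseData A Θ φ ρ p g) {m n : ℝ} {b : E d × E d → ℂ}
    (hb : SMem m n b) (f : 𝓢(E d, ℂ)) (x : E d) :
    Integrable (fun θ => b (x, θ) * ft (fun u => f (x - mv (A x).transpose u)) θ) := by
  obtain ⟨F, hF⟩ := h.exists_F f x
  simp only [← hF]
  exact (rd_ft_schwartz F).integrable_mul (hb.xgrowth.pg x)

/-- The transplanted symbol is `opU` with amplitude `outAmp` and phase g applied to a₀, plus the
transplant of e. -/
theorem exists_symbol (h : PhaseData A Θ φ ρ p g) {m n : ℝ} {a₀ e : Symb d}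
    (ha : SMem m n (unc a₀)) (he : RS (unc e)) : ∃ a : Symb d, SMem m n (sharp A a) ∧
      ∀ (f : 𝓢(E d, ℂ)) (x : E d), opT a f x = phaseOp Θ φ a₀ f x + opT e f x := by
  have h1 := h.outAmp_ampl.opU_smem h.g_phase ha
  have h2 := (he.sharp h.gl).smem m n
  refine ⟨flat A fun q => opU (outAmp A φ p g) g (unc a₀) q + sharp A e q, ?_, fun f x => ?_⟩
  · rw [sharp_flat h.gl]
    exact fun k => (h1 k).add (h2 k)
  · rw [opT_sharp h.gl, opT_sharp h.gl, h.phaseOp_eq ha, sharp_flat h.gl,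
      ← integral_add (h.integrable_sharp h1 f x) (h.integrable_sharp h2 f x)]
    exact integral_congr_ae (Filter.Eventually.of_forall fun θ => add_mul _ _ _)

/-- With a₀ the image of a♯ under `opU` with amplitude `inAmp` and phase p, the composition is a
flat operator whose amplitude is 1 at w = 0. It differs from the identity by a rapidly decreasing
symbol, whose negative is e. -/
theorem exists_phaseOp (h : PhaseData A Θ φ ρ p g) {m n : ℝ} {a : Symb d}
    (ha : SMem m n (sharp A a)) : ∃ a₀ e : Symb d, SMem m n (unc a₀) ∧ RS (unc e) ∧
      ∀ (f : 𝓢(E d, ℂ)) (x : E d), opT a f x = phaseOp Θ φ a₀ f x + opT e f x := by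
  have h1 := h.inAmp_ampl.opU_smem h.p_phase ha
  have hone : ∀ x, cutAmp A φ (x, 0) = 1 := fun x => by
    obtain ⟨s, h0, hs⟩ := h.one
    exact hs x 0 (by simpa using h0)
  have h2 : RS (fun q => opU (fun q => cutAmp A φ q * cutAmp A φ q) (fun _ => 0) (sharp A a) q -
      sharp A a q) := by
    refine RS.of_smem (m := m) (n := n) fun l => ?_
    have := h.sq_flat.opU_sub_smem ha l
    simpa only [hone, one_mul] using this
  have h3 := h2.mul (TMem.const (-1))
  refine ⟨fun x ξ => opU (inAmp A φ p) p (sharp A a) (x, ξ), flat A _, h1, h3.flat h.gl,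
    fun f x => ?_⟩
  have h4 : SMem m n (opU (fun q => cutAmp A φ q * cutAmp A φ q) (fun _ => 0) (sharp A a)) :=
    fun k => ((ha k).add ((h2.smem m n) k)).cast rfl fun _ _ => by ring
  rw [opT_sharp h.gl, opT_sharp h.gl, h.phaseOp_inAmp ha, sharp_flat h.gl,
    ← integral_add (h.integrable_sharp h4 f x) (h.integrable_sharp (h3.smem m n) f x)]
  refine integral_congr_ae (Filter.Eventually.of_forall fun θ => ?_)
  dsimp only
  ring

end PhaseData

end representation

/-! ### Phase functions and their dual frames -/

section phaseFunctions
variable {d : ℕ}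

theorem isOpen_tube (δ : ℝ) : IsOpen (tube d δ) :=
  isOpen_lt (continuous_fst.sub continuous_snd).norm continuous_const

theorem convex_tube (δ : ℝ) : Convex ℝ (tube d δ) := by
  have h : tube d δ = (ContinuousLinearMap.fst ℝ (E d) (E d) -
      ContinuousLinearMap.snd ℝ (E d) (E d)) ⁻¹' Metric.ball 0 δ := by
    ext p
    simp [tube]
  rw [h]
  exact (convex_ball 0 δ).linear_preimage
    (ContinuousLinearMap.fst ℝ (E d) (E d) - ContinuousLinearMap.snd ℝ (E d) (E d)).toLinearMap

theorem diag_mem_tube {δ : ℝ} (hδ : 0 < δ) (x : E d) : (x, x) ∈ tube d δ := by simpa [tube] using hδ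

variable {δ c₀ : ℝ} {C : ℕ → ℝ} {Θ : E d → E d → E d}

/-- A phase function as a function of a single variable. -/
def uncΘ (Θ : E d → E d → E d) (q : E d × E d) : E d := Θ q.1 q.2

theorem IsPhase.differentiableAt (h : IsPhase δ C c₀ Θ) {q : E d × E d} (hq : q ∈ tube d δ) :
    DifferentiableAt ℝ (uncΘ Θ) q :=
  (h.smooth.contDiffAt ((isOpen_tube δ).mem_nhds hq)).differentiableAt (by simp)

/-- Mean value inequality on the convex set Δ, with the constant C₂ that bounds the second
derivatives. -/
theorem IsPhase.lipschitz_fderiv (h : IsPhase δ C c₀ Θ) {x y : E d} (hxy : ‖x - y‖ < δ) (v : E d) :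
    ‖fderiv ℝ (uncΘ Θ) (x, y) (0, v) - fderiv ℝ (uncΘ Θ) (x, x) (0, v)‖ ≤
      C 2 * ‖x - y‖ * ‖v‖ := by
  have hδ : 0 < δ := (norm_nonneg _).trans_lt hxy
  have h1 := Convex.norm_image_sub_le_of_norm_fderiv_le (𝕜 := ℝ) (f := fderiv ℝ (uncΘ Θ)) (C := C 2)
    (fun q hq => ?_) (fun q hq => ?_) (convex_tube δ) (diag_mem_tube hδ x)
    (show (x, y) ∈ tube d δ from hxy)
  · have e1 : ‖(x, y) - (x, x)‖ = ‖x - y‖ := by simp [Prod.norm_def, norm_sub_rev]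
    have e2 : ‖((0 : E d), v)‖ = ‖v‖ := by simp [Prod.norm_def]
    rw [e1] at h1
    have h2 := ContinuousLinearMap.le_of_opNorm_le _ h1 ((0 : E d), v)
    rwa [e2] at h2
  · exact ((h.smooth.contDiffAt ((isOpen_tube δ).mem_nhds hq)).fderiv_right
      (m := 1) (by norm_cast)).differentiableAt (by simp)
  · have := h.bounded 2 q hq
    rwa [← norm_iteratedFDeriv_fderiv, norm_iteratedFDeriv_one] at this

theorem IsPhase.fderiv_diag (h : IsPhase δ C c₀ Θ) (hδ : 0 < δ) (x w : E d) :
    fderiv ℝ (uncΘ Θ) (x, x) (0, w) = fderiv ℝ (fun y => Θ x y) x w := by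
  have h1 : HasFDerivAt (fun y => Θ x y) _ x :=
    (h.differentiableAt (diag_mem_tube hδ x)).hasFDerivAt.comp x
      ((hasFDerivAt_const x x).prodMk (hasFDerivAt_id x))
  simp [h1.fderiv]

theorem fderiv_eq_phaseMatrix (Θ : E d → E d → E d) (x w : E d) :
    fderiv ℝ (fun y => Θ x y) x w = -mv (phaseMatrix Θ x).transpose w := by
  conv_lhs => rw [← sum_coord_smul w]
  ext k
  simp [phaseMatrix, mv_apply, mul_comm]

theorem IsPhase.abs_phaseMatrix_le (h : IsPhase δ C c₀ Θ) (hδ : 0 < δ) (x : E d)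
    (j k : Fin (d + 1)) : |phaseMatrix Θ x j k| ≤ C 1 := by
  have h1 := h.bounded 1 _ (diag_mem_tube hδ x)
  rw [norm_iteratedFDeriv_one] at h1
  have h2 := ContinuousLinearMap.le_of_opNorm_le _ h1 ((0 : E d), (stdVec j : E d))
  rw [show ‖((0 : E d), (stdVec j : E d))‖ = 1 by simp [Prod.norm_def, norm_stdVec], mul_one] at h2
  have h3 := h.fderiv_diag hδ x (stdVec j)
  unfold uncΘ at h3
  rw [h3] at h2
  simp only [phaseMatrix, Matrix.of_apply, abs_neg]
  exact (norm_coord_le _ k).trans h2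

/-- A phase function multiplied with a cutoff. -/
def cutΘ (δ : ℝ) (Θ : E d → E d → E d) (q : E d × E d) : E d := cutR (δ / 3) (q.1 - q.2) • uncΘ Θ q

theorem IsPhase.cutΘ_cb (h : IsPhase δ C c₀ Θ) (hδ : 0 < δ) : Cb (cutΘ δ Θ) := by
  refine Cb.of_cutoff (isOpen_tube δ) h.smooth (fun k => ⟨C k, h.bounded k⟩)
    ((cutR_cb (δ / 3)).comp (Cb1.fst.sub Cb1.snd)) ?_
  have h1 : tsupport (fun q : E d × E d => cutR (δ / 3) (q.1 - q.2)) ⊆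
      {q | ‖q.1 - q.2‖ ≤ 2 * (δ / 3)} := by
    refine closure_minimal (fun q hq => ?_)
      (isClosed_le (continuous_fst.sub continuous_snd).norm continuous_const)
    by_contra hc
    exact hq (cutR_zero (by positivity) (not_le.1 hc).le)
  intro q hq
  have : ‖q.1 - q.2‖ ≤ 2 * (δ / 3) := h1 hq
  change ‖q.1 - q.2‖ < δ
  linarith

theorem cutΘ_eq (hδ : 0 < δ) {q : E d × E d} (hq : ‖q.1 - q.2‖ ≤ δ / 3) :
    cutΘ δ Θ q = uncΘ Θ q := by
  rw [cutΘ, cutR_one (by positivity) hq, one_smul]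

theorem fderiv_cutΘ (hδ : 0 < δ) {q : E d × E d} (hq : ‖q.1 - q.2‖ < δ / 3) :
    fderiv ℝ (cutΘ δ Θ) q = fderiv ℝ (uncΘ Θ) q := by
  refine Filter.EventuallyEq.fderiv_eq ?_
  filter_upwards [(isOpen_tube (δ / 3)).mem_nhds hq] with z hz
  exact cutΘ_eq hδ (le_of_lt hz)

/-- The matrix is the restriction to the diagonal of a derivative of the cut-off phase, which has
bounded derivatives on all of ℝ^N × ℝ^N. -/
theorem IsPhase.phaseMatrix_gl (h : IsPhase δ C c₀ Θ) (hδ : 0 < δ) (hc : 0 < c₀) :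
    CbGL (phaseMatrix Θ) := by
  refine ⟨fun j k => ?_, c₀, hc, h.det_bound⟩
  have h1 : Cb (fun x : E d => -(fderiv ℝ (cutΘ δ Θ) (x, x) (0, stdVec j)) k) :=
    ((((h.cutΘ_cb hδ).fderiv.comp (Cb1.id.prodMk Cb1.id)).clm_apply (Cb.const _)).clm
      (EuclideanSpace.proj k : E d →L[ℝ] ℝ)).neg
  convert h1 using 2 with x
  rw [fderiv_cutΘ hδ (by simpa using hδ), h.fderiv_diag hδ]
  rfl

/-- The frame dual to a phase function is adapted to the distributions with which the phase is
compatible. -/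
theorem IsPhase.adapted (h : IsPhase δ C c₀ Θ) (hδ : 0 < δ) (hc : 0 < c₀) {D : Distr d}
    (hD : IsCompatible Θ D) : IsAdaptedFrame D (fun x => (phaseMatrix Θ x)⁻¹) := by
  have hgl := h.phaseMatrix_gl hδ hc
  have hi := hgl.inv
  refine ⟨fun i j => (hi.cb i j).smooth, fun i j => (hi.cb i j).bdd, hi.det, fun x => ?_⟩
  have hu := isUnit_iff_ne_zero.2 (hgl.ne x)
  refine le_antisymm (fun v hv => ?_) (Submodule.span_le.2 ?_)
  · rw [hD x v] at hv
    have h1 : v = ∑ i, (Matrix.vecMul v (phaseMatrix Θ x) i) •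
        frameVec (fun x => (phaseMatrix Θ x)⁻¹) i x := by
      have h2 : Matrix.vecMul (Matrix.vecMul v (phaseMatrix Θ x)) (phaseMatrix Θ x)⁻¹ = v := by
        rw [Matrix.vecMul_vecMul, Matrix.mul_nonsing_inv _ hu, Matrix.vecMul_one]
      ext j
      conv_lhs => rw [← h2]
      simp [Matrix.vecMul, dotProduct, frameVec]
    have h3 : Matrix.vecMul v (phaseMatrix Θ x) (Fin.last d) = 0 := by
      rw [← hv]
      simp [Matrix.vecMul, dotProduct, mul_comm]
    rw [h1, Fin.sum_univ_castSucc, h3, zero_smul, add_zero]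
    exact Submodule.sum_mem _ fun i _ => Submodule.smul_mem _ _ (Submodule.subset_span ⟨i, rfl⟩)
  · rintro _ ⟨i, rfl⟩
    change frameVec _ _ x ∈ D x
    rw [hD]
    have h1 := congrFun (congrFun (Matrix.nonsing_inv_mul _ hu) i.castSucc) (Fin.last d)
    rw [Matrix.mul_apply, Matrix.one_apply_ne (Fin.castSucc_ne_last i)] at h1
    simpa [frameVec, mul_comm] using h1

theorem fderiv_cutΘ_diag (hδ : 0 < δ) (x : E d) :
    fderiv ℝ (cutΘ δ Θ) (x, x) = fderiv ℝ (uncΘ Θ) (x, x) :=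
  fderiv_cutΘ hδ (by rw [sub_self, norm_zero]; positivity)

theorem IsPhase.cutΘ_diag (h : IsPhase δ C c₀ Θ) (hδ : 0 < δ) (x : E d) :
    cutΘ δ Θ (x, x) = 0 := by
  rw [cutΘ_eq hδ (by rw [sub_self, norm_zero]; positivity)]
  exact h.diag x

theorem IsPhase.fderiv_cutΘ_diag_apply (h : IsPhase δ C c₀ Θ) (hδ : 0 < δ) (x v : E d) :
    fderiv ℝ (cutΘ δ Θ) (x, x) (0, v) = -mv (phaseMatrix Θ x).transpose v := by
  rw [fderiv_cutΘ_diag hδ, h.fderiv_diag hδ, fderiv_eq_phaseMatrix]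

theorem IsPhase.lipschitz_fderiv_cutΘ (h : IsPhase δ C c₀ Θ) (hδ : 0 < δ) (x y v : E d)
    (hxy : ‖x - y‖ < δ / 3) :
    ‖fderiv ℝ (cutΘ δ Θ) (x, y) (0, v) - fderiv ℝ (cutΘ δ Θ) (x, x) (0, v)‖ ≤
      max (C 2) 1 * ‖x - y‖ * ‖v‖ := by
  rw [fderiv_cutΘ_diag hδ, fderiv_cutΘ (q := (x, y)) hδ hxy]
  refine (h.lipschitz_fderiv (by linarith) v).trans ?_
  gcongr
  exact le_max_left _ _

theorem mv_transpose_inv {B : Mat d} (hB : B.det ≠ 0) (u : E d) :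
    mv B.transpose (mv B⁻¹.transpose u) = u := by
  rw [← mv_mul, ← Matrix.transpose_mul, Matrix.nonsing_inv_mul _ (isUnit_iff_ne_zero.2 hB),
    Matrix.transpose_one, mv_one]

/-- The bounds depend on d, K and c only; this is why δ₀ depends on the structural constants only.
-/
theorem exists_norm_mv_bounds (d : ℕ) (K : ℝ) {c : ℝ} (hc : 0 < c) :
    ∃ M M' : ℝ, 0 < M ∧ 0 < M' ∧ ∀ B : Mat d, (∀ j k, |B j k| ≤ K) → c ≤ |B.det| →
      ‖mv B⁻¹.transpose‖ ≤ M ∧ ‖mv B.transpose‖ ≤ M' := by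
  have hb1 : 1 ≤ max K 1 := le_max_right _ _
  have hb0 : 0 < max K 1 := by linarith
  refine ⟨((d : ℝ) + 1) ^ 2 * (c⁻¹ * (((d + 1).factorial : ℝ) * max K 1 ^ (d + 1))),
    ((d : ℝ) + 1) ^ 2 * max K 1, by positivity, by positivity, fun B hB hdet => ?_⟩
  have hent : ∀ j k, |B j k| ≤ max K 1 := fun j k => (hB j k).trans (le_max_left _ _)
  exact ⟨norm_mv_le fun i j => abs_inv_le hb1 hc hent hdet j i, norm_mv_le fun i j => hent j i⟩

theorem exists_phaseData {δ c₀ : ℝ} (C : ℕ → ℝ) (hδ : 0 < δ) (hc : 0 < c₀) :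
    ∃ δ₀ : ℝ, 0 < δ₀ ∧ δ₀ ≤ δ ∧ ∀ Θ : E d → E d → E d, IsPhase δ C c₀ Θ → ∀ φ : E d → ℂ,
      ContDiff ℝ ∞ φ → HasCompactSupport φ → tsupport φ ⊆ Metric.ball 0 δ₀ →
      (∀ u ∈ Metric.ball (0 : E d) (δ₀ / 2), φ u = 1) →
      ∃ ρ p g, PhaseData (fun x => (phaseMatrix Θ x)⁻¹) Θ φ ρ p g := by
  obtain ⟨M, M', hM0, hM0', hMM⟩ := exists_norm_mv_bounds d (C 1) hc
  obtain ⟨r, hr, H⟩ := exists_uphase (d := d) (δ := δ / 3) (K := max (C 2) 1) (M := M)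
    (by positivity) (by positivity) hM0
  -- For Aᵀu in the support of φ, the first bound makes the cutoff of Θ inactive, and the second
  -- gives |u| ≤ M'|Aᵀu| ≤ r, where p is not cut off. The numbers r, M and M' were fixed before Θ.
  refine ⟨min (δ / 3) (r / M'), by positivity, (min_le_left _ _).trans (by linarith),
    fun Θ hΘ φ hφ hφc hφs hφ1 => ?_⟩
  have hgl := hΘ.phaseMatrix_gl hδ hc
  have hb := fun x => hMM _ (hΘ.abs_phaseMatrix_le hδ x) (hΘ.det_bound x)
  have hTinv := fun x => mv_transpose_inv (hgl.ne x)
  obtain ⟨p, hp, hq, hpe⟩ := H (cutΘ δ Θ) (hΘ.cutΘ_cb hδ)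
    (fun x => mv (phaseMatrix Θ x)⁻¹.transpose)
    hgl.inv.transpose.cb.mv (fun x => (hb x).1) (hΘ.cutΘ_diag hδ)
    (fun x v => by rw [hΘ.fderiv_cutΘ_diag_apply hδ, hTinv])
    (hΘ.lipschitz_fderiv_cutΘ hδ)
  obtain ⟨g, hg, hleft, hright⟩ := hp.inverse hq
  have hsup : ∀ x u, φ (mv (phaseMatrix Θ x)⁻¹.transpose u) ≠ 0 →
      ‖mv (phaseMatrix Θ x)⁻¹.transpose u‖ < δ / 3 ∧ ‖u‖ ≤ r := by
    intro x u hu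
    have h1 := hφs (subset_tsupport φ hu)
    rw [mem_ball_zero_iff, lt_min_iff, lt_div_iff₀ hM0'] at h1
    refine ⟨h1.1, ?_⟩
    have h2 := ContinuousLinearMap.le_of_opNorm_le (mv (phaseMatrix Θ x).transpose)
      (hb x).2 (mv (phaseMatrix Θ x)⁻¹.transpose u)
    rw [hTinv] at h2
    linarith
  -- The support of p lies in |u| ≤ 2r and that of g in |w| ≤ 4r.
  refine ⟨4 * r, p, g, hgl.inv, by positivity, hp.mono (by linarith), hq,
    hg.mono (by linarith), hleft, hright, Cb.of_compact hφ hφc, fun x u hu => ?_,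
    fun x u hu => ?_, ?_⟩
  · linarith [(hsup x u hu).2]
  · obtain ⟨h1, h2⟩ := hsup x u hu
    rw [hpe x u h2, cutΘ_eq (q := (x, x - mv (phaseMatrix Θ x)⁻¹.transpose u)) hδ (by rw [sub_sub_cancel]; exact h1.le), sub_sub_cancel]
    rfl
  · refine ⟨min (δ / 3) (r / M') / 2 / M, by positivity, fun x u hu => hφ1 _ ?_⟩
    rw [mem_ball_zero_iff]
    rw [lt_div_iff₀ hM0] at hu
    have := ContinuousLinearMap.le_of_opNorm_le _ (hb x).1 u
    linarith

end phaseFunctions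

/-! ### Admissible changes of coordinates and image frames -/

section coordinates
variable {d : ℕ} {Φ : E d ≃ E d}

theorem IsAdmissible.cb1 (h : IsAdmissible Φ) : Cb1 Φ := ⟨h.smooth, h.bounded⟩

/-- The Jacobian matrix. -/
def jacMat (Φ : E d ≃ E d) (x : E d) : Mat d := toMat (fderiv ℝ Φ x)

theorem IsAdmissible.jac_gl (h : IsAdmissible Φ) : CbGL (jacMat Φ) := by
  refine ⟨h.cb1.fderiv.toMat, ?_⟩
  obtain ⟨c, h0, hc⟩ := h.det_bound
  exact ⟨c, h0, fun x => by rw [jacMat, det_toMat]; exact hc x⟩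

theorem IsAdmissible.fderiv_symm (h : IsAdmissible Φ) (y : E d) :
    fderiv ℝ Φ.symm y = mv (jacMat Φ (Φ.symm y))⁻¹ := by
  have h1 : HasFDerivAt (fun y => Φ (Φ.symm y)) ((fderiv ℝ Φ (Φ.symm y)).comp
      (fderiv ℝ Φ.symm y)) y :=
    (h.smooth.differentiable (by simp) _).hasFDerivAt.comp y
      (h.smooth_symm.differentiable (by simp) y).hasFDerivAt
  simp only [Equiv.apply_symm_apply] at h1
  have h2 := h1.unique (hasFDerivAt_id y)
  ext1 v
  have h3 := congrArg (fun L : E d →L[ℝ] E d => L v) h2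
  rw [← mv_inv_mv (h.jac_gl.ne (Φ.symm y)) (fderiv ℝ Φ.symm y v), jacMat, mv_toMat]
  exact congrArg _ h3

theorem IsAdmissible.symm_cb1 (h : IsAdmissible Φ) : Cb1 Φ.symm := by
  obtain ⟨C, -, hC⟩ := h.jac_gl.inv.cb.mv.bound
  exact h.cb1.symm h.smooth_symm (C := C) fun y => by rw [h.fderiv_symm]; exact hC _

/-- The image of a frame. -/
def pushFrame (Φ : E d ≃ E d) (A : Frame d) : Frame d := fun y =>
  A (Φ.symm y) * (jacMat Φ (Φ.symm y)).transpose

theorem IsAdmissible.pushFrame_adapted (h : IsAdmissible Φ) {D : Distr d} {A : Frame d}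
    (hA : IsAdaptedFrame D A) : IsAdaptedFrame (pushDistr Φ D) (pushFrame Φ A) := by
  have hgl : CbGL (pushFrame Φ A) := (hA.gl.mul h.jac_gl.transpose).comp h.symm_cb1
  refine ⟨fun i j => (hgl.cb i j).smooth, fun i j => (hgl.cb i j).bdd, hgl.det, fun y => ?_⟩
  rw [pushDistr, hA.span_eq, Submodule.map_span, ← Set.range_comp]
  congr 2
  ext i j
  change fderiv ℝ Φ (Φ.symm y) (frameVec A i.castSucc (Φ.symm y)) j = _
  rw [← mv_toMat (fderiv ℝ Φ (Φ.symm y))]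
  simp [mv_apply, frameVec, pushFrame, Matrix.mul_apply, jacMat, mul_comm]

theorem pushFrame_transpose (Φ : E d ≃ E d) (A : Frame d) (x : E d) :
    (pushFrame Φ A (Φ x)).transpose = jacMat Φ x * (A x).transpose := by
  simp [pushFrame, Matrix.transpose_mul]

end coordinates

/-! ### Transport of symbols under a change of coordinates -/

section changeOfCoordinates
variable {d : ℕ} {Φ : E d ≃ E d} {A : Frame d}

/-- A phase function that represents a change of coordinates near the diagonal. -/
def coordΘ (Φ : E d ≃ E d) (B : E d → Mat d) (q : E d × E d) : E d :=
  mv (B q.1)⁻¹ (Φ q.1 - Φ (q.1 - cutVec 1 (q.1 - q.2)))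

theorem coordΘ_eq (Φ : E d ≃ E d) (B : E d → Mat d) {x y : E d} (h : ‖x - y‖ ≤ 1) :
    coordΘ Φ B (x, y) = mv (B x)⁻¹ (Φ x - Φ y) := by
  simp only [coordΘ, cutVec_eq one_pos h, sub_sub_cancel]

theorem coordΘ_cb (hΦ : Cb1 Φ) {B : E d → Mat d} (hB : CbGL B) : Cb (coordΘ Φ B) := by
  refine (hB.inv.cb.mv.comp Cb1.fst).clm_apply ?_
  have hc : Cb (fun q : E d × E d => cutVec 1 (q.1 - q.2)) :=
    (cutVec_cb one_pos).comp (Cb1.fst.sub Cb1.snd)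
  refine Cb1.cb ((hΦ.comp Cb1.fst).sub (hΦ.comp (Cb1.fst.sub hc.cb1))) ?_
  obtain ⟨C, hC0, hC⟩ := hΦ.lipschitz
  obtain ⟨K, -, hK⟩ := hc.bound
  refine ⟨C * K, fun q => (hC _ _).trans ?_⟩
  rw [sub_sub_cancel]
  exact mul_le_mul_of_nonneg_left (hK q) hC0.le

theorem fderiv_coordΘ (hΦ : Cb1 Φ) {B : E d → Mat d} (hB : CbGL B) (x v : E d) :
    fderiv ℝ (coordΘ Φ B) (x, x) (0, v) = -mv (B x)⁻¹ (fderiv ℝ Φ x v) := by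
  have h1 : HasFDerivAt (fun y => coordΘ Φ B (x, y)) _ x :=
    ((coordΘ_cb hΦ hB).smooth.differentiable (by simp) (x, x)).hasFDerivAt.comp x
      ((hasFDerivAt_const x x).prodMk (hasFDerivAt_id x))
  have h2 : HasFDerivAt (fun y => mv (B x)⁻¹ (Φ x - Φ y)) _ x :=
    (mv (B x)⁻¹).hasFDerivAt.comp x
      ((hasFDerivAt_const (Φ x) x).sub (hΦ.smooth.differentiable (by simp) x).hasFDerivAt)
  have h3 : (fun y => coordΘ Φ B (x, y)) =ᶠ[nhds x] fun y => mv (B x)⁻¹ (Φ x - Φ y) := by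
    filter_upwards [Metric.ball_mem_nhds x one_pos] with y hy
    refine coordΘ_eq Φ B ?_
    rw [Metric.mem_ball, dist_eq_norm, norm_sub_rev] at hy
    exact hy.le
  have h4 := congrArg (fun L : E d →L[ℝ] E d => L v) (h1.unique (h2.congr_of_eventuallyEq h3))
  simpa using h4

/-- Apply the construction for phases to B(x)⁻¹(Φ(x) - Φ(y)), where B = JAᵀ, with J the Jacobian
matrix of Φ, is the transpose of the image frame at Φ(x). Its linear part in u, y = x - Aᵀu, is then
the identity. -/
theorem IsAdmissible.exists_uphase (h : IsAdmissible Φ) (hA : CbGL A) :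
    ∃ r ρ : ℝ, 0 < r ∧ r ≤ ρ ∧ ∃ p : E d × E d → E d, UPhase ρ p ∧ ∀ x u, ‖u‖ ≤ r →
      mv (pushFrame Φ A (Φ x)).transpose (u - p (x, u)) = Φ x - Φ (x - mv (A x).transpose u) := by
  have hB : CbGL (fun x => jacMat Φ x * (A x).transpose) := h.jac_gl.mul hA.transpose
  have hcb := coordΘ_cb h.cb1 hB
  obtain ⟨M, hM0, hM⟩ := hA.transpose.cb.mv.bound
  obtain ⟨K, hK0, hK⟩ := hcb.fderiv.cb1.lipschitz
  obtain ⟨r, hr, H⟩ := MixedPDO.exists_uphase (d := d) one_pos hK0 hM0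
  obtain ⟨p, hp, -, hpe⟩ := H (coordΘ Φ fun x => jacMat Φ x * (A x).transpose) hcb
    (fun x => mv (A x).transpose) hA.transpose.cb.mv hM
    (fun x => by rw [coordΘ_eq _ _ (by simp), sub_self, map_zero])
    (fun x v => by
      rw [fderiv_coordΘ h.cb1 hB, ← mv_toMat (fderiv ℝ Φ x), ← mv_mul (toMat _)]
      exact congrArg _ (mv_inv_mv (hB.ne x) v))
    (fun x y v _ => by
      have h1 := ContinuousLinearMap.le_of_opNorm_le _ (hK (x, y) (x, x)) ((0 : E d), v)
      have e1 : ‖(x, y) - (x, x)‖ = ‖x - y‖ := by simp [Prod.norm_def, norm_sub_rev]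
      have e2 : ‖((0 : E d), v)‖ = ‖v‖ := by simp [Prod.norm_def]
      rwa [e1, e2] at h1)
  -- The bound by 1/M ensures |Aᵀu| ≤ 1, where the truncation in `coordΘ` is inactive.
  refine ⟨min r M⁻¹, 2 * r, by positivity, (min_le_left _ _).trans (by linarith), p, hp,
    fun x u hu => ?_⟩
  have h1 : ‖mv (A x).transpose u‖ ≤ 1 := by
    refine (ContinuousLinearMap.le_of_opNorm_le _ (hM x) u).trans ?_
    have := hu.trans (min_le_right _ _)
    rwa [← mul_inv_cancel₀ hM0.ne', mul_le_mul_iff_right₀ hM0]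
  rw [hpe x u (hu.trans (min_le_left _ _)), sub_sub_cancel, coordΘ_eq _ _ (by
    rwa [sub_sub_cancel]), pushFrame_transpose, mv_mv_inv (hB.ne x)]

/-- The amplitude that cuts off at distance `r`. -/
def cutC (r : ℝ) (q : E d × E d) : ℂ := (cutR (r / 2) q.2 : ℂ)

theorem cutC_zero {r : ℝ} (hr : 0 < r) {x u : E d} (h : r ≤ ‖u‖) : cutC r (x, u) = 0 := by
  simp [cutC, cutR_zero (half_pos hr) (u := u) (by linarith)]

theorem cutC_one {r : ℝ} (hr : 0 < r) {x u : E d} (h : ‖u‖ ≤ r / 2) : cutC r (x, u) = 1 := by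
  simp [cutC, cutR_one (half_pos hr) h]

theorem cutC_cb (r : ℝ) : Cb (cutC r : E d × E d → ℂ) := ((cutR_cb _).comp Cb1.snd).ofReal

theorem cutC_flat {r ρ : ℝ} (hr : 0 < r) (hρ : r ≤ ρ) : Flat ρ (cutC r : E d × E d → ℂ) :=
  ⟨cutC_cb r, ⟨(cutC_cb r).smooth, fun _ _ hw => cutC_zero hr (hρ.trans hw.le)⟩, r / 2, half_pos hr,
    fun x w hw => by rw [cutC_one hr hw.le, cutC_one hr (by rw [norm_zero]; positivity)]⟩

theorem IsAdmissible.smem_comp_symm (h : IsAdmissible Φ) {m n : ℝ} {b : E d × E d → ℂ}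
    (hb : SMem m n b) : SMem m n (fun q => b (Φ.symm q.1, q.2)) := by
  have h1 := CbGL.one (P := E d) (d := d)
  have h2 : BlockTri (fun _ : E d => (1 : Mat d)) := fun x i => by
    simp [Fin.castSucc_ne_last]
  have h3 := hb.fib h.symm_cb1 h1.cb h1.cb h2 h2 (fun _ => one_mul _)
  simpa [fibMap, mv_one] using h3

theorem IsAdmissible.exists_schwartz_comp_symm (h : IsAdmissible Φ) (f : 𝓢(E d, ℂ)) :
    ∃ g : 𝓢(E d, ℂ), ∀ y, g y = f (Φ.symm y) := by
  obtain ⟨C, hC0, hC⟩ := h.cb1.lipschitz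
  refine exists_schwartz_comp h.symm_cb1 (K := C + ‖Φ 0‖) (fun y => ?_) f
  have h1 := hC (Φ.symm y) 0
  rw [Equiv.apply_symm_apply, sub_zero] at h1
  have h2 := norm_sub_norm_le y (Φ 0)
  nlinarith [norm_nonneg (Φ.symm y), norm_nonneg (Φ 0),
    mul_nonneg (norm_nonneg (Φ 0)) (norm_nonneg (Φ.symm y))]

theorem integrable_smem_mul_ft {m n : ℝ} {b : E d × E d → ℂ} (hb : SMem m n b) (x : E d)
    {M : Mat d} (hM : M.det ≠ 0) (f : 𝓢(E d, ℂ)) (y : E d) :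
    Integrable (fun θ => b (x, θ) * ft (fun u => f (y - mv M u)) θ) := by
  obtain ⟨F, hF⟩ := exists_schwartz_affine hM f y
  simp only [← hF]
  exact (rd_ft_schwartz F).integrable_mul (hb.xgrowth.pg x)

/-- Both sides equal the integral of b against the inverse Fourier transform of the cutoff times u ↦
f(x - Aᵀu): on the left the defining property of p turns f ∘ Φ⁻¹ back into f. -/
theorem integral_opU_coord (hA : CbGL A) (hA' : CbGL (pushFrame Φ A))
    {r ρ : ℝ} (hr : 0 < r) (hρ : r ≤ ρ) {p : E d × E d → E d} (hp : UPhase ρ p)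
    (hpe : ∀ x u, ‖u‖ ≤ r →
      mv (pushFrame Φ A (Φ x)).transpose (u - p (x, u)) = Φ x - Φ (x - mv (A x).transpose u))
    {m n : ℝ} {b : E d × E d → ℂ} (hb : SMem m n b) (f g : 𝓢(E d, ℂ))
    (hg : ∀ y, g y = f (Φ.symm y)) (x : E d) :
    ∫ θ, opU (cutC r) p b (x, θ) *
        ft (fun u => g (Φ x - mv (pushFrame Φ A (Φ x)).transpose u)) θ =
      ∫ θ, opU (cutC r) (fun _ => 0) b (x, θ) * ft (fun u => f (x - mv (A x).transpose u)) θ := by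
  have hψ := cutC_flat (d := d) hr hρ
  obtain ⟨F, hF⟩ := exists_schwartz_affine (M := (A x).transpose)
    (by rw [Matrix.det_transpose]; exact hA.ne x) f x
  obtain ⟨G, hG⟩ := exists_schwartz_affine (M := (pushFrame Φ A (Φ x)).transpose)
    (by rw [Matrix.det_transpose]; exact hA'.ne _) g (Φ x)
  simp only [← hF, ← hG]
  rw [integral_opU_mul hψ.cb hψ.supp hp.cb hb.xgrowth (rd_ft_schwartz G) x,
    integral_opU_mul hψ.cb hψ.supp (Cb.const 0) hb.xgrowth (rd_ft_schwartz F) x]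
  simp only [schwartz_integral_ft_mul_ee, sub_zero]
  congr 1
  ext η
  congr 2
  ext u
  rcases le_total ‖u‖ r with hu | hu
  · rw [hG, hF, hpe x u hu, sub_sub_cancel, hg, Equiv.symm_apply_apply]
  · rw [cutC_zero hr hu, zero_mul, zero_mul]

/-- Cutting off near the diagonal changes the operator by a smoothing one, which `smoothing_change`
transports. The part near the diagonal is given exactly by `opU` with phase p, moved to the base
point Φ(x). -/
theorem IsAdmissible.exists_symbol (h : IsAdmissible Φ) (hA : CbGL A)
    (hA' : CbGL (pushFrame Φ A)) {m n : ℝ} {a : Symb d} (ha : SMem m n (sharp A a)) :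
    ∃ a' : Symb d, SMem m n (sharp (pushFrame Φ A) a') ∧
      ∀ (f : 𝓢(E d, ℂ)) (x : E d), opT a f x = opT a' (f ∘ Φ.symm) (Φ x) := by
  obtain ⟨r, ρ, hr, hρ, p, hp, hpe⟩ := h.exists_uphase hA
  have hψ := cutC_flat (d := d) hr hρ
  have h1 := (UAmpl.of_cb (hr.le.trans hρ) hψ.cb hψ.supp.supp).opU_smem hp ha
  have h2 : RS (fun q => opU (cutC r) (fun _ => 0) (sharp A a) q - sharp A a q) := by
    refine RS.of_smem (m := m) (n := n) fun l => ?_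
    have := hψ.opU_sub_smem ha l
    have hone : ∀ x : E d, cutC r (x, (0 : E d)) = 1 := fun x =>
      cutC_one hr (by rw [norm_zero]; positivity)
    simpa only [hone, one_mul] using this
  have h3 := h2.mul (TMem.const (-1))
  have h4 : SMem m n (opU (cutC r) (fun _ => 0) (sharp A a)) :=
    fun k => ((ha k).add ((h2.smem m n) k)).cast rfl fun _ _ => by ring
  obtain ⟨e', he', H⟩ := smoothing_change h.cb1 h.symm_cb1 (h3.flat hA)
  have h5 := h.smem_comp_symm h1
  have h6 := (he'.sharp hA').smem m n
  refine ⟨flat (pushFrame Φ A) fun q => opU (cutC r) p (sharp A a) (Φ.symm q.1, q.2) +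
    sharp (pushFrame Φ A) e' q, ?_, fun f x => ?_⟩
  · rw [sharp_flat hA']
    exact fun k => (h5 k).add (h6 k)
  · obtain ⟨g, hg⟩ := h.exists_schwartz_comp_symm f
    have hgf : f ∘ Φ.symm = g := funext fun y => (hg y).symm
    have hdet := fun y => hA'.transpose.ne y
    have hx := H f f.integrable (by simpa only [← hg] using g.integrable) x
    simp only [← hg] at hx
    rw [hgf, opT_sharp hA' (flat _ _), sharp_flat hA']
    simp only [add_mul, Equiv.symm_apply_apply]
    rw [integral_add (integrable_smem_mul_ft h1 x (hdet _) g _)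
      (integrable_smem_mul_ft h6 _ (hdet _) g _), ← opT_sharp hA' e', ← hx,
      integral_opU_coord hA hA' hr hρ hp hpe ha f g hg, opT_sharp hA a, opT_sharp hA (flat _ _), sharp_flat hA,
      ← integral_add (integrable_smem_mul_ft h4 x (hA.transpose.ne _) f _)
        (integrable_smem_mul_ft (h3.smem m n) x (hA.transpose.ne _) f _)]
    refine integral_congr_ae (Filter.Eventually.of_forall fun θ => ?_)
    dsimp only
    ring

end changeOfCoordinates

end MixedPDO

end

/-! ### The theorem -/

theorem mainTheorem4 (d : ℕ) :
    -- the class `S^{m,n}(D)` does not depend on the frame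
    (∀ (D : Distr d) (A A' : Frame d), IsAdaptedFrame D A → IsAdaptedFrame D A' →
      ∀ (m n : ℝ) (a : Symb d), IsFrameSymbol A m n a ↔ IsFrameSymbol A' m n a) ∧
    -- invariance under admissible changes of coordinates
    (∀ (D : Distr d) (Φ : E d ≃ E d), IsAdmissible Φ →
      ∀ (m n : ℝ), ∀ a ∈ mixedSymbols D m n,
        ∃ a' ∈ mixedSymbols (pushDistr Φ D) m n,
          ∀ (f : 𝓢(E d, ℂ)) (x : E d), opT a f x = opT a' (f ∘ Φ.symm) (Φ x)) ∧
    -- representation with a compatible phase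
    (∀ (δ : ℝ) (C : ℕ → ℝ) (c₀ : ℝ), 0 < δ → 0 < c₀ →
      ∃ δ₀ : ℝ, 0 < δ₀ ∧ δ₀ ≤ δ ∧
        ∀ (D : Distr d), (∃ A : Frame d, IsAdaptedFrame D A) →
        ∀ (Θ : E d → E d → E d), IsPhase δ C c₀ Θ → IsCompatible Θ D →
        ∀ (φ : E d → ℂ), ContDiff ℝ ∞ φ → HasCompactSupport φ →
          tsupport φ ⊆ Metric.ball 0 δ₀ → (∀ u ∈ Metric.ball (0 : E d) (δ₀ / 2), φ u = 1) →
        ∀ (m n : ℝ),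
          (∀ a₀ ∈ mixedSymbols (constDistr d) m n, ∀ (f : 𝓢(E d, ℂ)) (x : E d),
            Integrable (phaseInner Θ φ a₀ f x)) ∧
          (∀ a ∈ mixedSymbols D m n,
            ∃ a₀ ∈ mixedSymbols (constDistr d) m n, ∃ e ∈ smoothingSymbols d,
              ∀ (f : 𝓢(E d, ℂ)) (x : E d), opT a f x = phaseOp Θ φ a₀ f x + opT e f x) ∧
          (∀ a₀ ∈ mixedSymbols (constDistr d) m n, ∀ e ∈ smoothingSymbols d,
            ∃ a ∈ mixedSymbols D m n,
              ∀ (f : 𝓢(E d, ℂ)) (x : E d), opT a f x = phaseOp Θ φ a₀ f x + opT e f x)) := by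
  refine ⟨fun D A A' hA hA' m n a => ⟨isFrameSymbol_of_adapted hA hA',
    isFrameSymbol_of_adapted hA' hA⟩, fun D Φ hΦ m n a ⟨A, hA, ha⟩ => ?_,
    fun δ C c₀ hδ hc => ?_⟩
  · have hA' := hΦ.pushFrame_adapted hA
    obtain ⟨a', ha', H⟩ := hΦ.exists_symbol hA.gl hA'.gl ((isFrameSymbol_iff hA.gl).1 ha)
    exact ⟨a', (mem_mixedSymbols_iff hA').2 ha', H⟩
  · obtain ⟨δ₀, h0, h1, H⟩ := exists_phaseData (d := d) C hδ hc
    refine ⟨δ₀, h0, h1, fun D _ Θ hΘ hD φ hφ hφc hφs hφ1 m n => ?_⟩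
    obtain ⟨ρ, p, g, h⟩ := H Θ hΘ φ hφ hφc hφs hφ1
    -- The frame 𝓑⁻¹ of the phase is adapted to D, so S^{m,n}(D) may be tested in it.
    have hA := hΘ.adapted hδ hc hD
    refine ⟨fun a₀ ha₀ f x => h.integrable_phaseInner (mem_mixedSymbols_const.1 ha₀) f x,
      fun a ha => ?_, fun a₀ ha₀ e he => ?_⟩
    · obtain ⟨a₀, e, h2, h3, h4⟩ := h.exists_phaseOp ((mem_mixedSymbols_iff hA).1 ha)
      exact ⟨a₀, mem_mixedSymbols_const.2 h2, e, mem_smoothingSymbols_iff.2 h3, h4⟩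
    · obtain ⟨a, h2, h3⟩ := h.exists_symbol (mem_mixedSymbols_const.1 ha₀)
        (mem_smoothingSymbols_iff.1 he)
      exact ⟨a, (mem_mixedSymbols_iff hA).2 h2, h3⟩
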